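/- Let $\mathcal H$ be the Hilbert space of a single bosonic mode, with Fock basis $\{|n\rangle\}_{n\in\mathbb N}$, annihilation operator $\hat a|n\rangle=\sqrt n\,|n-1\rangle$, number operator $\hat n=\hat a^\dagger\hat a$ and canonical operators $\hat q=(\hat a+\hat a^\dagger)/\sqrt2$, $\hat p=(\hat a-\hat a^\dagger)/(i\sqrt2)$. Let $\mathcal S\subset\mathcal H$ be the Schwartz space of vectors $\sum_n c_n|n\rangle$ with $\lim_{n\to\infty}n^kc_n=0$ for all $k\in\mathbb N$. A unitary operator $\hat U$ on $\mathcal H$ is called physical if $\hat U\mathcal S\subseteq\mathcal S$. For real $x\ge0$ let $E_{\hat U}(x)$ be the supremum of $\langle\psi|\hat U^\dagger\hat n\hat U|\psi\rangle$ over unit vectors $|\psi\rangle\in\mathrm{span}\{|n\rangle:n\le x\}$. For $E\ge0$ and unitary channels $\mathcal U=\hat U\cdot\hat U^\dagger$, $\mathcal V=\hat V\cdot\hat V^\dagger$ let $$\|\mathcal U-\mathcal V\|_\diamond^E=\sup_{\mathrm{Tr}[\rho(\hat n\otimes\hat I)]\le E}\|((\mathcal U-\mathcal V)\otimes\mathrm{id})\rho\|_1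 ,$$ the supremum being over density operators $\rho$ on $\mathcal H\otimes\mathcal H'$ with $\mathcal H'$ isomorphic to $\mathcal H$. **Theorem.** There are universal constants $C$, $r$ and a single algorithm such that the following holds for every physical unitary operator $\hat U$, every $E\ge0$ and every $\epsilon>0$. The quantity $E_{\hat U}(64E/\epsilon^2)$ is finite, and there exist $d\in\mathbb N$ with $$d\le C\,\frac{E+\epsilon^2}{\epsilon^4}\,E_{\hat U}\!\left(\frac{64E}{\epsilon^2}\right),\qquad\text{and moreover}\quad d\le C\,\frac{E}{\epsilon^4}\,E_{\hat U}\!\left(\frac{64E}{\epsilon^2}\right)\ \text{ if }\ 64E\ge\epsilon^2,$$ and a polynomial $P$ of degree at most $3d$ such that $P(\hat q,\hat p)$ is Hermitian and essentially self-adjoint on $\mathcal S$ and, writing $e^{iP(\hat q,\hat p)}$ for the unitary operator generated by its closure and $\mathcal V=e^{iP(\hat q,\hat p)}\cdot e^{-iP(\hat q,\hat p)}$, $$\|\mathcal U-\mathcal V\|_\diamond^E\le\epsilon .$$ Moreover, the algorithm, which runs on a real random-access machine (unit-cost arithmetic operations, square roots and comparisons on real numbers), receives $E$ and $\epsilon$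 as input, and may query the Fock-basis matrix entries $\langle i|\hat U|j\rangle$ at unit cost, outputs $d$ and the coefficients $c_{jk}$ of $P(\hat q,\hat p)=\sum_{j,k}c_{jk}\hat q^j\hat p^k$ in at most $C(1+d+E+1/\epsilon)^r$ steps. -/

import Mathlib

open Filter Topology
open scoped ENNReal ComplexConjugate

noncomputable section

namespace Boson

/-! ### The single-mode Hilbert space and its Schwartz space -/

/-- The Hilbert space of one mode, in the Fock basis: `∑ cₙ |n⟩` is the sequence `(cₙ)`. -/
abbrev Mode : Type := lp (fun _ : ℕ => ℂ) 2

/-- The Fock state `|n⟩`. -/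
def fock (n : ℕ) : Mode := lp.single 2 n 1

/-- A sequence is rapidly decreasing if `n ^ k * cₙ → 0` for every `k`. -/
def RapidDecay (c : ℕ → ℂ) : Prop :=
  ∀ k : ℕ, Tendsto (fun n : ℕ => (n : ℂ) ^ k * c n) atTop (𝓝 0)

/-- The Schwartz space of physical states. -/
def schwartz : Submodule ℂ Mode where
  carrier := {ψ | RapidDecay ψ}
  zero_mem' := fun k => by simp
  add_mem' := fun {a b} ha hb k => by
    simpa [mul_add] using (ha k).add (hb k)
  smul_mem' := fun z a ha k => by
    simpa [mul_left_comm] using (ha k).const_mul z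

theorem RapidDecay.memℓp {c : ℕ → ℂ} (h : RapidDecay c) : Memℓp c 2 := by
  have h1 := (h 1).norm.eventually_le_const (u := 1) (by simp)
  refine memℓp_gen ?_
  have hs : Summable fun n : ℕ => 1 / (n : ℝ) ^ 2 :=
    Real.summable_one_div_nat_pow.mpr one_lt_two
  refine hs.of_norm_bounded_eventually_nat ?_
  filter_upwards [h1, eventually_gt_atTop 0] with n hn hpos
  have hn0 : (0 : ℝ) < n := by exact_mod_cast hpos
  have h2 : ‖c n‖ ≤ 1 / n := by
    rw [le_div_iff₀ hn0, mul_comm]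
    simpa using hn
  have h3 : ‖c n‖ ^ 2 ≤ (1 / (n : ℝ)) ^ 2 := by gcongr
  simpa [div_pow] using h3

theorem RapidDecay.sqrt_mul {c : ℕ → ℂ} (h : RapidDecay c) :
    RapidDecay fun n => (Real.sqrt n : ℂ) * c n := by
  intro k
  refine squeeze_zero_norm (fun n => ?_) (by simpa only [norm_zero] using (h (k + 1)).norm)
  have hs : Real.sqrt n ≤ n := by
    rcases Nat.eq_zero_or_pos n with rfl | hn
    · simp
    · have : (1 : ℝ) ≤ n := by exact_mod_cast hn
      exact Real.sqrt_le_self_iff.mpr (Or.inr this)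
  have : ‖((Real.sqrt n : ℝ) : ℂ)‖ ≤ n := by
    rw [Complex.norm_real, Real.norm_of_nonneg (Real.sqrt_nonneg _)]
    exact hs
  calc ‖(n : ℂ) ^ k * ((Real.sqrt n : ℂ) * c n)‖
      = (n : ℝ) ^ k * (‖((Real.sqrt n : ℝ) : ℂ)‖ * ‖c n‖) := by simp
    _ ≤ (n : ℝ) ^ k * (n * ‖c n‖) := by gcongr
    _ = ‖(n : ℂ) ^ (k + 1) * c n‖ := by simp [pow_succ, mul_assoc]

theorem RapidDecay.shiftDown {c : ℕ → ℂ} (h : RapidDecay c) :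
    RapidDecay fun n => c (n + 1) := by
  intro k
  refine squeeze_zero_norm (fun n => ?_)
    (by simpa only [norm_zero] using ((tendsto_add_atTop_iff_nat 1).mpr (h k)).norm)
  have : (n : ℝ) ^ k ≤ ((n + 1 : ℕ) : ℝ) ^ k := by gcongr; omega
  calc ‖(n : ℂ) ^ k * c (n + 1)‖ = (n : ℝ) ^ k * ‖c (n + 1)‖ := by simp
    _ ≤ ((n + 1 : ℕ) : ℝ) ^ k * ‖c (n + 1)‖ := by gcongr
    _ = _ := by rw [norm_mul, norm_pow, Complex.norm_natCast]

theorem RapidDecay.shiftUp {c : ℕ → ℂ} (h : RapidDecay c) :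
    RapidDecay fun n => c (n - 1) := by
  intro k
  rw [← tendsto_add_atTop_iff_nat 2]
  have h2 := ((((tendsto_add_atTop_iff_nat 1).mpr (h k)).norm).const_mul ((2 : ℝ) ^ k))
  refine squeeze_zero_norm (fun n => ?_) (by simpa only [norm_zero, mul_zero] using h2)
  have : ((n + 2 : ℕ) : ℝ) ^ k ≤ 2 ^ k * ((n + 1 : ℕ) : ℝ) ^ k := by
    rw [← mul_pow]
    gcongr
    push_cast
    linarith [(Nat.cast_nonneg n : (0 : ℝ) ≤ n)]
  calc ‖((n + 2 : ℕ) : ℂ) ^ k * c (n + 2 - 1)‖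
      = ((n + 2 : ℕ) : ℝ) ^ k * ‖c (n + 1)‖ := by
        rw [norm_mul, norm_pow, Complex.norm_natCast]; rfl
    _ ≤ (2 ^ k * ((n + 1 : ℕ) : ℝ) ^ k) * ‖c (n + 1)‖ := by gcongr
    _ = 2 ^ k * (((n + 1 : ℕ) : ℝ) ^ k * ‖c (n + 1)‖) := by ring
    _ = 2 ^ k * ‖((n + 1 : ℕ) : ℂ) ^ k * c (n + 1)‖ := by
        rw [norm_mul, norm_pow, Complex.norm_natCast]

/-! ### Canonical operators and polynomial Hamiltonians -/

/-- The annihilation operator: `a |n+1⟩ = √(n+1) |n⟩`, `a |0⟩ = 0`. -/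
def annihilation : Module.End ℂ schwartz where
  toFun ψ := ⟨⟨fun n => (Real.sqrt ((n + 1 : ℕ) : ℝ) : ℂ) * ψ.1 (n + 1),
      (RapidDecay.sqrt_mul ψ.2).shiftDown.memℓp⟩, (RapidDecay.sqrt_mul ψ.2).shiftDown⟩
  map_add' ψ φ := by
    ext n
    exact mul_add _ _ _
  map_smul' z ψ := by
    ext n
    exact mul_left_comm _ _ _

/-- The creation operator: `a† |n⟩ = √(n+1) |n+1⟩` (the component at `0` is `√0 * _ = 0`). -/
def creation : Module.End ℂ schwartz where
  toFun ψ := ⟨⟨fun n => (Real.sqrt (n : ℝ) : ℂ) * ψ.1 (n - 1),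
      (RapidDecay.shiftUp ψ.2).sqrt_mul.memℓp⟩, (RapidDecay.shiftUp ψ.2).sqrt_mul⟩
  map_add' ψ φ := by
    ext n
    exact mul_add _ _ _
  map_smul' z ψ := by
    ext n
    exact mul_left_comm _ _ _

/-- The position operator `q = (a + a†) / √2`. -/
def position : Module.End ℂ schwartz :=
  (1 / (Real.sqrt 2 : ℂ)) • (annihilation + creation)

/-- The momentum operator `p = (a - a†) / (i √2)`. -/
def momentum : Module.End ℂ schwartz :=
  (1 / (Complex.I * (Real.sqrt 2 : ℂ))) • (annihilation - creation)

/-- Complex polynomials in the canonical operators, in the ordered form `∑ c (j, k) q ^ j p ^ k`.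
By the commutation relation `[q, p] = i`, every noncommutative polynomial in `q` and `p` of degree
at most `D` can be written uniquely in this form, with `c (j, k) = 0` whenever `D < j + k`. -/
abbrev CanonicalPoly : Type := ℕ × ℕ →₀ ℂ

/-- The degree, `max (j + k)` over the monomials `q ^ j p ^ k` that occur. -/
def CanonicalPoly.degree (P : CanonicalPoly) : ℕ := P.support.sup fun m => m.1 + m.2

/-- The operator `P(q, p)` on the Schwartz space. -/
def CanonicalPoly.op (P : CanonicalPoly) : Module.End ℂ schwartz :=
  P.sum fun m c => c • (position ^ m.1 * momentum ^ m.2)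

/-- `P(q, p)` as an unbounded operator on the Hilbert space, with the Schwartz space as domain. -/
def CanonicalPoly.unbounded (P : CanonicalPoly) : Mode →ₗ.[ℂ] Mode :=
  ⟨schwartz, schwartz.subtype ∘ₗ P.op⟩

/-- `P(q, p)` is a Hermitian operator. -/
def CanonicalPoly.IsHermitian (P : CanonicalPoly) : Prop :=
  ∀ φ ψ : schwartz, inner ℂ (P.op φ : Mode) (ψ : Mode) = inner ℂ (φ : Mode) (P.op ψ : Mode)

/-- `V = e^{iA}` for a densely defined operator `A`: the closure of `A` is the infinitesimal
generator of a strongly continuous one-parameter unitary group `W t = e^{itA}`, and `V = W 1`.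
By Stone's theorem this says that `A` is essentially self-adjoint and that `V` is the exponential
`e^{iĀ}` of its self-adjoint closure `Ā` given by the spectral theorem. -/
def IsUnitaryExp (A : Mode →ₗ.[ℂ] Mode) (V : Mode ≃ₗᵢ[ℂ] Mode) : Prop :=
  ∃ W : ℝ → (Mode ≃ₗᵢ[ℂ] Mode),
    (∀ s t ψ, W (s + t) ψ = W s (W t ψ)) ∧
    (∀ ψ, Continuous fun t => W t ψ) ∧
    (∀ ψ φ : Mode, (ψ, φ) ∈ A.graph.topologicalClosure ↔
      HasDerivAt (fun t : ℝ => W t ψ) (Complex.I • φ) 0) ∧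
    W 1 = V

/-! ### Physical unitary operators and their energy -/

/-- A physical unitary operator maps Schwartz states to Schwartz states. -/
def IsPhysical (U : Mode ≃ₗᵢ[ℂ] Mode) : Prop :=
  ∀ ψ ∈ schwartz, U ψ ∈ schwartz

/-- The mean particle number `⟨ψ| n̂ |ψ⟩ = ∑ n |ψₙ|²`, possibly infinite. -/
def energy (ψ : Mode) : ℝ≥0∞ := ∑' n : ℕ, ENNReal.ofReal (n * ‖ψ n‖ ^ 2)

/-- The states with at most `x` particles (`x` real): the span of `|n⟩`, `n ≤ x`. -/
def lowSpace (x : ℝ) : Submodule ℂ Mode := Submodule.span ℂ {ψ | ∃ n : ℕ, (n : ℝ) ≤ x ∧ ψ = fock n}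

/-- `E_U(x)`, the largest energy of `U |ψ⟩` over the normalized states with at most `x` particles. -/
def maxEnergy (U : Mode ≃ₗᵢ[ℂ] Mode) (x : ℝ) : ℝ≥0∞ :=
  ⨆ (ψ : Mode) (_ : ψ ∈ lowSpace x) (_ : ‖ψ‖ = 1), energy (U ψ)

/-! ### The energy-constrained diamond distance -/

/-- The mode together with an isomorphic reference system: `H ⊗ ℓ²(ℕ)`, realized as the Hilbert
sum of copies of `H` indexed by the basis `|j⟩` of the reference; `ψ ⊗ |j⟩` is the family with
entry `ψ` at `j` and `0` elsewhere. -/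
abbrev Joint : Type := lp (fun _ : ℕ => Mode) 2

/-- The product basis vector `|i⟩ ⊗ |j⟩`. -/
def fockPair (m : ℕ × ℕ) : Joint := lp.single 2 m.2 (fock m.1)

theorem memℓp_map (A : Mode →L[ℂ] Mode) (ψ : Joint) : Memℓp (fun j => A (ψ j)) 2 := by
  refine memℓp_gen ?_
  have h := (lp.memℓp ψ).summable (by simp)
  refine Summable.of_nonneg_of_le (fun _ => by positivity) (fun j => ?_)
    (h.mul_left (‖A‖ ^ (2 : ℝ≥0∞).toReal))
  rw [← Real.mul_rpow (norm_nonneg _) (norm_nonneg _)]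
  exact Real.rpow_le_rpow (norm_nonneg _) (A.le_opNorm _) (by simp)

/-- `A ⊗ I`. -/
def tensorId (A : Mode →L[ℂ] Mode) : Joint →L[ℂ] Joint :=
  LinearMap.mkContinuous
    { toFun := fun ψ => ⟨fun j => A (ψ j), memℓp_map A ψ⟩
      map_add' := fun ψ φ => by
        ext1
        funext j
        exact map_add A (ψ j) (φ j)
      map_smul' := fun z ψ => by
        ext1
        funext j
        exact map_smul A z (ψ j) }
    ‖A‖ (fun ψ => by
      refine lp.norm_le_of_tsum_le (by simp) (by positivity) ?_
      have h := (lp.memℓp ψ).summable (p := 2) (by simp)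
      rw [Real.mul_rpow (norm_nonneg _) (norm_nonneg _),
        lp.norm_rpow_eq_tsum (by simp) ψ, ← tsum_mul_left]
      refine Summable.tsum_le_tsum (fun j => ?_) ((memℓp_map A ψ).summable (by simp))
        (h.mul_left _)
      rw [← Real.mul_rpow (norm_nonneg _) (norm_nonneg _)]
      exact Real.rpow_le_rpow (norm_nonneg _) (A.le_opNorm _) (by simp))

/-- `(𝒰 ⊗ id) ρ = (U ⊗ I) ρ (U ⊗ I)†` for the unitary channel `𝒰 = U · U†`. -/
def channelTensorId (U : Mode ≃ₗᵢ[ℂ] Mode) (ρ : Joint →L[ℂ] Joint) : Joint →L[ℂ] Joint :=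
  tensorId (U : Mode →L[ℂ] Mode) ∘L ρ ∘L (tensorId (U : Mode →L[ℂ] Mode)).adjoint

/-- The diagonal entry `⟨i, j| T |i, j⟩`. -/
def diagEntry (T : Joint →L[ℂ] Joint) (m : ℕ × ℕ) : ℝ :=
  (inner ℂ (fockPair m) (T (fockPair m))).re

/-- The trace, in `[0, ∞]`, of a positive operator. -/
def posTrace (T : Joint →L[ℂ] Joint) : ℝ≥0∞ :=
  ∑' m : ℕ × ℕ, ENNReal.ofReal (diagEntry T m)

/-- The absolute value `|T| = √(T† T)` of a bounded operator. -/
def absOp {H : Type*} [NormedAddCommGroup H] [InnerProductSpace ℂ H] [CompleteSpace H]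
    (T : H →L[ℂ] H) : H →L[ℂ] H := CFC.abs T

/-- The trace norm `‖T‖₁ = Tr |T|` with `|T| = √(T† T)`, infinite if `T` is not trace class. -/
def traceNorm (T : Joint →L[ℂ] Joint) : ℝ≥0∞ := posTrace (absOp T)

/-- Density operators of the joint system. -/
def IsDensity (ρ : Joint →L[ℂ] Joint) : Prop := ρ.IsPositive ∧ posTrace ρ = 1

/-- `Tr[ρ (n̂ ⊗ I)]` for positive `ρ`, possibly infinite. -/
def jointEnergy (ρ : Joint →L[ℂ] Joint) : ℝ≥0∞ :=
  ∑' m : ℕ × ℕ, ENNReal.ofReal (m.1 * diagEntry ρ m)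

/-- The energy-constrained diamond norm `‖𝒰 - 𝒱‖_⋄^E` of the difference of two unitary channels,
with respect to the number operator. -/
def ecDiamond (E : ℝ) (U V : Mode ≃ₗᵢ[ℂ] Mode) : ℝ≥0∞ :=
  ⨆ (ρ : Joint →L[ℂ] Joint) (_ : IsDensity ρ) (_ : jointEnergy ρ ≤ ENNReal.ofReal E),
    traceNorm (channelTensorId U ρ - channelTensorId V ρ)

/-! ### The machine model

A real RAM: integer registers, two-dimensional arrays of real cells addressed through integer
registers, unit-cost addition, subtraction, multiplication, division, square root and comparison
of reals, unit-cost addition, subtraction and comparison of integers, and unit-cost queries to the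
matrix entries of an operator. The only real constant is `1`; there is no rounding function. -/

namespace RealRAM

/-- The memory of the machine: integer registers, and real arrays `real name row column`. -/
structure Store where
  nat : ℕ → ℕ
  real : ℕ → ℕ → ℕ → ℝ

/-- A reference to a real cell: the name of an array, and the names of the two integer registers
that hold the row and the column. -/
structure Cell where
  arr : ℕ
  row : ℕ
  col : ℕ

def Store.get (s : Store) (c : Cell) : ℝ := s.real c.arr (s.nat c.row) (s.nat c.col)

def Store.setNat (s : Store) (v n : ℕ) : Store := { s with nat := Function.update s.nat v n }

def Store.set (s : Store) (c : Cell) (x : ℝ) : Store :=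
  { s with
    real := fun a i j =>
      if a = c.arr ∧ i = s.nat c.row ∧ j = s.nat c.col then x else s.real a i j }

/-- The primitive instructions. -/
inductive Instr
  | natZero (v : ℕ)
  | natOne (v : ℕ)
  | natAdd (v a b : ℕ)
  | natSub (v a b : ℕ)
  | realOne (c : Cell)
  | realAdd (c a b : Cell)
  | realSub (c a b : Cell)
  | realMul (c a b : Cell)
  | realDiv (c a b : Cell)
  | realSqrt (c a : Cell)
  | query (re im : Cell) (i j : ℕ)

/-- The effect of an instruction, where the oracle holds the matrix `O`; the query stores the real
and the imaginary part of the entry whose indices are held in the registers `i` and `j`. -/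
def Instr.exec (O : ℕ → ℕ → ℂ) (s : Store) : Instr → Store
  | natZero v => s.setNat v 0
  | natOne v => s.setNat v 1
  | natAdd v a b => s.setNat v (s.nat a + s.nat b)
  | natSub v a b => s.setNat v (s.nat a - s.nat b)
  | realOne c => s.set c 1
  | realAdd c a b => s.set c (s.get a + s.get b)
  | realSub c a b => s.set c (s.get a - s.get b)
  | realMul c a b => s.set c (s.get a * s.get b)
  | realDiv c a b => s.set c (s.get a / s.get b)
  | realSqrt c a => s.set c (Real.sqrt (s.get a))
  | query re im i j =>
      (s.set re (O (s.nat i) (s.nat j)).re).set im (O (s.nat i) (s.nat j)).im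

/-- Programs. The tests are `nat v ≤ nat w`, `a ≤ b` for real cells, and `nat v < nat w`. -/
inductive Prog
  | instr (c : Instr)
  | seq (p r : Prog)
  | ifNat (v w : ℕ) (p r : Prog)
  | ifReal (a b : Cell) (p r : Prog)
  | whileNat (v w : ℕ) (p : Prog)

/-- `Exec O p s t s'`: with oracle `O`, the program `p` started in the store `s` halts after
exactly `t` steps in the store `s'`; each instruction and each test is one step. -/
inductive Exec (O : ℕ → ℕ → ℂ) : Prog → Store → ℕ → Store → Prop
  | instr (c : Instr) (s : Store) : Exec O (.instr c) s 1 (c.exec O s)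
  | seq {p r : Prog} {s s' s'' : Store} {t t' : ℕ} :
      Exec O p s t s' → Exec O r s' t' s'' → Exec O (.seq p r) s (t + t') s''
  | ifNat_true {v w : ℕ} {p r : Prog} {s s' : Store} {t : ℕ} :
      s.nat v ≤ s.nat w → Exec O p s t s' → Exec O (.ifNat v w p r) s (t + 1) s'
  | ifNat_false {v w : ℕ} {p r : Prog} {s s' : Store} {t : ℕ} :
      ¬ s.nat v ≤ s.nat w → Exec O r s t s' → Exec O (.ifNat v w p r) s (t + 1) s'
  | ifReal_true {a b : Cell} {p r : Prog} {s s' : Store} {t : ℕ} :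
      s.get a ≤ s.get b → Exec O p s t s' → Exec O (.ifReal a b p r) s (t + 1) s'
  | ifReal_false {a b : Cell} {p r : Prog} {s s' : Store} {t : ℕ} :
      ¬ s.get a ≤ s.get b → Exec O r s t s' → Exec O (.ifReal a b p r) s (t + 1) s'
  | while_true {v w : ℕ} {p : Prog} {s s' s'' : Store} {t t' : ℕ} :
      s.nat v < s.nat w → Exec O p s t s' → Exec O (.whileNat v w p) s' t' s'' →
      Exec O (.whileNat v w p) s (t + t' + 1) s''
  | while_false {v w : ℕ} {p : Prog} {s : Store} :
      ¬ s.nat v < s.nat w → Exec O (.whileNat v w p) s 1 s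

/-- The initial memory: `E` and `ε` in the cells `(0, 0)` and `(0, 1)` of array `0`, and zeros. -/
def input (E ε : ℝ) : Store where
  nat := fun _ => 0
  real := fun a i j =>
    if a = 0 ∧ i = 0 ∧ j = 0 then E else if a = 0 ∧ i = 0 ∧ j = 1 then ε else 0

/-- The final memory holds `d` in register `0`, and the real and imaginary parts of the
coefficients of `P` in the arrays `0` and `1`. -/
def Store.Outputs (s : Store) (d : ℕ) (P : CanonicalPoly) : Prop :=
  s.nat 0 = d ∧ ∀ j k, s.real 0 j k = (P (j, k)).re ∧ s.real 1 j k = (P (j, k)).im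

end RealRAM

/-- The matrix entries `⟨i| U |j⟩` of `U` in the Fock basis. -/
def fockMatrix (U : Mode ≃ₗᵢ[ℂ] Mode) (i j : ℕ) : ℂ := U (fock j) i

end Boson

end

open Filter Topology
open scoped ENNReal ComplexConjugate

noncomputable section

namespace Boson

/-! ### The unitary group generated by the inverse of a bounded self-adjoint operator -/

section Group

variable {H : Type*} [NormedAddCommGroup H] [InnerProductSpace ℂ H] [CompleteSpace H]

/-! Only finitely many matrix entries of `U` matter. A state of energy at most `E` has little weight
above a level `K` of order `E / ε²`, so it is enough to imitate `U` on the first `K` Fock states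
(`ecDiamond_le`). Their images have energy at most `E_U(64E/ε²)`, hence by Markov's inequality they
lie, up to a total weight `ε² / 1000`, in the first `L + 1` levels, with `L` at most of order `K E_U
/ ε²` (`mul_le_of_headSum_lt`, `rows_le`). What remains is to find a Hermitian matrix `h` of size `m
= 2(L + 1)` whose exponential is close, on these `K` vectors and up to a phase, to the truncated
matrix, and a polynomial in `q` and `p` that acts as `h` on the first `m` levels.

The polynomial. On the first `m` levels the matrix unit `|i⟩⟨j|` equals `a†^i v(n̂) a^j / √(i! j!)`,
where `v` has degree `m`, `v(0) = 1` and `v = 0` at `1, …, m`. Sums of such terms are Hermitian, but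
self-adjointness is not automatic. The confining term `∏_{k ≤ m} (n̂ - k)²` does not touch the block
and outgrows all the other terms, which become relatively bounded with bound `1/2` after a shift by
a constant `l`. Therefore the closure of `P + l` has a bounded injective self-adjoint inverse `J`,
and the unitary group is made from `J` by the continuous functional calculus of `x e^{it/x}`
(`exists_group_of_isSelfAdjoint`). The span of the first `m` Fock states is invariant, so `e^{iP}`
is `e^{ih}` there (`exists_unitary_blockHamiltonian`).

The matrix. The truncated block `T` is nearly a partial isometry. In a space of twice the dimension,
exchanging the two halves gives an explicit nearly unitary extension (`completion`); Newton–Schulz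
steps converge geometrically to an exact unitary `W` (`exists_polar_limit`). A logarithm of `W` must
be found by arithmetic alone: partial sums of the Fourier series of the angle are used
(`argSeries`), which converge where the spectrum stays away from `-1`. Among `m + 1` explicit phases
one rotates the spectrum away from `-1` by the pigeonhole principle (`exists_phase_gap`), and a
Frobenius norm of a matrix power certifies a suitable phase (`Passing`). The partial sums are
exactly self-adjoint even for an inexact `W`, so the polynomial is exactly Hermitian, and a global
phase is invisible to channels.

The algorithm searches for `K`, an integer `Y` near `1/ε`, and `L`, and then computes `h` and the
coefficients. It is written in a small language over complex arrays, whose translation to the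
machine is verified once and for all; the cost is polynomial in a common bound of the loops. The
output is `d = 7L`. The bounds on `d` have no additive constant, so `L = 0` must give `d = 0`, and
is treated separately with `P = 0`. -/

/-- The function `x ↦ x e^{it/x}`, as a function of the real part. -/
def invPhase (t : ℝ) (z : ℂ) : ℂ := z.re * Complex.exp (Complex.I * ((t / z.re : ℝ) : ℂ))

theorem norm_invPhase (t : ℝ) (z : ℂ) : ‖invPhase t z‖ = |z.re| := by
  rw [invPhase, norm_mul, mul_comm Complex.I, Complex.norm_exp_ofReal_mul_I, mul_one,
    Complex.norm_real, Real.norm_eq_abs]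

/-- The factor `x` damps the oscillation of `e^{it/x}` at `0`. So the group generated by the
unbounded operator `1/J`, multiplied by `J`, is accessible to the continuous functional calculus. -/
theorem continuous_invPhase (t : ℝ) : Continuous (invPhase t) := by
  rw [continuous_iff_continuousAt]
  intro z
  by_cases hz : z.re = 0
  · have h0 : invPhase t z = 0 := by rw [← norm_eq_zero, norm_invPhase, hz, abs_zero]
    rw [ContinuousAt, h0]
    refine squeeze_zero_norm (fun w => (norm_invPhase t w).le) ?_
    have : Continuous fun w : ℂ => |w.re| := by fun_prop
    simpa [hz] using this.tendsto z
  · unfold invPhase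
    have h1 : ContinuousAt (fun w : ℂ => t / w.re) z :=
      continuousAt_const.div Complex.continuous_re.continuousAt hz
    fun_prop

theorem norm_exp_I_mul_sub_sub_le (u : ℝ) :
    ‖Complex.exp (Complex.I * u) - 1 - Complex.I * u‖ ≤ 2 * u ^ 2 := by
  rcases le_total |u| 1 with h | h
  · have := Complex.norm_exp_sub_one_sub_id_le (x := Complex.I * u) (by simpa using h)
    have h2 : ‖Complex.I * (u : ℂ)‖ ^ 2 = u ^ 2 := by simp
    nlinarith [sq_nonneg u]
  · have h1 := Real.norm_exp_I_mul_ofReal_sub_one_le (x := u)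
    have h2 : ‖Complex.I * (u : ℂ)‖ = |u| := by simp
    have h3 := norm_sub_le (Complex.exp (Complex.I * u) - 1) (Complex.I * u)
    rw [Real.norm_eq_abs] at h1
    nlinarith [sq_abs u]

/-- The prefactor `x` cancels the frequency `1/x`, which makes the Lipschitz constant in time
uniform in `x`. -/
theorem norm_invPhase_sub_le (s t : ℝ) (z : ℂ) : ‖invPhase s z - invPhase t z‖ ≤ |s - t| := by
  by_cases hz : z.re = 0
  · simp [invPhase, hz]
  have e : invPhase s z - invPhase t z = z.re * (Complex.exp (Complex.I * ((t / z.re : ℝ) : ℂ)) *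
      (Complex.exp (Complex.I * (((s - t) / z.re : ℝ) : ℂ)) - 1)) := by
    rw [mul_sub, ← Complex.exp_add, ← mul_add, ← Complex.ofReal_add, ← add_div,
      add_sub_cancel, invPhase, invPhase]
    ring
  rw [e, norm_mul, norm_mul, mul_comm Complex.I, Complex.norm_exp_ofReal_mul_I, one_mul,
    Complex.norm_real, Real.norm_eq_abs]
  calc |z.re| * ‖Complex.exp (Complex.I * (((s - t) / z.re : ℝ) : ℂ)) - 1‖
      ≤ |z.re| * ‖(s - t) / z.re‖ := by gcongr; exact Real.norm_exp_I_mul_ofReal_sub_one_le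
    _ = |s - t| := by
      rw [Real.norm_eq_abs, abs_div]; field_simp

/-- The Taylor remainder of `e^{iu}` at `u = t/x` is at most `2t²/x²`; two factors `x` make it
uniform in `x`. This is the differentiability of the group on the range of `J²`. -/
theorem norm_invPhase_taylor (t : ℝ) (z : ℂ) :
    ‖invPhase t z * z.re - z.re * z.re - Complex.I * t * z.re‖ ≤ 2 * t ^ 2 := by
  by_cases hz : z.re = 0
  · simp [hz]; positivity
  have hz' : (z.re : ℂ) ≠ 0 := by exact_mod_cast hz
  have e : invPhase t z * z.re - z.re * z.re - Complex.I * t * z.re =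
      z.re ^ 2 * (Complex.exp (Complex.I * ((t / z.re : ℝ) : ℂ)) - 1 -
        Complex.I * ((t / z.re : ℝ) : ℂ)) := by
    rw [invPhase]; push_cast; field_simp
  rw [e, norm_mul, norm_pow, Complex.norm_real, Real.norm_eq_abs, sq_abs]
  calc z.re ^ 2 * _ ≤ z.re ^ 2 * (2 * (t / z.re) ^ 2) := by
        gcongr; exact norm_exp_I_mul_sub_sub_le _
    _ = 2 * t ^ 2 := by field_simp

variable {J : H →L[ℂ] H}

theorem re_eq_of_mem_spectrum (hJ : IsSelfAdjoint J) {z : ℂ} (hz : z ∈ spectrum ℂ J) :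
    (z.re : ℂ) = z := (hJ.mem_spectrum_eq_re hz).symm

theorem cfc_re_eq_self (hJ : IsSelfAdjoint J) : cfc (fun z : ℂ => (z.re : ℂ)) J = J := by
  have : cfc (fun z : ℂ => (z.re : ℂ)) J = cfc (id : ℂ → ℂ) J :=
    cfc_congr fun z hz => re_eq_of_mem_spectrum hJ hz
  rw [this, cfc_id ℂ J hJ.isStarNormal]

theorem cfc_invPhase_comm (t : ℝ) : Commute (cfc (invPhase t) J) (cfc (fun z : ℂ => (z.re : ℂ)) J) :=
  cfc_commute_cfc _ _ _

/-- The group law of `e^{it/x}`, with the factor `x²` split as `x · x` on the left and once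
extracted on the right. -/
theorem cfc_invPhase_mul (s t : ℝ) :
    cfc (invPhase s) J * cfc (invPhase t) J =
      cfc (fun z : ℂ => (z.re : ℂ)) J * cfc (invPhase (s + t)) J := by
  have hs := (continuous_invPhase s).continuousOn (s := spectrum ℂ J)
  have ht := (continuous_invPhase t).continuousOn (s := spectrum ℂ J)
  have hst := (continuous_invPhase (s + t)).continuousOn (s := spectrum ℂ J)
  rw [← cfc_mul _ _ _ hs ht, ← cfc_mul _ _ _ (by fun_prop) hst]
  refine cfc_congr fun z _ => ?_
  simp only [invPhase, add_div, Complex.ofReal_add, mul_add, Complex.exp_add]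
  ring

/-- Both operators have the same `star A * A`, because `x e^{it/x}` has modulus `|x|`. Consequently
the assignment of `cfc (invPhase t) J ψ` to `J ψ` is well defined and isometric on the range of `J`.
-/
theorem norm_cfc_invPhase_apply (hJ : IsSelfAdjoint J) (t : ℝ) (ψ : H) :
    ‖cfc (invPhase t) J ψ‖ = ‖J ψ‖ := by
  have ht := (continuous_invPhase t).continuousOn (s := spectrum ℂ J)
  have key : star (cfc (invPhase t) J) * cfc (invPhase t) J = star J * J := by
    conv_rhs => rw [← cfc_re_eq_self hJ]
    rw [← cfc_star, ← cfc_star, ← cfc_mul _ _ _ (by fun_prop) ht,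
      ← cfc_mul _ _ _ (by fun_prop) (by fun_prop)]
    refine cfc_congr fun z _ => ?_
    have h1 := Complex.conj_mul' (invPhase t z)
    have h2 := Complex.conj_mul' (z.re : ℂ)
    simp only [RCLike.star_def]
    rw [h1, h2, norm_invPhase, Complex.norm_real, Real.norm_eq_abs]
  have e : ∀ A : H →L[ℂ] H, ‖A ψ‖ ^ 2 = (inner ℂ ((star A * A) ψ) ψ).re := fun A => by
    rw [mul_apply_eq_comp, ContinuousLinearMap.star_eq_adjoint,
      ContinuousLinearMap.adjoint_inner_left, ← RCLike.re_to_complex, inner_self_eq_norm_sq]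
  rw [← sq_eq_sq₀ (norm_nonneg _) (norm_nonneg _), e, e, key]

theorem denseRange_of_isSelfAdjoint (hJ : IsSelfAdjoint J) (hinj : Function.Injective J) :
    DenseRange J := by
  have h := ContinuousLinearMap.orthogonal_range J
  rw [hJ.adjoint_eq, LinearMap.ker_eq_bot.mpr hinj] at h
  have := (Submodule.topologicalClosure_eq_top_iff (K := J.range)).mpr h
  rw [← Submodule.dense_iff_topologicalClosure_eq_top] at this
  exact this

/-- The group is `e^{it/J}`: it sends `J φ` to `G t φ`, and extends isometrically from the dense
range of `J`. The last clause says that its generator is exactly `J⁻¹`, with the range of `J` as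
domain. -/
theorem exists_group_of_isSelfAdjoint (hJ : IsSelfAdjoint J) (hinj : Function.Injective J) :
    ∃ W : ℝ → (H ≃ₗᵢ[ℂ] H),
      (∀ s t ψ, W (s + t) ψ = W s (W t ψ)) ∧
      (∀ ψ, Continuous fun t => W t ψ) ∧
      (∀ ψ φ : H, ψ = J φ ↔ HasDerivAt (fun t : ℝ => W t ψ) (Complex.I • φ) 0) := by
  have hd := denseRange_of_isSelfAdjoint hJ hinj
  set G : ℝ → (H →L[ℂ] H) := fun t => cfc (invPhase t) J with hG
  have hre := cfc_re_eq_self hJ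
  have hcomm : ∀ t φ, G t (J φ) = J (G t φ) := fun t φ => by
    have := (cfc_invPhase_comm (J := J) t).eq
    rw [hre] at this
    exact congrArg (fun A : H →L[ℂ] H => A φ) this
  have hmul : ∀ s t φ, G s (G t φ) = J (G (s + t) φ) := fun s t φ => by
    have := cfc_invPhase_mul (J := J) s t
    rw [hre] at this
    exact congrArg (fun A : H →L[ℂ] H => A φ) this
  have hG0 : G 0 = J := by
    conv_rhs => rw [← hre]
    refine cfc_congr fun z _ => ?_
    simp [invPhase]
  have hnorm : ∀ t φ, ‖G t φ‖ = ‖J φ‖ := norm_cfc_invPhase_apply hJ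
  set F : ℝ → (H →L[ℂ] H) := fun t => LinearMap.extendOfNorm (G t).toLinearMap J.toLinearMap with hF
  have hd' : DenseRange J.toLinearMap := hd
  have hFJ : ∀ t φ, F t (J φ) = G t φ := fun t φ =>
    LinearMap.extendOfNorm_eq (f := (G t).toLinearMap) (e := J.toLinearMap) hd'
      ⟨1, fun x => by simpa using (hnorm t x).le⟩ φ
  have hFnorm : ∀ t ψ, ‖F t ψ‖ = ‖ψ‖ := fun t ψ => by
    refine hd.induction_on (p := fun ψ => ‖F t ψ‖ = ‖ψ‖) ψ
      (isClosed_eq (by fun_prop) (by fun_prop)) fun φ => ?_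
    rw [hFJ, hnorm]
  have hFadd : ∀ s t ψ, F (s + t) ψ = F s (F t ψ) := fun s t ψ => by
    refine hd.induction_on (p := fun ψ => F (s + t) ψ = F s (F t ψ)) ψ
      (isClosed_eq (by fun_prop) (by fun_prop)) fun φ => ?_
    rw [hFJ, hFJ]
    refine hd.induction_on (p := fun φ => G (s + t) φ = F s (G t φ)) φ
      (isClosed_eq (by fun_prop) (by fun_prop)) fun χ => ?_
    rw [hcomm, hcomm, hFJ, hmul]
  have hF0 : ∀ ψ, F 0 ψ = ψ := fun ψ => by
    refine hd.induction_on (p := fun ψ => F 0 ψ = ψ) ψ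
      (isClosed_eq (by fun_prop) (by fun_prop)) fun φ => ?_
    rw [hFJ, hG0]
  let W : ℝ → (H ≃ₗᵢ[ℂ] H) := fun t =>
    { toLinearEquiv := LinearEquiv.ofLinearMap (F t).toLinearMap (F (-t)).toLinearMap
        (by ext ψ; simp [← hFadd, hF0]) (by ext ψ; simp [← hFadd, hF0])
      norm_map' := hFnorm t }
  have hWF : ∀ t ψ, W t ψ = F t ψ := fun _ _ => rfl
  have hGlip : ∀ s t φ, ‖G s φ - G t φ‖ ≤ |s - t| * ‖φ‖ := fun s t φ => by
    have hs := (continuous_invPhase s).continuousOn (s := spectrum ℂ J)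
    have ht := (continuous_invPhase t).continuousOn (s := spectrum ℂ J)
    have : ‖G s - G t‖ ≤ |s - t| := by
      rw [hG]; dsimp only
      rw [← cfc_sub _ _ _ hs ht]
      exact norm_cfc_le (abs_nonneg _) fun z _ => norm_invPhase_sub_le s t z
    exact (ContinuousLinearMap.le_of_opNorm_le _ this φ)
  have hcont : ∀ ψ, Continuous fun t => F t ψ := fun ψ => by
    rw [Metric.continuous_iff]
    intro t ε hε
    obtain ⟨φ, hφ⟩ := hd.exists_dist_lt ψ (show 0 < ε / 3 by positivity)
    refine ⟨ε / 3 / (‖φ‖ + 1), by positivity, fun s hs => ?_⟩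
    have h1 : ‖F s (J φ) - F t (J φ)‖ < ε / 3 := by
      rw [hFJ, hFJ]
      refine (hGlip s t φ).trans_lt ?_
      rw [Real.dist_eq, lt_div_iff₀ (by positivity)] at hs
      nlinarith [abs_nonneg (s - t)]
    have h2 : ∀ u, ‖F u ψ - F u (J φ)‖ < ε / 3 := fun u => by
      rw [← map_sub, hFnorm, ← dist_eq_norm]; exact hφ
    have h3 := norm_add₃_le (a := F s ψ - F s (J φ)) (b := F s (J φ) - F t (J φ))
      (c := F t (J φ) - F t ψ)
    have h4 := h2 t
    rw [norm_sub_rev] at h4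
    rw [dist_eq_norm, show F s ψ - F t ψ = F s ψ - F s (J φ) + (F s (J φ) - F t (J φ)) +
      (F t (J φ) - F t ψ) by abel]
    linarith [h2 s]
  have htaylor : ∀ t φ, ‖G t (J φ) - J (J φ) - (Complex.I * t) • J φ‖ ≤ 2 * t ^ 2 * ‖φ‖ := by
    intro t φ
    have ht := (continuous_invPhase t).continuousOn (s := spectrum ℂ J)
    have h1 : ‖G t * J - J * J - (Complex.I * t) • J‖ ≤ 2 * t ^ 2 := by
      have : G t * J - J * J - (Complex.I * t) • J = cfc (fun z : ℂ =>
          invPhase t z * z.re - z.re * z.re - Complex.I * t * z.re) J := by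
        rw [cfc_sub _ _ _ (by fun_prop) (by fun_prop), cfc_sub _ _ _ (by fun_prop) (by fun_prop),
          cfc_mul _ _ _ ht (by fun_prop), cfc_mul _ _ _ (by fun_prop) (by fun_prop),
          cfc_const_mul _ _ _ (by fun_prop), hre]
      rw [this]
      exact norm_cfc_le (by positivity) fun z _ => norm_invPhase_taylor t z
    exact ContinuousLinearMap.le_of_opNorm_le _ h1 φ
  -- The Taylor bound gives the derivative only at vectors `J (J χ)`. For general `φ` one
  -- approximates by `J χ` and pays with the Lipschitz bound, which is again proportional to `|t|`.
  have hderiv : ∀ φ, HasDerivAt (fun t : ℝ => F t (J φ)) (Complex.I • φ) 0 := fun φ => by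
    simp only [hFJ]
    rw [hasDerivAt_iff_isLittleO_nhds_zero, Asymptotics.isLittleO_iff]
    intro ε hε
    obtain ⟨χ, hχ⟩ := hd.exists_dist_lt φ (show 0 < ε / 3 by positivity)
    have hball : ∀ᶠ t : ℝ in 𝓝 0, |t| < ε / 3 / (2 * ‖χ‖ + 1) := by
      have : Tendsto (fun t : ℝ => |t|) (𝓝 0) (𝓝 0) := by
        simpa using (continuous_abs (G := ℝ)).tendsto 0
      exact this.eventually_lt_const (by positivity)
    filter_upwards [hball] with t ht
    rw [zero_add, hG0]
    have h1 := htaylor t χ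
    have h2 : ‖G t (φ - J χ) - G 0 (φ - J χ)‖ ≤ |t| * (ε / 3) := by
      refine (hGlip t 0 _).trans ?_
      rw [sub_zero]
      gcongr
      rw [← dist_eq_norm]; exact hχ.le
    have h3 : ‖(Complex.I * t) • (φ - J χ)‖ ≤ |t| * (ε / 3) := by
      rw [norm_smul]
      have : ‖Complex.I * (t : ℂ)‖ = |t| := by simp
      rw [this]
      gcongr
      rw [← dist_eq_norm]; exact hχ.le
    have h4 : 2 * t ^ 2 * ‖χ‖ ≤ |t| * (ε / 3) := by
      rw [lt_div_iff₀ (by positivity)] at ht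
      have := abs_nonneg t
      rw [← sq_abs]
      nlinarith [norm_nonneg χ]
    have e : G t φ - J φ - t • Complex.I • φ = (G t (J χ) - J (J χ) - (Complex.I * t) • J χ) +
        (G t (φ - J χ) - G 0 (φ - J χ)) - (Complex.I * t) • (φ - J χ) := by
      have : t • Complex.I • φ = (Complex.I * t) • φ := by
        rw [← Complex.coe_smul, smul_smul, mul_comm]
      rw [this, hG0, map_sub, map_sub, smul_sub]
      abel
    rw [e, Real.norm_eq_abs]
    have h5 := norm_sub_le ((G t (J χ) - J (J χ) - (Complex.I * t) • J χ) +
        (G t (φ - J χ) - G 0 (φ - J χ))) ((Complex.I * t) • (φ - J χ))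
    have h6 := norm_add_le (G t (J χ) - J (J χ) - (Complex.I * t) • J χ)
        (G t (φ - J χ) - G 0 (φ - J χ))
    linarith
  refine ⟨W, hFadd, hcont, fun ψ φ => ⟨?_, fun h => ?_⟩⟩
  · rintro rfl
    exact hderiv φ
  -- The generator is not larger than `J⁻¹`: for a test vector `J χ`, the derivative of `⟨J χ, F t
  -- ψ⟩` at `0` is computed once from the hypothesis and once by moving the group to the left
  -- factor.
  have hadj : ∀ t χ ξ, inner ℂ (F t χ) ξ = inner ℂ χ (F (-t) ξ) := fun t χ ξ => by
    have := (W t).inner_map_map χ (F (-t) ξ)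
    rw [hWF, hWF, ← hFadd, add_neg_cancel, hF0] at this
    exact this
  refine ext_inner_left ℂ fun χ => ?_
  have h1 : HasDerivAt (fun t : ℝ => inner ℂ (J χ) (F t ψ)) (inner ℂ (J χ) (Complex.I • φ)) 0 := by
    have := (hasDerivAt_const (0 : ℝ) (J χ)).inner ℂ h
    rw [inner_zero_left, add_zero] at this
    exact this
  have h2 : HasDerivAt (fun t : ℝ => inner ℂ (F (-t) (J χ)) ψ) (inner ℂ (-(Complex.I • χ)) ψ) 0 := by
    have hneg : HasDerivAt (fun t : ℝ => F (-t) (J χ)) (-(Complex.I • χ)) 0 := by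
      have := HasDerivAt.scomp (𝕜 := ℝ) (0 : ℝ) (h := fun t : ℝ => -t) (h' := -1)
        (g₁ := fun t => F t (J χ)) (by simpa using hderiv χ) (hasDerivAt_neg 0)
      rw [neg_one_smul] at this
      exact this
    have := hneg.inner ℂ (hasDerivAt_const (0 : ℝ) ψ)
    simpa using this
  have h3 : (fun t : ℝ => inner ℂ (F (-t) (J χ)) ψ) = fun t : ℝ => inner ℂ (J χ) (F t ψ) := by
    funext t
    rw [hadj, neg_neg]
  rw [h3] at h2
  have h4 := h1.unique h2
  rw [inner_smul_right, inner_neg_left, inner_smul_left, Complex.conj_I, neg_mul, neg_neg] at h4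
  have h5 := mul_left_cancel₀ Complex.I_ne_zero h4
  rw [← h5, ← ContinuousLinearMap.adjoint_inner_right, hJ.adjoint_eq]

end Group

/-! ### Relatively bounded perturbations and the inverse of a shifted symmetric operator -/

section Perturbation

variable {H : Type*} [NormedAddCommGroup H] [InnerProductSpace ℂ H]

/-- `R + B = (1 + T) R`, where `T` is the bounded extension of `B R⁻¹`. Its norm is at most `1/2`,
so `1 + T` is invertible and maps a dense range to a dense range. -/
theorem denseRange_add_of_relatively_bounded [CompleteSpace H] {D : Type*} [AddCommGroup D] [Module ℂ D]
    (R B : D →ₗ[ℂ] H) (hR : DenseRange R) (hB : ∀ s, ‖B s‖ ≤ 1 / 2 * ‖R s‖) :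
    DenseRange (R + B) := by
  set T : H →L[ℂ] H := LinearMap.extendOfNorm B R with hT
  have hTR : ∀ s, T (R s) = B s := fun s => LinearMap.extendOfNorm_eq hR ⟨_, hB⟩ s
  have hTn : ‖T‖ ≤ 1 / 2 := LinearMap.opNorm_extendOfNorm_le hR (by norm_num) hB
  have hu : IsUnit (1 + T) := by
    have := (Units.oneSub (-T) (by rw [norm_neg]; linarith)).isUnit
    simpa using this
  have hsurj : Function.Surjective (1 + T : H →L[ℂ] H) := by
    obtain ⟨u, hu⟩ := hu
    intro y
    refine ⟨(↑u⁻¹ : H →L[ℂ] H) y, ?_⟩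
    rw [← hu, ← mul_apply_eq_comp, Units.mul_inv]
    rfl
  have h := hsurj.denseRange.comp hR (1 + T : H →L[ℂ] H).continuous
  have e : (⇑(1 + T : H →L[ℂ] H) ∘ ⇑R) = ⇑(R + B) := by
    funext s
    simp [hTR]
  rwa [e] at h

/-- The data of a bounded self-adjoint inverse of `A + λ` on a dense domain. -/
theorem exists_shifted_inverse [CompleteSpace H] {D : Submodule ℂ H} (hD : Dense (D : Set H)) (A : D →ₗ[ℂ] H)
    (hsymm : ∀ s t : D, inner ℂ (A s) (t : H) = inner ℂ (s : H) (A t)) (l c : ℝ)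
    (hdense : DenseRange (A + (l : ℂ) • D.subtype))
    (hbound : ∀ s : D, ‖(s : H)‖ ≤ c * ‖A s + (l : ℂ) • (s : H)‖) :
    ∃ J : H →L[ℂ] H, IsSelfAdjoint J ∧ Function.Injective J ∧
      ∀ s : D, J (A s + (l : ℂ) • (s : H)) = s := by
  set J : H →L[ℂ] H := LinearMap.extendOfNorm D.subtype (A + (l : ℂ) • D.subtype) with hJ
  have hJA : ∀ s : D, J (A s + (l : ℂ) • (s : H)) = s := fun s =>
    LinearMap.extendOfNorm_eq hdense ⟨c, hbound⟩ s
  have hsa : IsSelfAdjoint J := by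
    rw [ContinuousLinearMap.isSelfAdjoint_iff_isSymmetric]
    intro x y
    refine hdense.induction_on (p := fun x => inner ℂ (J x) y = inner ℂ x (J y)) x
      (isClosed_eq (by fun_prop) (by fun_prop)) fun s => ?_
    refine hdense.induction_on (p := fun y => inner ℂ (J ((A + (l : ℂ) • D.subtype) s)) y =
      inner ℂ ((A + (l : ℂ) • D.subtype) s) (J y)) y
      (isClosed_eq (by fun_prop) (by fun_prop)) fun t => ?_
    simp only [LinearMap.add_apply, LinearMap.smul_apply, Submodule.subtype_apply, hJA]
    rw [inner_add_left, inner_add_right, hsymm, inner_smul_left, inner_smul_right,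
      Complex.conj_ofReal]
  refine ⟨J, hsa, ?_, hJA⟩
  -- The kernel of the self-adjoint `J` is the orthogonal complement of its range, and the range
  -- contains the dense subspace `D`.
  have h := ContinuousLinearMap.orthogonal_range J
  rw [hsa.adjoint_eq] at h
  have hr : Dense (J.range : Set H) := hD.mono fun s hs => ⟨_, hJA ⟨s, hs⟩⟩
  rw [Submodule.dense_iff_topologicalClosure_eq_top] at hr
  rw [(Submodule.topologicalClosure_eq_top_iff (K := J.range)).mp hr] at h
  exact LinearMap.ker_eq_bot.mp h.symm

/-- The closure of `A` is `J⁻¹ - l`. The relation on the right is closed and holds on the graph;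
conversely the pairs `(J χ, χ - l J χ)` depend continuously on `χ` and lie in the graph for `χ` in
the dense range of `A + l`. -/
theorem mem_closure_graph_iff {D : Submodule ℂ H} (A : D →ₗ[ℂ] H) (l : ℝ)
    (hdense : DenseRange (A + (l : ℂ) • D.subtype)) (J : H →L[ℂ] H)
    (hJA : ∀ s : D, J (A s + (l : ℂ) • (s : H)) = s) (ψ φ : H) :
    (ψ, φ) ∈ (LinearPMap.mk D A).graph.topologicalClosure ↔ ψ = J (φ + (l : ℂ) • ψ) := by
  rw [← SetLike.mem_coe, Submodule.topologicalClosure_coe]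
  constructor
  · intro h
    have hcl : IsClosed {p : H × H | p.1 = J (p.2 + (l : ℂ) • p.1)} :=
      isClosed_eq (by fun_prop) (by fun_prop)
    refine closure_minimal ?_ hcl h
    rintro ⟨x, y⟩ hxy
    rw [SetLike.mem_coe, LinearPMap.mem_graph_iff] at hxy
    obtain ⟨s, rfl, rfl⟩ := hxy
    exact (hJA s).symm
  · intro h
    have hc : ∀ χ : H, (J χ, χ - (l : ℂ) • J χ) ∈
        closure ((LinearPMap.mk D A).graph : Set (H × H)) := fun χ => by
      refine hdense.induction_on (p := fun χ => (J χ, χ - (l : ℂ) • J χ) ∈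
        closure ((LinearPMap.mk D A).graph : Set (H × H))) χ ?_ fun s => ?_
      · exact isClosed_closure.preimage (f := fun χ => (J χ, χ - (l : ℂ) • J χ)) (by fun_prop)
      · apply subset_closure
        rw [SetLike.mem_coe, LinearPMap.mem_graph_iff]
        refine ⟨s, ?_, ?_⟩
        · exact (hJA s).symm
        · rw [LinearMap.add_apply, LinearMap.smul_apply, Submodule.subtype_apply, hJA,
            add_sub_cancel_right]
          rfl
    have := hc (φ + (l : ℂ) • ψ)
    rw [← h, add_sub_cancel_right] at this
    exact this

end Perturbation

/-! ### Removing the shift, and the action of the group on an invariant block -/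

/-- Multiplication of a unitary operator by a phase. -/
def phaseSMul {H : Type*} [NormedAddCommGroup H] [InnerProductSpace ℂ H] (z : ℂ) (hz : ‖z‖ = 1)
    (U : H ≃ₗᵢ[ℂ] H) : H ≃ₗᵢ[ℂ] H :=
  (⟨z, by rw [unitary, Submonoid.mem_mk]; constructor <;> simp [Complex.mul_conj', Complex.conj_mul', hz]⟩ : unitary ℂ) • U

theorem phaseSMul_apply {H : Type*} [NormedAddCommGroup H] [InnerProductSpace ℂ H] (z : ℂ)
    (hz : ‖z‖ = 1) (U : H ≃ₗᵢ[ℂ] H) (ψ : H) : phaseSMul z hz U ψ = z • U ψ := rfl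

/-- The factor `e^{-ilt}` turns the generator `A + l` into `A`. The converse direction is the same
statement with `-l`, since the phases cancel. -/
theorem hasDerivAt_phase_smul_iff {H : Type*} [NormedAddCommGroup H] [InnerProductSpace ℂ H]
    (f : ℝ → H) (l : ℝ) (φ : H) (h0 : HasDerivAt f (Complex.I • φ) 0) :
    HasDerivAt (fun t : ℝ => Complex.exp (((-(l * t) : ℝ) : ℂ) * Complex.I) • f t)
      (Complex.I • (φ - (l : ℂ) • f 0)) 0 := by
  have h1 : HasDerivAt (fun t : ℝ => Complex.exp (((-(l * t) : ℝ) : ℂ) * Complex.I))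
      (-(l : ℂ) * Complex.I) 0 := by
    have h2 : HasDerivAt (fun t : ℝ => (((-(l * t) : ℝ) : ℂ) * Complex.I)) (-(l : ℂ) * Complex.I) 0 := by
      have := (((hasDerivAt_id (0 : ℝ)).const_mul l).neg).ofReal_comp.mul_const Complex.I
      simpa using this
    have := h2.cexp
    simpa using this
  have h3 := h1.smul h0
  simp only [mul_zero, neg_zero, Complex.ofReal_zero, zero_mul, Complex.exp_zero, one_smul] at h3
  have e : Complex.I • (φ - (l : ℂ) • f 0) = Complex.I • φ + (-(l : ℂ) * Complex.I) • f 0 := by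
    rw [smul_sub, smul_smul, sub_eq_add_neg, ← neg_smul]
    ring_nf
  rw [e]
  exact h3

theorem isUnitaryExp_of_shifted_inverse {D : Submodule ℂ Mode} (A : D →ₗ[ℂ] Mode) (l : ℝ)
    (hdense : DenseRange (A + (l : ℂ) • D.subtype)) (J : Mode →L[ℂ] Mode) (hsa : IsSelfAdjoint J)
    (hinj : Function.Injective J) (hJA : ∀ s : D, J (A s + (l : ℂ) • (s : Mode)) = s) :
    ∃ V, IsUnitaryExp (LinearPMap.mk D A) V := by
  obtain ⟨W, hadd, hcont, hgen⟩ := exists_group_of_isSelfAdjoint hsa hinj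
  let p : ℝ → ℂ := fun t => Complex.exp (((-(l * t) : ℝ) : ℂ) * Complex.I)
  have hp : ∀ t, ‖p t‖ = 1 := fun t => Complex.norm_exp_ofReal_mul_I _
  have hW0 : ∀ ψ, W 0 ψ = ψ := fun ψ => by
    have := hadd 0 0 ψ
    rw [add_zero] at this
    exact ((W 0).injective this).symm
  let W' : ℝ → (Mode ≃ₗᵢ[ℂ] Mode) := fun t => phaseSMul (p t) (hp t) (W t)
  have hW' : ∀ t ψ, W' t ψ = p t • W t ψ := fun _ _ => rfl
  refine ⟨W' 1, W', fun s t ψ => ?_, fun ψ => ?_, fun ψ φ => ?_, rfl⟩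
  · simp only [hW', map_smul, smul_smul, hadd]
    congr 1
    simp only [p, ← Complex.exp_add]
    push_cast
    ring_nf
  · simp only [hW']
    have : Continuous p := by unfold p; fun_prop
    exact this.smul (hcont ψ)
  · rw [mem_closure_graph_iff A l hdense J hJA, hgen]
    simp only [hW']
    constructor
    · intro h
      have := hasDerivAt_phase_smul_iff _ l _ h
      rwa [hW0, add_sub_cancel_right] at this
    · intro h
      have := hasDerivAt_phase_smul_iff _ (-l) _ h
      simp only [hW0, p, smul_smul, ← Complex.exp_add,
        neg_mul, neg_neg, mul_zero, neg_zero, Complex.ofReal_zero, zero_mul, Complex.exp_zero,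
        one_smul, add_neg_cancel, Complex.ofReal_neg, neg_smul, sub_neg_eq_add] at this
      exact this

-- The vector `∑ i, (e^{ith})_{ij} W(-t) e_i` has derivative zero in `t`, hence is `e_j` for all
-- `t`; at `t = 1` one applies `W 1`. Differentiability of the group is needed only at the vectors
-- `e_i`, never on the whole space.
open scoped Matrix.Norms.L2Operator in
theorem group_apply_of_invariant {H : Type*} [NormedAddCommGroup H] [InnerProductSpace ℂ H]
    {m : ℕ} (W : ℝ → (H ≃ₗᵢ[ℂ] H))
    (hadd : ∀ s t ψ, W (s + t) ψ = W s (W t ψ)) (e : Fin m → H) (h : Matrix (Fin m) (Fin m) ℂ)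
    (hd : ∀ j, HasDerivAt (fun t : ℝ => W t (e j)) (Complex.I • ∑ i, h i j • e i) 0) (j : Fin m) :
    W 1 (e j) = ∑ i, NormedSpace.exp (Complex.I • h) i j • e i := by
  have hW0 : ∀ ψ, W 0 ψ = ψ := fun ψ => by
    have := hadd 0 0 ψ
    rw [add_zero] at this
    exact ((W 0).injective this).symm
  have hdt : ∀ (i : Fin m) (t : ℝ), HasDerivAt (fun s : ℝ => W (-s) (e i))
      (-(W (-t) (Complex.I • ∑ k, h k i • e k))) t := fun i t => by
    have h1 : HasDerivAt (fun s : ℝ => W (t - s) (e i)) (-(Complex.I • ∑ k, h k i • e k)) t := by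
      have := HasDerivAt.scomp (𝕜 := ℝ) t (h := fun s : ℝ => t - s) (h' := -1)
        (g₁ := fun s => W s (e i)) (by simpa using hd i) ((hasDerivAt_id t).const_sub t)
      rw [neg_one_smul] at this
      exact this
    have h2 := ((W (-t) : H →L[ℂ] H).restrictScalars ℝ).hasFDerivAt.comp_hasDerivAt t h1
    have e2 : (⇑((W (-t) : H →L[ℂ] H).restrictScalars ℝ) ∘ fun s : ℝ => W (t - s) (e i)) =
        fun s => W (-s) (e i) := by
      funext s
      change W (-t) (W (t - s) (e i)) = _
      rw [← hadd]
      congr 2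
      ring
    rw [e2] at h2
    convert h2 using 1
    change _ = W (-t) (-(Complex.I • ∑ k, h k i • e k))
    rw [map_neg]
  have hc : ∀ (i : Fin m) (t : ℝ), HasDerivAt
      (fun s : ℝ => NormedSpace.exp (s • (Complex.I • h)) i j)
      (∑ k, Complex.I * h i k * NormedSpace.exp (t • (Complex.I • h)) k j) t := fun i t => by
    have h1 := hasDerivAt_exp_smul_const' (𝕂 := ℝ) (Complex.I • h) t
    let ent : Matrix (Fin m) (Fin m) ℂ →L[ℝ] ℂ :=
      (Matrix.entryLinearMap ℝ ℂ i j).toContinuousLinearMap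
    have h2 := ent.hasFDerivAt.comp_hasDerivAt t h1
    have e3 : ent (Complex.I • h * NormedSpace.exp (t • Complex.I • h)) =
        ∑ k, Complex.I * h i k * NormedSpace.exp (t • (Complex.I • h)) k j := by
      change (Complex.I • h * NormedSpace.exp (t • Complex.I • h)) i j = _
      rw [Matrix.mul_apply]
      rfl
    rw [e3] at h2
    exact h2
  have hg : ∀ t : ℝ, HasDerivAt (fun s : ℝ => ∑ i, NormedSpace.exp (s • (Complex.I • h)) i j •
      W (-s) (e i)) 0 t := fun t => by
    have h1 := HasDerivAt.fun_sum (u := Finset.univ) fun i (_ : i ∈ Finset.univ) =>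
      (hc i t).fun_smul (hdt i t)
    convert h1 using 1
    rw [Finset.sum_add_distrib, eq_comm]
    simp only [smul_neg, map_smul, map_sum, Finset.smul_sum, Finset.sum_smul,
      Finset.sum_neg_distrib, smul_smul]
    rw [Finset.sum_comm, neg_add_eq_zero]
    refine Finset.sum_congr rfl fun i _ => Finset.sum_congr rfl fun k _ => ?_
    congr 1
    ring
  have hconst := is_const_of_deriv_eq_zero (fun t => (hg t).differentiableAt)
    (fun t => (hg t).deriv) 1 0
  simp only [one_smul, zero_smul, NormedSpace.exp_zero, neg_zero, hW0, Matrix.one_apply,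
    ite_smul, Finset.sum_ite_eq', Finset.mem_univ, if_true] at hconst
  rw [← hconst, map_sum]
  refine Finset.sum_congr rfl fun i _ => ?_
  rw [map_smul, ← hadd, add_neg_cancel, hW0]

/-! ### Components of products of canonical operators -/

theorem annihilation_apply (ψ : schwartz) (n : ℕ) :
    (annihilation ψ : Mode) n = (Real.sqrt ((n + 1 : ℕ) : ℝ) : ℂ) * (ψ : Mode) (n + 1) := rfl

theorem creation_apply_zero (ψ : schwartz) : (creation ψ : Mode) 0 = 0 := by
  change (Real.sqrt ((0 : ℕ) : ℝ) : ℂ) * (ψ : Mode) (0 - 1) = 0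
  simp

theorem creation_apply_succ (ψ : schwartz) (n : ℕ) :
    (creation ψ : Mode) (n + 1) = (Real.sqrt ((n + 1 : ℕ) : ℝ) : ℂ) * (ψ : Mode) n := rfl

theorem schwartz_ext {ψ φ : schwartz} (h : ∀ n, (ψ : Mode) n = (φ : Mode) n) : ψ = φ := by
  ext n
  exact h n

/-- The number operator on the Schwartz space. -/
def number : Module.End ℂ schwartz := creation * annihilation

theorem number_apply (ψ : schwartz) (n : ℕ) : (number ψ : Mode) n = n * (ψ : Mode) n := by
  change (creation (annihilation ψ) : Mode) n = _
  cases n with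
  | zero => rw [creation_apply_zero]; simp
  | succ n =>
    rw [creation_apply_succ, annihilation_apply, ← mul_assoc, ← Complex.ofReal_mul,
      Real.mul_self_sqrt (by positivity)]
    simp

theorem annihilation_mul_creation : annihilation * creation = creation * annihilation + 1 := by
  ext1 ψ
  refine schwartz_ext fun n => ?_
  have h := number_apply ψ n
  change (annihilation (creation ψ) : Mode) n = (number ψ : Mode) n + (ψ : Mode) n
  rw [h, annihilation_apply, creation_apply_succ, ← mul_assoc, ← Complex.ofReal_mul,
      Real.mul_self_sqrt (by positivity)]
  push_cast
  ring

theorem sqrt_two_mul_self : ((Real.sqrt 2 : ℝ) : ℂ) * ((Real.sqrt 2 : ℝ) : ℂ) = 2 := by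
  rw [← Complex.ofReal_mul, Real.mul_self_sqrt (by norm_num)]; simp

theorem sqrt_two_ne_zero : ((Real.sqrt 2 : ℝ) : ℂ) ≠ 0 := by
  intro h; have := sqrt_two_mul_self; rw [h] at this; norm_num at this

theorem one_div_sqrt_two_mul_self :
    (1 / ((Real.sqrt 2 : ℝ) : ℂ)) * (1 / ((Real.sqrt 2 : ℝ) : ℂ)) = 1 / 2 := by
  rw [div_mul_div_comm, sqrt_two_mul_self, one_mul]

section Algebra

variable {A : Type*} [Ring A] [Algebra ℂ A] {a c q p : A}

theorem add_ladder_eq (hq : q = (1 / (Real.sqrt 2 : ℂ)) • (a + c))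
    (hp : p = (1 / (Complex.I * (Real.sqrt 2 : ℂ))) • (a - c)) :
    (1 / (Real.sqrt 2 : ℂ)) • (q + Complex.I • p) = a := by
  have h2 := sqrt_two_ne_zero
  rw [hq, hp, smul_smul, show Complex.I * (1 / (Complex.I * (Real.sqrt 2 : ℂ))) =
    1 / (Real.sqrt 2 : ℂ) by field_simp, ← smul_add, smul_smul, one_div_sqrt_two_mul_self,
    show a + c + (a - c) = (2 : ℂ) • a by rw [two_smul]; abel, smul_smul]
  norm_num

theorem sub_ladder_eq (hq : q = (1 / (Real.sqrt 2 : ℂ)) • (a + c))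
    (hp : p = (1 / (Complex.I * (Real.sqrt 2 : ℂ))) • (a - c)) :
    (1 / (Real.sqrt 2 : ℂ)) • (q + (-Complex.I) • p) = c := by
  have h2 := sqrt_two_ne_zero
  rw [hq, hp, smul_smul, show -Complex.I * (1 / (Complex.I * (Real.sqrt 2 : ℂ))) =
    -(1 / (Real.sqrt 2 : ℂ)) by field_simp, neg_smul, ← sub_eq_add_neg, ← smul_sub, smul_smul,
    one_div_sqrt_two_mul_self,
    show a + c - (a - c) = (2 : ℂ) • c by rw [two_smul]; abel, smul_smul]
  norm_num

theorem canonical_commutation (hac : a * c = c * a + 1)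
    (hq : q = (1 / (Real.sqrt 2 : ℂ)) • (a + c))
    (hp : p = (1 / (Complex.I * (Real.sqrt 2 : ℂ))) • (a - c)) :
    p * q = q * p - Complex.I • 1 := by
  have h2 := sqrt_two_ne_zero
  have hI : 1 / (Complex.I * (Real.sqrt 2 : ℂ)) = -Complex.I * (1 / (Real.sqrt 2 : ℂ)) := by
    field_simp
    simp
  have h3 : (a - c) * (a + c) = (a + c) * (a - c) + (2 : ℂ) • 1 := by
    simp only [sub_mul, mul_add, add_mul, mul_sub, hac, two_smul]
    abel
  rw [hq, hp, hI, smul_mul_smul_comm, smul_mul_smul_comm, h3, smul_add, smul_smul, mul_assoc,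
    mul_left_comm _ (-Complex.I), one_div_sqrt_two_mul_self,
    show -Complex.I * (1 / 2) * 2 = -Complex.I by ring, neg_smul Complex.I, ← sub_eq_add_neg]

theorem mul_pow_of_canonical (h : p * q = q * p - Complex.I • 1) (j : ℕ) :
    p * q ^ j = q ^ j * p - (Complex.I * j) • q ^ (j - 1) := by
  induction j with
  | zero => simp
  | succ j ih =>
    rw [pow_succ, ← mul_assoc, ih, sub_mul, mul_assoc, h, mul_sub,
      ← mul_assoc, sub_sub, smul_mul_assoc]
    congr 1
    cases j with
    | zero => simp
    | succ j =>
      simp only [Nat.add_sub_cancel, ← pow_succ, mul_smul_comm, mul_one]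
      rw [← add_smul]
      push_cast
      ring_nf

/-- The only reordering that is ever needed: `p` passes `q^j` at the price of `-i j q^{j-1}`, and
the factor `σ i` in front of `p` turns this into `σ j q^{j-1}`. Multiplication by a ladder operator
thus keeps the ordered form, with three terms per monomial. -/
theorem ladder_mul_monomial (h : p * q = q * p - Complex.I • 1) (σ z : ℂ) (j k : ℕ) :
    z • (1 / (Real.sqrt 2 : ℂ)) • (q ^ (j + 1) * p ^ k +
      σ • (Complex.I • (q ^ j * p ^ (k + 1)) + (j : ℂ) • (q ^ (j - 1) * p ^ k))) =
    ((1 / (Real.sqrt 2 : ℂ)) • (q + (σ * Complex.I) • p)) * z • (q ^ j * p ^ k) := by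
  rw [mul_smul_comm, smul_mul_assoc, add_mul, smul_mul_assoc, ← mul_assoc, ← mul_assoc,
    mul_pow_of_canonical h, sub_mul, mul_assoc (q ^ j), ← pow_succ', ← pow_succ', mul_smul]
  congr 4
  rw [smul_sub, smul_mul_assoc, smul_smul, ← mul_assoc, Complex.I_mul_I, neg_one_mul, neg_smul,
    sub_neg_eq_add]

end Algebra

theorem momentum_mul_position :
    momentum * position = position * momentum - Complex.I • (1 : Module.End ℂ schwartz) :=
  canonical_commutation annihilation_mul_creation rfl rfl

/-! ### Left multiplication in the ordered basis -/

namespace CanonicalPoly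

/-- The operator of a polynomial, as a linear map. -/
def opLin : CanonicalPoly →ₗ[ℂ] Module.End ℂ schwartz :=
  Finsupp.linearCombination ℂ fun m : ℕ × ℕ => position ^ m.1 * momentum ^ m.2

theorem opLin_apply (P : CanonicalPoly) : opLin P = P.op := Finsupp.linearCombination_apply ℂ P

/-- Left multiplication by `(q + σ i p) / √2`, the ladder operator `a` for `σ = 1` and `a†` for
`σ = -1`. -/
def ladder (σ : ℂ) : CanonicalPoly →ₗ[ℂ] CanonicalPoly :=
  Finsupp.linearCombination ℂ fun m : ℕ × ℕ => (1 / (Real.sqrt 2 : ℂ)) •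
    (Finsupp.single (m.1 + 1, m.2) (1 : ℂ) + σ • (Complex.I • Finsupp.single (m.1, m.2 + 1) (1 : ℂ) +
      (m.1 : ℂ) • Finsupp.single (m.1 - 1, m.2) (1 : ℂ)))

theorem op_ladder (σ : ℂ) (P : CanonicalPoly) : (ladder σ P).op =
    ((1 / (Real.sqrt 2 : ℂ)) • (position + (σ * Complex.I) • momentum)) * P.op := by
  rw [← opLin_apply, ← opLin_apply]
  induction P using Finsupp.induction_linear with
  | zero => simp
  | add P Q hP hQ => rw [map_add, map_add, map_add, hP, hQ, mul_add]
  | single m z =>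
    simp only [ladder, opLin, Finsupp.linearCombination_single, map_smul, map_add, one_smul]
    exact ladder_mul_monomial momentum_mul_position σ z m.1 m.2

theorem op_ladder_one (P : CanonicalPoly) : (ladder 1 P).op = annihilation * P.op := by
  rw [op_ladder, one_mul]
  exact congrArg (· * P.op) (add_ladder_eq (A := Module.End ℂ schwartz) rfl rfl)

theorem op_ladder_neg_one (P : CanonicalPoly) : (ladder (-1) P).op = creation * P.op := by
  rw [op_ladder, neg_one_mul]
  exact congrArg (· * P.op) (sub_ladder_eq (A := Module.End ℂ schwartz) rfl rfl)

/-- The recursion for the coefficients in the form in which the machine evaluates it, from three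
neighbouring entries. -/
theorem ladder_apply (σ : ℂ) (P : CanonicalPoly) (j k : ℕ) : ladder σ P (j, k) =
    (1 / (Real.sqrt 2 : ℂ)) * ((if j = 0 then 0 else P (j - 1, k)) +
      σ * (Complex.I * (if k = 0 then 0 else P (j, k - 1)) + (j + 1) * P (j + 1, k))) := by
  induction P using Finsupp.induction_linear with
  | zero => simp
  | add P Q hP hQ =>
    rw [map_add, Finsupp.add_apply, hP, hQ]
    simp only [Finsupp.add_apply]
    split_ifs <;> ring
  | single m z =>
    obtain ⟨a, b⟩ := m
    simp only [ladder, Finsupp.linearCombination_single, Finsupp.smul_apply, Finsupp.add_apply,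
      smul_eq_mul]
    have e1 : (Finsupp.single (a + 1, b) (1 : ℂ)) (j, k) * z =
        if j = 0 then 0 else (Finsupp.single (a, b) z) (j - 1, k) := by
      rcases j with _ | j
      · simp
      · simp [Finsupp.single_apply]
    have e2 : (Finsupp.single (a, b + 1) (1 : ℂ)) (j, k) * z =
        if k = 0 then 0 else (Finsupp.single (a, b) z) (j, k - 1) := by
      rcases k with _ | k
      · simp
      · simp [Finsupp.single_apply]
    have e3 : (a : ℂ) * (Finsupp.single (a - 1, b) (1 : ℂ)) (j, k) * z =
        (j + 1) * (Finsupp.single (a, b) z) (j + 1, k) := by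
      rcases a with _ | a
      · simp [Finsupp.single_apply]
      · by_cases h : a = j ∧ b = k
        · obtain ⟨rfl, rfl⟩ := h; simp
        · have h1 : ¬ ((a, b) = (j, k)) := by simpa using h
          simp [h]
    rw [← e1, ← e2, ← e3]
    ring

/-- The degree is at most `D`. -/
def DegLE (P : CanonicalPoly) (D : ℕ) : Prop := ∀ j k, D < j + k → P (j, k) = 0

theorem DegLE.degree_le {P : CanonicalPoly} {D : ℕ} (h : P.DegLE D) : P.degree ≤ D := by
  refine Finset.sup_le fun m hm => ?_
  by_contra hlt
  exact Finsupp.mem_support_iff.mp hm (h m.1 m.2 (not_le.mp hlt))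

theorem DegLE.mono {P : CanonicalPoly} {D D' : ℕ} (h : P.DegLE D) (hD : D ≤ D') : P.DegLE D' :=
  fun j k hjk => h j k (hD.trans_lt hjk)

theorem DegLE.add {P Q : CanonicalPoly} {D : ℕ} (hP : P.DegLE D) (hQ : Q.DegLE D) :
    (P + Q).DegLE D := fun j k h => by rw [Finsupp.add_apply, hP j k h, hQ j k h, add_zero]

theorem DegLE.sum {ι : Type*} (s : Finset ι) {P : ι → CanonicalPoly} {D : ℕ}
    (hP : ∀ i ∈ s, (P i).DegLE D) : (∑ i ∈ s, P i).DegLE D := fun j k h => by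
  rw [Finsupp.finsetSum_apply]
  exact Finset.sum_eq_zero fun i hi => hP i hi j k h

theorem DegLE.smul {P : CanonicalPoly} {D : ℕ} (hP : P.DegLE D) (z : ℂ) :
    (z • P).DegLE D := fun j k h => by rw [Finsupp.smul_apply, hP j k h, smul_zero]

theorem DegLE.ladder {P : CanonicalPoly} {D : ℕ} (hP : P.DegLE D) (σ : ℂ) :
    (ladder σ P).DegLE (D + 1) := fun j k h => by
  rw [ladder_apply, hP (j + 1) k (by omega)]
  have h1 : (if j = 0 then 0 else P (j - 1, k)) = 0 := by
    split_ifs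
    · rfl
    · exact hP _ _ (by omega)
  have h2 : (if k = 0 then 0 else P (j, k - 1)) = 0 := by
    split_ifs
    · rfl
    · exact hP _ _ (by omega)
  rw [h1, h2]
  ring

/-- Left multiplication by `x + y n̂`. -/
def affineNumber (x y : ℂ) (P : CanonicalPoly) : CanonicalPoly :=
  x • P + y • ladder (-1) (ladder 1 P)

theorem DegLE.affineNumber {P : CanonicalPoly} {D : ℕ} (hP : P.DegLE D) (x y : ℂ) :
    (affineNumber x y P).DegLE (D + 2) :=
  ((hP.mono (by omega)).smul x).add (((hP.ladder 1).ladder (-1)).smul y)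

theorem op_affineNumber (x y : ℂ) (P : CanonicalPoly) :
    (affineNumber x y P).op = (x • 1 + y • number) * P.op := by
  rw [affineNumber, ← opLin_apply, map_add, map_smul, map_smul, opLin_apply, opLin_apply,
    op_ladder_neg_one, op_ladder_one, number, add_mul, smul_mul_assoc, smul_mul_assoc, one_mul,
    mul_assoc]

end CanonicalPoly

/-! ### The Hamiltonian with a prescribed finite block -/

theorem annihilation_pow_apply (j : ℕ) (ψ : schwartz) (n : ℕ) :
    ((annihilation ^ j) ψ : Mode) n =
      (Real.sqrt ((n + 1).ascFactorial j : ℕ) : ℂ) * (ψ : Mode) (n + j) := by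
  induction j generalizing ψ with
  | zero => simp
  | succ j ih =>
    rw [pow_succ, Module.End.mul_apply, ih, annihilation_apply, ← mul_assoc, ← Complex.ofReal_mul,
      ← Real.sqrt_mul (by positivity), Nat.ascFactorial_succ]
    push_cast
    ring_nf

theorem creation_pow_apply_add (i : ℕ) (ψ : schwartz) (n : ℕ) :
    ((creation ^ i) ψ : Mode) (n + i) =
      (Real.sqrt ((n + 1).ascFactorial i : ℕ) : ℂ) * (ψ : Mode) n := by
  induction i with
  | zero => simp
  | succ i ih =>
    rw [pow_succ', Module.End.mul_apply, ← add_assoc, creation_apply_succ, ih, ← mul_assoc,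
      ← Complex.ofReal_mul, ← Real.sqrt_mul (by positivity), Nat.ascFactorial_succ]
    push_cast
    ring_nf

theorem creation_pow_apply_of_lt (i : ℕ) (ψ : schwartz) (n : ℕ) (hn : n < i) :
    ((creation ^ i) ψ : Mode) n = 0 := by
  induction i generalizing n with
  | zero => omega
  | succ i ih =>
    rw [pow_succ', Module.End.mul_apply]
    cases n with
    | zero => exact creation_apply_zero _
    | succ n => rw [creation_apply_succ, ih n (by omega), mul_zero]

/-- `X` is the function `f` of the number operator. -/
def IsNumberFunction (X : Module.End ℂ schwartz) (f : ℕ → ℂ) : Prop :=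
  ∀ (ψ : schwartz) n, (X ψ : Mode) n = f n * (ψ : Mode) n

theorem IsNumberFunction.mul {X Y : Module.End ℂ schwartz} {f g : ℕ → ℂ} (hX : IsNumberFunction X f)
    (hY : IsNumberFunction Y g) : IsNumberFunction (X * Y) fun n => f n * g n := fun ψ n => by
  rw [Module.End.mul_apply, hX, hY, mul_assoc]

theorem IsNumberFunction.affine (x y : ℂ) :
    IsNumberFunction (x • 1 + y • number) fun n => x + y * n := fun ψ n => by
  change x * (ψ : Mode) n + y * (number ψ : Mode) n = _
  rw [number_apply]
  ring

/-- The function `∏ k ∈ [1, b], (1 - n / k)`, which is `δ_{n0}` on `n ≤ b`. -/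
def vacuumFun (b n : ℕ) : ℂ := ∏ k ∈ Finset.range b, (1 + (-1 / ((k : ℂ) + 1)) * n)

/-- The function `∏ k ∈ [0, b), (n - k) ^ 2`. -/
def confiningFun (b n : ℕ) : ℂ :=
  ∏ k ∈ Finset.range b, ((-(k : ℂ) + 1 * n) * (-(k : ℂ) + 1 * n))

namespace CanonicalPoly

/-- Left multiplication by `vacuumFun b n̂`. -/
def vacuum (P : CanonicalPoly) : ℕ → CanonicalPoly
  | 0 => P
  | b + 1 => affineNumber 1 (-1 / ((b : ℂ) + 1)) (vacuum P b)

/-- Left multiplication by `confiningFun b n̂`. -/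
def confining (P : CanonicalPoly) : ℕ → CanonicalPoly
  | 0 => P
  | b + 1 => affineNumber (-(b : ℂ)) 1 (affineNumber (-(b : ℂ)) 1 (confining P b))

/-- The constant polynomial `1`. -/
def unit : CanonicalPoly := Finsupp.single (0, 0) 1

theorem op_unit : unit.op = 1 := by
  rw [← opLin_apply, unit, opLin, Finsupp.linearCombination_single, one_smul, pow_zero, pow_zero,
    mul_one]

theorem degLE_unit : unit.DegLE 0 := fun j k h => by
  have : ((0 : ℕ), (0 : ℕ)) ≠ (j, k) := by
    intro he
    rw [Prod.mk.injEq] at he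
    omega
  rw [unit, Finsupp.single_apply, if_neg this]

theorem op_vacuum (b : ℕ) :
    ∃ X, IsNumberFunction X (vacuumFun b) ∧ ∀ P, (vacuum P b).op = X * P.op := by
  induction b with
  | zero =>
    refine ⟨1, fun ψ n => ?_, fun P => (one_mul _).symm⟩
    simp [vacuumFun]
  | succ b ih =>
    obtain ⟨X, hX, h⟩ := ih
    refine ⟨((1 : ℂ) • 1 + (-1 / ((b : ℂ) + 1)) • number) * X, fun ψ n => ?_, fun P => ?_⟩
    rotate_left
    · rw [vacuum, op_affineNumber, h, ← mul_assoc]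
    · refine (((IsNumberFunction.affine _ _).mul hX) ψ n).trans ?_
      simp only [vacuumFun, Finset.prod_range_succ]
      ring

theorem op_confining (b : ℕ) :
    ∃ X, IsNumberFunction X (confiningFun b) ∧ ∀ P, (confining P b).op = X * P.op := by
  induction b with
  | zero =>
    refine ⟨1, fun ψ n => ?_, fun P => (one_mul _).symm⟩
    simp [confiningFun]
  | succ b ih =>
    obtain ⟨X, hX, h⟩ := ih
    refine ⟨((-(b : ℂ)) • 1 + (1 : ℂ) • number) * ((-(b : ℂ)) • 1 + (1 : ℂ) • number) * X,
      fun ψ n => ?_, fun P => ?_⟩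
    rotate_left
    · rw [confining, op_affineNumber, op_affineNumber, h, ← mul_assoc, ← mul_assoc]
    · refine ((((IsNumberFunction.affine _ _).mul (IsNumberFunction.affine _ _)).mul hX) ψ n).trans ?_
      simp only [confiningFun, Finset.prod_range_succ]
      ring

theorem DegLE.vacuum {P : CanonicalPoly} {D : ℕ} (hP : P.DegLE D) (b : ℕ) :
    (vacuum P b).DegLE (D + 2 * b) := by
  induction b with
  | zero => exact hP
  | succ b ih => exact (ih.affineNumber _ _).mono (by omega)

theorem DegLE.confining {P : CanonicalPoly} {D : ℕ} (hP : P.DegLE D) (b : ℕ) :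
    (confining P b).DegLE (D + 4 * b) := by
  induction b with
  | zero => exact hP
  | succ b ih => exact ((ih.affineNumber _ _).affineNumber _ _).mono (by omega)

theorem DegLE.ladder_iterate {P : CanonicalPoly} {D : ℕ} (hP : P.DegLE D) (σ : ℂ) (i : ℕ) :
    ((CanonicalPoly.ladder σ)^[i] P).DegLE (D + i) := by
  induction i with
  | zero => exact hP
  | succ i ih =>
    rw [Function.iterate_succ_apply']
    exact ih.ladder σ

theorem op_ladder_iterate_one (P : CanonicalPoly) (j : ℕ) :
    ((ladder 1)^[j] P).op = annihilation ^ j * P.op := by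
  induction j with
  | zero => exact (one_mul _).symm
  | succ j ih => rw [Function.iterate_succ_apply', op_ladder_one, ih, pow_succ', mul_assoc]

theorem op_ladder_iterate_neg_one (P : CanonicalPoly) (j : ℕ) :
    ((ladder (-1))^[j] P).op = creation ^ j * P.op := by
  induction j with
  | zero => exact (one_mul _).symm
  | succ j ih => rw [Function.iterate_succ_apply', op_ladder_neg_one, ih, pow_succ', mul_assoc]

/-- The coefficient of `a† ^ i |0⟩⟨0| a ^ j` in the Hamiltonian with block `h`. -/
def blockCoeff (h : ℕ → ℕ → ℂ) (i j : ℕ) : ℂ :=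
  h i j / ((Real.sqrt (i.factorial : ℝ) : ℂ) * (Real.sqrt (j.factorial : ℝ) : ℂ))

/-- A polynomial Hamiltonian that acts as the matrix `h` on the span of `|0⟩, …, |m - 1⟩`. -/
def blockHamiltonian (m : ℕ) (h : ℕ → ℕ → ℂ) : CanonicalPoly :=
  (∑ j ∈ Finset.range m, ∑ i ∈ Finset.range m,
    blockCoeff h i j • (ladder (-1))^[i] (vacuum ((ladder 1)^[j] unit) m)) + confining unit (m + 1)

/-- The block terms have degree at most `i + 2m + j ≤ 4m - 2`. The confining term has two factors of
degree `2` for each of the `m + 1` levels, and determines the bound. -/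
theorem degLE_blockHamiltonian (m : ℕ) (h : ℕ → ℕ → ℂ) :
    (blockHamiltonian m h).DegLE (4 * m + 4) := by
  refine DegLE.add (DegLE.sum _ fun j hj => DegLE.sum _ fun i hi => ?_) ?_
  · rw [Finset.mem_range] at hi hj
    refine DegLE.smul ?_ _
    exact (((degLE_unit.ladder_iterate 1 j).vacuum m).ladder_iterate (-1) i).mono (by omega)
  · exact (degLE_unit.confining (m + 1)).mono (by omega)

theorem op_blockHamiltonian (m : ℕ) (h : ℕ → ℕ → ℂ) :
    ∃ X Y, IsNumberFunction X (vacuumFun m) ∧ IsNumberFunction Y (confiningFun (m + 1)) ∧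
      (blockHamiltonian m h).op = (∑ j ∈ Finset.range m, ∑ i ∈ Finset.range m,
        blockCoeff h i j • (creation ^ i * (X * annihilation ^ j))) + Y := by
  obtain ⟨X, hX, hX'⟩ := op_vacuum m
  obtain ⟨Y, hY, hY'⟩ := op_confining (m + 1)
  refine ⟨X, Y, hX, hY, ?_⟩
  rw [← opLin_apply, blockHamiltonian, map_add, opLin_apply (confining _ _), hY', op_unit, mul_one, map_sum]
  congr 1
  refine Finset.sum_congr rfl fun j _ => ?_
  rw [map_sum]
  refine Finset.sum_congr rfl fun i _ => ?_
  rw [map_smul, opLin_apply, op_ladder_iterate_neg_one, hX', op_ladder_iterate_one, op_unit,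
    mul_one]

end CanonicalPoly

/-! ### Symmetry -/

theorem _root_.HasSum.unique_of_eq {f g : ℕ → ℂ} {a b : ℂ} (hf : HasSum f a) (hg : HasSum g b)
    (h : ∀ n, f n = g n) : a = b := by
  obtain rfl : f = g := funext h
  exact hf.unique hg

theorem hasSum_inner_mode (φ ψ : Mode) : HasSum (fun n => conj (φ n) * ψ n) (inner ℂ φ ψ) := by
  have h := lp.hasSum_inner (𝕜 := ℂ) φ ψ
  simpa only [RCLike.inner_apply, mul_comm] using h

theorem inner_annihilation (φ ψ : schwartz) :
    inner ℂ (annihilation φ : Mode) (ψ : Mode) = inner ℂ (φ : Mode) (creation ψ : Mode) := by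
  have h1 := hasSum_inner_mode (annihilation φ : Mode) ψ
  have h2 := hasSum_inner_mode (φ : Mode) (creation ψ : Mode)
  rw [← hasSum_nat_add_iff' 1] at h2
  simp only [Finset.sum_range_one, creation_apply_zero, mul_zero, sub_zero, creation_apply_succ]
    at h2
  refine h1.unique_of_eq h2 fun n => ?_
  rw [annihilation_apply, map_mul, Complex.conj_ofReal]
  ring

/-- `Y` is a formal adjoint of `X` on the Schwartz space. -/
def IsFormalAdjoint (X Y : Module.End ℂ schwartz) : Prop :=
  ∀ φ ψ : schwartz, inner ℂ (X φ : Mode) (ψ : Mode) = inner ℂ (φ : Mode) (Y ψ : Mode)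

namespace IsFormalAdjoint

variable {X Y X' Y' : Module.End ℂ schwartz}

theorem symm (h : IsFormalAdjoint X Y) : IsFormalAdjoint Y X := fun φ ψ => by
  rw [← inner_conj_symm, ← h, inner_conj_symm]

theorem mul (h : IsFormalAdjoint X Y) (h' : IsFormalAdjoint X' Y') :
    IsFormalAdjoint (X * X') (Y' * Y) := fun φ ψ => by
  rw [Module.End.mul_apply, Module.End.mul_apply, h, h']

theorem pow (h : IsFormalAdjoint X Y) (n : ℕ) : IsFormalAdjoint (X ^ n) (Y ^ n) := by
  induction n with
  | zero => exact fun _ _ => rfl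
  | succ n ih => rw [pow_succ, pow_succ']; exact ih.mul h

theorem smul (h : IsFormalAdjoint X Y) (z : ℂ) : IsFormalAdjoint (z • X) (conj z • Y) :=
  fun φ ψ => by
    change inner ℂ (z • (X φ : Mode)) (ψ : Mode) = inner ℂ (φ : Mode) (conj z • (Y ψ : Mode))
    rw [inner_smul_left, inner_smul_right, h]

theorem add (h : IsFormalAdjoint X Y) (h' : IsFormalAdjoint X' Y') :
    IsFormalAdjoint (X + X') (Y + Y') := fun φ ψ => by
  change inner ℂ ((X φ : Mode) + (X' φ : Mode)) (ψ : Mode) =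
    inner ℂ (φ : Mode) ((Y ψ : Mode) + (Y' ψ : Mode))
  rw [inner_add_left, inner_add_right, h, h']

theorem sum {ι : Type*} (s : Finset ι) {F G : ι → Module.End ℂ schwartz}
    (h : ∀ i ∈ s, IsFormalAdjoint (F i) (G i)) : IsFormalAdjoint (∑ i ∈ s, F i) (∑ i ∈ s, G i) := by
  classical
  induction s using Finset.induction_on with
  | empty =>
    intro φ ψ
    simp
  | insert a s ha ih =>
    rw [Finset.sum_insert ha, Finset.sum_insert ha]
    exact (h a (Finset.mem_insert_self _ _)).add
      (ih fun i hi => h i (Finset.mem_insert_of_mem hi))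

end IsFormalAdjoint

theorem IsNumberFunction.isFormalAdjoint {X : Module.End ℂ schwartz} {f : ℕ → ℂ}
    (hX : IsNumberFunction X f) (hf : ∀ n, conj (f n) = f n) : IsFormalAdjoint X X := fun φ ψ => by
  have h1 := hasSum_inner_mode (X φ : Mode) ψ
  have h2 := hasSum_inner_mode (φ : Mode) (X ψ : Mode)
  refine h1.unique_of_eq h2 fun n => ?_
  rw [hX, hX, map_mul, hf]
  ring

theorem conj_vacuumFun (b n : ℕ) : conj (vacuumFun b n) = vacuumFun b n := by
  rw [vacuumFun, map_prod]
  exact Finset.prod_congr rfl fun k _ => by simp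

theorem conj_confiningFun (b n : ℕ) : conj (confiningFun b n) = confiningFun b n := by
  rw [confiningFun, map_prod]
  exact Finset.prod_congr rfl fun k _ => by simp

/-- The functions of the number operator are real, so taking adjoints exchanges the terms `(i, j)`
and `(j, i)`, and their coefficients are conjugate. -/
theorem isHermitian_blockHamiltonian (m : ℕ) (h : ℕ → ℕ → ℂ)
    (hh : ∀ i < m, ∀ j < m, conj (h i j) = h j i) :
    (CanonicalPoly.blockHamiltonian m h).IsHermitian := by
  obtain ⟨X, Y, hX, hY, e⟩ := CanonicalPoly.op_blockHamiltonian m h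
  have key : IsFormalAdjoint (CanonicalPoly.blockHamiltonian m h).op
      (CanonicalPoly.blockHamiltonian m h).op := by
    rw [e]
    refine IsFormalAdjoint.add ?_ (hY.isFormalAdjoint (conj_confiningFun _))
    have ha : IsFormalAdjoint annihilation creation := inner_annihilation
    conv => rhs; rw [Finset.sum_comm]
    refine IsFormalAdjoint.sum _ fun j hj => IsFormalAdjoint.sum _ fun i hi => ?_
    have h1 := (((ha.symm.pow i).mul ((hX.isFormalAdjoint (conj_vacuumFun m)).mul
      (ha.pow j)))).smul (CanonicalPoly.blockCoeff h i j)
    rw [Finset.mem_range] at hi hj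
    have h2 : conj (CanonicalPoly.blockCoeff h i j) = CanonicalPoly.blockCoeff h j i := by
      rw [CanonicalPoly.blockCoeff, CanonicalPoly.blockCoeff, map_div₀, map_mul,
        Complex.conj_ofReal, Complex.conj_ofReal, hh i hi j hj, mul_comm (Complex.ofReal _)]
    rw [h2, mul_assoc] at h1
    exact h1
  exact key

/-! ### Norms of sequences -/

theorem hasSum_norm_sq (ψ : Mode) : HasSum (fun n => ‖ψ n‖ ^ 2) (‖ψ‖ ^ 2) := by
  have h := lp.hasSum_norm (p := 2) (by simp) ψ
  simpa using h

/-- A term `a†^i f(n̂) a^j` is a weighted shift that takes the component `n + j` to the component `n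
+ i`, so its norm is controlled by the size of the weights. -/
theorem norm_le_of_shift {x y : Mode} {i j : ℕ} {c : ℝ} (hc : 0 ≤ c) (h0 : ∀ k < i, x k = 0)
    (h : ∀ n, ‖x (n + i)‖ ≤ c * ‖y (n + j)‖) : ‖x‖ ≤ c * ‖y‖ := by
  have hx := hasSum_norm_sq x
  have hy := hasSum_norm_sq y
  rw [← hasSum_nat_add_iff' i, Finset.sum_eq_zero fun k hk => by
    rw [h0 k (Finset.mem_range.mp hk), norm_zero, zero_pow two_ne_zero], sub_zero] at hx
  have hy' := (hasSum_nat_add_iff' j).mpr hy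
  have h1 : ‖x‖ ^ 2 ≤ c ^ 2 * (‖y‖ ^ 2 - ∑ k ∈ Finset.range j, ‖y k‖ ^ 2) := by
    refine hasSum_le (fun n => ?_) hx (hy'.mul_left (c ^ 2))
    rw [← mul_pow]
    gcongr
    exact h n
  have h2 : 0 ≤ ∑ k ∈ Finset.range j, ‖y k‖ ^ 2 := Finset.sum_nonneg fun _ _ => by positivity
  refine le_of_sq_le_sq ?_ (by positivity)
  rw [mul_pow]
  nlinarith [mul_nonneg (sq_nonneg c) h2]

theorem norm_le_of_forall_le {x y : Mode} (h : ∀ n, ‖x n‖ ≤ ‖y n‖) : ‖x‖ ≤ ‖y‖ := by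
  have := norm_le_of_shift (x := x) (y := y) (i := 0) (j := 0) zero_le_one (by simp)
    (by simpa using h)
  simpa using this

theorem fock_apply (n k : ℕ) : (fock n : Mode) k = if k = n then 1 else 0 := by
  rw [fock, lp.coeFn_single]
  by_cases h : k = n
  · subst h; simp
  · simp [h]

theorem fock_mem_schwartz (n : ℕ) : fock n ∈ schwartz := by
  intro k
  refine tendsto_const_nhds.congr' ?_
  filter_upwards [eventually_gt_atTop n] with l hl
  rw [fock_apply, if_neg hl.ne', mul_zero]

theorem dense_span_fock : Dense (Submodule.span ℂ (Set.range fock) : Set Mode) := by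
  intro ψ
  have h := lp.hasSum_single (p := 2) (by simp) ψ
  refine mem_closure_of_tendsto h (Eventually.of_forall fun s => ?_)
  refine Submodule.sum_mem _ fun n _ => ?_
  have : lp.single 2 n (ψ n) = ψ n • fock n := by
    rw [fock, ← lp.single_smul, smul_eq_mul, mul_one]
  rw [this]
  exact Submodule.smul_mem _ _ (Submodule.subset_span ⟨n, rfl⟩)

theorem dense_schwartz : Dense (schwartz : Set Mode) :=
  dense_span_fock.mono (Submodule.span_le.mpr (by rintro _ ⟨n, rfl⟩; exact fock_mem_schwartz n))

/-- The Fock state as a Schwartz vector. -/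
def fockS (n : ℕ) : schwartz := ⟨fock n, fock_mem_schwartz n⟩

/-! ### Growth of the coefficients -/

theorem sqrt_ascFactorial_le {m i n : ℕ} (hi : i < m) :
    Real.sqrt ((n + 1).ascFactorial i : ℕ) ≤ Real.sqrt (((n + m : ℕ) : ℝ) ^ m) := by
  apply Real.sqrt_le_sqrt
  have h1 : (n + 1).ascFactorial i ≤ (n + m) ^ m :=
    (Nat.ascFactorial_le_pow_add n i).trans
      ((Nat.pow_le_pow_left (by omega) i).trans (Nat.pow_le_pow_right (by omega) hi.le))
  exact_mod_cast h1

theorem norm_vacuumFun_le (m n : ℕ) (hm : 0 < m) : ‖vacuumFun m n‖ ≤ ((n + m : ℕ) : ℝ) ^ m := by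
  rw [vacuumFun, norm_prod]
  calc ∏ k ∈ Finset.range m, ‖(1 + (-1 / ((k : ℂ) + 1)) * n : ℂ)‖
      ≤ ∏ _k ∈ Finset.range m, ((n + m : ℕ) : ℝ) := by
        refine Finset.prod_le_prod (fun _ _ => norm_nonneg _) fun k _ => ?_
        refine (norm_add_le _ _).trans ?_
        have h1 : ‖(-1 / ((k : ℂ) + 1))‖ ≤ 1 := by
          rw [norm_div, norm_neg, norm_one]
          have : ‖(k : ℂ) + 1‖ = k + 1 := by
            rw [← Nat.cast_succ, Complex.norm_natCast]; simp
          rw [this, div_le_one (by positivity)]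
          linarith [(Nat.cast_nonneg k : (0 : ℝ) ≤ k)]
        rw [norm_one, norm_mul, Complex.norm_natCast]
        have h2 : (1 : ℝ) ≤ m := by exact_mod_cast hm
        push_cast
        nlinarith [(Nat.cast_nonneg n : (0 : ℝ) ≤ n)]
    _ = _ := by rw [Finset.prod_const, Finset.card_range]

/-- The confining function, as a real number. -/
def confiningReal (b n : ℕ) : ℝ := ∏ k ∈ Finset.range b, (((n : ℝ) - k) ^ 2)

theorem confiningFun_eq (b n : ℕ) : confiningFun b n = (confiningReal b n : ℂ) := by
  rw [confiningFun, confiningReal, Complex.ofReal_prod]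
  refine Finset.prod_congr rfl fun k _ => ?_
  push_cast
  ring

theorem confiningReal_nonneg (b n : ℕ) : 0 ≤ confiningReal b n :=
  Finset.prod_nonneg fun _ _ => sq_nonneg _

/-- At level `n + j` a block term is at most `(n + j + m)^{2m}`, whereas the confining product is of
order `(n + j)^{2m + 2}`. The two extra powers win over any constant `c` at high levels, and the
shift `l` pays for the finitely many others. -/
theorem exists_confining_bound (m : ℕ) (hm : 0 < m) (c : ℝ) (hc : 0 ≤ c) :
    ∃ l : ℝ, 1 ≤ l ∧ ∀ n j i : ℕ, i < m → j < m →
      c * (Real.sqrt ((n + 1).ascFactorial i : ℕ) * ‖vacuumFun m n‖ *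
        Real.sqrt ((n + 1).ascFactorial j : ℕ)) ≤ confiningReal (m + 1) (n + j) + l := by
  -- With `n + j = m + y` and `y ≥ m + k₁`, the confining product is at least `y^{2(m+1)}` and `n +
  -- j + m ≤ 3y`. This costs the factor `9^m`, and `y ≥ k₁` ensures `c 9^m ≤ y²`.
  obtain ⟨k₁, hk₁⟩ := exists_nat_ge (c * 9 ^ m + 1)
  refine ⟨c * ((3 * m + k₁ : ℕ) : ℝ) ^ (2 * m) + 1, by
    have : 0 ≤ c * ((3 * m + k₁ : ℕ) : ℝ) ^ (2 * m) := by positivity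
    linarith, fun n j i hi hj => ?_⟩
  have h1 : Real.sqrt ((n + 1).ascFactorial i : ℕ) * ‖vacuumFun m n‖ *
        Real.sqrt ((n + 1).ascFactorial j : ℕ) ≤ ((n + j + m : ℕ) : ℝ) ^ (2 * m) := by
    calc Real.sqrt ((n + 1).ascFactorial i : ℕ) * ‖vacuumFun m n‖ *
        Real.sqrt ((n + 1).ascFactorial j : ℕ)
        ≤ Real.sqrt (((n + m : ℕ) : ℝ) ^ m) * ((n + m : ℕ) : ℝ) ^ m *
          Real.sqrt (((n + m : ℕ) : ℝ) ^ m) := by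
          gcongr ?_ * ?_ * ?_
          · exact sqrt_ascFactorial_le hi
          · exact norm_vacuumFun_le m n hm
          · exact sqrt_ascFactorial_le hj
      _ = ((n + m : ℕ) : ℝ) ^ (2 * m) := by
          rw [mul_right_comm, Real.mul_self_sqrt (by positivity), ← pow_add, two_mul]
      _ ≤ _ := by
          gcongr
          omega
  have h0 := confiningReal_nonneg (m + 1) (n + j)
  rcases lt_or_ge (n + j) (2 * m + k₁) with hlt | hge
  · have h2 : ((n + j + m : ℕ) : ℝ) ^ (2 * m) ≤ ((3 * m + k₁ : ℕ) : ℝ) ^ (2 * m) := by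
      have : n + j + m ≤ 3 * m + k₁ := by omega
      exact pow_le_pow_left₀ (Nat.cast_nonneg _) (by exact_mod_cast this) _
    nlinarith [mul_le_mul_of_nonneg_left (h1.trans h2) hc]
  · obtain ⟨y, hy⟩ : ∃ y, n + j = m + y := ⟨n + j - m, by omega⟩
    have hy1 : m + k₁ ≤ y := by omega
    have h3 : ((y : ℝ) ^ 2) ^ (m + 1) ≤ confiningReal (m + 1) (n + j) := by
      rw [confiningReal, ← Finset.card_range (m + 1), ← Finset.prod_const, Finset.card_range]
      refine Finset.prod_le_prod (fun _ _ => sq_nonneg _) fun k hk => ?_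
      rw [Finset.mem_range] at hk
      have : (k : ℝ) ≤ m := by exact_mod_cast Nat.lt_succ_iff.mp hk
      have h4 : (y : ℝ) ≤ ((n + j : ℕ) : ℝ) - k := by
        rw [hy]; push_cast; linarith
      exact pow_le_pow_left₀ (Nat.cast_nonneg _) h4 2
    have h5 : ((n + j + m : ℕ) : ℝ) ^ (2 * m) ≤ 9 ^ m * ((y : ℝ) ^ 2) ^ m := by
      rw [← mul_pow, pow_mul]
      have : ((n + j + m : ℕ) : ℝ) ≤ 3 * y := by
        have : n + j + m ≤ 3 * y := by omega
        exact_mod_cast this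
      gcongr
      nlinarith [(Nat.cast_nonneg (n + j + m) : (0 : ℝ) ≤ _)]
    have hyk : (k₁ : ℝ) ≤ y := by exact_mod_cast (show k₁ ≤ y by omega)
    have hc9 : 0 ≤ c * 9 ^ m := by positivity
    have h6 : c * 9 ^ m ≤ (y : ℝ) ^ 2 := by nlinarith
    have h7 : c * (9 ^ m * ((y : ℝ) ^ 2) ^ m) ≤ ((y : ℝ) ^ 2) ^ (m + 1) := by
      rw [pow_succ' ((y : ℝ) ^ 2) m, ← mul_assoc]
      gcongr
    have h8 : 0 ≤ c * ((3 * m + k₁ : ℕ) : ℝ) ^ (2 * m) := by positivity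
    have := mul_le_mul_of_nonneg_left (h1.trans h5) hc
    linarith

theorem vacuumFun_zero (m : ℕ) : vacuumFun m 0 = 1 := by
  simp [vacuumFun]

theorem vacuumFun_eq_zero {m n : ℕ} (h0 : 0 < n) (hn : n ≤ m) : vacuumFun m n = 0 := by
  refine Finset.prod_eq_zero (i := n - 1) (Finset.mem_range.mpr (by omega)) ?_
  have : ((n - 1 : ℕ) : ℂ) + 1 = n := by
    rw [Nat.cast_sub (by omega)]; simp
  rw [this]
  have : (n : ℂ) ≠ 0 := by exact_mod_cast h0.ne'
  field_simp
  norm_num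

theorem confiningFun_eq_zero {b n : ℕ} (hn : n < b) : confiningFun b n = 0 := by
  refine Finset.prod_eq_zero (i := n) (Finset.mem_range.mpr hn) ?_
  ring

/-- After `a^j` only the component `n = l - j ≤ m` survives, and in this range the vacuum function
is `1` at `n = 0` and `0` elsewhere. So exactly `j = l` contributes. -/
theorem block_apply_fock {m : ℕ} {X : Module.End ℂ schwartz} (hX : IsNumberFunction X (vacuumFun m))
    (i j l : ℕ) (hl : l ≤ m) :
    (((creation ^ i * (X * annihilation ^ j)) (fockS l) : schwartz) : Mode) =
      if j = l then ((Real.sqrt (i.factorial : ℝ) : ℂ) * (Real.sqrt (j.factorial : ℝ) : ℂ)) • fock i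
      else 0 := by
  have hval : ∀ n, (((creation ^ i * (X * annihilation ^ j)) (fockS l) : schwartz) : Mode) (n + i) =
      (Real.sqrt ((n + 1).ascFactorial i : ℕ) : ℂ) * (vacuumFun m n *
        ((Real.sqrt ((n + 1).ascFactorial j : ℕ) : ℂ) * if n + j = l then 1 else 0)) := fun n => by
    rw [Module.End.mul_apply, Module.End.mul_apply, creation_pow_apply_add, hX,
      annihilation_pow_apply]
    congr 3
    exact fock_apply l (n + j)
  ext k
  rcases lt_or_ge k i with hk | hk
  · rw [Module.End.mul_apply, creation_pow_apply_of_lt i _ k hk]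
    split_ifs
    · rw [lp.coeFn_smul, Pi.smul_apply, fock_apply, if_neg hk.ne, smul_zero]
    · rfl
  · obtain ⟨n, rfl⟩ := Nat.exists_eq_add_of_le' hk
    rw [hval]
    rcases Nat.eq_zero_or_pos n with rfl | hn
    · rw [vacuumFun_zero, zero_add, zero_add]
      by_cases h : j = l
      · rw [if_pos h, if_pos ((zero_add j).trans h), lp.coeFn_smul, Pi.smul_apply, fock_apply, if_pos rfl]
        simp [Nat.one_ascFactorial]
      · rw [if_neg h, if_neg (by omega)]
        simp
    · have h1 : (if j = l then ((Real.sqrt (i.factorial : ℝ) : ℂ) *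
          (Real.sqrt (j.factorial : ℝ) : ℂ)) • fock i else 0 : Mode) (n + i) = 0 := by
        split_ifs
        · rw [lp.coeFn_smul, Pi.smul_apply, fock_apply, if_neg (by omega), smul_zero]
        · rfl
      rw [h1]
      by_cases h : n + j = l
      · rw [vacuumFun_eq_zero hn (by omega)]; ring
      · rw [if_neg h]; ring

theorem op_blockHamiltonian_fock (m : ℕ) (h : ℕ → ℕ → ℂ) (l : ℕ) (hl : l < m) :
    ((CanonicalPoly.blockHamiltonian m h).op (fockS l) : Mode) =
      ∑ i ∈ Finset.range m, h i l • fock i := by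
  obtain ⟨X, Y, hX, hY, e⟩ := CanonicalPoly.op_blockHamiltonian m h
  rw [e, LinearMap.add_apply, LinearMap.sum_apply]
  have hY0 : Y (fockS l) = 0 := schwartz_ext fun n => by
    rw [hY]
    have h1 : ((fockS l : schwartz) : Mode) n = if n = l then 1 else 0 := fock_apply l n
    rw [h1]
    split_ifs with h2
    · rw [h2, confiningFun_eq_zero (by omega), zero_mul]; rfl
    · rw [mul_zero]; rfl
  rw [hY0, add_zero, Finset.sum_eq_single_of_mem l (Finset.mem_range.mpr hl), LinearMap.sum_apply,
    Submodule.coe_sum]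
  · refine Finset.sum_congr rfl fun i _ => ?_
    rw [LinearMap.smul_apply, Submodule.coe_smul, block_apply_fock hX i l l hl.le, if_pos rfl,
      smul_smul, CanonicalPoly.blockCoeff, div_mul_cancel₀]
    rw [← Complex.ofReal_mul, ← Real.sqrt_mul (by positivity)]
    have : Real.sqrt ((i.factorial : ℝ) * (l.factorial : ℝ)) ≠ 0 := by positivity
    exact_mod_cast this
  · intro j _ hj
    rw [LinearMap.sum_apply]
    refine Finset.sum_eq_zero fun i _ => ?_
    rw [LinearMap.smul_apply]
    have : (creation ^ i * (X * annihilation ^ j)) (fockS l) = 0 := by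
      rw [← Submodule.coe_eq_zero, block_apply_fock hX i j l hl.le, if_neg hj]
    rw [this, smul_zero]

theorem exists_unitary_blockHamiltonian (m : ℕ) (hm : 0 < m) (h : ℕ → ℕ → ℂ)
    (hh : ∀ i < m, ∀ j < m, conj (h i j) = h j i) :
    ∃ V, IsUnitaryExp (CanonicalPoly.blockHamiltonian m h).unbounded V ∧
      ∀ j : Fin m, V (fock j) = ∑ i : Fin m, NormedSpace.exp
        (Complex.I • (Matrix.of fun i j : Fin m => h i j)) i j • fock i := by
  obtain ⟨X, Y, hX, hY, e⟩ := CanonicalPoly.op_blockHamiltonian m h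
  set P := CanonicalPoly.blockHamiltonian m h with hP
  set g := CanonicalPoly.blockCoeff h with hg
  set S : ℝ := ∑ j ∈ Finset.range m, ∑ i ∈ Finset.range m, ‖g i j‖ with hS
  have hS0 : 0 ≤ S := Finset.sum_nonneg fun _ _ => Finset.sum_nonneg fun _ _ => norm_nonneg _
  -- The constant `2(S + 1)`, with `S` the sum of the absolute values of the coefficients, makes
  -- each term at most `‖R s‖ / (2(S + 1))`, so that the weighted sum of all terms is at most `‖R s‖
  -- / 2`.
  obtain ⟨l, hl1, hl⟩ := exists_confining_bound m hm (2 * (S + 1)) (by positivity)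
  let R : schwartz →ₗ[ℂ] Mode := schwartz.subtype ∘ₗ (Y + (l : ℂ) • 1)
  let B : schwartz →ₗ[ℂ] Mode := schwartz.subtype ∘ₗ
    (∑ j ∈ Finset.range m, ∑ i ∈ Finset.range m, g i j • (creation ^ i * (X * annihilation ^ j)))
  have hRn : ∀ s n, (R s) n = ((confiningReal (m + 1) n + l : ℝ) : ℂ) * (s : Mode) n := by
    intro s n
    change (Y s : Mode) n + (l : ℂ) * (s : Mode) n = _
    rw [hY, confiningFun_eq]
    push_cast
    ring
  have hpos : ∀ n, 1 ≤ confiningReal (m + 1) n + l := fun n => by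
    linarith [confiningReal_nonneg (m + 1) n]
  have hRnorm : ∀ s n, ‖(R s) n‖ = (confiningReal (m + 1) n + l) * ‖(s : Mode) n‖ := by
    intro s n
    rw [hRn, norm_mul, Complex.norm_real, Real.norm_of_nonneg (by linarith [hpos n])]
  have hRs : ∀ s : schwartz, ‖(s : Mode)‖ ≤ ‖R s‖ := fun s => by
    refine norm_le_of_forall_le fun n => ?_
    rw [hRnorm]
    nlinarith [hpos n, norm_nonneg ((s : Mode) n)]
  have hRd : DenseRange R := by
    have : Submodule.span ℂ (Set.range fock) ≤ LinearMap.range R := by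
      refine Submodule.span_le.mpr ?_
      rintro _ ⟨n, rfl⟩
      have hne : ((confiningReal (m + 1) n + l : ℝ) : ℂ) ≠ 0 := by
        exact_mod_cast (by linarith [hpos n] : confiningReal (m + 1) n + l ≠ 0)
      refine ⟨(((confiningReal (m + 1) n + l : ℝ) : ℂ))⁻¹ • fockS n, ?_⟩
      rw [map_smul, inv_smul_eq_iff₀ hne]
      ext k
      rw [hRn, lp.coeFn_smul, Pi.smul_apply, smul_eq_mul]
      change _ * (fock n : Mode) k = _
      rw [fock_apply]
      split_ifs with hk
      · rw [hk]
      · simp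
    exact dense_span_fock.mono this
  have hterm : ∀ (s : schwartz), ∀ j < m, ∀ i < m,
      ‖((creation ^ i * (X * annihilation ^ j)) s : Mode)‖ ≤ (1 / (2 * (S + 1))) * ‖R s‖ := by
    intro s j hj i hi
    refine norm_le_of_shift (i := i) (j := j) (by positivity) (fun k hk => ?_) fun n => ?_
    · rw [Module.End.mul_apply]
      exact creation_pow_apply_of_lt i _ k hk
    · rw [Module.End.mul_apply, Module.End.mul_apply, creation_pow_apply_add, hX,
        annihilation_pow_apply, hRnorm, norm_mul, norm_mul, norm_mul, Complex.norm_real,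
        Complex.norm_real, Real.norm_of_nonneg (Real.sqrt_nonneg _),
        Real.norm_of_nonneg (Real.sqrt_nonneg _), ← mul_assoc, ← mul_assoc, ← mul_assoc]
      refine mul_le_mul_of_nonneg_right ?_ (norm_nonneg _)
      rw [one_div_mul_eq_div, le_div_iff₀ (by positivity), mul_comm]
      exact hl n j i hi hj
  have hB : ∀ s, ‖B s‖ ≤ 1 / 2 * ‖R s‖ := fun s => by
    have e1 : B s = ∑ j ∈ Finset.range m, ∑ i ∈ Finset.range m,
        g i j • ((creation ^ i * (X * annihilation ^ j)) s : Mode) := by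
      simp only [B, LinearMap.comp_apply, LinearMap.sum_apply, map_sum, LinearMap.smul_apply,
        map_smul, Submodule.subtype_apply]
    rw [e1]
    calc _ ≤ ∑ j ∈ Finset.range m, ∑ i ∈ Finset.range m, ‖g i j‖ * ((1 / (2 * (S + 1))) * ‖R s‖) := by
          refine norm_sum_le_of_le _ fun j hj => norm_sum_le_of_le _ fun i hi => ?_
          rw [norm_smul]
          gcongr
          exact hterm s j (Finset.mem_range.mp hj) i (Finset.mem_range.mp hi)
      _ = (S / (S + 1)) * (1 / 2 * ‖R s‖) := by
          simp only [← Finset.sum_mul]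
          rw [← hS]
          field_simp
      _ ≤ 1 * (1 / 2 * ‖R s‖) := by
          gcongr
          rw [div_le_one (by positivity)]
          linarith
      _ = _ := one_mul _
  have hAl : (schwartz.subtype ∘ₗ P.op) + (l : ℂ) • schwartz.subtype = R + B := by
    rw [e]
    ext1 s
    simp only [R, B, LinearMap.add_apply, LinearMap.comp_apply, LinearMap.smul_apply,
      Submodule.subtype_apply, Submodule.coe_add, Submodule.coe_smul, Module.End.one_apply]
    abel
  have hdense : DenseRange ((schwartz.subtype ∘ₗ P.op) + (l : ℂ) • schwartz.subtype) := by
    rw [hAl]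
    exact denseRange_add_of_relatively_bounded R B hRd hB
  -- The constant `2` comes from `‖s‖ ≤ ‖R s‖` and `‖B s‖ ≤ ‖R s‖ / 2`, which give `‖s‖ ≤ 2 ‖R s + B
  -- s‖`.
  obtain ⟨J, hJsa, hJinj, hJA⟩ := exists_shifted_inverse dense_schwartz (schwartz.subtype ∘ₗ P.op)
    (isHermitian_blockHamiltonian m h hh) l 2 hdense fun s => by
      have h1 : (schwartz.subtype ∘ₗ P.op) s + (l : ℂ) • (s : Mode) = R s + B s :=
        LinearMap.congr_fun hAl s
      rw [h1]
      have h2 := norm_sub_le_norm_add (R s) (B s)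
      linarith [hB s, hRs s]
  obtain ⟨V, hV⟩ := isUnitaryExp_of_shifted_inverse _ l hdense J hJsa hJinj hJA
  refine ⟨V, hV, ?_⟩
  obtain ⟨W, hadd, -, hgen, rfl⟩ := hV
  -- The Fock vectors lie in the domain of `P` itself, so the generator condition applies to them
  -- directly; the block is invariant because the confining term vanishes there.
  refine group_apply_of_invariant W hadd (fun j : Fin m => fock j) _ fun j => ?_
  refine (hgen _ _).mp ?_
  refine Submodule.le_topologicalClosure _ ?_
  rw [LinearPMap.mem_graph_iff]
  refine ⟨fockS j, rfl, ?_⟩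
  change (P.op (fockS j) : Mode) = _
  rw [op_blockHamiltonian_fock m h j j.2, Finset.sum_range]
  rfl

/-- With the shift `1` the inverse is the identity, and the closure of the zero operator is zero on
the whole space by density. This serves the case `d = 0`. -/
theorem isUnitaryExp_zero :
    IsUnitaryExp (CanonicalPoly.unbounded 0) (LinearIsometryEquiv.refl ℂ Mode) := by
  refine ⟨fun _ => LinearIsometryEquiv.refl ℂ Mode, fun _ _ _ => rfl, fun _ => continuous_const,
    fun ψ φ => ?_, rfl⟩
  have hop : (0 : CanonicalPoly).op = 0 := by
    rw [← CanonicalPoly.opLin_apply, map_zero]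
  have h := mem_closure_graph_iff (schwartz.subtype ∘ₗ (0 : CanonicalPoly).op) 1 ?_
    (ContinuousLinearMap.id ℂ Mode) ?_ ψ φ
  · refine h.trans ?_
    have h1 : HasDerivAt (fun _ : ℝ => ψ) (0 : Mode) 0 := hasDerivAt_const _ _
    constructor
    · intro h2
      have h3 : φ = 0 := by simpa using h2
      rw [h3, smul_zero]
      exact h1
    · intro h2
      have h3 := h1.unique h2
      rw [eq_comm, smul_eq_zero_iff_right Complex.I_ne_zero] at h3
      simp [h3]
  · rw [hop, LinearMap.comp_zero, zero_add, Complex.ofReal_one, one_smul]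
    exact dense_schwartz.denseRange_val
  · intro s
    rw [hop]
    simp

/-! ### The Fourier series of the angle -/

/-- Telescoping as for the Dirichlet kernel: `2 cos((k+1)θ) cos(θ/2)` is the sum of `cos((k+3/2)θ)`
and `cos((k+1/2)θ)`. The left factor in brackets is the derivative of `sawtooth N θ - θ`. -/
theorem cos_half_mul_alternating_sum (N : ℕ) (θ : ℝ) :
    Real.cos (θ / 2) * (∑ k ∈ Finset.range N, 2 * (-1) ^ k * Real.cos (((k : ℝ) + 1) * θ) - 1) =
      (-1) ^ (N + 1) * Real.cos ((N + 1 / 2) * θ) := by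
  induction N with
  | zero => simp; ring_nf
  | succ N ih =>
    rw [Finset.sum_range_succ, add_sub_right_comm, mul_add, ih]
    have h := Real.cos_add_cos (((N : ℝ) + 1 + 1 / 2) * θ) (((N : ℝ) + 1 / 2) * θ)
    rw [show (((N : ℝ) + 1 + 1 / 2) * θ + ((N : ℝ) + 1 / 2) * θ) / 2 = ((N : ℝ) + 1) * θ by ring,
      show (((N : ℝ) + 1 + 1 / 2) * θ - ((N : ℝ) + 1 / 2) * θ) / 2 = θ / 2 by ring] at h
    push_cast
    rw [pow_succ, pow_succ, pow_succ]
    linear_combination (-((-1 : ℝ) ^ N)) * h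

/-- The partial sums of the Fourier series of `θ` on `(-π, π)`. -/
def sawtooth (N : ℕ) (θ : ℝ) : ℝ :=
  ∑ k ∈ Finset.range N, 2 * (-1) ^ k / ((k : ℝ) + 1) * Real.sin (((k : ℝ) + 1) * θ)

theorem sawtooth_neg (N : ℕ) (θ : ℝ) : sawtooth N (-θ) = -sawtooth N θ := by
  rw [sawtooth, sawtooth, ← Finset.sum_neg_distrib]
  refine Finset.sum_congr rfl fun k _ => ?_
  rw [mul_neg, Real.sin_neg, mul_neg]

theorem hasDerivAt_sawtooth (N : ℕ) (θ : ℝ) : HasDerivAt (sawtooth N)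
    (∑ k ∈ Finset.range N, 2 * (-1) ^ k * Real.cos (((k : ℝ) + 1) * θ)) θ := by
  unfold sawtooth
  refine HasDerivAt.fun_sum fun k _ => ?_
  have h1 : HasDerivAt (fun θ : ℝ => ((k : ℝ) + 1) * θ) ((k : ℝ) + 1) θ := by
    simpa using (hasDerivAt_id θ).const_mul ((k : ℝ) + 1)
  have h2 := (h1.sin).const_mul (2 * (-1) ^ k / ((k : ℝ) + 1))
  refine h2.congr_deriv ?_
  have : (k : ℝ) + 1 ≠ 0 := by positivity
  field_simp

/-- Integration by parts without integrals. The derivative of the error is `± cos(Mθ) / cos(θ/2)`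
with `M = N + 1/2`. Subtracting the boundary term `± sin(Mθ) / (M cos(θ/2))` leaves a function `G`
whose derivative is dominated by that of `1 / (M cos(θ/2))`; the boundary term and `G` each
contribute half of the bound. -/
theorem abs_sawtooth_sub_le_of_nonneg (N : ℕ) {θ : ℝ} (h0 : 0 ≤ θ) (hπ : θ < Real.pi) :
    |sawtooth N θ - θ| ≤ 2 / ((N + 1 / 2) * Real.cos (θ / 2)) := by
  set M : ℝ := (N : ℝ) + 1 / 2 with hM
  have hMpos : 0 < M := by positivity
  have hcos : ∀ x ∈ Set.Icc 0 θ, 0 < Real.cos (x / 2) := fun x hx =>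
    Real.cos_pos_of_mem_Ioo ⟨by linarith [hx.1, Real.pi_pos], by linarith [hx.2]⟩
  have hc : ∀ x : ℝ, HasDerivAt (fun x : ℝ => Real.cos (x / 2)) (-(Real.sin (x / 2) / 2)) x :=
    fun x => by
      have := ((hasDerivAt_id x).div_const 2).cos
      simpa [div_eq_mul_inv] using this
  set G : ℝ → ℝ := fun x => sawtooth N x - x -
    (-1) ^ (N + 1) * Real.sin (M * x) / (M * Real.cos (x / 2)) with hG
  have hGd : ∀ x ∈ Set.Icc 0 θ, HasDerivAt G (-((-1) ^ (N + 1) * Real.sin (M * x) / M *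
      (Real.sin (x / 2) / 2 / Real.cos (x / 2) ^ 2))) x := fun x hx => by
    have hcx := (hcos x hx).ne'
    have h1 : HasDerivAt (fun x : ℝ => Real.sin (M * x)) (Real.cos (M * x) * M) x := by
      have := ((hasDerivAt_id x).const_mul M).sin
      simpa using this
    have h2 := (h1.const_mul ((-1) ^ (N + 1))).div ((hc x).const_mul M)
      (mul_ne_zero hMpos.ne' hcx)
    have h3 := ((hasDerivAt_sawtooth N x).sub (hasDerivAt_id x)).sub h2
    refine h3.congr_deriv ?_
    have h4 : ∑ k ∈ Finset.range N, 2 * (-1) ^ k * Real.cos (((k : ℝ) + 1) * x) - 1 =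
        (-1) ^ (N + 1) * Real.cos (M * x) / Real.cos (x / 2) := by
      rw [eq_div_iff hcx, mul_comm, cos_half_mul_alternating_sum]
    rw [h4]
    field_simp
    ring
  have hB : ∀ x ∈ Set.Icc 0 θ, HasDerivAt (fun x : ℝ => 1 / M * (Real.cos (x / 2))⁻¹)
      (1 / M * (Real.sin (x / 2) / 2 / Real.cos (x / 2) ^ 2)) x := fun x hx => by
    have := ((hc x).inv (hcos x hx).ne').const_mul (1 / M)
    simpa using this
  have key : ‖G θ‖ ≤ 1 / M * (Real.cos (θ / 2))⁻¹ := by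
    refine image_norm_le_of_norm_deriv_right_le_deriv_boundary' (a := 0) (b := θ)
      (fun x hx => (hGd x hx).continuousAt.continuousWithinAt)
      (fun x hx => (hGd x ⟨hx.1, hx.2.le⟩).hasDerivWithinAt) ?_
      (fun x hx => (hB x hx).continuousAt.continuousWithinAt)
      (fun x hx => (hB x ⟨hx.1, hx.2.le⟩).hasDerivWithinAt) (fun x hx => ?_) ⟨h0, le_rfl⟩
    · have : G 0 = 0 := by simp [hG, sawtooth]
      rw [this, norm_zero]
      have := hcos 0 ⟨le_rfl, h0⟩
      positivity
    · have hs : 0 ≤ Real.sin (x / 2) :=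
        Real.sin_nonneg_of_nonneg_of_le_pi (by linarith [hx.1]) (by linarith [hx.2, hx.1])
      have hcx := hcos x ⟨hx.1, hx.2.le⟩
      rw [norm_neg, norm_mul, Real.norm_of_nonneg (r := Real.sin (x / 2) / 2 / _) (by positivity)]
      gcongr
      rw [norm_div, norm_mul, norm_pow, norm_neg, norm_one, one_pow, one_mul,
        Real.norm_of_nonneg hMpos.le]
      gcongr
      exact Real.abs_sin_le_one _
  have hcθ := hcos θ ⟨h0, le_rfl⟩
  have h5 : |(-1) ^ (N + 1) * Real.sin (M * θ) / (M * Real.cos (θ / 2))| ≤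
      1 / (M * Real.cos (θ / 2)) := by
    rw [abs_div, abs_mul, abs_pow, abs_neg, abs_one, one_pow, one_mul,
      abs_of_pos (mul_pos hMpos hcθ)]
    gcongr
    exact Real.abs_sin_le_one _
  have h6 : sawtooth N θ - θ = G θ + (-1) ^ (N + 1) * Real.sin (M * θ) / (M * Real.cos (θ / 2)) := by
    rw [hG]; ring
  rw [h6]
  refine (abs_add_le _ _).trans ((add_le_add key h5).trans_eq ?_)
  field_simp
  norm_num

theorem abs_sawtooth_sub_le (N : ℕ) {θ : ℝ} (h : |θ| < Real.pi) :
    |sawtooth N θ - θ| ≤ 2 / ((N + 1 / 2) * Real.cos (θ / 2)) := by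
  rcases le_total 0 θ with h0 | h0
  · exact abs_sawtooth_sub_le_of_nonneg N h0 ((le_abs_self _).trans_lt h)
  · have := abs_sawtooth_sub_le_of_nonneg N (θ := -θ) (by linarith) ((neg_le_abs _).trans_lt h)
    rwa [sawtooth_neg, ← neg_sub', abs_neg, neg_div, Real.cos_neg] at this

/-- The partial sums of the series of `arg w` in the powers of `w` and of its adjoint. -/
def argSeries {A : Type*} [Ring A] [StarRing A] [Algebra ℂ A] (N : ℕ) (w : A) : A :=
  ∑ k ∈ Finset.range N, (-Complex.I * ((-1) ^ k / ((k : ℂ) + 1))) • (w ^ (k + 1) - star (w ^ (k + 1)))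

theorem argSeries_exp (N : ℕ) (θ : ℝ) :
    argSeries N (Complex.exp (θ * Complex.I)) = (sawtooth N θ : ℂ) := by
  rw [argSeries, sawtooth, Complex.ofReal_sum]
  refine Finset.sum_congr rfl fun k _ => ?_
  have h1 : Complex.exp (θ * Complex.I) ^ (k + 1) =
      Complex.exp (((((k : ℝ) + 1) * θ : ℝ) : ℂ) * Complex.I) := by
    rw [← Complex.exp_nat_mul]
    congr 1
    push_cast
    ring
  rw [h1, Complex.exp_mul_I, Complex.star_def, map_add, map_mul, Complex.conj_I,
    ← Complex.ofReal_cos, ← Complex.ofReal_sin, Complex.conj_ofReal, Complex.conj_ofReal,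
    smul_eq_mul]
  push_cast
  linear_combination (-2 * ((-1 : ℂ) ^ k / ((k : ℂ) + 1)) * Complex.sin (((k : ℂ) + 1) * θ)) *
    Complex.I_mul_I

/-- For `|w| = 1` one has `|1 + w| = 2 cos(arg w / 2)`, so the distance of `w` from `-1` is what
controls the error of the Fourier series. -/
theorem norm_exp_argSeries_sub_le {N : ℕ} (hN : 0 < N) {w : ℂ} (hw : ‖w‖ = 1) {g : ℝ} (hg : 0 < g)
    (hgap : g ≤ ‖1 + w‖) : ‖Complex.exp (Complex.I * argSeries N w) - w‖ ≤ 4 / (N * g) := by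
  have hwe : w = Complex.exp (w.arg * Complex.I) := by
    conv_lhs => rw [← Complex.norm_mul_exp_arg_mul_I w, hw, Complex.ofReal_one, one_mul]
  set θ := w.arg with hθ
  have hn : ‖1 + w‖ = 2 * |Real.cos (θ / 2)| := by
    have : 1 + w = 2 * Complex.cos ((θ / 2 : ℝ)) * Complex.exp (((θ / 2 : ℝ) : ℂ) * Complex.I) := by
      rw [hwe, Complex.two_cos, add_mul, ← Complex.exp_add, ← Complex.exp_add, add_comm]
      congr 1
      · congr 1; push_cast; ring
      · rw [neg_mul, neg_add_cancel, Complex.exp_zero]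
    rw [this, norm_mul, Complex.norm_exp_ofReal_mul_I, mul_one, norm_mul, ← Complex.ofReal_cos,
      Complex.norm_real]
    simp
  have hcn : 0 ≤ Real.cos (θ / 2) := Real.cos_nonneg_of_mem_Icc
    ⟨by linarith [Complex.neg_pi_lt_arg w], by linarith [Complex.arg_le_pi w]⟩
  rw [abs_of_nonneg hcn] at hn
  have hcg : g / 2 ≤ Real.cos (θ / 2) := by linarith
  have hlt : |θ| < Real.pi := by
    refine lt_of_le_of_ne (Complex.abs_arg_le_pi w) fun h => ?_
    have : Real.cos (θ / 2) = 0 := by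
      rcases abs_eq (Real.pi_pos.le) |>.mp h with h | h
      · rw [h, Real.cos_pi_div_two]
      · rw [h, neg_div, Real.cos_neg, Real.cos_pi_div_two]
    linarith
  have h1 := abs_sawtooth_sub_le N hlt
  have h2 : ‖Complex.exp (Complex.I * argSeries N w) - w‖ ≤ |sawtooth N θ - θ| := by
    have : Complex.exp (Complex.I * argSeries N w) - w = Complex.exp (θ * Complex.I) *
        (Complex.exp (Complex.I * ((sawtooth N θ - θ : ℝ) : ℂ)) - 1) := by
      rw [mul_sub, ← Complex.exp_add, mul_one, ← hwe]
      congr 2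
      conv_lhs => rw [hwe, argSeries_exp]
      push_cast
      ring
    rw [this, norm_mul, Complex.norm_exp_ofReal_mul_I, one_mul]
    exact Real.norm_exp_I_mul_ofReal_sub_one_le
  have hN' : (0 : ℝ) < N := by exact_mod_cast hN
  refine h2.trans (h1.trans ?_)
  calc 2 / (((N : ℝ) + 1 / 2) * Real.cos (θ / 2)) ≤ 2 / (N * (g / 2)) := by
        gcongr
        linarith
    _ = 4 / (N * g) := by field_simp; norm_num

section CStar

variable {A : Type*} [CStarAlgebra A]

/-! ### The Newton–Schulz iteration for the unitary polar factor -/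

/-- One step `S ↦ S (3 - S† S) / 2`. -/
def newtonStep (S : A) : A := (3 / 2 : ℂ) • S - (1 / 2 : ℂ) • (S * (star S * S))

/-- The failure `1 - S† S` to be an isometry. -/
def defect (S : A) : A := 1 - star S * S

theorem newtonStep_sub (S : A) : newtonStep S - S = (1 / 2 : ℂ) • (S * defect S) := by
  simp only [newtonStep, defect, mul_sub, mul_one]
  module

/-- With `x = 1 - S†S` this is the scalar identity `1 - (1 - x)(2 + x)² / 4 = 3x²/4 + x³/4`; the
absence of a linear term is the quadratic convergence. -/
theorem defect_newtonStep (S : A) : defect (newtonStep S) =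
    (3 / 4 : ℂ) • (defect S * defect S) + (1 / 4 : ℂ) • (defect S * (defect S * defect S)) := by
  have h1 : star (newtonStep S) = (3 / 2 : ℂ) • star S - (1 / 2 : ℂ) • (star S * S * star S) := by
    rw [newtonStep, star_sub, star_smul, star_smul, star_mul, star_mul, star_star]
    simp
  have h2 : star (newtonStep S) * newtonStep S = (9 / 4 : ℂ) • (star S * S) -
      (3 / 2 : ℂ) • ((star S * S) * (star S * S)) +
      (1 / 4 : ℂ) • ((star S * S) * ((star S * S) * (star S * S))) := by
    rw [h1, newtonStep]
    simp only [sub_mul, mul_sub, smul_mul_assoc, mul_smul_comm, mul_assoc]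
    module
  simp only [defect] at *
  rw [h2]
  generalize star S * S = D
  simp only [sub_mul, mul_sub, mul_one, one_mul]
  module

/-- Only a linear rate is kept: it already gives `4^{-N}` after `N` steps, and the same `N` is
needed for the Fourier series anyway. -/
theorem norm_defect_newtonStep_le (S : A) (h : ‖defect S‖ ≤ 1 / 4) :
    ‖defect (newtonStep S)‖ ≤ ‖defect S‖ / 4 := by
  set x := ‖defect S‖ with hx
  have hx0 : 0 ≤ x := norm_nonneg _
  have h2 : ‖defect S * defect S‖ ≤ x * x := norm_mul_le _ _
  have h3 : ‖defect S * (defect S * defect S)‖ ≤ x * (x * x) :=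
    (norm_mul_le _ _).trans (by gcongr)
  rw [defect_newtonStep]
  refine (norm_add_le _ _).trans ?_
  rw [norm_smul, norm_smul]
  norm_num
  nlinarith [mul_nonneg hx0 hx0]

theorem norm_le_two_of_defect [Nontrivial A] (S : A) (h : ‖defect S‖ ≤ 1 / 4) : ‖S‖ ≤ 2 := by
  have h1 : ‖star S * S‖ ≤ 5 / 4 := by
    have e : star S * S = 1 - defect S := by rw [defect, sub_sub_cancel]
    rw [e]
    have := norm_sub_le (1 : A) (defect S)
    rw [CStarRing.norm_one] at this
    linarith
  rw [CStarRing.norm_star_mul_self] at h1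
  nlinarith [norm_nonneg S]

/-- One step moves `S` by half of `S` times its defect, at most the defect itself since `‖S‖ ≤ 2`;
the increments form a geometric series. The limit has defect zero, so it is an isometry; that it is
unitary is a matter of finite dimension. -/
theorem exists_polar_limit [Nontrivial A] (S : A) (h : ‖defect S‖ ≤ 1 / 4) :
    ∃ W : A, star W * W = 1 ∧ ∀ n, ‖newtonStep^[n] S - W‖ ≤ 2 * ‖defect S‖ * (1 / 4) ^ n := by
  have hd : ∀ n, ‖defect (newtonStep^[n] S)‖ ≤ ‖defect S‖ * (1 / 4) ^ n := fun n => by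
    induction n with
    | zero => simp
    | succ n ih =>
      rw [Function.iterate_succ_apply', pow_succ]
      have h1 : ‖defect S‖ * (1 / 4) ^ n ≤ 1 / 4 :=
        (mul_le_of_le_one_right (norm_nonneg _) (pow_le_one₀ (by norm_num) (by norm_num))).trans h
      have := norm_defect_newtonStep_le _ (ih.trans h1)
      linarith
  have hd4 : ∀ n, ‖defect (newtonStep^[n] S)‖ ≤ 1 / 4 := fun n => (hd n).trans
    ((mul_le_of_le_one_right (norm_nonneg _) (pow_le_one₀ (by norm_num) (by norm_num))).trans h)
  have hstep : ∀ n, dist (newtonStep^[n] S) (newtonStep^[n + 1] S) ≤ ‖defect S‖ * (1 / 4) ^ n :=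
    fun n => by
      rw [dist_comm, dist_eq_norm, Function.iterate_succ_apply', newtonStep_sub, norm_smul]
      have h1 := norm_mul_le (newtonStep^[n] S) (defect (newtonStep^[n] S))
      have h2 := norm_le_two_of_defect _ (hd4 n)
      have h3 : ‖newtonStep^[n] S‖ * ‖defect (newtonStep^[n] S)‖ ≤
          2 * (‖defect S‖ * (1 / 4) ^ n) := by
        gcongr
        exact hd n
      norm_num at h1 h2 h3 ⊢
      linarith
  obtain ⟨W, hW⟩ := cauchySeq_tendsto_of_complete
    (cauchySeq_of_le_geometric (1 / 4) ‖defect S‖ (by norm_num) hstep)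
  refine ⟨W, ?_, fun n => ?_⟩
  · have h1 : Tendsto (fun n => defect (newtonStep^[n] S)) atTop (𝓝 (defect W)) := by
      unfold defect
      exact tendsto_const_nhds.sub (hW.star.mul hW)
    have h2 : Tendsto (fun n => defect (newtonStep^[n] S)) atTop (𝓝 0) := by
      refine squeeze_zero_norm hd ?_
      have := (tendsto_pow_atTop_nhds_zero_of_lt_one (r := (1 / 4 : ℝ)) (by norm_num)
        (by norm_num)).const_mul ‖defect S‖
      simpa using this
    have h3 := tendsto_nhds_unique h1 h2
    rw [defect, sub_eq_zero] at h3
    exact h3.symm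
  · have h1 := dist_le_of_le_geometric_of_tendsto (1 / 4) ‖defect S‖ (by norm_num) hstep hW n
    rw [dist_eq_norm] at h1
    have h2 : 0 ≤ ‖defect S‖ * (1 / 4) ^ n := by positivity
    refine h1.trans ?_
    rw [div_le_iff₀ (by norm_num)]
    linarith

/-! ### Perturbation of powers -/

theorem one_add_pow_sub_one_le (k : ℕ) {e : ℝ} (he : 0 ≤ e) (hk : k * e ≤ 1) :
    (1 + e) ^ k - 1 ≤ 2 * (k * e) := by
  have h1 : (1 + e) ^ k ≤ Real.exp (k * e) := by
    rw [Real.exp_nat_mul]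
    gcongr
    linarith [Real.add_one_le_exp e]
  have h2 := Real.abs_exp_sub_one_le (x := k * e) (by rwa [abs_of_nonneg (by positivity)])
  rw [abs_of_nonneg (a := (k : ℝ) * e) (by positivity)] at h2
  linarith [le_abs_self (Real.exp (k * e) - 1)]

theorem norm_pow_sub_pow_le [Nontrivial A] {S W : A} {e : ℝ} (hW : ‖W‖ ≤ 1) (he : ‖S - W‖ ≤ e) (k : ℕ) :
    ‖S ^ k - W ^ k‖ ≤ (1 + e) ^ k - 1 := by
  have he0 : 0 ≤ e := (norm_nonneg _).trans he
  induction k with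
  | zero => simp
  | succ k ih =>
    have h1 : S ^ (k + 1) - W ^ (k + 1) = (S ^ k - W ^ k) * S + W ^ k * (S - W) := by
      rw [pow_succ, pow_succ]; noncomm_ring
    have hS : ‖S‖ ≤ 1 + e := by
      have := norm_add_le W (S - W)
      rw [add_sub_cancel] at this
      linarith
    have hWk : ‖W ^ k‖ ≤ 1 := (norm_pow_le W k).trans (pow_le_one₀ (norm_nonneg _) hW)
    rw [h1]
    refine (norm_add_le _ _).trans ((add_le_add (norm_mul_le _ _) (norm_mul_le _ _)).trans ?_)
    have h2 : ‖S ^ k - W ^ k‖ * ‖S‖ ≤ ((1 + e) ^ k - 1) * (1 + e) :=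
      mul_le_mul ih hS (norm_nonneg _) ((norm_nonneg _).trans ih)
    have h3 : ‖W ^ k‖ * ‖S - W‖ ≤ 1 * e := by gcongr
    rw [pow_succ]
    linarith

theorem norm_pow_sub_pow_le' [Nontrivial A] {S W : A} {e : ℝ} (hW : ‖W‖ ≤ 1) (he : ‖S - W‖ ≤ e) {k N : ℕ}
    (hk : k ≤ N) (hN : N * e ≤ 1) : ‖S ^ k - W ^ k‖ ≤ 2 * (k * e) := by
  have he0 : 0 ≤ e := (norm_nonneg _).trans he
  refine (norm_pow_sub_pow_le hW he k).trans (one_add_pow_sub_one_le k he0 ?_)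
  refine le_trans ?_ hN
  gcongr

/-- The error of `w^{k+1}` grows like `k + 1` and is cancelled by the coefficient `1/(k+1)`. Thus
the total error is only linear in the number of terms. -/
theorem norm_argSeries_sub_le [Nontrivial A] {S W : A} {e : ℝ} (hW : ‖W‖ ≤ 1) (he : ‖S - W‖ ≤ e) {N : ℕ}
    (hN : N * e ≤ 1) : ‖argSeries N S - argSeries N W‖ ≤ 4 * (N * e) := by
  rw [argSeries, argSeries, ← Finset.sum_sub_distrib]
  have h1 : ∀ k ∈ Finset.range N,
      ‖(-Complex.I * ((-1) ^ k / ((k : ℂ) + 1))) • (S ^ (k + 1) - star (S ^ (k + 1))) -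
        (-Complex.I * ((-1) ^ k / ((k : ℂ) + 1))) • (W ^ (k + 1) - star (W ^ (k + 1)))‖ ≤ 4 * e := by
    intro k hk
    rw [Finset.mem_range] at hk
    rw [← smul_sub, sub_sub_sub_comm, ← star_sub, norm_smul]
    have h2 : ‖-Complex.I * ((-1) ^ k / ((k : ℂ) + 1))‖ = 1 / ((k : ℝ) + 1) := by
      have : ‖(k : ℂ) + 1‖ = (k : ℝ) + 1 := by
        rw [← Nat.cast_succ, Complex.norm_natCast]; simp
      simp [this]
    have h3 := norm_pow_sub_pow_le' hW he (k := k + 1) (by omega) hN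
    have h4 := norm_sub_le (S ^ (k + 1) - W ^ (k + 1)) (star (S ^ (k + 1) - W ^ (k + 1)))
    rw [norm_star] at h4
    rw [h2, one_div_mul_eq_div, div_le_iff₀ (by positivity)]
    push_cast at h3
    linarith
  refine (norm_sum_le_of_le _ h1).trans_eq ?_
  rw [Finset.sum_const, Finset.card_range, nsmul_eq_mul]
  ring

/-- The operator `(2 - S - S†) / 4`, of norm one exactly if `-1` is in the spectrum of `S`. -/
def gapOp (S : A) : A := (1 / 2 : ℂ) • 1 - (1 / 4 : ℂ) • (S + star S)

theorem norm_gapOp_le [Nontrivial A] {W : A} (hW : ‖W‖ ≤ 1) : ‖gapOp W‖ ≤ 1 := by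
  refine (norm_sub_le _ _).trans ?_
  rw [norm_smul, norm_smul, CStarRing.norm_one]
  have := norm_add_le W (star W)
  rw [norm_star] at this
  norm_num
  linarith

theorem norm_gapOp_sub_le {S W : A} {e : ℝ} (he : ‖S - W‖ ≤ e) : ‖gapOp S - gapOp W‖ ≤ e := by
  have h1 : gapOp S - gapOp W = (-(1 / 4) : ℂ) • ((S - W) + star (S - W)) := by
    rw [gapOp, gapOp, star_sub]; module
  have h2 := norm_add_le (S - W) (star (S - W))
  rw [norm_star] at h2
  have h3 : ‖(-(1 / 4) : ℂ)‖ = 1 / 4 := by norm_num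
  rw [h1, norm_smul, h3]
  linarith [norm_nonneg (S - W)]

/-! ### Functional calculus of unitaries -/

theorem argSeries_eq_cfc {W : A} (hW : IsStarNormal W) (N : ℕ) :
    argSeries N W = cfc (fun w : ℂ => argSeries N w) W := by
  have e : (fun w : ℂ => argSeries N w) = ∑ k ∈ Finset.range N, fun w : ℂ =>
      (-Complex.I * ((-1) ^ k / ((k : ℂ) + 1))) * (w ^ (k + 1) - star (w ^ (k + 1))) := by
    funext w
    simp [argSeries, Finset.sum_apply]
  rw [e, cfc_sum _ _ _ (fun k _ => by fun_prop), argSeries]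
  refine Finset.sum_congr rfl fun k _ => ?_
  rw [cfc_const_mul _ _ _ (by fun_prop), cfc_sub _ _ _ (by fun_prop) (by fun_prop), cfc_star,
    cfc_pow_id W (k + 1) hW]

theorem gapOp_pow_eq_cfc {W : A} (hW : IsStarNormal W) (N : ℕ) :
    gapOp W ^ N = cfc (fun w : ℂ => (gapOp w) ^ N) W := by
  have e : (fun w : ℂ => (gapOp w) ^ N) = fun w : ℂ => ((1 / 2) - (1 / 4) * (w + star w)) ^ N := by
    funext w
    simp [gapOp]
  rw [e, cfc_pow _ _ _ (by fun_prop) hW, cfc_sub _ _ _ (by fun_prop) (by fun_prop),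
    cfc_const_mul _ _ _ (by fun_prop), cfc_add _ _ _ (by fun_prop) (by fun_prop), cfc_star,
    cfc_id' ℂ W hW, cfc_const _ _ hW, gapOp, Algebra.algebraMap_eq_smul_one]

theorem gapOp_complex {w : ℂ} (hw : ‖w‖ = 1) : gapOp w = ((1 - ‖1 + w‖ ^ 2 / 4 : ℝ) : ℂ) := by
  have h1 : ((‖1 + w‖ ^ 2 : ℝ) : ℂ) = (1 + w) * (1 + conj w) := by
    rw [Complex.ofReal_pow, ← Complex.mul_conj', map_add, map_one]
  have h2 : w * conj w = 1 := by rw [Complex.mul_conj', hw]; simp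
  rw [Complex.ofReal_sub, Complex.ofReal_div, h1]
  simp only [gapOp, smul_eq_mul, Complex.star_def]
  push_cast
  linear_combination (1 / 4) * h2

theorem isStarNormal_of_unitary {W : A} (hW : W ∈ unitary A) : IsStarNormal W :=
  ⟨by rw [Commute, SemiconjBy, (Unitary.mem_iff.mp hW).1, (Unitary.mem_iff.mp hW).2]⟩

theorem isSelfAdjoint_argSeries (N : ℕ) (S : A) : IsSelfAdjoint (argSeries N S) := by
  rw [IsSelfAdjoint, argSeries, star_sum]
  refine Finset.sum_congr rfl fun k _ => ?_
  rw [star_smul, star_sub, star_star, ← neg_sub, smul_neg, ← neg_smul]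
  congr 1
  simp

/-- All operators involved are continuous functions of the normal element `W`, so the scalar
estimate on the spectrum, which lies on the unit circle, carries over. -/
theorem norm_exp_I_argSeries_sub_le [Nontrivial A] {W : A} (hW : W ∈ unitary A) {N : ℕ} (hN : 0 < N) {g : ℝ}
    (hg : 0 < g) (hgap : ∀ w ∈ spectrum ℂ W, g ≤ ‖1 + w‖) :
    ‖NormedSpace.exp (Complex.I • argSeries N W) - W‖ ≤ 4 / (N * g) := by
  have hn := isStarNormal_of_unitary hW
  have hc : Continuous fun w : ℂ => Complex.I * argSeries N w := by
    unfold argSeries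
    fun_prop
  have h1 : Complex.I • argSeries N W = cfc (fun w : ℂ => Complex.I * argSeries N w) W := by
    rw [cfc_const_mul _ _ _ (by unfold argSeries; fun_prop), argSeries_eq_cfc hn]
  have h2 : NormedSpace.exp (Complex.I • argSeries N W) =
      cfc (fun w : ℂ => Complex.exp (Complex.I * argSeries N w)) W := by
    rw [h1, ← CFC.complex_exp_eq_normedSpace_exp (cfc_predicate _ _),
      ← cfc_comp' Complex.exp _ W (by fun_prop) hc.continuousOn hn]
  have h3 : NormedSpace.exp (Complex.I • argSeries N W) - W =
      cfc (fun w : ℂ => Complex.exp (Complex.I * argSeries N w) - w) W := by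
    have hc2 : Continuous fun w : ℂ => Complex.exp (Complex.I * argSeries N w) :=
      Complex.continuous_exp.comp hc
    rw [cfc_sub _ _ _ hc2.continuousOn (by fun_prop), ← h2,
      cfc_id' ℂ W hn]
  rw [h3]
  exact norm_cfc_le (by positivity) fun w hw =>
    norm_exp_argSeries_sub_le hN (spectrum.norm_eq_one_of_unitary hW hw) hg (hgap w hw)

/-- Soundness of the test. On the spectrum `gapOp` is `1 - c` with `c = |1 + w|² / 4`, and
Bernoulli's inequality `(1 - c)^N ≥ 1 - Nc` forces `Nc ≥ 1/4`. -/
theorem gap_of_norm_gapOp_pow_le [Nontrivial A] {W : A} (hW : W ∈ unitary A) {N : ℕ} (hN : 0 < N)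
    (h : ‖gapOp W ^ N‖ ≤ 3 / 4) : ∀ w ∈ spectrum ℂ W, 1 / Real.sqrt N ≤ ‖1 + w‖ := by
  intro w hw
  have hn := isStarNormal_of_unitary hW
  rw [gapOp_pow_eq_cfc hn] at h
  have hc : Continuous fun w : ℂ => (gapOp w) ^ N := by
    unfold gapOp
    fun_prop
  have h1 := (norm_apply_le_norm_cfc (fun w : ℂ => (gapOp w) ^ N) W hw hc.continuousOn hn).trans h
  have hw1 := spectrum.norm_eq_one_of_unitary hW hw
  rw [gapOp_complex hw1, norm_pow, Complex.norm_real] at h1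
  set c := ‖1 + w‖ ^ 2 / 4 with hcdef
  have hc1 : c ≤ 1 := by
    have := norm_add_le (1 : ℂ) w
    rw [hw1, norm_one] at this
    rw [hcdef]
    nlinarith [norm_nonneg (1 + w)]
  rw [Real.norm_of_nonneg (by linarith)] at h1
  have h2 := one_add_mul_le_pow (a := -c) (by linarith) N
  rw [← sub_eq_add_neg] at h2
  have hN' : (0 : ℝ) < N := by exact_mod_cast hN
  have h3 : 1 / (N : ℝ) ≤ ‖1 + w‖ ^ 2 := by
    rw [div_le_iff₀ hN']
    rw [hcdef] at h2 h1
    nlinarith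
  rw [← Real.sqrt_one, ← Real.sqrt_div zero_le_one, Real.sqrt_le_left (norm_nonneg _)]
  exact h3

/-- Completeness of the test: a gap `g` gives `(1 - g²/4)^N ≤ e^{-N g²/4} ≤ 4 / (N g²)`. -/
theorem norm_gapOp_pow_le [Nontrivial A] {W : A} (hW : W ∈ unitary A) {N : ℕ} {g : ℝ} (hg : 0 < g)
    (hN : 0 < N) (hgap : ∀ w ∈ spectrum ℂ W, g ≤ ‖1 + w‖) : ‖gapOp W ^ N‖ ≤ 4 / (N * g ^ 2) := by
  have hn := isStarNormal_of_unitary hW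
  rw [gapOp_pow_eq_cfc hn]
  have hN' : (0 : ℝ) < N := by exact_mod_cast hN
  refine norm_cfc_le (by positivity) fun w hw => ?_
  have hw1 := spectrum.norm_eq_one_of_unitary hW hw
  rw [gapOp_complex hw1, norm_pow, Complex.norm_real]
  have h1 := norm_add_le (1 : ℂ) w
  rw [hw1, norm_one] at h1
  have h2 := hgap w hw
  rw [Real.norm_of_nonneg (by nlinarith [norm_nonneg (1 + w)])]
  have h3 : 1 - ‖1 + w‖ ^ 2 / 4 ≤ 1 - g ^ 2 / 4 := by gcongr
  have h4 : (1 - ‖1 + w‖ ^ 2 / 4) ^ N ≤ Real.exp (-(g ^ 2 / 4)) ^ N := by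
    refine pow_le_pow_left₀ (by nlinarith [norm_nonneg (1 + w)]) (h3.trans ?_) N
    linarith [Real.add_one_le_exp (-(g ^ 2 / 4))]
  refine h4.trans ?_
  rw [← Real.exp_nat_mul, mul_neg, Real.exp_neg, inv_le_comm₀ (Real.exp_pos _) (by positivity)]
  have h5 := Real.add_one_le_exp ((N : ℝ) * (g ^ 2 / 4))
  rw [inv_div]
  linarith

/-! ### Perturbation of the exponential -/

theorem norm_exp_I_smul_of_isSelfAdjoint [Nontrivial A] {a : A} (ha : IsSelfAdjoint a) (t : ℝ) :
    ‖NormedSpace.exp (t • (Complex.I • a))‖ = 1 := by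
  have h1 : IsSelfAdjoint (t • a) := by
    rw [IsSelfAdjoint, star_smul, ha.star_eq, star_trivial]
  have h2 := (selfAdjoint.expUnitary ⟨t • a, h1⟩).2
  rw [selfAdjoint.expUnitary_coe] at h2
  rw [smul_comm]
  exact CStarRing.norm_of_mem_unitary h2

/-- Duhamel's formula: the path `e^{ita} e^{i(1-t)b}` joins the two exponentials, and its velocity
is `i(a - b)` between two unitaries. -/
theorem norm_exp_I_sub_exp_I_le [Nontrivial A] {a b : A} (ha : IsSelfAdjoint a) (hb : IsSelfAdjoint b) :
    ‖NormedSpace.exp (Complex.I • a) - NormedSpace.exp (Complex.I • b)‖ ≤ ‖a - b‖ := by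
  have hd : ∀ t : ℝ, HasDerivAt (fun t : ℝ => NormedSpace.exp (t • (Complex.I • a)) *
      NormedSpace.exp ((1 - t) • (Complex.I • b)))
      (NormedSpace.exp (t • (Complex.I • a)) * (Complex.I • (a - b)) *
        NormedSpace.exp ((1 - t) • (Complex.I • b))) t := fun t => by
    have h1 := hasDerivAt_exp_smul_const (𝕂 := ℝ) (Complex.I • a) t
    have h2 := hasDerivAt_exp_smul_const' (𝕂 := ℝ) (Complex.I • b) (1 - t)
    have h3 := HasDerivAt.scomp t h2 ((hasDerivAt_id t).const_sub 1)
    have h4 := h1.mul h3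
    refine h4.congr_deriv ?_
    simp only [Function.comp, smul_sub, mul_sub, sub_mul, neg_smul, one_smul, mul_neg, mul_assoc]
    abel
  have h := norm_image_sub_le_of_norm_deriv_le_segment_01' (C := ‖a - b‖)
    (fun t _ => (hd t).hasDerivWithinAt) fun t _ => by
      refine (norm_mul_le _ _).trans ?_
      rw [norm_exp_I_smul_of_isSelfAdjoint hb, mul_one]
      refine (norm_mul_le _ _).trans ?_
      rw [norm_exp_I_smul_of_isSelfAdjoint ha, one_mul, norm_smul, Complex.norm_I, one_mul]
  simpa using h

end CStar

section Completion

variable {A : Type*} [CStarAlgebra A]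

/-! ### Completing a partial isometry to an approximate unitary -/

/-- For a partial isometry `T` and a self-adjoint unitary `J` with `T J T = 0`, the unitary
`e^{π Z / 2} J = (1 + Z + Z ^ 2) J` where `Z = T J - J T†`. -/
def completion (J T : A) : A := J + T - J * star T * J - T * star T * J - J * star T * T

/-- All products containing `T J T` or its adjoint vanish. What survives is measured by `T - T T†T`,
which is zero for an exact partial isometry. -/
theorem defect_completion {J T : A} (hJ : star J = J) (hJJ : J * J = 1) (hT : T * J * T = 0) :
    defect (completion J T) = J * (T - T * star T * T) * star T * J +
      star T * (T - T * star T * T) := by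
  have hT' : star T * J * star T = 0 := by
    have := congrArg star hT
    rwa [star_mul, star_mul, star_zero, hJ, ← mul_assoc] at this
  have a1 : T * (J * T) = 0 := by rw [← mul_assoc, hT]
  have a2 : ∀ x, T * (J * (T * x)) = 0 := fun x => by rw [← mul_assoc, ← mul_assoc, hT, zero_mul]
  have a3 : star T * (J * star T) = 0 := by rw [← mul_assoc, hT']
  have a4 : ∀ x, star T * (J * (star T * x)) = 0 := fun x => by
    rw [← mul_assoc, ← mul_assoc, hT', zero_mul]
  have a5 : ∀ x, J * (J * x) = x := fun x => by rw [← mul_assoc, hJJ, one_mul]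
  rw [defect, completion]
  simp only [star_sub, star_add, star_mul, star_star, hJ, sub_mul, mul_sub, add_mul, mul_add,
    mul_assoc, a1, a2, a4, a5, hJJ, mul_zero, mul_one]
  abel

theorem norm_defect_completion_le [Nontrivial A] {J T p : A} (hJ : star J = J) (hJJ : J * J = 1)
    (hT : T * J * T = 0) (hTp : T * p = T) (hT1 : ‖T‖ ≤ 1) {τ : ℝ} (hτ : ‖p - star T * T‖ ≤ τ) :
    ‖defect (completion J T)‖ ≤ 2 * τ := by
  have hJn : ‖J‖ ≤ 1 := by
    have h := CStarRing.norm_star_mul_self (x := J)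
    rw [hJ, hJJ, CStarRing.norm_one] at h
    nlinarith [norm_nonneg J]
  have hY : ‖T - T * star T * T‖ ≤ τ := by
    have e : T - T * star T * T = T * (p - star T * T) := by
      rw [mul_sub, hTp, mul_assoc]
    rw [e]
    have := norm_mul_le T (p - star T * T)
    nlinarith [norm_nonneg (p - star T * T), norm_nonneg T]
  have hτ0 : 0 ≤ τ := (norm_nonneg _).trans hτ
  rw [defect_completion hJ hJJ hT]
  have h1 : ‖J * (T - T * star T * T) * star T * J‖ ≤ 1 * τ * 1 * 1 := by
    refine (norm_mul_le _ _).trans (mul_le_mul ?_ hJn (norm_nonneg _) (by positivity))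
    refine (norm_mul_le _ _).trans (mul_le_mul ?_ (by rwa [norm_star]) (norm_nonneg _)
      (by positivity))
    exact (norm_mul_le _ _).trans (mul_le_mul hJn hY (norm_nonneg _) zero_le_one)
  have h2 : ‖star T * (T - T * star T * T)‖ ≤ 1 * τ :=
    (norm_mul_le _ _).trans (mul_le_mul (by rwa [norm_star]) hY (norm_nonneg _) zero_le_one)
  exact (norm_add_le _ _).trans (by linarith)

/-- On the range of `p` the terms with `T†J` vanish, and `J - J T†T` is `J` times the failure of `T`
to be isometric there. -/
theorem norm_completion_sub_mul_le [Nontrivial A] {J T p : A} (hJ : star J = J) (hJJ : J * J = 1)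
    (hTp : T * p = T) (hTJp : star T * J * p = 0) {τ : ℝ} (hτ : ‖p - star T * T‖ ≤ τ) :
    ‖(completion J T - T) * p‖ ≤ τ := by
  have hJn : ‖J‖ ≤ 1 := by
    have h := CStarRing.norm_star_mul_self (x := J)
    rw [hJ, hJJ, CStarRing.norm_one] at h
    nlinarith [norm_nonneg J]
  have e : (completion J T - T) * p = J * (p - star T * T) := by
    have a1 : star T * (J * p) = 0 := by rw [← mul_assoc, hTJp]
    rw [completion]
    simp only [sub_mul, mul_sub, add_mul, mul_assoc, a1, hTp, mul_zero]
    abel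
  rw [e]
  have := norm_mul_le J (p - star T * T)
  nlinarith [norm_nonneg (p - star T * T), norm_nonneg J]

/-! ### The approximate logarithm -/

theorem mul_quarter_pow_le (N : ℕ) : (N : ℝ) ^ 2 * (1 / 4) ^ N ≤ 1 := by
  have h : ((N ^ 2 : ℕ) : ℝ) ≤ ((4 ^ N : ℕ) : ℝ) := by
    have h2 := (Nat.lt_two_pow_self (n := N)).le
    have : N ^ 2 ≤ 4 ^ N := by
      calc N ^ 2 ≤ (2 ^ N) ^ 2 := Nat.pow_le_pow_left h2 2
        _ = 4 ^ N := by
          rw [← pow_mul, mul_comm, pow_mul]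
          norm_num
    exact_mod_cast this
  rw [one_div, inv_pow, ← div_eq_mul_inv, div_le_one (by positivity)]
  exact_mod_cast h

theorem unitary_of_limit [FiniteDimensional ℂ A] {W : A} (h : star W * W = 1) : W ∈ unitary A := by
  refine Unitary.mem_iff.mpr ⟨h, ?_⟩
  have hinj : Function.Injective (LinearMap.mulLeft ℂ W) := fun x y hxy => by
    have := congrArg (star W * ·) hxy
    simpa [← mul_assoc, h] using this
  obtain ⟨V, hV⟩ := LinearMap.surjective_of_injective hinj 1
  rw [LinearMap.mulLeft_apply] at hV
  have : star W = V := by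
    calc star W = star W * (W * V) := by rw [hV, mul_one]
      _ = V := by rw [← mul_assoc, h, one_mul]
  rw [this, hV]

theorem smul_mem_unitary {W : A} (hW : W ∈ unitary A) {z : ℂ} (hz : ‖z‖ = 1) :
    z • W ∈ unitary A := by
  rw [Unitary.mem_iff] at hW ⊢
  have h1 : conj z * z = 1 := by rw [Complex.conj_mul', hz]; simp
  have h2 : z * conj z = 1 := by rw [mul_comm, h1]
  constructor
  · rw [star_smul, smul_mul_smul_comm, hW.1, Complex.star_def, h1, one_smul]
  · rw [star_smul, smul_mul_smul_comm, hW.2, Complex.star_def, h2, one_smul]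

/-- The test is made with the computed `S`, while the functional calculus needs a gap for `W`. The
difference `4^{-N}` changes the `N`-th power by at most `1/4`, so `1/2` becomes `3/4` and the gap is
at least `1/√N`. One half of the bound is the Fourier error at `W`, the other is the passage from
`S` to `W`. -/
theorem norm_exp_argSeries_sub_unitary_le [Nontrivial A] {S W : A} (hW : W ∈ unitary A) {N : ℕ}
    (hN : 4 ≤ N) (hSW : ‖S - W‖ ≤ (1 / 4) ^ N) (hgap : ‖gapOp S ^ N‖ ≤ 1 / 2) :
    ‖NormedSpace.exp (Complex.I • argSeries N S) - W‖ ≤ 8 / Real.sqrt N := by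
  have hN' : (4 : ℝ) ≤ N := by exact_mod_cast hN
  have hq := mul_quarter_pow_le N
  have hq0 : (0 : ℝ) ≤ (1 / 4) ^ N := by positivity
  have hNe : (N : ℝ) * (1 / 4) ^ N ≤ 1 / N := by
    rw [le_div_iff₀ (by linarith)]
    linarith
  have hNe1 : (1 : ℝ) / N ≤ 1 / 4 := by gcongr
  have hWn : ‖W‖ ≤ 1 := (CStarRing.norm_of_mem_unitary hW).le
  have h1 : ‖gapOp S ^ N - gapOp W ^ N‖ ≤ 2 * (N * (1 / 4) ^ N) :=
    norm_pow_sub_pow_le' (norm_gapOp_le hWn) (norm_gapOp_sub_le hSW) le_rfl (by linarith)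
  have hNe2 : (N : ℝ) * (1 / 4) ^ N ≤ 1 / 8 := by
    have h5 : ∀ n : ℕ, 4 ≤ n → (n : ℝ) * (1 / 4) ^ n ≤ 1 / 8 := by
      intro n hn
      induction n, hn using Nat.le_induction with
      | base => norm_num
      | succ n hn ih =>
        have hn' : (4 : ℝ) ≤ n := by exact_mod_cast hn
        have h0 : (0 : ℝ) ≤ (1 / 4) ^ n := by positivity
        push_cast
        rw [pow_succ]
        nlinarith
    exact h5 N hN
  have h2 : ‖gapOp W ^ N‖ ≤ 3 / 4 := by
    have := norm_sub_norm_le (gapOp W ^ N) (gapOp S ^ N)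
    rw [norm_sub_rev] at this
    linarith
  have hNpos : 0 < N := by omega
  have hs : 0 < Real.sqrt N := Real.sqrt_pos.mpr (by linarith)
  have hss : Real.sqrt N * Real.sqrt N = N := Real.mul_self_sqrt (by linarith)
  have h3 := norm_exp_I_argSeries_sub_le hW hNpos (g := 1 / Real.sqrt N) (by positivity)
    (gap_of_norm_gapOp_pow_le hW hNpos h2)
  have h4 : (4 : ℝ) / (N * (1 / Real.sqrt N)) = 4 / Real.sqrt N := by
    congr 1
    rw [mul_one_div, div_eq_iff hs.ne', hss]
  rw [h4] at h3
  have h5 := norm_exp_I_sub_exp_I_le (isSelfAdjoint_argSeries N S) (isSelfAdjoint_argSeries N W)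
  have h6 := norm_argSeries_sub_le hWn hSW (N := N) (by linarith)
  have h7 : 4 * (1 / (N : ℝ)) ≤ 4 / Real.sqrt N := by
    rw [mul_one_div]
    gcongr
    rw [Real.sqrt_le_left (by linarith)]
    nlinarith
  have h8 := norm_sub_le_norm_sub_add_norm_sub (NormedSpace.exp (Complex.I • argSeries N S))
    (NormedSpace.exp (Complex.I • argSeries N W)) W
  have h9 : 8 / Real.sqrt N = 4 / Real.sqrt N + 4 / Real.sqrt N := by ring
  rw [h9]
  linarith

/-- The contributions are `8/√N` for the logarithm, `4τ` for the distance from the completion to its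
unitary limit (twice a defect of at most `2τ`), and `τ` for that between the completion and `T` on
the range of `p`. -/
theorem norm_exp_argSeries_sub_mul_le [Nontrivial A] [FiniteDimensional ℂ A] {J T p : A}
    (hJ : star J = J) (hJJ : J * J = 1) (hT : T * J * T = 0) (hTp : T * p = T)
    (hTJp : star T * J * p = 0) (hT1 : ‖T‖ ≤ 1) (hp : ‖p‖ ≤ 1) {τ : ℝ} (hτ : ‖p - star T * T‖ ≤ τ)
    (hτ8 : τ ≤ 1 / 8) {N : ℕ} (hN : 4 ≤ N) {z : ℂ} (hz : ‖z‖ = 1)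
    (hgap : ‖gapOp (z • newtonStep^[N] (completion J T)) ^ N‖ ≤ 1 / 2) :
    ‖(NormedSpace.exp (Complex.I • argSeries N (z • newtonStep^[N] (completion J T))) - z • T) * p‖
      ≤ 8 / Real.sqrt N + 5 * τ := by
  have hd := norm_defect_completion_le hJ hJJ hT hTp hT1 hτ
  obtain ⟨W, hW1, hW⟩ := exists_polar_limit (completion J T) (by linarith)
  have hWu := smul_mem_unitary (unitary_of_limit hW1) hz
  have h0 := hW 0
  rw [Function.iterate_zero_apply, pow_zero, mul_one] at h0
  have hq0 : (0 : ℝ) ≤ (1 / 4) ^ N := by positivity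
  have h1 : ‖z • newtonStep^[N] (completion J T) - z • W‖ ≤ (1 / 4) ^ N := by
    rw [← smul_sub, norm_smul, hz, one_mul]
    refine (hW N).trans ?_
    nlinarith
  have h2 := norm_exp_argSeries_sub_unitary_le hWu hN h1 hgap
  have h3 := norm_completion_sub_mul_le hJ hJJ hTp hTJp hτ
  set X := NormedSpace.exp (Complex.I • argSeries N (z • newtonStep^[N] (completion J T)))
  have e : (X - z • T) * p = (X - z • W) * p + -(z • (completion J T - W)) * p +
      z • ((completion J T - T) * p) := by
    rw [← smul_mul_assoc, ← add_mul, ← add_mul]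
    congr 1
    module
  rw [e]
  have h4 : ‖(X - z • W) * p‖ ≤ 8 / Real.sqrt N * 1 :=
    (norm_mul_le _ _).trans (mul_le_mul h2 hp (norm_nonneg _) (by positivity))
  have h5 : ‖-(z • (completion J T - W)) * p‖ ≤ 4 * τ * 1 := by
    refine (norm_mul_le _ _).trans (mul_le_mul ?_ hp (norm_nonneg _) ?_)
    · rw [norm_neg, norm_smul, hz, one_mul]; linarith
    · linarith [norm_nonneg (p - star T * T)]
  have h6 : ‖z • ((completion J T - T) * p)‖ ≤ τ := by rw [norm_smul, hz, one_mul]; exact h3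
  refine (norm_add₃_le).trans ?_
  linarith

end Completion

section MatrixNorm

open scoped Matrix.Norms.L2Operator Pointwise

/-! ### Operator norm and Frobenius norm -/

theorem norm_sq_le_sum_sq {m : ℕ} (A : Matrix (Fin m) (Fin m) ℂ) :
    ‖A‖ ^ 2 ≤ ∑ i, ∑ j, ‖A i j‖ ^ 2 := by
  have hS : 0 ≤ ∑ i, ∑ j, ‖A i j‖ ^ 2 :=
    Finset.sum_nonneg fun _ _ => Finset.sum_nonneg fun _ _ => by positivity
  have h : ‖A‖ ≤ Real.sqrt (∑ i, ∑ j, ‖A i j‖ ^ 2) := by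
    rw [Matrix.cstar_norm_def]
    refine ContinuousLinearMap.opNorm_le_bound _ (Real.sqrt_nonneg _) fun x => ?_
    refine le_of_sq_le_sq ?_ (by positivity)
    rw [mul_pow, Real.sq_sqrt hS, EuclideanSpace.norm_sq_eq, EuclideanSpace.norm_sq_eq,
      Finset.sum_mul]
    refine Finset.sum_le_sum fun i _ => ?_
    rw [Matrix.ofLp_toEuclideanCLM, Matrix.mulVec, dotProduct]
    calc ‖∑ j, A i j * x j‖ ^ 2 ≤ (∑ j, ‖A i j‖ * ‖x j‖) ^ 2 := by
          gcongr
          exact (norm_sum_le _ _).trans (Finset.sum_le_sum fun j _ => norm_mul_le _ _)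
      _ ≤ _ := Finset.sum_mul_sq_le_sq_mul_sq _ _ _
  calc ‖A‖ ^ 2 ≤ Real.sqrt (∑ i, ∑ j, ‖A i j‖ ^ 2) ^ 2 := by gcongr
    _ = _ := Real.sq_sqrt hS

theorem sum_sq_col_le {m : ℕ} (A : Matrix (Fin m) (Fin m) ℂ) (j : Fin m) :
    ∑ i, ‖A i j‖ ^ 2 ≤ ‖A‖ ^ 2 := by
  have h := Matrix.l2_opNorm_mulVec A (EuclideanSpace.single j 1)
  rw [PiLp.norm_single, norm_one, mul_one] at h
  have h2 := pow_le_pow_left₀ (norm_nonneg _) h 2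
  rw [EuclideanSpace.norm_sq_eq] at h2
  simpa using h2

theorem sum_sq_le_norm_sq {m : ℕ} (A : Matrix (Fin m) (Fin m) ℂ) :
    ∑ i, ∑ j, ‖A i j‖ ^ 2 ≤ m * ‖A‖ ^ 2 := by
  rw [Finset.sum_comm]
  refine (Finset.sum_le_sum fun j _ => sum_sq_col_le A j).trans ?_
  simp

/-! ### Rotating the spectrum away from `-1` -/

/-- The phase `(m + i s) ^ 2 / (m ^ 2 + s ^ 2)`. -/
def phase (m s : ℕ) : ℂ := ((m : ℂ) + Complex.I * s) * (m + Complex.I * s) /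
  ((m : ℂ) * m + s * s)

theorem add_I_mul_ne_zero {m : ℕ} (hm : 0 < m) (s : ℝ) : (m : ℂ) + Complex.I * s ≠ 0 := by
  intro h
  have := congrArg Complex.re h
  simp at this
  omega

theorem phase_eq {m : ℕ} (hm : 0 < m) (s : ℕ) :
    phase m s = ((m : ℂ) + Complex.I * s) / (m - Complex.I * s) := by
  have h1 := add_I_mul_ne_zero hm s
  have h2 := add_I_mul_ne_zero hm (-s)
  push_cast at h1 h2
  have h3 : (m : ℂ) - Complex.I * s ≠ 0 := by
    rwa [mul_neg, ← sub_eq_add_neg] at h2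
  have h4 : (m : ℂ) * m + s * s = (m + Complex.I * s) * (m - Complex.I * s) := by
    linear_combination ((s : ℂ) ^ 2) * Complex.I_sq
  rw [phase, h4, mul_div_mul_left _ _ h1]

theorem norm_sub_I_mul (m s : ℕ) : ‖(m : ℂ) - Complex.I * s‖ = ‖(m : ℂ) + Complex.I * s‖ := by
  rw [← Complex.norm_conj]
  congr 1
  simp

theorem norm_phase {m : ℕ} (hm : 0 < m) (s : ℕ) : ‖phase m s‖ = 1 := by
  have h1 := add_I_mul_ne_zero hm s
  push_cast at h1
  rw [phase_eq hm, norm_div, norm_sub_I_mul, div_self (norm_ne_zero_iff.mpr h1)]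

theorem norm_add_I_mul_le {m s : ℕ} (h : s ≤ m) : ‖(m : ℂ) + Complex.I * s‖ ^ 2 ≤ 2 * m ^ 2 := by
  have h' : (s : ℝ) ≤ m := by exact_mod_cast h
  rw [← Complex.normSq_eq_norm_sq, Complex.normSq_apply]
  simp
  nlinarith [(Nat.cast_nonneg s : (0 : ℝ) ≤ s)]

/-- The phases are Cayley transforms `(m + is)/(m - is)`, hence rational. The difference of two of
them is `2im(s - t)` over `(m - is)(m - it)`, and this denominator has modulus at most `2m²`. -/
theorem one_le_norm_phase_sub {m s t : ℕ} (hm : 0 < m) (hs : s ≤ m) (ht : t ≤ m) (h : s ≠ t) :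
    1 / (m : ℝ) ≤ ‖phase m s - phase m t‖ := by
  have hm' : (0 : ℝ) < m := by exact_mod_cast hm
  have hz : ∀ u : ℕ, (m : ℂ) - Complex.I * u ≠ 0 := fun u => by
    have h2 := add_I_mul_ne_zero hm (-u)
    push_cast at h2
    rwa [mul_neg, ← sub_eq_add_neg] at h2
  have e : phase m s - phase m t =
      2 * Complex.I * m * ((s : ℂ) - t) / ((m - Complex.I * s) * (m - Complex.I * t)) := by
    rw [phase_eq hm, phase_eq hm, div_sub_div _ _ (hz s) (hz t)]
    congr 1
    ring
  have h1 : (1 : ℝ) ≤ ‖(s : ℂ) - t‖ := by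
    have : (1 : ℤ) ≤ |(s : ℤ) - t| := Int.one_le_abs (by omega)
    have h2 : ‖(s : ℂ) - t‖ = ((|(s : ℤ) - t| : ℤ) : ℝ) := by
      rw [← Int.cast_natCast s, ← Int.cast_natCast t, ← Int.cast_sub, Complex.norm_intCast,
        Int.cast_abs]
    rw [h2]
    exact_mod_cast this
  have h3 : ‖(m : ℂ) + Complex.I * s‖ * ‖(m : ℂ) + Complex.I * t‖ ≤ 2 * m ^ 2 := by
    nlinarith [norm_add_I_mul_le hs, norm_add_I_mul_le ht,
      sq_nonneg (‖(m : ℂ) + Complex.I * s‖ - ‖(m : ℂ) + Complex.I * t‖)]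
  rw [e, norm_div, norm_mul, norm_mul, norm_mul, norm_mul, norm_sub_I_mul, norm_sub_I_mul,
    Complex.norm_I, Complex.norm_natCast, Complex.norm_two, mul_one]
  have h4 : 0 < ‖(m : ℂ) + Complex.I * s‖ * ‖(m : ℂ) + Complex.I * t‖ := by
    rw [← norm_sub_I_mul m s, ← norm_sub_I_mul m t]
    exact mul_pos (norm_pos_iff.mpr (hz s)) (norm_pos_iff.mpr (hz t))
  rw [div_le_div_iff₀ hm' h4]
  nlinarith

theorem finite_spectrum {m : ℕ} (W : Matrix (Fin m) (Fin m) ℂ) :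
    spectrum ℂ W ⊆ W.charpoly.roots.toFinset ∧ W.charpoly.roots.toFinset.card ≤ m := by
  constructor
  · intro w hw
    rw [Matrix.mem_spectrum_iff_isRoot_charpoly] at hw
    simp only [Finset.mem_coe, Multiset.mem_toFinset]
    exact (Polynomial.mem_roots W.charpoly_monic.ne_zero).mpr hw
  · refine (Multiset.toFinset_card_le _).trans ((Polynomial.card_roots' _).trans ?_)
    rw [Matrix.charpoly_natDegree_eq_dim, Fintype.card_fin]

/-- Pigeonhole: if each of the `m + 1` phases brought an eigenvalue within `1/(2m)` of `-1`, two
phases would do so with the same eigenvalue, and would be closer to each other than `1/m`. -/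
theorem exists_phase_gap {m : ℕ} (hm : 0 < m) {W : Matrix (Fin m) (Fin m) ℂ}
    (hW : W ∈ unitary (Matrix (Fin m) (Fin m) ℂ)) :
    ∃ s ≤ m, ∀ w ∈ spectrum ℂ (phase m s • W), 1 / (2 * (m : ℝ)) ≤ ‖1 + w‖ := by
  by_contra! hcon
  have hm' : (0 : ℝ) < m := by exact_mod_cast hm
  have : Nonempty (Fin m) := ⟨⟨0, hm⟩⟩
  have h1 : ∀ s : Fin (m + 1), ∃ w ∈ spectrum ℂ W, ‖1 + phase m s * w‖ < 1 / (2 * (m : ℝ)) := by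
    intro s
    obtain ⟨w, hw, hlt⟩ := hcon s (by omega)
    have hz : phase m s ≠ 0 := by
      rw [← norm_ne_zero_iff, norm_phase hm]
      exact one_ne_zero
    have e : spectrum ℂ (phase m s • W) = phase m s • spectrum ℂ W :=
      spectrum.unit_smul_eq_smul W (Units.mk0 _ hz)
    rw [e] at hw
    obtain ⟨u, hu, rfl⟩ := hw
    exact ⟨u, hu, hlt⟩
  choose f hf hlt using h1
  obtain ⟨hsub, hcard⟩ := finite_spectrum W
  obtain ⟨s, -, t, -, hst, heq⟩ := Finset.exists_ne_map_eq_of_card_lt_of_maps_to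
    (s := Finset.univ) (t := W.charpoly.roots.toFinset) (f := f)
    (by rw [Finset.card_univ, Fintype.card_fin]; omega) (fun s _ => hsub (hf s))
  have h2 := one_le_norm_phase_sub hm (s := s) (t := t) (by omega) (by omega)
    (fun h => hst (Fin.ext h))
  have h3 := hlt s
  have h4 := hlt t
  rw [← heq] at h4
  have hw1 : ‖f s‖ = 1 := spectrum.norm_eq_one_of_unitary hW (hf s)
  have h5 : phase m s * f s - phase m t * f s = (1 + phase m s * f s) - (1 + phase m t * f s) := by
    ring
  have h6 : ‖phase m s - phase m t‖ < 1 / (2 * (m : ℝ)) + 1 / (2 * (m : ℝ)) := by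
    calc ‖phase m s - phase m t‖ = ‖phase m s * f s - phase m t * f s‖ := by
          rw [← sub_mul, norm_mul, hw1, mul_one]
      _ ≤ _ := by
          rw [h5]
          exact norm_sub_le _ _
      _ < _ := add_lt_add h3 h4
  have h7 : 1 / (2 * (m : ℝ)) + 1 / (2 * (m : ℝ)) = 1 / m := by
    field_simp
    norm_num
  linarith

/-- With the gap `1/(2m)` the power of the exact operator has norm at most `16m²/N ≤ 16/(36m)`, and
the inexactness adds at most `2/(36m)`, in total `1/(2m)`. The squared Frobenius norm, which the
machine can compute, is larger than the squared operator norm by at most a factor `m`; so it is at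
most `1/4`. -/
theorem exists_phase_sum_sq_le {m : ℕ} (hm : 0 < m) {S : Matrix (Fin m) (Fin m) ℂ}
    (hS : ‖defect S‖ ≤ 1 / 4) {N : ℕ} (hN : 36 * m ^ 3 ≤ N) :
    ∃ s ≤ m, ∑ i, ∑ j, ‖(gapOp (phase m s • newtonStep^[N] S) ^ N) i j‖ ^ 2 ≤ 1 / 4 := by
  have : Nonempty (Fin m) := ⟨⟨0, hm⟩⟩
  obtain ⟨W, hW1, hW⟩ := exists_polar_limit S hS
  have hWu := unitary_of_limit hW1
  obtain ⟨s, hs, hgap⟩ := exists_phase_gap hm hWu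
  refine ⟨s, hs, ?_⟩
  have hz := norm_phase hm s
  have hzW := smul_mem_unitary hWu hz
  have hm1 : (1 : ℝ) ≤ m := by exact_mod_cast hm
  have hN1 : 36 * (m : ℝ) ^ 3 ≤ N := by exact_mod_cast hN
  have hm3 : (m : ℝ) ≤ m ^ 3 := by nlinarith [sq_nonneg ((m : ℝ) - 1)]
  have hN36 : (36 : ℝ) ≤ N := by linarith
  have hNpos : 0 < N := by
    have : (0 : ℝ) < N := by linarith
    exact_mod_cast this
  have h1 : ‖phase m s • newtonStep^[N] S - phase m s • W‖ ≤ (1 / 4) ^ N := by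
    rw [← smul_sub, norm_smul, hz, one_mul]
    refine (hW N).trans ?_
    have : (0 : ℝ) ≤ (1 / 4) ^ N := by positivity
    nlinarith
  have hq := mul_quarter_pow_le N
  have hNe : (N : ℝ) * (1 / 4) ^ N ≤ 1 / N := by
    rw [le_div_iff₀ (by linarith)]
    linarith
  have hNe1 : 1 / (N : ℝ) ≤ 1 / (36 * m) := by gcongr; linarith
  have hNe2 : 1 / (36 * (m : ℝ)) ≤ 1 := by
    rw [div_le_one (by positivity)]
    linarith
  have hWn : ‖phase m s • W‖ ≤ 1 := (CStarRing.norm_of_mem_unitary hzW).le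
  have h2 : ‖gapOp (phase m s • newtonStep^[N] S) ^ N - gapOp (phase m s • W) ^ N‖ ≤
      2 * (N * (1 / 4) ^ N) :=
    norm_pow_sub_pow_le' (norm_gapOp_le hWn) (norm_gapOp_sub_le h1) le_rfl (by linarith)
  have h3 := norm_gapOp_pow_le hzW (by positivity) hNpos hgap
  have h4 : 4 / (N * (1 / (2 * (m : ℝ))) ^ 2) ≤ 16 / (36 * m) := by
    have e : 4 / (N * (1 / (2 * (m : ℝ))) ^ 2) = 16 * m ^ 2 / N := by
      field_simp
      norm_num
    rw [e, div_le_div_iff₀ (by linarith) (by positivity)]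
    nlinarith
  have h5 : ‖gapOp (phase m s • newtonStep^[N] S) ^ N‖ ≤ 1 / (2 * m) := by
    have h6 := norm_le_norm_add_norm_sub' (gapOp (phase m s • newtonStep^[N] S) ^ N)
      (gapOp (phase m s • W) ^ N)
    have h7 : 16 / (36 * (m : ℝ)) + 2 * (1 / (36 * m)) = 1 / (2 * m) := by
      field_simp
      norm_num
    linarith
  refine (sum_sq_le_norm_sq _).trans ?_
  have h8 : ‖gapOp (phase m s • newtonStep^[N] S) ^ N‖ ^ 2 ≤ (1 / (2 * (m : ℝ))) ^ 2 := by gcongr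
  have h9 : (m : ℝ) * (1 / (2 * (m : ℝ))) ^ 2 = 1 / 4 * (1 / m) := by
    field_simp
    norm_num
  have h10 : 1 / (m : ℝ) ≤ 1 := by
    rw [div_le_one (by positivity)]
    exact hm1
  nlinarith

theorem norm_le_half_of_sum_sq_le {m : ℕ} {A : Matrix (Fin m) (Fin m) ℂ}
    (h : ∑ i, ∑ j, ‖A i j‖ ^ 2 ≤ 1 / 4) : ‖A‖ ≤ 1 / 2 := by
  have := norm_sq_le_sum_sq A
  nlinarith [norm_nonneg A]

end MatrixNorm

/-! ### Hilbert-Schmidt norms on the joint system -/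

theorem enorm_sq_eq_ofReal {E : Type*} [NormedAddCommGroup E] (x : E) :
    ‖x‖ₑ ^ 2 = ENNReal.ofReal (‖x‖ ^ 2) := by
  rw [ENNReal.ofReal_pow (norm_nonneg _), ofReal_norm]

theorem tsum_enorm_sq {G : ℕ → Type*} [∀ i, NormedAddCommGroup (G i)] (ψ : lp G 2) :
    ∑' i, ‖ψ i‖ₑ ^ 2 = ‖ψ‖ₑ ^ 2 := by
  have h := lp.hasSum_norm (p := 2) (by simp) ψ
  have h' : HasSum (fun i => ‖ψ i‖ ^ 2) (‖ψ‖ ^ 2) := by simpa using h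
  rw [enorm_sq_eq_ofReal, ← h'.tsum_eq, ENNReal.ofReal_tsum_of_nonneg (fun _ => by positivity)
    h'.summable]
  simp only [enorm_sq_eq_ofReal]

theorem inner_fockPair (m : ℕ × ℕ) (ψ : Joint) : inner ℂ (fockPair m) ψ = ψ m.2 m.1 := by
  rw [fockPair, lp.inner_single_left, fock, lp.inner_single_left]
  simp

theorem tsum_enorm_inner_sq (ψ : Joint) :
    ∑' m : ℕ × ℕ, ‖inner ℂ (fockPair m) ψ‖ₑ ^ 2 = ‖ψ‖ₑ ^ 2 := by
  simp only [inner_fockPair]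
  rw [ENNReal.tsum_prod' (f := fun m : ℕ × ℕ => ‖ψ m.2 m.1‖ₑ ^ 2), ENNReal.tsum_comm,
    ← tsum_enorm_sq ψ]
  exact tsum_congr fun j => tsum_enorm_sq (ψ j)

/-- The squared Hilbert-Schmidt norm. -/
def hsSq (X : Joint →L[ℂ] Joint) : ℝ≥0∞ := ∑' m, ‖X (fockPair m)‖ₑ ^ 2

/-- Tonelli's theorem in `[0, ∞]`. The weight sits on the output index, and this is what allows a
bound growing with the level to be used under an energy constraint. -/
theorem tsum_mul_enorm_inner_adjoint (w : ℕ × ℕ → ℝ≥0∞) (X : Joint →L[ℂ] Joint) :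
    ∑' n, ∑' m, w m * ‖inner ℂ (fockPair m) (X (fockPair n))‖ₑ ^ 2 =
      ∑' m, w m * ‖X.adjoint (fockPair m)‖ₑ ^ 2 := by
  rw [ENNReal.tsum_comm]
  refine tsum_congr fun m => ?_
  rw [ENNReal.tsum_mul_left, ← tsum_enorm_inner_sq (X.adjoint (fockPair m))]
  congr 1
  refine tsum_congr fun n => ?_
  rw [ContinuousLinearMap.adjoint_inner_right, ← inner_conj_symm, RCLike.enorm_conj]

theorem hsSq_adjoint (X : Joint →L[ℂ] Joint) : hsSq X.adjoint = hsSq X := by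
  have h := tsum_mul_enorm_inner_adjoint (fun _ => 1) X
  simp only [one_mul, tsum_enorm_inner_sq] at h
  exact h.symm

theorem hsSq_comp_le {F X : Joint →L[ℂ] Joint} (hF : ∀ ψ, ‖F ψ‖ ≤ ‖ψ‖) : hsSq (F ∘L X) ≤ hsSq X := by
  refine ENNReal.tsum_le_tsum fun m => ?_
  gcongr
  rw [enorm_le_iff_norm_le]
  exact hF _

theorem sum_norm_mul_norm_le {X Y : Joint →L[ℂ] Joint} {η : ℝ} (hη : 0 ≤ η)
    (hX : hsSq X ≤ ENNReal.ofReal (η ^ 2)) (hY : hsSq Y ≤ 1) (s : Finset (ℕ × ℕ)) :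
    ∑ m ∈ s, ‖X (fockPair m)‖ * ‖Y (fockPair m)‖ ≤ η := by
  have key : ∀ (Z : Joint →L[ℂ] Joint) (c : ℝ), 0 ≤ c → hsSq Z ≤ ENNReal.ofReal c →
      ∑ m ∈ s, ‖Z (fockPair m)‖ ^ 2 ≤ c := fun Z c hc hZ => by
    rw [← ENNReal.ofReal_le_ofReal_iff hc, ENNReal.ofReal_sum_of_nonneg fun _ _ => by positivity]
    simp only [← enorm_sq_eq_ofReal]
    exact (ENNReal.sum_le_tsum s).trans hZ
  have h1 := key X _ (by positivity) hX
  have h2 := key Y 1 zero_le_one (by rwa [ENNReal.ofReal_one])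
  calc _ ≤ Real.sqrt (∑ m ∈ s, ‖X (fockPair m)‖ ^ 2) * Real.sqrt (∑ m ∈ s, ‖Y (fockPair m)‖ ^ 2) :=
        Real.sum_mul_le_sqrt_mul_sqrt _ _ _
    _ ≤ Real.sqrt (η ^ 2) * Real.sqrt 1 := by gcongr
    _ = η := by rw [Real.sqrt_one, mul_one, Real.sqrt_sq hη]

/-! ### The trace norm -/

/-- The sign function is not continuous on the spectrum. The function `x/(|x| + δ)` is, and
replacing the sign by it loses `|x|δ/(|x| + δ) ≤ δ`. -/
theorem exists_approx_sign {H : Type*} [NormedAddCommGroup H] [InnerProductSpace ℂ H]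
    [CompleteSpace H] {T : H →L[ℂ] H} (hT : IsSelfAdjoint T) {δ : ℝ} (hδ : 0 < δ) :
    ∃ F : H →L[ℂ] H, IsSelfAdjoint F ∧ ‖F‖ ≤ 1 ∧ ‖absOp T - F * T‖ ≤ δ := by
  have hc : Continuous fun x : ℝ => x / (|x| + δ) :=
    continuous_id.div (by fun_prop) fun x => by positivity
  refine ⟨cfc (fun x : ℝ => x / (|x| + δ)) T, cfc_predicate _ _, ?_, ?_⟩
  · refine norm_cfc_le zero_le_one fun x _ => ?_
    rw [Real.norm_eq_abs, abs_div, abs_of_pos (by positivity : 0 < |x| + δ),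
      div_le_one (by positivity)]
    linarith
  · have e : absOp T - cfc (fun x : ℝ => x / (|x| + δ)) T * T =
        cfc (fun x : ℝ => ‖x‖ - x / (|x| + δ) * x) T := by
      have hc2 : Continuous fun x : ℝ => x / (|x| + δ) * x := hc.mul continuous_id
      rw [cfc_sub _ _ _ (by fun_prop) hc2.continuousOn,
        cfc_mul _ _ _ hc.continuousOn (by fun_prop), cfc_id' ℝ T hT, absOp,
        CFC.abs_eq_cfc_norm T hT]
    rw [e]
    refine norm_cfc_le hδ.le fun x _ => ?_
    have hp : 0 < |x| + δ := by positivity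
    have e2 : ‖x‖ - x / (|x| + δ) * x = |x| * δ / (|x| + δ) := by
      rw [Real.norm_eq_abs, eq_div_iff hp.ne', sub_mul, div_mul_eq_mul_div, div_mul_cancel₀ _ hp.ne']
      nlinarith [abs_mul_abs_self x]
    rw [e2, Real.norm_of_nonneg (by positivity), div_le_iff₀ hp]
    nlinarith [abs_nonneg x]

theorem isPositive_absOp {H : Type*} [NormedAddCommGroup H] [InnerProductSpace ℂ H]
    [CompleteSpace H] (T : H →L[ℂ] H) : (absOp T).IsPositive :=
  (ContinuousLinearMap.nonneg_iff_isPositive _).mp (CFC.abs_nonneg T)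

theorem exists_sqrt_of_isPositive {H : Type*} [NormedAddCommGroup H] [InnerProductSpace ℂ H]
    [CompleteSpace H] {ρ : H →L[ℂ] H} (hρ : ρ.IsPositive) :
    ∃ R : H →L[ℂ] H, R * R = ρ ∧ R.adjoint = R := by
  have hρ0 : 0 ≤ ρ := (ContinuousLinearMap.nonneg_iff_isPositive _).mpr hρ
  exact ⟨CFC.sqrt ρ, CFC.sqrt_mul_sqrt_self ρ, ((ContinuousLinearMap.nonneg_iff_isPositive _).mp
    (CFC.sqrt_nonneg ρ)).isSelfAdjoint.adjoint_eq⟩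

/-- `|T|` is nearly `F T` with a contraction `F`. Each of the two summands of `F T` is a product of
two Hilbert–Schmidt operators of norms at most `η` and `1`, and Cauchy–Schwarz bounds every partial
sum of its diagonal. -/
theorem traceNorm_le {X Y Z : Joint →L[ℂ] Joint} {η : ℝ} (hη : 0 ≤ η)
    (hX : hsSq X ≤ ENNReal.ofReal (η ^ 2)) (hY : hsSq Y ≤ 1) (hZ : hsSq Z ≤ 1)
    (hT : IsSelfAdjoint (X ∘L Y.adjoint + Z ∘L X.adjoint)) :
    traceNorm (X ∘L Y.adjoint + Z ∘L X.adjoint) ≤ ENNReal.ofReal (2 * η) := by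
  set T := X ∘L Y.adjoint + Z ∘L X.adjoint with hTdef
  have habs : ∀ m, 0 ≤ diagEntry (absOp T) m := fun m =>
    (isPositive_absOp T).re_inner_nonneg_right _
  rw [traceNorm, posTrace, ENNReal.tsum_eq_iSup_sum]
  refine iSup_le fun s => ?_
  rw [← ENNReal.ofReal_sum_of_nonneg fun m _ => habs m]
  refine ENNReal.ofReal_le_ofReal (le_of_forall_pos_le_add fun κ hκ => ?_)
  -- The error of the approximate sign enters once for each index in `s`; this choice keeps the sum
  -- of these errors below `κ`.
  have hδ : 0 < κ / (s.card + 1) := by positivity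
  obtain ⟨F, hF, hF1, hFT⟩ := exists_approx_sign hT hδ
  have hFn : ∀ ψ, ‖F ψ‖ ≤ ‖ψ‖ := fun ψ => by
    simpa using F.le_of_opNorm_le hF1 ψ
  have hFa : F.adjoint = F := hF.adjoint_eq
  have hn : ∀ m, ‖fockPair m‖ = 1 := fun m => by
    rw [fockPair, lp.norm_single (by simp), fock, lp.norm_single (by simp), norm_one]
  have hpt : ∀ m, diagEntry (absOp T) m ≤ ‖(F ∘L X).adjoint (fockPair m)‖ * ‖Y.adjoint (fockPair m)‖ +
      ‖X.adjoint (fockPair m)‖ * ‖(F ∘L Z).adjoint (fockPair m)‖ + κ / (s.card + 1) := fun m => by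
    set e := fockPair m with he
    have h1 : inner ℂ e (absOp T e) = inner ℂ ((F ∘L X).adjoint e) (Y.adjoint e) +
        inner ℂ ((F ∘L Z).adjoint e) (X.adjoint e) + inner ℂ e ((absOp T - F * T) e) := by
      rw [ContinuousLinearMap.adjoint_inner_left, ContinuousLinearMap.adjoint_inner_left,
        ← inner_add_right, ← inner_add_right]
      congr 1
      have : (F * T) e = F (X (Y.adjoint e)) + F (Z (X.adjoint e)) := by
        rw [← map_add]
        rfl
      rw [sub_apply, this]
      simp only [ContinuousLinearMap.comp_apply]
      abel
    rw [diagEntry, ← he, h1, Complex.add_re, Complex.add_re]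
    have h2 : ∀ x y : Joint, (inner ℂ x y).re ≤ ‖x‖ * ‖y‖ := fun x y =>
      (Complex.re_le_norm _).trans (norm_inner_le_norm _ _)
    have h3 := h2 e ((absOp T - F * T) e)
    have h4 := (absOp T - F * T).le_of_opNorm_le hFT e
    rw [hn, one_mul] at h3
    rw [hn, mul_one] at h4
    have h5 := h2 ((F ∘L Z).adjoint e) (X.adjoint e)
    rw [mul_comm] at h5
    linarith [h2 ((F ∘L X).adjoint e) (Y.adjoint e)]
  have hs1 := sum_norm_mul_norm_le (X := (F ∘L X).adjoint) (Y := Y.adjoint) hη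
    (by rw [hsSq_adjoint]; exact (hsSq_comp_le hFn).trans hX) (by rwa [hsSq_adjoint]) s
  have hs2 := sum_norm_mul_norm_le (X := X.adjoint) (Y := (F ∘L Z).adjoint) hη
    (by rwa [hsSq_adjoint]) (by rw [hsSq_adjoint]; exact (hsSq_comp_le hFn).trans hZ) s
  refine (Finset.sum_le_sum fun m _ => hpt m).trans ?_
  rw [Finset.sum_add_distrib, Finset.sum_add_distrib, Finset.sum_const, nsmul_eq_mul]
  have : (s.card : ℝ) * (κ / (s.card + 1)) ≤ κ := by
    rw [← mul_div_assoc, div_le_iff₀ (by positivity)]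
    nlinarith
  linarith

theorem tensorId_sub (A B : Mode →L[ℂ] Mode) : tensorId (A - B) = tensorId A - tensorId B := by
  ext ψ j i
  rfl

theorem enorm_tensorId_sq (A : Mode →L[ℂ] Mode) (ψ : Joint) :
    ‖tensorId A ψ‖ₑ ^ 2 = ∑' j, ‖A (ψ j)‖ₑ ^ 2 := by
  rw [← tsum_enorm_sq]
  rfl

theorem norm_tensorId_isometry (U : Mode ≃ₗᵢ[ℂ] Mode) (ψ : Joint) :
    ‖tensorId (U : Mode →L[ℂ] Mode) ψ‖ = ‖ψ‖ := by
  have h := enorm_tensorId_sq (U : Mode →L[ℂ] Mode) ψ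
  have h2 : ∀ j, ‖(U : Mode →L[ℂ] Mode) (ψ j)‖ₑ = ‖ψ j‖ₑ := fun j => by
    rw [← ofReal_norm, ← ofReal_norm]
    exact congrArg _ (U.norm_map (ψ j))
  simp only [h2, tsum_enorm_sq] at h
  rw [enorm_sq_eq_ofReal, enorm_sq_eq_ofReal,
    ENNReal.ofReal_eq_ofReal_iff (by positivity) (by positivity)] at h
  exact (pow_left_inj₀ (norm_nonneg _) (norm_nonneg _) two_ne_zero).mp h

/-- With `ρ = R²` and `D = U - V`, the difference of the outputs is `(D R)(U R)† + (V R)(D R)†`.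
Here `U R` and `V R` have Hilbert–Schmidt norm at most `1`, and that of `D R` is bounded through the
weights by the diagonal of `ρ`. -/
theorem traceNorm_channel_sub_le (U V : Mode ≃ₗᵢ[ℂ] Mode) {ρ : Joint →L[ℂ] Joint} (hρ : IsDensity ρ)
    (w : ℕ → ℝ≥0∞) (hw : ∀ ψ : Mode, ‖U ψ - V ψ‖ₑ ^ 2 ≤ ∑' i, w i * ‖ψ i‖ₑ ^ 2) {η : ℝ} (hη : 0 ≤ η)
    (h : ∑' m : ℕ × ℕ, w m.1 * ENNReal.ofReal (diagEntry ρ m) ≤ ENNReal.ofReal (η ^ 2)) :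
    traceNorm (channelTensorId U ρ - channelTensorId V ρ) ≤ ENNReal.ofReal (2 * η) := by
  obtain ⟨R, hRR, hRa⟩ := exists_sqrt_of_isPositive hρ.1
  have hRd : ∀ m, ‖R (fockPair m)‖ₑ ^ 2 = ENNReal.ofReal (diagEntry ρ m) := fun m => by
    rw [enorm_sq_eq_ofReal, diagEntry, ← hRR]
    congr 1
    rw [mul_apply_eq_comp, ← ContinuousLinearMap.adjoint_inner_left, hRa]
    exact norm_sq_eq_re_inner (𝕜 := ℂ) _
  have hR1 : hsSq R = 1 := by
    rw [← hρ.2, hsSq, posTrace]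
    exact tsum_congr hRd
  set A := tensorId (U : Mode →L[ℂ] Mode) with hA
  set B := tensorId (V : Mode →L[ℂ] Mode) with hB
  set D := tensorId ((U : Mode →L[ℂ] Mode) - (V : Mode →L[ℂ] Mode)) with hD
  have hDAB : D = A - B := tensorId_sub _ _
  have e : channelTensorId U ρ - channelTensorId V ρ =
      (D ∘L R) ∘L (A ∘L R).adjoint + (B ∘L R) ∘L (D ∘L R).adjoint := by
    rw [channelTensorId, channelTensorId, ← hRR, ContinuousLinearMap.adjoint_comp,
      ContinuousLinearMap.adjoint_comp, hRa, hDAB, ← hA, ← hB]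
    ext1 ψ
    simp only [ContinuousLinearMap.comp_apply, add_apply,
      sub_apply, map_sub, mul_apply_eq_comp]
    abel
  have hsa : IsSelfAdjoint (channelTensorId U ρ - channelTensorId V ρ) := by
    have : ∀ W : Mode ≃ₗᵢ[ℂ] Mode, IsSelfAdjoint (channelTensorId W ρ) := fun W =>
      (hρ.1.conj_adjoint _).isSelfAdjoint
    exact (this U).sub (this V)
  rw [e] at hsa ⊢
  refine traceNorm_le hη ?_ ?_ ?_ hsa
  · refine le_trans ?_ h
    have h1 : hsSq (D ∘L R) ≤
        ∑' n, ∑' m : ℕ × ℕ, w m.1 * ‖inner ℂ (fockPair m) (R (fockPair n))‖ₑ ^ 2 := by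
      refine ENNReal.tsum_le_tsum fun n => ?_
      rw [ContinuousLinearMap.comp_apply, hD, enorm_tensorId_sq]
      simp only [inner_fockPair]
      rw [ENNReal.tsum_prod' (f := fun m : ℕ × ℕ => w m.1 * ‖R (fockPair n) m.2 m.1‖ₑ ^ 2),
        ENNReal.tsum_comm]
      exact ENNReal.tsum_le_tsum fun j => hw _
    rw [tsum_mul_enorm_inner_adjoint (fun m => w m.1) R, hRa] at h1
    simpa only [hRd] using h1
  · exact (hsSq_comp_le fun ψ => (norm_tensorId_isometry U ψ).le).trans hR1.le
  · exact (hsSq_comp_le fun ψ => (norm_tensorId_isometry V ψ).le).trans hR1.le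

/-! ### Bounds on the energy-constrained diamond distance -/

theorem channelTensorId_phaseSMul (z : ℂ) (hz : ‖z‖ = 1) (U : Mode ≃ₗᵢ[ℂ] Mode)
    (ρ : Joint →L[ℂ] Joint) : channelTensorId (phaseSMul z hz U) ρ = channelTensorId U ρ := by
  have e : tensorId (phaseSMul z hz U : Mode →L[ℂ] Mode) = z • tensorId (U : Mode →L[ℂ] Mode) := by
    ext ψ j i
    rfl
  rw [channelTensorId, channelTensorId, e]
  have h2 : (z • tensorId (U : Mode →L[ℂ] Mode)).adjoint =
      conj z • (tensorId (U : Mode →L[ℂ] Mode)).adjoint := map_smulₛₗ _ _ _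
  rw [h2]
  ext1 ψ
  simp only [ContinuousLinearMap.comp_apply, smul_apply, map_smul, smul_smul]
  rw [Complex.conj_mul', hz]
  simp

theorem ecDiamond_phaseSMul (E : ℝ) (z : ℂ) (hz : ‖z‖ = 1) (U V : Mode ≃ₗᵢ[ℂ] Mode) :
    ecDiamond E (phaseSMul z hz U) V = ecDiamond E U V := by
  simp only [ecDiamond, channelTensorId_phaseSMul]

/-- A crude bound, but it is all that is needed to dispose of `ε ≥ 4`. -/
theorem ecDiamond_le_four (E : ℝ) (U V : Mode ≃ₗᵢ[ℂ] Mode) : ecDiamond E U V ≤ ENNReal.ofReal 4 := by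
  refine iSup_le fun ρ => iSup_le fun hρ => iSup_le fun _ => ?_
  have e : (4 : ℝ) = 2 * 2 := by norm_num
  rw [e]
  refine traceNorm_channel_sub_le U V hρ (fun _ => ENNReal.ofReal (2 ^ 2)) (fun ψ => ?_)
    (by norm_num) ?_
  · rw [ENNReal.tsum_mul_left, tsum_enorm_sq, enorm_sq_eq_ofReal, enorm_sq_eq_ofReal,
      ← ENNReal.ofReal_mul (by norm_num), ← mul_pow]
    refine ENNReal.ofReal_le_ofReal (pow_le_pow_left₀ (norm_nonneg _) ?_ 2)
    refine (norm_sub_le _ _).trans ?_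
    rw [U.norm_map, V.norm_map]
    linarith
  · rw [ENNReal.tsum_mul_left]
    have := hρ.2
    rw [posTrace] at this
    rw [this, mul_one]

/-- Cutting a vector at level `K` into `φ` and a rest `χ` gives `‖(U - V)ψ‖² ≤ (ε²/8) ‖φ‖² + 8
‖χ‖²`. On the levels of `χ` the constant `8` is at most `8i/K`, so the affine weight `ε²/8 + 8i/K`
suffices. Its mean is at most `ε²/8 + 8E/K ≤ ε²/4`; this is the origin of the factor `64`. -/
theorem ecDiamond_le {E ε : ℝ} (hE : 0 ≤ E) (hε : 0 < ε) {K : ℕ} (hK : 0 < K)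
    (hEK : 64 * E ≤ K * ε ^ 2) {U V : Mode ≃ₗᵢ[ℂ] Mode}
    (h : ∀ φ : Mode, (∀ i, K ≤ i → φ i = 0) → ‖U φ - V φ‖ ≤ ε / 4 * ‖φ‖) :
    ecDiamond E U V ≤ ENNReal.ofReal ε := by
  have hK' : (0 : ℝ) < K := by exact_mod_cast hK
  refine iSup_le fun ρ => iSup_le fun hρ => iSup_le fun hen => ?_
  have e : ε = 2 * (ε / 2) := by ring
  rw [e]
  refine traceNorm_channel_sub_le U V hρ
    (fun i => ENNReal.ofReal (ε ^ 2 / 8 + 8 / K * i)) (fun ψ => ?_) (by positivity) ?_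
  · set φ : Mode := ∑ i ∈ Finset.range K, lp.single 2 i (ψ i) with hφ
    have hφi : ∀ i, φ i = if i < K then ψ i else 0 := fun i => by
      have h1 : φ i = ∑ k ∈ Finset.range K, (lp.single 2 k (ψ k) : Mode) i := by
        rw [hφ, lp.coeFn_sum, Finset.sum_apply]
      rw [h1]
      simp only [lp.single_apply, Pi.single_apply, Finset.sum_ite_eq, Finset.mem_range]
    have hχi : ∀ i, (ψ - φ) i = if i < K then 0 else ψ i := fun i => by
      have h1 : (ψ - φ) i = ψ i - φ i := rfl
      rw [h1, hφi]
      split_ifs <;> simp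
    have h1 := h φ fun i hi => by rw [hφi, if_neg (by omega)]
    have h2 : ‖U (ψ - φ) - V (ψ - φ)‖ ≤ 2 * ‖ψ - φ‖ := by
      refine (norm_sub_le _ _).trans ?_
      rw [U.norm_map, V.norm_map]
      linarith
    have h3 : ‖U ψ - V ψ‖ ≤ ε / 4 * ‖φ‖ + 2 * ‖ψ - φ‖ := by
      have e2 : U ψ - V ψ = (U φ - V φ) + (U (ψ - φ) - V (ψ - φ)) := by
        rw [map_sub, map_sub]
        abel
      rw [e2]
      exact (norm_add_le _ _).trans (add_le_add h1 h2)
    have h4 : ‖U ψ - V ψ‖ ^ 2 ≤ ε ^ 2 / 8 * ‖φ‖ ^ 2 + 8 * ‖ψ - φ‖ ^ 2 := by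
      have := pow_le_pow_left₀ (norm_nonneg _) h3 2
      nlinarith [sq_nonneg (ε / 4 * ‖φ‖ - 2 * ‖ψ - φ‖)]
    have h5 := ((hasSum_norm_sq φ).mul_left (ε ^ 2 / 8)).add ((hasSum_norm_sq (ψ - φ)).mul_left 8)
    rw [enorm_sq_eq_ofReal]
    refine (ENNReal.ofReal_le_ofReal h4).trans ?_
    rw [← h5.tsum_eq, ENNReal.ofReal_tsum_of_nonneg (fun _ => by positivity) h5.summable]
    refine ENNReal.tsum_le_tsum fun i => ?_
    rw [enorm_sq_eq_ofReal, ← ENNReal.ofReal_mul (by positivity)]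
    refine ENNReal.ofReal_le_ofReal ?_
    rw [hφi, hχi]
    by_cases hi : i < K
    · rw [if_pos hi, if_pos hi, norm_zero]
      have : 0 ≤ 8 / (K : ℝ) * i := by positivity
      nlinarith [sq_nonneg ‖ψ i‖]
    · rw [if_neg hi, if_neg hi, norm_zero]
      have h6 : (K : ℝ) ≤ i := by exact_mod_cast not_lt.mp hi
      have : 8 ≤ 8 / (K : ℝ) * i := by
        rw [div_mul_eq_mul_div, le_div_iff₀ hK']
        linarith
      nlinarith [sq_nonneg ‖ψ i‖, sq_nonneg ε]
  · have hd : ∀ m, 0 ≤ diagEntry ρ m := fun m => hρ.1.re_inner_nonneg_right _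
    have h1 : ∀ m : ℕ × ℕ, ENNReal.ofReal (ε ^ 2 / 8 + 8 / K * m.1) * ENNReal.ofReal (diagEntry ρ m) =
        ENNReal.ofReal (ε ^ 2 / 8) * ENNReal.ofReal (diagEntry ρ m) +
          ENNReal.ofReal (8 / K) * ENNReal.ofReal (m.1 * diagEntry ρ m) := fun m => by
      rw [ENNReal.ofReal_add (by positivity) (by positivity), add_mul,
        ENNReal.ofReal_mul (p := 8 / (K : ℝ)) (by positivity), mul_assoc,
        ENNReal.ofReal_mul (p := (m.1 : ℝ)) (by positivity)]
    simp only [h1]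
    rw [ENNReal.tsum_add, ENNReal.tsum_mul_left, ENNReal.tsum_mul_left]
    have h2 := hρ.2
    rw [posTrace] at h2
    rw [h2, mul_one]
    rw [jointEnergy] at hen
    calc _ ≤ ENNReal.ofReal (ε ^ 2 / 8) + ENNReal.ofReal (8 / K) * ENNReal.ofReal E := by gcongr
      _ = ENNReal.ofReal (ε ^ 2 / 8 + 8 / K * E) := by
        rw [← ENNReal.ofReal_mul (by positivity), ← ENNReal.ofReal_add (by positivity)
          (by positivity)]
      _ ≤ _ := by
        refine ENNReal.ofReal_le_ofReal ?_
        have : 8 / (K : ℝ) * E ≤ ε ^ 2 / 8 := by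
          rw [div_mul_eq_mul_div, div_le_iff₀ hK']
          linarith
        linarith

/-! ### Energies -/

theorem energy_lt_top_of_mem_schwartz {ψ : Mode} (hψ : ψ ∈ schwartz) : energy ψ < ⊤ := by
  have h2 := (hψ 2).norm.eventually_le_const (u := 1) (by simp)
  have hs : Summable fun n : ℕ => 1 / (n : ℝ) ^ 2 :=
    Real.summable_one_div_nat_pow.mpr one_lt_two
  have hsum : Summable fun n : ℕ => (n : ℝ) * ‖ψ n‖ ^ 2 := by
    refine hs.of_norm_bounded_eventually_nat ?_
    filter_upwards [h2, eventually_gt_atTop 0] with n hn hpos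
    have hn1 : (1 : ℝ) ≤ n := by exact_mod_cast hpos
    rw [norm_mul, norm_pow, Complex.norm_natCast] at hn
    rw [Real.norm_of_nonneg (by positivity), le_div_iff₀ (by positivity)]
    have h3 : ((n : ℝ) ^ 2 * ‖ψ n‖) ^ 2 ≤ 1 := pow_le_one₀ (by positivity) hn
    have h4 : (n : ℝ) ^ 3 ≤ (n : ℝ) ^ 4 := pow_le_pow_right₀ hn1 (by norm_num)
    nlinarith [sq_nonneg ‖ψ n‖]
  rw [energy, ← ENNReal.ofReal_tsum_of_nonneg (fun _ => by positivity) hsum]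
  exact ENNReal.ofReal_lt_top

/-- The states with fewer than `K` particles. -/
theorem lowSpace_apply_eq_zero {x : ℝ} {ψ : Mode} (hψ : ψ ∈ lowSpace x) (n : ℕ) (hn : x < n) :
    ψ n = 0 := by
  induction hψ using Submodule.span_induction with
  | mem ψ h =>
    obtain ⟨k, hk, rfl⟩ := h
    rw [fock_apply, if_neg]
    rintro rfl
    linarith
  | zero => rfl
  | add ψ φ _ _ h1 h2 =>
    have : (ψ + φ) n = ψ n + φ n := rfl
    rw [this, h1, h2, add_zero]
  | smul a ψ _ h =>
    have : (a • ψ) n = a * ψ n := rfl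
    rw [this, h, mul_zero]

theorem eq_sum_fock {φ : Mode} {K : ℕ} (hφ : ∀ i, K ≤ i → φ i = 0) :
    φ = ∑ j ∈ Finset.range K, φ j • fock j := by
  ext i
  have h1 : (∑ j ∈ Finset.range K, φ j • fock j : Mode) i = ∑ j ∈ Finset.range K, (φ j • fock j) i := by
    rw [lp.coeFn_sum, Finset.sum_apply]
  have h2 : ∀ j, (φ j • fock j) i = φ j * (if i = j then 1 else 0) := fun j => by
    rw [← fock_apply]
    rfl
  rw [h1]
  simp only [h2, mul_ite, mul_one, mul_zero, Finset.sum_ite_eq, Finset.mem_range]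
  split_ifs with h
  · rfl
  · exact hφ i (by omega)

theorem norm_sq_eq_sum {φ : Mode} {K : ℕ} (hφ : ∀ i, K ≤ i → φ i = 0) :
    ‖φ‖ ^ 2 = ∑ j ∈ Finset.range K, ‖φ j‖ ^ 2 := by
  refine (hasSum_norm_sq φ).unique (hasSum_sum_of_ne_finset_zero fun j hj => ?_)
  rw [hφ j (by simpa using hj), norm_zero, zero_pow two_ne_zero]

theorem map_apply_eq_sum (U : Mode ≃ₗᵢ[ℂ] Mode) {φ : Mode} {K : ℕ} (hφ : ∀ i, K ≤ i → φ i = 0)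
    (i : ℕ) : (U φ) i = ∑ j ∈ Finset.range K, fockMatrix U i j * φ j := by
  have h1 : (U φ) i = (∑ j ∈ Finset.range K, φ j • U (fock j) : Mode) i := by
    conv_lhs => rw [eq_sum_fock hφ]
    rw [map_sum]
    simp only [map_smul]
  rw [h1, lp.coeFn_sum, Finset.sum_apply]
  exact Finset.sum_congr rfl fun j _ => mul_comm _ _

theorem norm_map_apply_sq_le (U : Mode ≃ₗᵢ[ℂ] Mode) {φ : Mode} {K : ℕ} (hφ : ∀ i, K ≤ i → φ i = 0)
    (i : ℕ) : ‖(U φ) i‖ ^ 2 ≤ (∑ j ∈ Finset.range K, ‖fockMatrix U i j‖ ^ 2) * ‖φ‖ ^ 2 := by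
  rw [map_apply_eq_sum U hφ, norm_sq_eq_sum hφ]
  calc _ ≤ (∑ j ∈ Finset.range K, ‖fockMatrix U i j‖ * ‖φ j‖) ^ 2 := by
        gcongr
        exact (norm_sum_le _ _).trans (Finset.sum_le_sum fun j _ => (norm_mul_le _ _))
    _ ≤ _ := Finset.sum_mul_sq_le_sq_mul_sq _ _ _

/-- By Cauchy–Schwarz the energy of `U ψ` is at most the sum of the energies of the finitely many
Schwartz vectors `U |j⟩`. -/
theorem maxEnergy_lt_top {U : Mode ≃ₗᵢ[ℂ] Mode} (hU : IsPhysical U) (x : ℝ) : maxEnergy U x < ⊤ := by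
  obtain ⟨K, hK⟩ := exists_nat_gt x
  have hfin : ∑ j ∈ Finset.range K, energy (U (fock j)) < ⊤ :=
    ENNReal.sum_lt_top.mpr fun j _ =>
      energy_lt_top_of_mem_schwartz (hU _ (fockS j).2)
  refine lt_of_le_of_lt (iSup_le fun ψ => iSup_le fun hψ => iSup_le fun h1 => ?_) hfin
  have hψ0 : ∀ i, K ≤ i → ψ i = 0 := fun i hi => lowSpace_apply_eq_zero hψ i
    (hK.trans_le (by exact_mod_cast hi))
  simp only [energy]
  rw [← Summable.tsum_finsetSum fun _ _ => ENNReal.summable]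
  refine ENNReal.tsum_le_tsum fun n => ?_
  rw [← ENNReal.ofReal_sum_of_nonneg fun _ _ => by positivity, ← Finset.mul_sum]
  refine ENNReal.ofReal_le_ofReal ?_
  have := norm_map_apply_sq_le U hψ0 n
  rw [h1, one_pow, mul_one] at this
  gcongr
  exact this

theorem energy_fock_le_maxEnergy (U : Mode ≃ₗᵢ[ℂ] Mode) {x : ℝ} {j : ℕ} (hj : (j : ℝ) ≤ x) :
    energy (U (fock j)) ≤ maxEnergy U x := by
  refine le_iSup_of_le (fock j) (le_iSup_of_le (Submodule.subset_span ⟨j, hj, rfl⟩)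
    (le_iSup_of_le ?_ le_rfl))
  rw [fock, lp.norm_single (by simp), norm_one]

/-! ### Truncation -/

/-- The part of a state with more than `L` particles. -/
def tail (L : ℕ) (ψ : Mode) : Mode := ψ - ∑ i ∈ Finset.range (L + 1), ψ i • fock i

theorem tail_apply (L : ℕ) (ψ : Mode) (n : ℕ) : tail L ψ n = if n ≤ L then 0 else ψ n := by
  have h1 : tail L ψ n = ψ n - (∑ i ∈ Finset.range (L + 1), ψ i • fock i : Mode) n := rfl
  have h2 : ∀ j, (ψ j • fock j) n = ψ j * (if n = j then 1 else 0) := fun j => by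
    rw [← fock_apply]
    rfl
  rw [h1, lp.coeFn_sum, Finset.sum_apply]
  simp only [h2, mul_ite, mul_one, mul_zero, Finset.sum_ite_eq, Finset.mem_range, Nat.lt_succ_iff]
  split_ifs <;> simp

theorem inner_tail (L : ℕ) (ψ φ : Mode) : inner ℂ (tail L ψ) (tail L φ) =
    inner ℂ ψ φ - ∑ i ∈ Finset.range (L + 1), (starRingEnd ℂ) (ψ i) * φ i := by
  have h1 : HasSum (fun n => inner ℂ (tail L ψ n) (tail L φ n)) (inner ℂ (tail L ψ) (tail L φ)) :=
    lp.hasSum_inner _ _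
  have h2 : HasSum (fun n => inner ℂ (ψ n) (φ n)) (inner ℂ ψ φ) := lp.hasSum_inner _ _
  have h3 : HasSum (fun n => if n ∈ Finset.range (L + 1) then inner ℂ (ψ n) (φ n) else 0)
      (∑ i ∈ Finset.range (L + 1), inner ℂ (ψ i) (φ i)) := by
    rw [← Finset.sum_congr rfl (g := fun i => inner ℂ (ψ i) (φ i)) fun i hi => if_pos hi]
    exact hasSum_sum_of_ne_finset_zero fun i hi => if_neg hi
  have h4 := h2.sub h3
  have h5 := h1.unique (h4.congr_fun fun n => by
    rw [tail_apply, tail_apply]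
    simp only [Finset.mem_range, Nat.lt_succ_iff]
    split_ifs <;> simp)
  rw [h5]
  congr 1
  exact Finset.sum_congr rfl fun i _ => by rw [RCLike.inner_apply, mul_comm]

theorem norm_tail_sq (L : ℕ) (ψ : Mode) :
    ‖tail L ψ‖ ^ 2 = ‖ψ‖ ^ 2 - ∑ i ∈ Finset.range (L + 1), ‖ψ i‖ ^ 2 := by
  have h := congrArg Complex.re (inner_tail L ψ ψ)
  rw [Complex.sub_re, Complex.re_sum] at h
  rw [norm_sq_eq_re_inner (𝕜 := ℂ) (tail L ψ), norm_sq_eq_re_inner (𝕜 := ℂ) ψ]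
  refine h.trans (congrArg _ (Finset.sum_congr rfl fun i _ => ?_))
  rw [Complex.conj_mul', ← Complex.ofReal_pow, Complex.ofReal_re]

/-- The weight of the first `K` columns of a matrix in its first `L + 1` rows. -/
def headSum (O : ℕ → ℕ → ℂ) (K L : ℕ) : ℝ :=
  ∑ j ∈ Finset.range K, ∑ i ∈ Finset.range (L + 1), ‖O i j‖ ^ 2

theorem norm_fock (j : ℕ) : ‖fock j‖ = 1 := by
  rw [fock, lp.norm_single (by simp), norm_one]

theorem sum_norm_tail_sq (U : Mode ≃ₗᵢ[ℂ] Mode) (K L : ℕ) :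
    ∑ j ∈ Finset.range K, ‖tail L (U (fock j))‖ ^ 2 = K - headSum (fockMatrix U) K L := by
  simp only [norm_tail_sq, U.norm_map, norm_fock, Finset.sum_sub_distrib, headSum, fockMatrix]
  simp

/-- The columns of `U` are unit vectors, so the head sums tend to `K`. It is this that makes the
search for the number of rows terminate. -/
theorem exists_le_headSum (U : Mode ≃ₗᵢ[ℂ] Mode) (K : ℕ) {τ : ℝ} (hτ : 0 < τ) :
    ∃ L, K - τ ≤ headSum (fockMatrix U) K L := by
  have h : Tendsto (headSum (fockMatrix U) K) atTop (𝓝 (∑ j ∈ Finset.range K, 1)) := by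
    refine tendsto_finsetSum _ fun j _ => ?_
    have := (hasSum_norm_sq (U (fock j))).tendsto_sum_nat
    rw [U.norm_map, norm_fock, one_pow] at this
    exact this.comp (tendsto_add_atTop_nat 1)
  rw [Finset.sum_const, Finset.card_range, nsmul_one] at h
  obtain ⟨L, hL⟩ := (h.eventually_const_lt (show (K : ℝ) - τ < K by linarith)).exists
  exact ⟨L, hL.le⟩

/-- Markov's inequality: more than `τ` of the weight of the `K` columns lies above level `L`, and
each unit of it carries energy at least `L + 1`. -/
theorem mul_le_of_headSum_lt (U : Mode ≃ₗᵢ[ℂ] Mode) {K L : ℕ} {τ : ℝ} {M : ℝ≥0∞} (hM : M < ⊤)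
    (h : ∀ j < K, energy (U (fock j)) ≤ M) (hτ : headSum (fockMatrix U) K L < K - τ) :
    (L + 1) * τ ≤ K * M.toReal := by
  have h1 : ∀ j ∈ Finset.range K, (L + 1) * ‖tail L (U (fock j))‖ ^ 2 ≤ M.toReal := fun j hj => by
    rw [← ENNReal.ofReal_le_iff_le_toReal hM.ne]
    refine le_trans ?_ (h j (Finset.mem_range.mp hj))
    have h2 := (hasSum_norm_sq (tail L (U (fock j)))).mul_left ((L : ℝ) + 1)
    rw [energy, ← h2.tsum_eq, ENNReal.ofReal_tsum_of_nonneg (fun _ => by positivity) h2.summable]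
    refine ENNReal.tsum_le_tsum fun n => ENNReal.ofReal_le_ofReal ?_
    rw [tail_apply]
    split_ifs with hn
    · rw [norm_zero, zero_pow two_ne_zero, mul_zero]
      positivity
    · have : (L : ℝ) + 1 ≤ n := by exact_mod_cast not_le.mp hn
      gcongr
  have h3 := Finset.sum_le_sum h1
  rw [← Finset.mul_sum, sum_norm_tail_sq, Finset.sum_const, Finset.card_range, nsmul_eq_mul] at h3
  nlinarith

/-- The rows of `U` are, up to conjugation, columns of its inverse, so each has norm at most `1`. -/
theorem headSum_le (U : Mode ≃ₗᵢ[ℂ] Mode) (K L : ℕ) : headSum (fockMatrix U) K L ≤ L + 1 := by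
  rw [headSum, Finset.sum_comm]
  have h : ∀ i ∈ Finset.range (L + 1), ∑ j ∈ Finset.range K, ‖fockMatrix U i j‖ ^ 2 ≤ 1 := fun i _ => by
    have h1 : ∀ j, ‖fockMatrix U i j‖ = ‖(U.symm (fock i)) j‖ := fun j => by
      have h2 : inner ℂ (fock i) (U (fock j)) = fockMatrix U i j := by
        rw [fock, lp.inner_single_left]
        simp [fockMatrix]
      have h3 : inner ℂ (fock j) (U.symm (fock i)) = (U.symm (fock i)) j := by
        rw [fock, lp.inner_single_left]
        simp
      rw [← h2, ← h3, ← inner_conj_symm, RCLike.norm_conj, ← U.inner_map_map (fock j),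
        U.apply_symm_apply]
    simp only [h1]
    have h4 := hasSum_norm_sq (U.symm (fock i))
    rw [U.symm.norm_map, norm_fock, one_pow] at h4
    exact sum_le_hasSum _ (fun _ _ => by positivity) h4
  refine (Finset.sum_le_sum h).trans ?_
  simp

/-- Cauchy–Schwarz over the columns: the squared Hilbert–Schmidt norm of the discarded part of the
`K` columns is at most `τ`, and bounds its squared operator norm. -/
theorem norm_tail_map_le (U : Mode ≃ₗᵢ[ℂ] Mode) {K L : ℕ} {τ : ℝ}
    (hτ : K - τ ≤ headSum (fockMatrix U) K L) {φ : Mode} (hφ : ∀ i, K ≤ i → φ i = 0) :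
    ‖tail L (U φ)‖ ^ 2 ≤ τ * ‖φ‖ ^ 2 := by
  have h1 := hasSum_norm_sq (tail L (U φ))
  have h2 : HasSum (fun n => (∑ j ∈ Finset.range K, ‖tail L (U (fock j)) n‖ ^ 2) * ‖φ‖ ^ 2)
      ((∑ j ∈ Finset.range K, ‖tail L (U (fock j))‖ ^ 2) * ‖φ‖ ^ 2) :=
    (hasSum_sum fun j _ => hasSum_norm_sq _).mul_right _
  have h3 := hasSum_le (fun n => ?_) h1 h2
  · refine h3.trans ?_
    rw [sum_norm_tail_sq]
    gcongr
    linarith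
  · rw [tail_apply]
    simp only [tail_apply]
    split_ifs
    · rw [norm_zero, zero_pow two_ne_zero]
      positivity
    · exact norm_map_apply_sq_le U hφ n

/-! ### The truncated matrix and the exchange of the halves of the doubled space -/

section Matrices

open scoped Matrix.Norms.L2Operator

/-- The block of the first `L + 1` rows and `K` columns of a matrix. -/
def truncMat (O : ℕ → ℕ → ℂ) (K L : ℕ) : Matrix (Fin (2 * (L + 1))) (Fin (2 * (L + 1))) ℂ :=
  Matrix.of fun i j => if (i : ℕ) ≤ L ∧ (j : ℕ) < K then O i j else 0

/-- The exchange of the two halves of the basis. -/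
def swapMat (L : ℕ) : Matrix (Fin (2 * (L + 1))) (Fin (2 * (L + 1))) ℂ :=
  Matrix.of fun i j => if (i : ℕ) = j + (L + 1) ∨ (j : ℕ) = i + (L + 1) then 1 else 0

/-- The projection to the first `K` basis vectors. -/
def lowMat (K L : ℕ) : Matrix (Fin (2 * (L + 1))) (Fin (2 * (L + 1))) ℂ :=
  Matrix.diagonal fun j => if (j : ℕ) < K then 1 else 0

/-- The index exchanged with `i` by `swapMat`. -/
def swapIdx {L : ℕ} (i : Fin (2 * (L + 1))) : Fin (2 * (L + 1)) :=
  ⟨if (i : ℕ) ≤ L then i + (L + 1) else i - (L + 1), by split_ifs <;> omega⟩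

theorem swapMat_apply {L : ℕ} (i j : Fin (2 * (L + 1))) :
    swapMat L i j = if j = swapIdx i then 1 else 0 := by
  rw [swapMat, Matrix.of_apply]
  congr 1
  rw [eq_iff_iff, Fin.ext_iff, swapIdx]
  simp only
  split_ifs <;> omega

theorem swapIdx_swapIdx {L : ℕ} (i : Fin (2 * (L + 1))) : swapIdx (swapIdx i) = i := by
  simp only [swapIdx, Fin.ext_iff]
  split_ifs <;> omega

theorem swapMat_mul_apply {L : ℕ} (A : Matrix (Fin (2 * (L + 1))) (Fin (2 * (L + 1))) ℂ)
    (i j : Fin (2 * (L + 1))) : (swapMat L * A) i j = A (swapIdx i) j := by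
  simp [Matrix.mul_apply, swapMat_apply]

theorem star_swapMat (L : ℕ) : star (swapMat L) = swapMat L := by
  ext i j
  rw [Matrix.star_apply, swapMat, Matrix.of_apply, Matrix.of_apply]
  simp only [or_comm]
  split_ifs <;> simp

theorem swapMat_mul_self (L : ℕ) : swapMat L * swapMat L = 1 := by
  ext i j
  rw [swapMat_mul_apply, swapMat_apply, swapIdx_swapIdx, Matrix.one_apply]
  simp only [eq_comm]

variable {O : ℕ → ℕ → ℂ} {K L : ℕ}

/-- The range of `T` lies in the first half of the basis, the swap moves it to the second half, and
there `T` vanishes because `K ≤ L + 1`. The dimension is doubled to achieve precisely this. -/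
theorem truncMat_mul_swap_mul (hK : K ≤ L + 1) :
    truncMat O K L * swapMat L * truncMat O K L = 0 := by
  ext i j
  rw [mul_assoc, Matrix.mul_apply, Matrix.zero_apply]
  refine Finset.sum_eq_zero fun k _ => ?_
  rw [swapMat_mul_apply]
  simp only [truncMat, Matrix.of_apply]
  by_cases hk : (k : ℕ) < K
  · have h1 : ¬ ((swapIdx k : Fin (2 * (L + 1))) : ℕ) ≤ L := by
      simp only [swapIdx]
      rw [if_pos (by omega)]
      omega
    rw [if_neg (c := ((swapIdx k : Fin (2 * (L + 1))) : ℕ) ≤ L ∧ _) (by tauto), mul_zero]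
  · rw [if_neg (by tauto), zero_mul]

theorem truncMat_mul_lowMat : truncMat O K L * lowMat K L = truncMat O K L := by
  ext i j
  rw [lowMat, Matrix.mul_diagonal]
  simp only [truncMat, Matrix.of_apply]
  split_ifs <;> simp_all

theorem star_truncMat_mul_swap_mul (hK : K ≤ L + 1) :
    star (truncMat O K L) * swapMat L * lowMat K L = 0 := by
  ext i j
  rw [mul_assoc, Matrix.mul_apply, Matrix.zero_apply]
  refine Finset.sum_eq_zero fun k _ => ?_
  rw [swapMat_mul_apply, Matrix.star_apply]
  simp only [truncMat, Matrix.of_apply, lowMat, Matrix.diagonal_apply]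
  by_cases hk : (k : ℕ) ≤ L
  · have h1 : ¬ ((swapIdx k : Fin (2 * (L + 1))) : ℕ) < K := by
      simp only [swapIdx]
      rw [if_pos hk]
      omega
    rw [if_neg h1]
    simp
  · rw [if_neg (by tauto), star_zero, zero_mul]

theorem norm_lowMat_le : ‖lowMat K L‖ ≤ 1 := by
  rw [lowMat, Matrix.l2_opNorm_diagonal, pi_norm_le_iff_of_nonneg zero_le_one]
  intro i
  split_ifs <;> simp

/-- The state with the coordinates `x i`, `i < m`. -/
def ofVec {m : ℕ} (x : Fin m → ℂ) : Mode := ∑ i, x i • fock i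

theorem ofVec_apply {m : ℕ} (x : Fin m → ℂ) (n : ℕ) :
    ofVec x n = if h : n < m then x ⟨n, h⟩ else 0 := by
  have h1 : ofVec x n = ∑ i, (x i • fock i) n := by
    rw [ofVec, lp.coeFn_sum, Finset.sum_apply]
  have h2 : ∀ i : Fin m, (x i • fock i) n = x i * (if n = i then 1 else 0) := fun j => by
    rw [← fock_apply]
    rfl
  rw [h1]
  simp only [h2]
  split_ifs with h
  · rw [Finset.sum_eq_single ⟨n, h⟩]
    · simp
    · intro b _ hb
      rw [if_neg, mul_zero]
      rintro rfl
      exact hb rfl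
    · simp
  · refine Finset.sum_eq_zero fun i _ => ?_
    rw [if_neg (by omega), mul_zero]

theorem norm_ofVec {m : ℕ} (x : Fin m → ℂ) : ‖ofVec x‖ = ‖WithLp.toLp 2 x‖ := by
  have h : ‖ofVec x‖ ^ 2 = ‖WithLp.toLp 2 x‖ ^ 2 := by
    rw [EuclideanSpace.norm_sq_eq, norm_sq_eq_sum (K := m), Finset.sum_range]
    · refine Finset.sum_congr rfl fun i _ => ?_
      rw [ofVec_apply, dif_pos i.2]
    · intro i hi
      rw [ofVec_apply, dif_neg (by omega)]
  exact (pow_left_inj₀ (norm_nonneg _) (norm_nonneg _) two_ne_zero).mp h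

theorem norm_ofVec_mulVec_le {m : ℕ} (A : Matrix (Fin m) (Fin m) ℂ) (x : Fin m → ℂ) :
    ‖ofVec (A.mulVec x)‖ ≤ ‖A‖ * ‖ofVec x‖ := by
  rw [norm_ofVec, norm_ofVec]
  exact Matrix.l2_opNorm_mulVec A (WithLp.toLp 2 x)

end Matrices

/-! ### Truncation errors in operator norm -/

section TruncationBounds

open scoped Matrix.Norms.L2Operator

theorem norm_le_of_mulVec {m : ℕ} {A : Matrix (Fin m) (Fin m) ℂ} {c : ℝ} (hc : 0 ≤ c)
    (h : ∀ x, ‖ofVec (A.mulVec x)‖ ≤ c * ‖ofVec x‖) : ‖A‖ ≤ c := by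
  rw [Matrix.cstar_norm_def]
  refine ContinuousLinearMap.opNorm_le_bound _ hc fun x => ?_
  have := h (WithLp.ofLp x)
  rwa [norm_ofVec, norm_ofVec] at this

theorem ofVec_coords {φ : Mode} {K m : ℕ} (hφ : ∀ i, K ≤ i → φ i = 0) (hK : K ≤ m) :
    ofVec (fun i : Fin m => φ i) = φ := by
  ext n
  rw [ofVec_apply]
  split_ifs with h
  · rfl
  · rw [hφ n (by omega)]

theorem norm_tail_le (L : ℕ) (ψ : Mode) : ‖ψ - tail L ψ‖ ≤ ‖ψ‖ := by
  refine norm_le_of_forall_le fun n => ?_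
  have h1 : (ψ - tail L ψ) n = ψ n - tail L ψ n := rfl
  rw [h1, tail_apply]
  split_ifs <;> simp

variable (U : Mode ≃ₗᵢ[ℂ] Mode) {K L : ℕ}

theorem ofVec_truncMat {φ : Mode} (hφ : ∀ i, K ≤ i → φ i = 0) (hK : K ≤ L + 1) :
    ofVec ((truncMat (fockMatrix U) K L).mulVec fun i => φ i) = U φ - tail L (U φ) := by
  ext n
  have h1 : (U φ - tail L (U φ)) n = (U φ) n - tail L (U φ) n := rfl
  rw [h1, tail_apply, ofVec_apply]
  by_cases hn : n ≤ L
  · rw [dif_pos (by omega), if_pos hn, sub_zero, map_apply_eq_sum U hφ, Matrix.mulVec, dotProduct]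
    simp only [truncMat, Matrix.of_apply]
    rw [Finset.sum_fin_eq_sum_range, Finset.sum_subset (Finset.range_subset_range.mpr
      (show K ≤ 2 * (L + 1) by omega)) (f := fun j => fockMatrix U n j * φ j)]
    · refine Finset.sum_congr rfl fun j hj => ?_
      rw [dif_pos (Finset.mem_range.mp hj)]
      by_cases hjK : j < K
      · rw [if_pos ⟨hn, hjK⟩]
      · rw [if_neg (by tauto), hφ j (by omega), mul_zero, mul_zero]
    · intro j _ hj
      rw [hφ j (by simpa using hj), mul_zero]
  · rw [if_neg hn, sub_self]
    split_ifs with h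
    · rw [Matrix.mulVec, dotProduct]
      refine Finset.sum_eq_zero fun j _ => ?_
      rw [truncMat, Matrix.of_apply, if_neg (by tauto), zero_mul]
    · rfl

theorem ofVec_lowMat_apply {x : Fin (2 * (L + 1)) → ℂ} (i : ℕ) (hi : K ≤ i) :
    ofVec ((lowMat K L).mulVec x) i = 0 := by
  rw [ofVec_apply]
  split_ifs with h
  · rw [lowMat, Matrix.mulVec_diagonal, if_neg (by simpa using hi), zero_mul]
  · rfl

theorem norm_truncMat_le (hK : K ≤ L + 1) : ‖truncMat (fockMatrix U) K L‖ ≤ 1 := by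
  refine norm_le_of_mulVec zero_le_one fun x => ?_
  set φ := ofVec ((lowMat K L).mulVec x) with hφdef
  have hφ : ∀ i, K ≤ i → φ i = 0 := fun i hi => ofVec_lowMat_apply i hi
  have hx : (fun i : Fin (2 * (L + 1)) => φ i) = (lowMat K L).mulVec x := by
    funext i
    rw [hφdef, ofVec_apply, dif_pos i.2]
  rw [← truncMat_mul_lowMat, ← Matrix.mulVec_mulVec, ← hx, ofVec_truncMat U hφ hK, one_mul]
  refine (norm_tail_le L _).trans ?_
  rw [U.norm_map]
  refine (norm_ofVec_mulVec_le _ _).trans ?_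
  have := norm_lowMat_le (K := K) (L := L)
  nlinarith [norm_nonneg (ofVec x)]

/-- The Gram matrix of the full columns is the identity; truncation removes from it exactly the Gram
matrix of the tails. -/
theorem lowMat_sub_star_mul_apply (j k : Fin (2 * (L + 1))) :
    (lowMat K L - star (truncMat (fockMatrix U) K L) * truncMat (fockMatrix U) K L) j k =
      if (j : ℕ) < K ∧ (k : ℕ) < K then
        inner ℂ (tail L (U (fock j))) (tail L (U (fock k))) else 0 := by
  rw [Matrix.sub_apply, Matrix.mul_apply]
  simp only [Matrix.star_apply, truncMat, Matrix.of_apply]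
  split_ifs with h
  · have h1 : (inner ℂ (fock j) (fock k) : ℂ) = lowMat K L j k := by
      have : (inner ℂ (fock j) (fock k) : ℂ) = fock k j := by
        rw [fock, lp.inner_single_left]
        simp
      rw [this, fock_apply, lowMat, Matrix.diagonal_apply]
      simp only [Fin.ext_iff, h.1, if_true]
    rw [inner_tail, U.inner_map_map, h1]
    congr 1
    rw [Finset.sum_fin_eq_sum_range, ← Finset.sum_subset (Finset.range_subset_range.mpr
      (show L + 1 ≤ 2 * (L + 1) by omega))]
    · refine Finset.sum_congr rfl fun i hi => ?_
      have hi' : i ≤ L := by simpa [Nat.lt_succ_iff] using hi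
      rw [dif_pos (by omega), if_pos ⟨hi', h.1⟩, if_pos ⟨hi', h.2⟩]
      rfl
    · intro i hi hi'
      rw [dif_pos (by simpa using hi), if_neg, mul_comm, star_zero, mul_zero]
      rintro ⟨h1, -⟩
      have h2 : i ≤ L := h1
      simp at hi'
      omega
  · have h2 : lowMat K L j k = 0 := by
      rw [lowMat, Matrix.diagonal_apply]
      split_ifs with h3 h4
      · subst h3
        exact absurd ⟨h4, h4⟩ h
      · rfl
      · rfl
    rw [h2, zero_sub, neg_eq_zero]
    refine Finset.sum_eq_zero fun i _ => ?_
    by_cases hj : (j : ℕ) < K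
    · rw [if_neg (c := _ ∧ (k : ℕ) < K) (by tauto), mul_zero]
    · rw [if_neg (c := _ ∧ (j : ℕ) < K) (by tauto), star_zero, zero_mul]

/-- The entries of a Gram matrix satisfy `|⟨x_j, x_k⟩|² ≤ ‖x_j‖² ‖x_k‖²`, so its Frobenius norm is
at most its trace, here the total weight of the tails. -/
theorem norm_lowMat_sub_le (hK : K ≤ L + 1) {τ : ℝ} (hτ0 : 0 ≤ τ)
    (hτ : K - τ ≤ headSum (fockMatrix U) K L) :
    ‖lowMat K L - star (truncMat (fockMatrix U) K L) * truncMat (fockMatrix U) K L‖ ≤ τ := by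
  set a : ℕ → ℝ := fun j => if j < K then ‖tail L (U (fock j))‖ ^ 2 else 0 with ha
  have ha0 : ∀ j, 0 ≤ a j := fun j => by
    simp only [ha]
    split_ifs <;> positivity
  have hsum : ∑ j : Fin (2 * (L + 1)), a j ≤ τ := by
    rw [Fin.sum_univ_eq_sum_range a, ← Finset.sum_subset (Finset.range_subset_range.mpr
      (show K ≤ 2 * (L + 1) by omega))]
    · rw [Finset.sum_congr rfl (g := fun j => ‖tail L (U (fock j))‖ ^ 2) fun j hj =>
        if_pos (Finset.mem_range.mp hj), sum_norm_tail_sq]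
      linarith
    · intro j _ hj
      exact if_neg (by simpa using hj)
  have h := norm_sq_le_sum_sq
    (lowMat K L - star (truncMat (fockMatrix U) K L) * truncMat (fockMatrix U) K L)
  have h2 : ∑ j, ∑ k, ‖(lowMat K L - star (truncMat (fockMatrix U) K L) *
      truncMat (fockMatrix U) K L) j k‖ ^ 2 ≤
      ∑ j : Fin (2 * (L + 1)), ∑ k : Fin (2 * (L + 1)), a j * a k := by
    refine Finset.sum_le_sum fun j _ => Finset.sum_le_sum fun k _ => ?_
    rw [lowMat_sub_star_mul_apply U]
    split_ifs with hjk
    · simp only [ha]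
      rw [if_pos hjk.1, if_pos hjk.2, ← mul_pow]
      gcongr
      exact norm_inner_le_norm _ _
    · rw [norm_zero, zero_pow two_ne_zero]
      exact mul_nonneg (ha0 _) (ha0 _)
  have h3 : ∑ j : Fin (2 * (L + 1)), ∑ k : Fin (2 * (L + 1)), a j * a k =
      (∑ j : Fin (2 * (L + 1)), a j) ^ 2 := by
    rw [sq, Finset.sum_mul_sum]
  have h4 : (∑ j : Fin (2 * (L + 1)), a j) ^ 2 ≤ τ ^ 2 :=
    pow_le_pow_left₀ (Finset.sum_nonneg fun _ _ => ha0 _) hsum 2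
  exact le_of_sq_le_sq (by linarith) hτ0

end TruncationBounds

/-! ### The approximating unitary -/

section Approximation

open scoped Matrix.Norms.L2Operator

variable (U : Mode ≃ₗᵢ[ℂ] Mode) {K L : ℕ}

/-- The approximate unitary completion of the truncated matrix after `N` Newton steps. -/
def polarMat (O : ℕ → ℕ → ℂ) (K L N : ℕ) : Matrix (Fin (2 * (L + 1))) (Fin (2 * (L + 1))) ℂ :=
  newtonStep^[N] (completion (swapMat L) (truncMat O K L))

/-- The test that the rotated spectrum stays away from `-1`. -/
def Passing (O : ℕ → ℕ → ℂ) (K L N s : ℕ) : Prop :=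
  ∑ i, ∑ j, ‖(gapOp (phase (2 * (L + 1)) s • polarMat O K L N) ^ N) i j‖ ^ 2 ≤ 1 / 4

/-- At least `K - ε²/1000 > K - 1` of weight fits into `L + 1` rows of norm at most `1`. -/
theorem le_succ_of_headSum {ε : ℝ} (hε : 0 < ε) (hε4 : ε < 4)
    (hL : K - ε ^ 2 / 1000 ≤ headSum (fockMatrix U) K L) : K ≤ L + 1 := by
  have h1 := headSum_le U K L
  have h2 : (K : ℝ) < L + 1 + 1 := by nlinarith
  have h3 : K < L + 1 + 1 := by exact_mod_cast h2
  omega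

theorem exists_passing {ε : ℝ} (hε : 0 < ε) (hε4 : ε < 4)
    (hL : K - ε ^ 2 / 1000 ≤ headSum (fockMatrix U) K L) {N : ℕ} (hN : 36 * (2 * (L + 1)) ^ 3 ≤ N) :
    ∃ s ≤ 2 * (L + 1), Passing (fockMatrix U) K L N s := by
  have hK := le_succ_of_headSum U hε hε4 hL
  refine exists_phase_sum_sq_le (by omega) ?_ hN
  refine (norm_defect_completion_le (star_swapMat L) (swapMat_mul_self L) (truncMat_mul_swap_mul hK)
    truncMat_mul_lowMat (norm_truncMat_le U hK) (norm_lowMat_sub_le U hK (by positivity) hL)).trans ?_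
  nlinarith

/-- The budget is `ε/4` for the distance on vectors below level `K`. The tail takes `√(ε²/1000) ≤
ε/31`, the logarithm `8/√N ≤ ε/8` by `Nε² ≥ 4096`, and the defect `5ε²/1000 ≤ ε/50` by `ε < 4`. -/
theorem ecDiamond_le_of_passing {E ε : ℝ} (hE : 0 ≤ E) (hε : 0 < ε) (hε4 : ε < 4) (hK0 : 0 < K)
    (hKE : 64 * E ≤ K * ε ^ 2) (hL : K - ε ^ 2 / 1000 ≤ headSum (fockMatrix U) K L) {N s : ℕ}
    (hN4 : 4 ≤ N) (hN : 4096 ≤ N * ε ^ 2) (hs : Passing (fockMatrix U) K L N s)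
    {V : Mode ≃ₗᵢ[ℂ] Mode}
    (hV : ∀ j : Fin (2 * (L + 1)), V (fock j) = ∑ i : Fin (2 * (L + 1)), NormedSpace.exp (Complex.I •
      argSeries N (phase (2 * (L + 1)) s • polarMat (fockMatrix U) K L N)) i j • fock i) :
    ecDiamond E U V ≤ ENNReal.ofReal ε := by
  have hK := le_succ_of_headSum U hε hε4 hL
  have hz := norm_phase (m := 2 * (L + 1)) (by omega) s
  -- The rotation that moved the spectrum away from `-1` need not be undone: the channel of `z U` is
  -- that of `U`.
  rw [← ecDiamond_phaseSMul E _ hz]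
  refine ecDiamond_le hE hε hK0 hKE fun φ hφ => ?_
  rw [phaseSMul_apply]
  set z := phase (2 * (L + 1)) s with hzdef
  set X := NormedSpace.exp (Complex.I • argSeries N (z • polarMat (fockMatrix U) K L N)) with hX
  set T := truncMat (fockMatrix U) K L with hT
  have hb : ‖(X - z • T) * lowMat K L‖ ≤ 8 / Real.sqrt N + 5 * (ε ^ 2 / 1000) :=
    norm_exp_argSeries_sub_mul_le (star_swapMat L) (swapMat_mul_self L) (truncMat_mul_swap_mul hK)
      truncMat_mul_lowMat (star_truncMat_mul_swap_mul hK) (norm_truncMat_le U hK) norm_lowMat_le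
      (norm_lowMat_sub_le U hK (by positivity) hL) (by nlinarith) hN4 hz
      (norm_le_half_of_sum_sq_le hs)
  have hlow : (lowMat K L).mulVec (fun i => φ i) = fun i : Fin (2 * (L + 1)) => φ i := by
    funext i
    rw [lowMat, Matrix.mulVec_diagonal]
    split_ifs with h
    · rw [one_mul]
    · rw [zero_mul, hφ i (by omega)]
  have hVφ : V φ = ofVec (X.mulVec fun i => φ i) := by
    conv_lhs => rw [← ofVec_coords hφ (show K ≤ 2 * (L + 1) by omega), ofVec, map_sum]
    simp only [map_smul, hV, ofVec, Finset.smul_sum, smul_smul, Matrix.mulVec, dotProduct,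
      Finset.sum_smul]
    rw [Finset.sum_comm]
    exact Finset.sum_congr rfl fun i _ => Finset.sum_congr rfl fun j _ => by rw [mul_comm]
  have hTφ : z • (U φ - tail L (U φ)) = ofVec ((z • T).mulVec fun i => φ i) := by
    rw [← ofVec_truncMat U hφ hK, ofVec, ofVec, Finset.smul_sum]
    refine Finset.sum_congr rfl fun i _ => ?_
    rw [smul_smul, Matrix.smul_mulVec, Pi.smul_apply, smul_eq_mul]
  have h1 : ‖V φ - z • (U φ - tail L (U φ))‖ ≤ (8 / Real.sqrt N + 5 * (ε ^ 2 / 1000)) * ‖φ‖ := by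
    have e : V φ - z • (U φ - tail L (U φ)) =
        ofVec (((X - z • T) * lowMat K L).mulVec fun i => φ i) := by
      rw [hVφ, hTφ, ← Matrix.mulVec_mulVec, hlow, Matrix.sub_mulVec, ofVec, ofVec, ofVec,
        ← Finset.sum_sub_distrib]
      simp only [Pi.sub_apply, sub_smul]
    rw [e]
    refine (norm_ofVec_mulVec_le _ _).trans ?_
    rw [ofVec_coords hφ (show K ≤ 2 * (L + 1) by omega)]
    gcongr
  have h2 : ‖tail L (U φ)‖ ≤ ε / 31 * ‖φ‖ := by
    refine le_of_sq_le_sq ((norm_tail_map_le U hL hφ).trans ?_) (by positivity)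
    rw [mul_pow, div_pow]
    gcongr
    norm_num
  have h3 : ‖z • U φ - V φ‖ ≤ ‖tail L (U φ)‖ + ‖V φ - z • (U φ - tail L (U φ))‖ := by
    have e : z • U φ - V φ = z • tail L (U φ) - (V φ - z • (U φ - tail L (U φ))) := by
      rw [smul_sub]
      abel
    rw [e]
    refine (norm_sub_le _ _).trans ?_
    rw [norm_smul, hz, one_mul]
  have h4 : 8 / Real.sqrt N ≤ ε / 8 := by
    have hNpos : (0 : ℝ) < N := by exact_mod_cast (by omega : 0 < N)
    rw [div_le_div_iff₀ (Real.sqrt_pos.mpr hNpos) (by norm_num)]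
    refine le_of_sq_le_sq ?_ (by positivity)
    rw [mul_pow ε, Real.sq_sqrt hNpos.le]
    linarith
  refine h3.trans ?_
  have h5 : (8 / Real.sqrt N + 5 * (ε ^ 2 / 1000)) * ‖φ‖ ≤ (ε / 8 + ε / 50) * ‖φ‖ := by
    gcongr
    nlinarith
  nlinarith [mul_nonneg hε.le (norm_nonneg φ)]

/-- A single row can hold the weight of only one column, so `K = 1` and only the vacuum matters. It
is nearly an eigenvector of `U`; with the phase that makes its matrix element positive, `U` is close
to the identity there. -/
theorem ecDiamond_refl_le {E ε : ℝ} (hE : 0 ≤ E) (hε : 0 < ε) (hε4 : ε < 4) (hK0 : 0 < K)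
    (hKE : 64 * E ≤ K * ε ^ 2) (hL : K - ε ^ 2 / 1000 ≤ headSum (fockMatrix U) K 0) :
    ecDiamond E U (LinearIsometryEquiv.refl ℂ Mode) ≤ ENNReal.ofReal ε := by
  have hK1 : K = 1 := by
    have := le_succ_of_headSum U hε hε4 hL
    omega
  subst hK1
  set u := fockMatrix U 0 0 with hu
  have hu1 : 1 - ε ^ 2 / 1000 ≤ ‖u‖ ^ 2 := by simpa [headSum] using hL
  have hu0 : 0 < ‖u‖ := by
    by_contra! h
    have : ‖u‖ = 0 := le_antisymm h (norm_nonneg _)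
    rw [this] at hu1
    nlinarith
  have hule : ‖u‖ ≤ 1 := by
    have := headSum_le U 1 0
    simp [headSum, ← hu] at this
    nlinarith
  set z : ℂ := conj u / ‖u‖ with hz
  have hz1 : ‖z‖ = 1 := by
    rw [hz, norm_div, RCLike.norm_conj, Complex.norm_real, norm_norm, div_self hu0.ne']
  have hzu : z * u = ‖u‖ := by
    rw [hz, div_mul_eq_mul_div, Complex.conj_mul', sq, mul_div_assoc, div_self, mul_one]
    exact_mod_cast hu0.ne'
  rw [← ecDiamond_phaseSMul E z hz1]
  refine ecDiamond_le hE hε hK0 hKE fun φ hφ => ?_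
  rw [phaseSMul_apply]
  have h0 : φ = φ 0 • fock 0 := by
    conv_lhs => rw [eq_sum_fock hφ]
    simp
  have h1 : ‖z • U (fock 0) - fock 0‖ ≤ ε / 4 := by
    refine le_of_sq_le_sq ?_ (by positivity)
    have h2 := norm_sub_sq (𝕜 := ℂ) (fock 0) (z • U (fock 0))
    have h3 : inner ℂ (fock 0) (z • U (fock 0)) = ((‖u‖ : ℝ) : ℂ) := by
      rw [← hzu, inner_smul_right]
      congr 1
      rw [fock, lp.inner_single_left]
      simp [hu, fockMatrix, fock]
    rw [h3, norm_smul, hz1, U.norm_map, norm_fock, norm_sub_rev] at h2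
    rw [h2]
    simp
    nlinarith
  have h4 : z • U φ - (LinearIsometryEquiv.refl ℂ Mode) φ = φ 0 • (z • U (fock 0) - fock 0) := by
    conv_lhs => rw [h0]
    rw [map_smul, map_smul, smul_sub, smul_comm]
    rfl
  have h5 : ‖φ‖ = ‖φ 0‖ := by
    conv_lhs => rw [h0, norm_smul, norm_fock, mul_one]
  rw [h4, norm_smul, h5, mul_comm]
  gcongr

end Approximation

/-! ### A structured language over complex arrays -/

namespace RealRAM

/-- A memory of integer registers and complex arrays. -/
structure CStore where
  nat : ℕ → ℕ
  arr : ℕ → ℕ → ℕ → ℂ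

def CStore.get (h : CStore) (c : Cell) : ℂ := h.arr c.arr (h.nat c.row) (h.nat c.col)

def CStore.setNat (h : CStore) (v n : ℕ) : CStore := { h with nat := Function.update h.nat v n }

def CStore.set (h : CStore) (c : Cell) (x : ℂ) : CStore :=
  { h with
    arr := fun a i j =>
      if a = c.arr ∧ i = h.nat c.row ∧ j = h.nat c.col then x else h.arr a i j }

/-- Complex expressions; division is by the real part, and the root is that of the real part. -/
inductive CExpr
  | cell (c : Cell)
  | one
  | imag
  | add (e f : CExpr)
  | sub (e f : CExpr)
  | mul (e f : CExpr)
  | cconj (e : CExpr)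
  | divRe (e f : CExpr)
  | sqrtRe (e : CExpr)

namespace CExpr

def eval (h : CStore) : CExpr → ℂ
  | cell c => h.get c
  | one => 1
  | imag => Complex.I
  | add e f => e.eval h + f.eval h
  | sub e f => e.eval h - f.eval h
  | mul e f => e.eval h * f.eval h
  | cconj e => (starRingEnd ℂ) (e.eval h)
  | divRe e f => e.eval h / ((f.eval h).re : ℂ)
  | sqrtRe e => (Real.sqrt (e.eval h).re : ℂ)

/-- All arrays that occur have names below `100`. -/
def Valid : CExpr → Bool
  | cell c => decide (c.arr < 100)
  | one => true
  | imag => true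
  | add e f => e.Valid && f.Valid
  | sub e f => e.Valid && f.Valid
  | mul e f => e.Valid && f.Valid
  | cconj e => e.Valid
  | divRe e f => e.Valid && f.Valid
  | sqrtRe e => e.Valid

end CExpr

/-- A sequence of instructions. -/
def block (c : Instr) : List Instr → Prog
  | [] => .instr c
  | c' :: l => .seq (.instr c) (block c' l)

theorem exec_block (O : ℕ → ℕ → ℂ) (c : Instr) (l : List Instr) (s : Store) :
    Exec O (block c l) s (l.length + 1) ((c :: l).foldl (fun s c => c.exec O s) s) := by
  induction l generalizing c s with
  | nil => exact .instr c s
  | cons c' l ih =>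
    have := Exec.seq (Exec.instr (O := O) c s) (ih c' (c.exec O s))
    rw [add_comm] at this
    exact this

/-- The real part of a complex cell. -/
abbrev reCell (c : Cell) : Cell := ⟨2 * c.arr, c.row, c.col⟩

/-- The imaginary part of a complex cell. -/
abbrev imCell (c : Cell) : Cell := ⟨2 * c.arr + 1, c.row, c.col⟩

/-- The auxiliary cell at depth `d`. -/
abbrev tmp (d : ℕ) : Cell := ⟨100 + d, 0, 0⟩

/-- The code that evaluates an expression into the auxiliary cell at depth `d`. -/
def CExpr.compile : CExpr → ℕ → Prog
  | cell c, d => block (.realSub (reCell (tmp d)) (reCell (tmp d)) (reCell (tmp d)))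
      [.realAdd (reCell (tmp d)) (reCell (tmp d)) (reCell c),
       .realSub (imCell (tmp d)) (imCell (tmp d)) (imCell (tmp d)),
       .realAdd (imCell (tmp d)) (imCell (tmp d)) (imCell c)]
  | one, d => block (.realOne (reCell (tmp d)))
      [.realSub (imCell (tmp d)) (imCell (tmp d)) (imCell (tmp d))]
  | imag, d => block (.realOne (imCell (tmp d)))
      [.realSub (reCell (tmp d)) (reCell (tmp d)) (reCell (tmp d))]
  | add e f, d => .seq (.seq (e.compile d) (f.compile (d + 1)))
      (block (.realAdd (reCell (tmp d)) (reCell (tmp d)) (reCell (tmp (d + 1))))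
        [.realAdd (imCell (tmp d)) (imCell (tmp d)) (imCell (tmp (d + 1)))])
  | sub e f, d => .seq (.seq (e.compile d) (f.compile (d + 1)))
      (block (.realSub (reCell (tmp d)) (reCell (tmp d)) (reCell (tmp (d + 1))))
        [.realSub (imCell (tmp d)) (imCell (tmp d)) (imCell (tmp (d + 1)))])
  | mul e f, d => .seq (.seq (e.compile d) (f.compile (d + 1)))
      (block (.realMul (reCell (tmp (d + 2))) (reCell (tmp d)) (reCell (tmp (d + 1))))
        [.realMul (imCell (tmp (d + 2))) (imCell (tmp d)) (imCell (tmp (d + 1))),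
         .realMul (reCell (tmp d)) (reCell (tmp d)) (imCell (tmp (d + 1))),
         .realMul (imCell (tmp d)) (imCell (tmp d)) (reCell (tmp (d + 1))),
         .realAdd (imCell (tmp d)) (reCell (tmp d)) (imCell (tmp d)),
         .realSub (reCell (tmp d)) (reCell (tmp (d + 2))) (imCell (tmp (d + 2)))])
  | cconj e, d => .seq (e.compile d)
      (block (.realSub (imCell (tmp (d + 1))) (imCell (tmp (d + 1))) (imCell (tmp (d + 1))))
        [.realSub (imCell (tmp d)) (imCell (tmp (d + 1))) (imCell (tmp d))])
  | divRe e f, d => .seq (.seq (e.compile d) (f.compile (d + 1)))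
      (block (.realDiv (reCell (tmp d)) (reCell (tmp d)) (reCell (tmp (d + 1))))
        [.realDiv (imCell (tmp d)) (imCell (tmp d)) (reCell (tmp (d + 1)))])
  | sqrtRe e, d => .seq (e.compile d)
      (block (.realSqrt (reCell (tmp d)) (reCell (tmp d)))
        [.realSub (imCell (tmp d)) (imCell (tmp d)) (imCell (tmp d))])

/-- The number of steps that the evaluation of an expression takes. -/
def CExpr.cost : CExpr → ℕ
  | cell _ => 4
  | one => 2
  | imag => 2
  | add e f => e.cost + f.cost + 2
  | sub e f => e.cost + f.cost + 2
  | mul e f => e.cost + f.cost + 6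
  | cconj e => e.cost + 2
  | divRe e f => e.cost + f.cost + 2
  | sqrtRe e => e.cost + 2

/-- The real memory `s` represents the complex memory `h`, up to auxiliary arrays. -/
def Sim (s : Store) (h : CStore) : Prop :=
  s.nat = h.nat ∧ ∀ a < 100, ∀ i j,
    s.real (2 * a) i j = (h.arr a i j).re ∧ s.real (2 * a + 1) i j = (h.arr a i j).im

theorem Store.nat_set (s : Store) (c : Cell) (x : ℝ) : (s.set c x).nat = s.nat := rfl

theorem Store.real_set (s : Store) (c : Cell) (x : ℝ) {a : ℕ} (h : a ≠ c.arr) :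
    (s.set c x).real a = s.real a := by
  funext i j
  exact if_neg fun h' => h h'.1

theorem Store.get_set (s : Store) (c : Cell) (x : ℝ) : (s.set c x).get c = x :=
  if_pos ⟨rfl, rfl, rfl⟩

theorem Store.get_set_of_ne (s : Store) {c c' : Cell} (x : ℝ) (h : c'.arr ≠ c.arr) :
    (s.set c x).get c' = s.get c' := if_neg fun h' => h h'.1

theorem Sim.get {s : Store} {h : CStore} (hs : Sim s h) {c : Cell} (hc : c.arr < 100) :
    s.get (reCell c) = (h.get c).re ∧ s.get (imCell c) = (h.get c).im := by
  have := hs.2 c.arr hc (h.nat c.row) (h.nat c.col)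
  rw [← hs.1] at this
  rw [CStore.get, ← hs.1]
  exact this

theorem Sim.of_eq {s s' : Store} {h : CStore} (hs : Sim s h) (h1 : s'.nat = s.nat)
    (h2 : ∀ a < 200, s'.real a = s.real a) : Sim s' h := by
  refine ⟨h1.trans hs.1, fun a ha i j => ?_⟩
  rw [h2 _ (by omega), h2 _ (by omega)]
  exact hs.2 a ha i j

/-- Evaluation at depth `d` writes only arrays from `2(100 + d)` on. Hence the left operand, stored
at depth `d`, survives the evaluation of the right operand at depth `d + 1`, and the represented
memory, which lives below `200`, is untouched. -/
theorem CExpr.exec_compile (O : ℕ → ℕ → ℂ) {h : CStore} (e : CExpr) (he : e.Valid = true) (d : ℕ)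
    (s : Store) (hs : Sim s h) :
    ∃ s', Exec O (e.compile d) s e.cost s' ∧ s'.nat = s.nat ∧
      (∀ a < 2 * (100 + d), s'.real a = s.real a) ∧
      s'.get (reCell (tmp d)) = (e.eval h).re ∧ s'.get (imCell (tmp d)) = (e.eval h).im := by
  have binary : ∀ (e f : CExpr), e.Valid = true → f.Valid = true →
      (∀ (_ : e.Valid = true) (d : ℕ) (s : Store) (_ : Sim s h),
        ∃ s', Exec O (e.compile d) s e.cost s' ∧ s'.nat = s.nat ∧
        (∀ a < 2 * (100 + d), s'.real a = s.real a) ∧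
        s'.get (reCell (tmp d)) = (e.eval h).re ∧ s'.get (imCell (tmp d)) = (e.eval h).im) →
      (∀ (_ : f.Valid = true) (d : ℕ) (s : Store) (_ : Sim s h),
        ∃ s', Exec O (f.compile d) s f.cost s' ∧ s'.nat = s.nat ∧
        (∀ a < 2 * (100 + d), s'.real a = s.real a) ∧
        s'.get (reCell (tmp d)) = (f.eval h).re ∧ s'.get (imCell (tmp d)) = (f.eval h).im) →
      ∀ d s, Sim s h → ∃ s', Exec O (.seq (e.compile d) (f.compile (d + 1))) s (e.cost + f.cost) s' ∧
        s'.nat = s.nat ∧ (∀ a < 2 * (100 + d), s'.real a = s.real a) ∧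
        s'.get (reCell (tmp d)) = (e.eval h).re ∧ s'.get (imCell (tmp d)) = (e.eval h).im ∧
        s'.get (reCell (tmp (d + 1))) = (f.eval h).re ∧
        s'.get (imCell (tmp (d + 1))) = (f.eval h).im := by
    intro e f he hf ihe ihf d s hs
    obtain ⟨s1, h1, h2, h3, h4, h5⟩ := ihe he d s hs
    obtain ⟨s2, g1, g2, g3, g4, g5⟩ := ihf hf (d + 1) s1
      (hs.of_eq h2 fun a ha => h3 a (by omega))
    refine ⟨s2, .seq h1 g1, g2.trans h2, fun a ha => (g3 a (by omega)).trans (h3 a ha), ?_, ?_,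
      g4, g5⟩
    · rw [← h4, Store.get, Store.get, g2]
      exact congrFun (congrFun (g3 (2 * (100 + d)) (by omega)) _) _
    · rw [← h5, Store.get, Store.get, g2]
      exact congrFun (congrFun (g3 (2 * (100 + d) + 1) (by omega)) _) _
  induction e generalizing d s with
  | cell c =>
    simp only [Valid, decide_eq_true_eq] at he
    have hg := hs.get he
    refine ⟨_, exec_block O _ _ s, ?_, fun a ha => ?_, ?_, ?_⟩ <;>
      simp (disch := simp only [ne_eq]; omega) only [List.foldl_cons, List.foldl_nil, Instr.exec,
        Store.nat_set, Store.real_set, Store.get_set, Store.get_set_of_ne, hg, sub_self, zero_add,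
        eval]
  | one =>
    refine ⟨_, exec_block O _ _ s, ?_, fun a ha => ?_, ?_, ?_⟩ <;>
      simp (disch := simp only [ne_eq]; omega) only [List.foldl_cons, List.foldl_nil, Instr.exec,
        Store.nat_set, Store.real_set, Store.get_set, Store.get_set_of_ne, sub_self,
        eval, Complex.one_re, Complex.one_im]
  | imag =>
    refine ⟨_, exec_block O _ _ s, ?_, fun a ha => ?_, ?_, ?_⟩ <;>
      simp (disch := simp only [ne_eq]; omega) only [List.foldl_cons, List.foldl_nil, Instr.exec,
        Store.nat_set, Store.real_set, Store.get_set, Store.get_set_of_ne, sub_self,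
        eval, Complex.I_re, Complex.I_im]
  | add e f ihe ihf =>
    simp only [Valid, Bool.and_eq_true] at he
    obtain ⟨s', h1, h2, h3, h4, h5, h6, h7⟩ := binary e f he.1 he.2 ihe ihf d s hs
    refine ⟨_, .seq h1 (exec_block O _ _ s'), ?_, fun a ha => Eq.trans ?_ (h3 a ha), ?_, ?_⟩ <;>
      simp (disch := simp only [ne_eq]; omega) only [List.foldl_cons, List.foldl_nil, Instr.exec,
        Store.nat_set, Store.real_set, Store.get_set, Store.get_set_of_ne, h2, h4, h5, h6, h7,
        eval, Complex.add_re, Complex.add_im]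
  | sub e f ihe ihf =>
    simp only [Valid, Bool.and_eq_true] at he
    obtain ⟨s', h1, h2, h3, h4, h5, h6, h7⟩ := binary e f he.1 he.2 ihe ihf d s hs
    refine ⟨_, .seq h1 (exec_block O _ _ s'), ?_, fun a ha => Eq.trans ?_ (h3 a ha), ?_, ?_⟩ <;>
      simp (disch := simp only [ne_eq]; omega) only [List.foldl_cons, List.foldl_nil, Instr.exec,
        Store.nat_set, Store.real_set, Store.get_set, Store.get_set_of_ne, h2, h4, h5, h6, h7,
        eval, Complex.sub_re, Complex.sub_im]
  | mul e f ihe ihf =>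
    simp only [Valid, Bool.and_eq_true] at he
    obtain ⟨s', h1, h2, h3, h4, h5, h6, h7⟩ := binary e f he.1 he.2 ihe ihf d s hs
    refine ⟨_, .seq h1 (exec_block O _ _ s'), ?_, fun a ha => Eq.trans ?_ (h3 a ha), ?_, ?_⟩ <;>
      simp (disch := simp only [ne_eq]; omega) only [List.foldl_cons, List.foldl_nil, Instr.exec,
        Store.nat_set, Store.real_set, Store.get_set, Store.get_set_of_ne, h2, h4, h5, h6, h7,
        eval, Complex.mul_re, Complex.mul_im]
  | cconj e ihe =>
    simp only [Valid] at he
    obtain ⟨s', h1, h2, h3, h4, h5⟩ := ihe he d s hs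
    refine ⟨_, .seq h1 (exec_block O _ _ s'), ?_, fun a ha => Eq.trans ?_ (h3 a ha), ?_, ?_⟩ <;>
      simp (disch := simp only [ne_eq]; omega) only [List.foldl_cons, List.foldl_nil, Instr.exec,
        Store.nat_set, Store.real_set, Store.get_set, Store.get_set_of_ne, h2, h4, h5,
        eval, Complex.conj_re, Complex.conj_im, sub_self, zero_sub]
  | divRe e f ihe ihf =>
    simp only [Valid, Bool.and_eq_true] at he
    obtain ⟨s', h1, h2, h3, h4, h5, h6, h7⟩ := binary e f he.1 he.2 ihe ihf d s hs
    refine ⟨_, .seq h1 (exec_block O _ _ s'), ?_, fun a ha => Eq.trans ?_ (h3 a ha), ?_, ?_⟩ <;>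
      simp (disch := simp only [ne_eq]; omega) only [List.foldl_cons, List.foldl_nil, Instr.exec,
        Store.nat_set, Store.real_set, Store.get_set, Store.get_set_of_ne, h2, h4, h5, h6,
        eval, Complex.div_ofReal_re, Complex.div_ofReal_im]
  | sqrtRe e ihe =>
    simp only [Valid] at he
    obtain ⟨s', h1, h2, h3, h4, h5⟩ := ihe he d s hs
    refine ⟨_, .seq h1 (exec_block O _ _ s'), ?_, fun a ha => Eq.trans ?_ (h3 a ha), ?_, ?_⟩ <;>
      simp (disch := simp only [ne_eq]; omega) only [List.foldl_cons, List.foldl_nil, Instr.exec,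
        Store.nat_set, Store.real_set, Store.get_set, Store.get_set_of_ne, h2, h4,
        eval, Complex.ofReal_re, Complex.ofReal_im, sub_self]

end RealRAM

/-! ### Structured programs: semantics, cost and translation to the machine -/

namespace RealRAM

/-- Structured programs; register `1` holds the constant `1`. -/
inductive Code
  | set (c : Cell) (e : CExpr)
  | natZero (v : ℕ)
  | natAdd (v a b : ℕ)
  | natSub (v a b : ℕ)
  | query (c : Cell) (i j : ℕ)
  | seq (p q : Code)
  | ifNat (v w : ℕ) (p q : Code)
  | ifRe (e f : CExpr) (p q : Code)
  | loop (v n : ℕ) (p : Code)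

/-- Repeat `f` with the register `v` running through `0, …, n - 1`. -/
def iter (f : CStore → CStore) (v : ℕ) : ℕ → CStore → CStore
  | 0, h => h.setNat v 0
  | n + 1, h => (f (iter f v n h)).setNat v (n + 1)

namespace Code

/-- The effect of a program. -/
def run (O : ℕ → ℕ → ℂ) : Code → CStore → CStore
  | set c e, h => h.set c (e.eval h)
  | natZero v, h => h.setNat v 0
  | natAdd v a b, h => h.setNat v (h.nat a + h.nat b)
  | natSub v a b, h => h.setNat v (h.nat a - h.nat b)
  | query c i j, h => h.set c (O (h.nat i) (h.nat j))
  | seq p q, h => q.run O (p.run O h)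
  | ifNat v w p q, h => if h.nat v ≤ h.nat w then p.run O h else q.run O h
  | ifRe e f p q, h => if (e.eval h).re ≤ (f.eval h).re then p.run O h else q.run O h
  | loop v n p, h => iter (p.run O) v (h.nat n) h

/-- The registers that a program writes. -/
def natWrites : Code → List ℕ
  | set _ _ => []
  | natZero v => [v]
  | natAdd v _ _ => [v]
  | natSub v _ _ => [v]
  | query _ _ _ => []
  | seq p q => p.natWrites ++ q.natWrites
  | ifNat _ _ p q => p.natWrites ++ q.natWrites
  | ifRe _ _ p q => p.natWrites ++ q.natWrites
  | loop v _ p => v :: p.natWrites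

/-- The arrays that a program writes. -/
def arrWrites : Code → List ℕ
  | set c _ => [c.arr]
  | natZero _ => []
  | natAdd _ _ _ => []
  | natSub _ _ _ => []
  | query c _ _ => [c.arr]
  | seq p q => p.arrWrites ++ q.arrWrites
  | ifNat _ _ p q => p.arrWrites ++ q.arrWrites
  | ifRe _ _ p q => p.arrWrites ++ q.arrWrites
  | loop _ _ p => p.arrWrites

/-- The registers that bound the loops of a program. -/
def bounds : Code → List ℕ
  | set _ _ => []
  | natZero _ => []
  | natAdd _ _ _ => []
  | natSub _ _ _ => []
  | query _ _ _ => []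
  | seq p q => p.bounds ++ q.bounds
  | ifNat _ _ p q => p.bounds ++ q.bounds
  | ifRe _ _ p q => p.bounds ++ q.bounds
  | loop _ n p => n :: p.bounds

/-- Array names are below `100`, and loops do not change their counters or bounds. -/
def Valid : Code → Bool
  | set c e => decide (c.arr < 100) && e.Valid
  | natZero v => decide (v ≠ 1)
  | natAdd v _ _ => decide (v ≠ 1)
  | natSub v _ _ => decide (v ≠ 1)
  | query c _ _ => decide (c.arr < 100)
  | seq p q => p.Valid && q.Valid
  | ifNat _ _ p q => p.Valid && q.Valid
  | ifRe e f p q => (e.Valid && f.Valid) && (p.Valid && q.Valid)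
  | loop v n p => (decide (v ≠ 1) && decide (v ≠ n)) &&
      (!(p.natWrites.contains v) && !(p.natWrites.contains n) && p.Valid)

/-- No bound of a loop is changed. -/
def Stable (p : Code) : Bool := p.bounds.all fun n => !(p.natWrites.contains n)

/-- The machine code. -/
def compile : Code → Prog
  | set c e => .seq (e.compile 0)
      (block (.realSub (reCell c) (reCell c) (reCell c))
        [.realAdd (reCell c) (reCell c) (reCell (tmp 0)),
         .realSub (imCell c) (imCell c) (imCell c),
         .realAdd (imCell c) (imCell c) (imCell (tmp 0))])
  | natZero v => .instr (.natZero v)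
  | natAdd v a b => .instr (.natAdd v a b)
  | natSub v a b => .instr (.natSub v a b)
  | query c i j => .instr (.query (reCell c) (imCell c) i j)
  | seq p q => .seq p.compile q.compile
  | ifNat v w p q => .ifNat v w p.compile q.compile
  | ifRe e f p q => .seq (.seq (e.compile 0) (f.compile 1))
      (.ifReal (reCell (tmp 0)) (reCell (tmp 1)) p.compile q.compile)
  | loop v n p => .seq (.instr (.natZero v))
      (.whileNat v n (.seq p.compile (.instr (.natAdd v v 1))))

/-- A bound on the number of steps, if every loop bound is at most `X`. -/
def cost (X : ℕ) : Code → ℕ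
  | set _ e => e.cost + 4
  | natZero _ => 1
  | natAdd _ _ _ => 1
  | natSub _ _ _ => 1
  | query _ _ _ => 1
  | seq p q => p.cost X + q.cost X
  | ifNat _ _ p q => p.cost X + q.cost X + 1
  | ifRe e f p q => e.cost + f.cost + (p.cost X + q.cost X + 1)
  | loop _ _ p => X * (p.cost X + 2) + 2

/-- Each loop multiplies the cost of its body by `X` once, so the cost is a polynomial whose degree
is the nesting depth. -/
theorem exists_cost_le (p : Code) : ∃ c k : ℕ, ∀ X, 1 ≤ X → p.cost X ≤ c * X ^ k := by
  have join : ∀ (f g : ℕ → ℕ), (∃ c k : ℕ, ∀ X, 1 ≤ X → f X ≤ c * X ^ k) →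
      (∃ c k : ℕ, ∀ X, 1 ≤ X → g X ≤ c * X ^ k) →
      ∃ c k : ℕ, ∀ X, 1 ≤ X → f X + g X ≤ c * X ^ k := by
    rintro f g ⟨c, k, h⟩ ⟨c', k', h'⟩
    refine ⟨c + c', max k k', fun X hX => ?_⟩
    rw [add_mul]
    exact add_le_add
      ((h X hX).trans (Nat.mul_le_mul_left _ (Nat.pow_le_pow_right hX (le_max_left _ _))))
      ((h' X hX).trans (Nat.mul_le_mul_left _ (Nat.pow_le_pow_right hX (le_max_right _ _))))
  have const : ∀ n : ℕ, ∃ c k : ℕ, ∀ X, 1 ≤ X → n ≤ c * X ^ k := fun n => ⟨n, 0, by simp⟩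
  induction p with
  | set c e => exact const _
  | natZero v => exact const _
  | natAdd v a b => exact const _
  | natSub v a b => exact const _
  | query c i j => exact const _
  | seq p q hp hq => exact join _ _ hp hq
  | ifNat v w p q hp hq => exact join _ _ (join _ _ hp hq) (const 1)
  | ifRe e f p q hp hq => exact join _ _ (const _) (join _ _ (join _ _ hp hq) (const 1))
  | loop v n p hp =>
    obtain ⟨c, k, h⟩ := join _ _ hp (const 2)
    refine join _ _ ⟨c, k + 1, fun X hX => ?_⟩ (const 2)
    rw [pow_succ, mul_comm X, ← mul_assoc]
    exact Nat.mul_le_mul_right _ (h X hX)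

/-! ### Frames -/

theorem iter_nat {f : CStore → CStore} {v r : ℕ} (hv : r ≠ v) (hf : ∀ h, (f h).nat r = h.nat r)
    (n : ℕ) (h : CStore) : (iter f v n h).nat r = h.nat r := by
  induction n with
  | zero => exact Function.update_of_ne hv _ _
  | succ n ih => exact (Function.update_of_ne hv _ _).trans ((hf _).trans ih)

theorem iter_arr {f : CStore → CStore} {v a : ℕ} (hf : ∀ h, (f h).arr a = h.arr a)
    (n : ℕ) (h : CStore) : (iter f v n h).arr a = h.arr a := by
  induction n with
  | zero => rfl
  | succ n ih => exact (hf _).trans ih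

theorem iter_counter (f : CStore → CStore) (v n : ℕ) (h : CStore) : (iter f v n h).nat v = n := by
  cases n <;> exact Function.update_self _ _ _

theorem run_nat (O : ℕ → ℕ → ℂ) {p : Code} {r : ℕ} (hr : p.natWrites.contains r = false)
    (h : CStore) : (p.run O h).nat r = h.nat r := by
  rw [List.contains_eq_mem, decide_eq_false_iff_not] at hr
  induction p generalizing h with
  | set c e => rfl
  | natZero v => exact Function.update_of_ne (by simpa [natWrites] using hr) _ _
  | natAdd v a b => exact Function.update_of_ne (by simpa [natWrites] using hr) _ _
  | natSub v a b => exact Function.update_of_ne (by simpa [natWrites] using hr) _ _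
  | query c i j => rfl
  | seq p q hp hq =>
    simp only [natWrites, List.mem_append, not_or] at hr
    exact (hq hr.2 _).trans (hp hr.1 _)
  | ifNat v w p q hp hq =>
    simp only [natWrites, List.mem_append, not_or] at hr
    rw [run]
    split_ifs
    exacts [hp hr.1 _, hq hr.2 _]
  | ifRe e f p q hp hq =>
    simp only [natWrites, List.mem_append, not_or] at hr
    rw [run]
    split_ifs
    exacts [hp hr.1 _, hq hr.2 _]
  | loop v n p hp =>
    simp only [natWrites, List.mem_cons, not_or] at hr
    exact iter_nat hr.1 (hp hr.2) _ _

theorem run_arr (O : ℕ → ℕ → ℂ) {p : Code} {a : ℕ} (ha : p.arrWrites.contains a = false)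
    (h : CStore) : (p.run O h).arr a = h.arr a := by
  have hset : ∀ (h : CStore) (c : Cell) (x : ℂ), a ≠ c.arr → (h.set c x).arr a = h.arr a :=
    fun h c x hne => by
      funext i j
      exact if_neg fun h' => hne h'.1
  rw [List.contains_eq_mem, decide_eq_false_iff_not] at ha
  induction p generalizing h with
  | set c e => exact hset _ _ _ (by simpa [arrWrites] using ha)
  | natZero v => rfl
  | natAdd v a b => rfl
  | natSub v a b => rfl
  | query c i j => exact hset _ _ _ (by simpa [arrWrites] using ha)
  | seq p q hp hq =>
    simp only [arrWrites, List.mem_append, not_or] at ha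
    exact (hq ha.2 _).trans (hp ha.1 _)
  | ifNat v w p q hp hq =>
    simp only [arrWrites, List.mem_append, not_or] at ha
    rw [run]
    split_ifs
    exacts [hp ha.1 _, hq ha.2 _]
  | ifRe e f p q hp hq =>
    simp only [arrWrites, List.mem_append, not_or] at ha
    rw [run]
    split_ifs
    exacts [hp ha.1 _, hq ha.2 _]
  | loop v n p hp => exact iter_arr (hp ha) _ _

theorem one_not_mem_natWrites {p : Code} (hp : p.Valid = true) : 1 ∉ p.natWrites := by
  induction p with
  | set c e => simp [natWrites]
  | natZero v =>
    simp only [Valid, decide_eq_true_eq] at hp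
    simp only [natWrites, List.mem_singleton]
    exact Ne.symm hp
  | natAdd v a b =>
    simp only [Valid, decide_eq_true_eq] at hp
    simp only [natWrites, List.mem_singleton]
    exact Ne.symm hp
  | natSub v a b =>
    simp only [Valid, decide_eq_true_eq] at hp
    simp only [natWrites, List.mem_singleton]
    exact Ne.symm hp
  | query c i j => simp [natWrites]
  | seq p q hp hq => simp_all [natWrites, Valid]
  | ifNat v w p q hp hq => simp_all [natWrites, Valid]
  | ifRe e f p q hp hq => simp_all [natWrites, Valid]
  | loop v n p ih =>
    simp only [Valid, Bool.and_eq_true, decide_eq_true_eq] at hp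
    simp only [natWrites, List.mem_cons, not_or]
    exact ⟨Ne.symm hp.1.1, ih hp.2.2⟩

theorem run_one (O : ℕ → ℕ → ℂ) {p : Code} (hp : p.Valid = true) (h : CStore) :
    (p.run O h).nat 1 = h.nat 1 :=
  run_nat O (by rw [List.contains_eq_mem, decide_eq_false_iff_not]; exact one_not_mem_natWrites hp) h

/-! ### Correctness of the translation -/

theorem _root_.Boson.RealRAM.Store.set_set (s : Store) (c : Cell) (x y : ℝ) :
    (s.set c x).set c y = s.set c y := by
  have h : ((s.set c x).set c y).real = (s.set c y).real := by
    funext a i j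
    by_cases h : a = c.arr ∧ i = s.nat c.row ∧ j = s.nat c.col
    · exact (if_pos h).trans (if_pos h).symm
    · exact (if_neg h).trans ((if_neg h).trans (if_neg h).symm)
  exact congrArg (Store.mk s.nat) h

theorem _root_.Boson.RealRAM.Sim.setNat {s : Store} {h : CStore} (hs : Sim s h) (v n : ℕ) :
    Sim (s.setNat v n) (h.setNat v n) :=
  ⟨by rw [Store.setNat, CStore.setNat, hs.1], hs.2⟩

theorem _root_.Boson.RealRAM.Sim.set {s : Store} {h : CStore} (hs : Sim s h) (c : Cell) (x : ℂ) :
    Sim ((s.set (reCell c) x.re).set (imCell c) x.im) (h.set c x) := by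
  refine ⟨hs.1, fun a ha i j => ?_⟩
  have h1 := hs.2 a ha i j
  simp only [Store.set, CStore.set, hs.1]
  by_cases hc : a = c.arr ∧ i = h.nat c.row ∧ j = h.nat c.col
  · rw [if_neg (by omega), if_pos (by omega), if_pos hc, if_pos (by omega)]
    exact ⟨rfl, rfl⟩
  · rw [if_neg (by omega), if_neg (by omega), if_neg hc, if_neg (by omega), if_neg (by omega)]
    exact h1

/-- Registers that bound loops are never written (`hpb`), so the bound `X` on their initial values
is valid whenever a loop is entered. -/
theorem exec_compile (O : ℕ → ℕ → ℂ) (X : ℕ) (p : Code) (hp : p.Valid = true) (h : CStore)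
    (h1 : h.nat 1 = 1) (hX : ∀ n ∈ p.bounds, h.nat n ≤ X) (hpb : ∀ n ∈ p.bounds, n ∉ p.natWrites)
    (s : Store) (hs : Sim s h) :
    ∃ t s', t ≤ p.cost X ∧ Exec O p.compile s t s' ∧ Sim s' (p.run O h) := by
  have keep : ∀ (p : Code) (n : ℕ) (h : CStore), n ∉ p.natWrites → (p.run O h).nat n = h.nat n :=
    fun p n h hn => run_nat O (by rw [List.contains_eq_mem, decide_eq_false_iff_not]; exact hn) h
  induction p generalizing h s with
  | set c e =>
    simp only [Valid, Bool.and_eq_true, decide_eq_true_eq] at hp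
    obtain ⟨s1, e1, e2, e3, e4, e5⟩ := e.exec_compile O hp.2 0 s hs
    refine ⟨_, _, le_rfl, .seq e1 (exec_block O _ _ s1), ?_⟩
    have hs1 : Sim s1 h := hs.of_eq e2 fun a ha => e3 a (by omega)
    have := hs1.set c (e.eval h)
    have hc := hp.1
    simp (disch := simp only [ne_eq]; omega) only [List.foldl_cons, List.foldl_nil, Instr.exec,
      Store.get_set, Store.get_set_of_ne, sub_self, zero_add, e4, e5, Store.set_set]
    exact this
  | natZero v => exact ⟨_, _, le_rfl, .instr _ _, hs.setNat v 0⟩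
  | natAdd v a b =>
    refine ⟨_, _, le_rfl, .instr _ _, ?_⟩
    have := hs.setNat v (s.nat a + s.nat b)
    rw [hs.1] at this
    rw [Instr.exec, hs.1]
    exact this
  | natSub v a b =>
    refine ⟨_, _, le_rfl, .instr _ _, ?_⟩
    have := hs.setNat v (s.nat a - s.nat b)
    rw [hs.1] at this
    rw [Instr.exec, hs.1]
    exact this
  | query c i j =>
    refine ⟨_, _, le_rfl, .instr _ _, ?_⟩
    rw [Instr.exec, hs.1]
    exact hs.set c _
  | seq p q ihp ihq =>
    simp only [Valid, Bool.and_eq_true] at hp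
    simp only [bounds, natWrites, List.mem_append, not_or] at hX hpb
    obtain ⟨t1, s1, b1, e1, r1⟩ := ihp hp.1 h h1 (fun n hn => hX n (.inl hn))
      (fun n hn => (hpb n (.inl hn)).1) s hs
    obtain ⟨t2, s2, b2, e2, r2⟩ := ihq hp.2 (p.run O h) (by rw [run_one O hp.1, h1])
      (fun n hn => by rw [keep p n h (hpb n (.inr hn)).1]; exact hX n (.inr hn))
      (fun n hn => (hpb n (.inr hn)).2) s1 r1
    exact ⟨_, s2, add_le_add b1 b2, .seq e1 e2, r2⟩
  | ifNat v w p q ihp ihq =>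
    simp only [Valid, Bool.and_eq_true] at hp
    simp only [bounds, natWrites, List.mem_append, not_or] at hX hpb
    rw [run]
    by_cases hvw : h.nat v ≤ h.nat w
    · obtain ⟨t1, s1, b1, e1, r1⟩ := ihp hp.1 h h1 (fun n hn => hX n (.inl hn))
        (fun n hn => (hpb n (.inl hn)).1) s hs
      refine ⟨_, s1, ?_, .ifNat_true (by rw [hs.1]; exact hvw) e1, by rw [if_pos hvw]; exact r1⟩
      rw [cost]
      omega
    · obtain ⟨t1, s1, b1, e1, r1⟩ := ihq hp.2 h h1 (fun n hn => hX n (.inr hn))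
        (fun n hn => (hpb n (.inr hn)).2) s hs
      refine ⟨_, s1, ?_, .ifNat_false (by rw [hs.1]; exact hvw) e1, by rw [if_neg hvw]; exact r1⟩
      rw [cost]
      omega
  | ifRe e f p q ihp ihq =>
    simp only [Valid, Bool.and_eq_true] at hp
    simp only [bounds, natWrites, List.mem_append, not_or] at hX hpb
    obtain ⟨s1, a1, a2, a3, a4, -⟩ := e.exec_compile O hp.1.1 0 s hs
    have hs1 : Sim s1 h := hs.of_eq a2 fun a ha => a3 a (by omega)
    obtain ⟨s2, c1, c2, c3, c4, -⟩ := f.exec_compile O hp.1.2 1 s1 hs1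
    have hs2 : Sim s2 h := hs1.of_eq c2 fun a ha => c3 a (by omega)
    have a4' : s2.get (reCell (tmp 0)) = (e.eval h).re := by
      rw [← a4, Store.get, Store.get, c2]
      exact congrFun (congrFun (c3 200 (by omega)) _) _
    rw [run]
    by_cases hvw : (e.eval h).re ≤ (f.eval h).re
    · obtain ⟨t1, s3, b1, e1, r1⟩ := ihp hp.2.1 h h1 (fun n hn => hX n (.inl hn))
        (fun n hn => (hpb n (.inl hn)).1) s2 hs2
      refine ⟨_, s3, ?_, .seq (.seq a1 c1) (.ifReal_true (by rw [a4', c4]; exact hvw) e1),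
        by rw [if_pos hvw]; exact r1⟩
      rw [cost]
      omega
    · obtain ⟨t1, s3, b1, e1, r1⟩ := ihq hp.2.2 h h1 (fun n hn => hX n (.inr hn))
        (fun n hn => (hpb n (.inr hn)).2) s2 hs2
      refine ⟨_, s3, ?_, .seq (.seq a1 c1) (.ifReal_false (by rw [a4', c4]; exact hvw) e1),
        by rw [if_neg hvw]; exact r1⟩
      rw [cost]
      omega
  | loop v n p ih =>
    simp only [Valid, Bool.and_eq_true, decide_eq_true_eq, Bool.not_eq_true', List.contains_eq_mem,
      decide_eq_false_iff_not] at hp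
    obtain ⟨⟨hv1, hvn⟩, ⟨hvp, hnp⟩, hpv⟩ := hp
    simp only [bounds, natWrites, List.mem_cons, not_or] at hX hpb
    have hkeep : ∀ k r, r ≠ v → r ∉ p.natWrites → (iter (p.run O) v k h).nat r = h.nat r :=
      fun k r hrv hrp => iter_nat hrv (fun h => keep p r h hrp) k h
    -- Induction on the number `k` of remaining rounds: the state has then seen `h.nat n - k` of
    -- them, which matches the unrolling of the loop from its head.
    have key : ∀ k, k ≤ h.nat n → ∀ (s : Store), Sim s (iter (p.run O) v (h.nat n - k) h) →
        ∃ t s', t ≤ k * (p.cost X + 2) + 1 ∧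
          Exec O (.whileNat v n (.seq p.compile (.instr (.natAdd v v 1)))) s t s' ∧
          Sim s' (iter (p.run O) v (h.nat n) h) := by
      intro k
      induction k with
      | zero =>
        intro _ s hs
        refine ⟨1, s, by omega, .while_false ?_, hs⟩
        rw [hs.1, iter_counter, hkeep _ n (Ne.symm hvn) hnp]
        omega
      | succ k ihk =>
        intro hk s hs
        set h' := iter (p.run O) v (h.nat n - (k + 1)) h with hh'
        have hone : h'.nat 1 = 1 := by
          rw [hh', hkeep _ 1 (Ne.symm hv1) (one_not_mem_natWrites hpv), h1]
        obtain ⟨t1, s1, b1, e1, r1⟩ := ih hpv h' hone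
          (fun r hr => by
            rw [hh', hkeep _ r (hpb r (.inr hr)).1 (hpb r (.inr hr)).2]
            exact hX r (.inr hr))
          (fun r hr => (hpb r (.inr hr)).2) s hs
        have hcount : (p.run O h').nat v = h.nat n - (k + 1) := by
          rw [keep p v h' hvp, hh', iter_counter]
        have r2 : Sim (s1.setNat v (s1.nat v + s1.nat 1)) (iter (p.run O) v (h.nat n - k) h) := by
          have := r1.setNat v (s1.nat v + s1.nat 1)
          have e : s1.nat v + s1.nat 1 = h.nat n - (k + 1) + 1 := by
            rw [r1.1, hcount, run_one O hpv, hone]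
          rw [e] at this ⊢
          have e2 : h.nat n - k = h.nat n - (k + 1) + 1 := by omega
          rw [e2]
          exact this
        obtain ⟨t2, s2, b2, e2, r3⟩ := ihk (by omega) _ r2
        refine ⟨_, s2, ?_, .while_true ?_ (.seq e1 (.instr _ _)) e2, r3⟩
        · rw [add_mul, one_mul]
          omega
        · rw [hs.1, iter_counter, hh', hkeep _ n (Ne.symm hvn) hnp]
          omega
    have h0 : Sim (s.setNat v 0) (iter (p.run O) v (h.nat n - h.nat n) h) := by
      rw [Nat.sub_self]
      exact hs.setNat v 0
    obtain ⟨t, s', b, e, r⟩ := key (h.nat n) le_rfl _ h0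
    refine ⟨_, s', ?_, .seq (.instr _ _) e, r⟩
    have := Nat.mul_le_mul_right (p.cost X + 2) (hX n (.inl rfl))
    rw [cost]
    omega

/-! ### Rules for loops -/

/-- A Hoare rule in which everything that the body does not write is preserved automatically, so an
invariant has to mention only what changes. It holds once for each value of the counter. -/
theorem run_loop (O : ℕ → ℕ → ℂ) {v n : ℕ} {p : Code} (h : CStore) (Inv : ℕ → CStore → Prop)
    (h0 : Inv 0 (h.setNat v 0))
    (step : ∀ k < h.nat n, ∀ h' : CStore, h'.nat v = k →
      (∀ r, r ≠ v → p.natWrites.contains r = false → h'.nat r = h.nat r) →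
      (∀ a, p.arrWrites.contains a = false → h'.arr a = h.arr a) →
      Inv k h' → Inv (k + 1) ((p.run O h').setNat v (k + 1))) :
    Inv (h.nat n) ((loop v n p).run O h) := by
  have : ∀ k ≤ h.nat n, Inv k (iter (p.run O) v k h) := by
    intro k
    induction k with
    | zero => exact fun _ => h0
    | succ k ih =>
      intro hk
      exact step k hk _ (iter_counter _ _ _ _)
        (fun r hr hp => iter_nat hr (fun h => run_nat O hp h) _ _)
        (fun a ha => iter_arr (fun h => run_arr O ha h) _ _) (ih (by omega))
  exact this _ le_rfl

end Code
end RealRAM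

namespace RealRAM

/-! ### Elementwise operations and matrix products -/

theorem CStore.arr_set (h : CStore) (c : Cell) (x : ℂ) (u v : ℕ) :
    (h.set c x).arr c.arr u v = if u = h.nat c.row ∧ v = h.nat c.col then x else h.arr c.arr u v := by
  by_cases h' : u = h.nat c.row ∧ v = h.nat c.col
  · rw [if_pos h']
    exact if_pos ⟨rfl, h'⟩
  · rw [if_neg h']
    exact if_neg fun h'' => h' h''.2

theorem CStore.nat_setNat_self (h : CStore) (v n : ℕ) : (h.setNat v n).nat v = n :=
  Function.update_self _ _ _

theorem CStore.nat_setNat_of_ne (h : CStore) {v r : ℕ} (n : ℕ) (hr : r ≠ v) :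
    (h.setNat v n).nat r = h.nat r :=
  Function.update_of_ne hr _ _

/-- The literal `n`. -/
def CExpr.num : ℕ → CExpr
  | 0 => .sub .one .one
  | n + 1 => .add (num n) .one

theorem CExpr.eval_num (h : CStore) (n : ℕ) : (CExpr.num n).eval h = n := by
  induction n with
  | zero => simp [num, eval]
  | succ n ih => simp [num, eval, ih]

/-- The entry of the array `a` at the registers `r` and `c`. -/
abbrev entry (a r c : ℕ) : CExpr := .cell ⟨a, r, c⟩

/-- The scalar held in the array `a`, at the zero register `2`. -/
abbrev scalar (a : ℕ) : CExpr := .cell ⟨a, 2, 2⟩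

namespace Code

/-- Run `p` for all values of `v` and `w` below the bound `n`. -/
def sweep (v w n : ℕ) (p : Code) : Code := loop v n (loop w n p)

/-- The offset `o` is `0` for matrices and `1` for polynomials, whose arrays keep a zero row and
column as padding. The body may assume that the entry it is about to write still has its initial
value, which covers updates in place. -/
theorem run_sweep (O : ℕ → ℕ → ℂ) {v w n C : ℕ} {p : Code} (o : ℕ) {h : CStore} (F : ℕ → ℕ → ℂ)
    (hvw : v ≠ w) (hwn : n ≠ w) (hvn : n ≠ v) (hpv : p.natWrites.contains v = false)
    (hpn : p.natWrites.contains n = false)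
    (step : ∀ i < h.nat n, ∀ j < h.nat n, ∀ h' : CStore, h'.nat v = i → h'.nat w = j →
      (∀ r, r ≠ v → r ≠ w → p.natWrites.contains r = false → h'.nat r = h.nat r) →
      (∀ a, p.arrWrites.contains a = false → h'.arr a = h.arr a) →
      h'.arr C (i + o) (j + o) = h.arr C (i + o) (j + o) →
      ∀ a b, (p.run O h').arr C a b = if a = i + o ∧ b = j + o then F i j else h'.arr C a b)
    (a b : ℕ) : ((sweep v w n p).run O h).arr C a b =
      if (o ≤ a ∧ a < h.nat n + o) ∧ (o ≤ b ∧ b < h.nat n + o) then F (a - o) (b - o)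
      else h.arr C a b := by
  refine run_loop O h (fun k h' => ∀ a b, h'.arr C a b =
      if (o ≤ a ∧ a < k + o) ∧ (o ≤ b ∧ b < h.nat n + o) then F (a - o) (b - o) else h.arr C a b)
    (fun a b => ?_) (fun k hk h1 hv1 hr1 ha1 hI1 => ?_) a b
  · rw [if_neg (by omega)]
    rfl
  · have hn1 : h1.nat n = h.nat n := hr1 n hvn (by
      rw [List.contains_eq_mem, decide_eq_false_iff_not] at hpn ⊢
      simpa [natWrites, hwn] using hpn)
    have inner := run_loop O (v := w) (n := n) (p := p) h1 (fun l h' => ∀ a b, h'.arr C a b =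
      if ((o ≤ a ∧ a < k + o) ∧ (o ≤ b ∧ b < h.nat n + o)) ∨
        (a = k + o ∧ o ≤ b ∧ b < l + o) then F (a - o) (b - o) else h.arr C a b)
      (fun a b => ?_) (fun l hl h2 hw2 hr2 ha2 hI2 a b => ?_)
    · intro a b
      refine (inner a b).trans ?_
      rw [hn1]
      congr 1
      rw [eq_iff_iff]
      omega
    · refine (hI1 a b).trans ?_
      congr 1
      rw [eq_iff_iff]
      omega
    · rw [hn1] at hl
      refine (step k hk l hl h2 ((hr2 v hvw hpv).trans hv1) hw2
        (fun r hrv hrw hrp => (hr2 r hrw hrp).trans (hr1 r hrv (by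
          rw [List.contains_eq_mem, decide_eq_false_iff_not] at hrp ⊢
          simpa [natWrites, hrw] using hrp)))
        (fun a ha => (ha2 a ha).trans (ha1 a ha)) ?_ a b).trans ?_
      · rw [hI2, if_neg (by omega)]
      · by_cases hab : a = k + o ∧ b = l + o
        · rw [if_pos hab, if_pos (by omega), hab.1, hab.2, Nat.add_sub_cancel, Nat.add_sub_cancel]
        · rw [if_neg hab, hI2]
          congr 1
          rw [eq_iff_iff]
          omega

/-- Set the entries of the `m × m` array `C`, where `m` is in register `6`. -/
def ew (C : ℕ) (e : CExpr) : Code := sweep 10 11 6 (set ⟨C, 10, 11⟩ e)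

theorem run_ew (O : ℕ → ℕ → ℂ) {C : ℕ} {e : CExpr} {h : CStore} (F : ℕ → ℕ → ℂ)
    (he : ∀ i < h.nat 6, ∀ j < h.nat 6, ∀ h' : CStore, h'.nat 10 = i → h'.nat 11 = j →
      (∀ r, r ≠ 10 → r ≠ 11 → h'.nat r = h.nat r) → (∀ a, a ≠ C → h'.arr a = h.arr a) →
      h'.arr C i j = h.arr C i j → e.eval h' = F i j) (a b : ℕ) :
    ((ew C e).run O h).arr C a b = if a < h.nat 6 ∧ b < h.nat 6 then F a b else h.arr C a b := by
  have := run_sweep O (p := set ⟨C, 10, 11⟩ e) (C := C) 0 (h := h) F (show 10 ≠ 11 by decide)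
    (show 6 ≠ 11 by decide) (show 6 ≠ 10 by decide) rfl rfl
    (fun i hi j hj h' h1 h2 h3 h4 h5 a b => by
      rw [run, he i hi j hj h' h1 h2 (fun r h6 h7 => h3 r h6 h7 rfl)
        (fun a ha => h4 a (by simp [arrWrites, ha])) h5, CStore.arr_set]
      simp only [h1, h2, add_zero]) a b
  rw [ew]
  simpa using this

/-- The matrix product. -/
def mm (C A B : ℕ) : Code := sweep 10 11 6 (seq (set ⟨C, 10, 11⟩ (.num 0))
  (loop 12 6 (set ⟨C, 10, 11⟩ (.add (entry C 10 11) (.mul (entry A 10 12) (entry B 12 11))))))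

theorem run_mm (O : ℕ → ℕ → ℂ) {C A B : ℕ} {h : CStore} (hA : A ≠ C) (hB : B ≠ C) (a b : ℕ) :
    ((mm C A B).run O h).arr C a b = if a < h.nat 6 ∧ b < h.nat 6 then
      ∑ k ∈ Finset.range (h.nat 6), h.arr A a k * h.arr B k b else h.arr C a b := by
  have := run_sweep O (p := seq (set ⟨C, 10, 11⟩ (.num 0))
    (loop 12 6 (set ⟨C, 10, 11⟩ (.add (entry C 10 11) (.mul (entry A 10 12) (entry B 12 11))))))
    (C := C) 0 (h := h) (fun a b => ∑ k ∈ Finset.range (h.nat 6), h.arr A a k * h.arr B k b)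
    (show 10 ≠ 11 by decide) (show 6 ≠ 11 by decide) (show 6 ≠ 10 by decide) rfl rfl
    (fun i hi j hj h' h1 h2 h3 h4 h5 => by
      set h0 := (set ⟨C, 10, 11⟩ (.num 0)).run O h' with hh0
      have e0 : ∀ a b, h0.arr C a b = if a = i ∧ b = j then 0 else h'.arr C a b := fun a b => by
        rw [hh0, run, CStore.arr_set, CExpr.eval_num]
        simp only [h1, h2, Nat.cast_zero]
      have n6 : h0.nat 6 = h.nat 6 := h3 6 (by decide) (by decide) rfl
      have eA : ∀ X, X ≠ C → h0.arr X = h.arr X := fun X hX =>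
        (run_arr O (by simp [arrWrites, hX]) h').trans (h4 X (by simp [arrWrites, hX]))
      have := run_loop O (v := 12) (n := 6)
        (p := set ⟨C, 10, 11⟩ (.add (entry C 10 11) (.mul (entry A 10 12) (entry B 12 11)))) h0
        (fun k h'' => ∀ a b, h''.arr C a b = if a = i ∧ b = j then
          ∑ l ∈ Finset.range k, h.arr A i l * h.arr B l j else h'.arr C a b)
        (fun a b => by rw [Finset.sum_range_zero, ← e0]; rfl)
        (fun k hk h'' hk1 hr ha hI a b => by
          have r10 : h''.nat 10 = i := (hr 10 (by decide) rfl).trans h1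
          have r11 : h''.nat 11 = j := (hr 11 (by decide) rfl).trans h2
          refine (CStore.arr_set h'' ⟨C, 10, 11⟩ (CExpr.eval h'' _) a b).trans ?_
          simp only [r10, r11, CExpr.eval, CStore.get, hk1, hI, and_self, if_true]
          rw [ha A (by simp [arrWrites, hA]), ha B (by simp [arrWrites, hB]), eA A hA, eA B hB,
            Finset.sum_range_succ]
          by_cases hab : a = i ∧ b = j
          · rw [if_pos hab, if_pos hab]
          · rw [if_neg hab, if_neg hab, if_neg hab])
      rw [n6] at this
      intro a b
      rw [add_zero, add_zero]
      exact this a b) a b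
  rw [mm]
  simpa using this

/-- The conjugate transpose. -/
def adj (C A : ℕ) : Code := ew C (.cconj (entry A 11 10))

/-- The `m × m` matrix held in the array `a`. -/
def _root_.Boson.RealRAM.CStore.mat (h : CStore) (m a : ℕ) : Matrix (Fin m) (Fin m) ℂ :=
  Matrix.of fun i j => h.arr a i j

variable {O : ℕ → ℕ → ℂ} {h : CStore} {m : ℕ}

theorem mat_ew {C : ℕ} {e : CExpr} (hm : h.nat 6 = m) (M : Matrix (Fin m) (Fin m) ℂ)
    (he : ∀ (i j : Fin m) (h' : CStore), h'.nat 10 = i → h'.nat 11 = j →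
      (∀ r, r ≠ 10 → r ≠ 11 → h'.nat r = h.nat r) → (∀ a, a ≠ C → h'.arr a = h.arr a) →
      h'.arr C i j = h.arr C i j → e.eval h' = M i j) :
    ((ew C e).run O h).mat m C = M := by
  ext i j
  have := run_ew O (C := C) (e := e) (h := h)
    (fun i j => if hij : i < m ∧ j < m then M ⟨i, hij.1⟩ ⟨j, hij.2⟩ else 0)
    (fun i hi j hj h' h1 h2 h3 h4 h5 => by
      rw [hm] at hi hj
      rw [dif_pos ⟨hi, hj⟩]
      exact he ⟨i, hi⟩ ⟨j, hj⟩ h' h1 h2 h3 h4 h5) i j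
  rw [hm, if_pos ⟨i.2, j.2⟩, dif_pos ⟨i.2, j.2⟩] at this
  exact this

theorem mat_mm {C A B : ℕ} (hm : h.nat 6 = m) (hA : A ≠ C) (hB : B ≠ C) :
    ((mm C A B).run O h).mat m C = h.mat m A * h.mat m B := by
  ext i j
  have := run_mm O (h := h) hA hB i j
  rw [hm, if_pos ⟨i.2, j.2⟩, Finset.sum_range] at this
  exact this

theorem mat_adj {C A : ℕ} (hm : h.nat 6 = m) (hA : A ≠ C) :
    ((adj C A).run O h).mat m C = star (h.mat m A) := by
  refine mat_ew hm _ fun i j h' h1 h2 _ h4 _ => ?_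
  rw [CExpr.eval, CExpr.eval, CStore.get, h1, h2, h4 A hA]
  rfl

theorem mat_run_of_not_mem {p : Code} {a : ℕ} (ha : p.arrWrites.contains a = false) :
    (p.run O h).mat m a = h.mat m a := by
  rw [CStore.mat, CStore.mat, run_arr O ha]

end Code

/-! ### Composition of machine programs -/

/-- The machine program `P` leads from memories represented by `h` to ones represented by `h'`,
in at most `T` steps. -/
def Leads (O : ℕ → ℕ → ℂ) (P : Prog) (h : CStore) (T : ℕ) (h' : CStore) : Prop :=
  ∀ s, Sim s h → ∃ t s', t ≤ T ∧ Exec O P s t s' ∧ Sim s' h'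

variable {O : ℕ → ℕ → ℂ}

theorem Leads.code {p : Code} {h : CStore} {X : ℕ} (hp : p.Valid = true) (hs : p.Stable = true)
    (h1 : h.nat 1 = 1) (hX : ∀ n ∈ p.bounds, h.nat n ≤ X) :
    Leads O p.compile h (p.cost X) (p.run O h) := fun s hsim =>
  p.exec_compile O X hp h h1 hX (fun n hn hw => by
    have := List.all_eq_true.mp hs n hn
    rw [List.contains_eq_mem, Bool.not_eq_true', decide_eq_false_iff_not] at this
    exact this hw) s hsim

theorem Leads.seq {P Q : Prog} {h h' h'' : CStore} {T T' : ℕ} (h1 : Leads O P h T h')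
    (h2 : Leads O Q h' T' h'') : Leads O (.seq P Q) h (T + T') h'' := fun s hs => by
  obtain ⟨t, s', b, e, r⟩ := h1 s hs
  obtain ⟨t', s'', b', e', r'⟩ := h2 s' r
  exact ⟨_, s'', add_le_add b b', .seq e e', r'⟩

theorem Leads.mono {P : Prog} {h h' : CStore} {T T' : ℕ} (h1 : Leads O P h T h') (hT : T ≤ T') :
    Leads O P h T' h' := fun s hs => by
  obtain ⟨t, s', b, e, r⟩ := h1 s hs
  exact ⟨t, s', b.trans hT, e, r⟩

theorem Leads.ifNat_true {P Q : Prog} {h h' : CStore} {T v w : ℕ} (hvw : h.nat v ≤ h.nat w)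
    (h1 : Leads O P h T h') : Leads O (.ifNat v w P Q) h (T + 1) h' := fun s hs => by
  obtain ⟨t, s', b, e, r⟩ := h1 s hs
  exact ⟨_, s', Nat.add_le_add_right b 1, .ifNat_true (by rw [hs.1]; exact hvw) e, r⟩

theorem Leads.ifNat_false {P Q : Prog} {h h' : CStore} {T v w : ℕ} (hvw : ¬ h.nat v ≤ h.nat w)
    (h1 : Leads O Q h T h') : Leads O (.ifNat v w P Q) h (T + 1) h' := fun s hs => by
  obtain ⟨t, s', b, e, r⟩ := h1 s hs
  exact ⟨_, s', Nat.add_le_add_right b 1, .ifNat_false (by rw [hs.1]; exact hvw) e, r⟩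

/-- Repeat `p` until the register `v` is not below the register `w`. -/
theorem Leads.while {p : Code} {v w X : ℕ} (hp : p.Valid = true) (hs : p.Stable = true)
    {h : CStore} (h1 : h.nat 1 = 1) (n : ℕ)
    (hX : ∀ k < n, ∀ r ∈ p.bounds, ((p.run O)^[k] h).nat r ≤ X)
    (hlt : ∀ k < n, ((p.run O)^[k] h).nat v < ((p.run O)^[k] h).nat w)
    (hn : ¬ ((p.run O)^[n] h).nat v < ((p.run O)^[n] h).nat w) :
    Leads O (.whileNat v w p.compile) h (n * (p.cost X + 1) + 1) ((p.run O)^[n] h) := by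
  induction n generalizing h with
  | zero => exact fun s hsim => ⟨1, s, by omega, .while_false (by rw [hsim.1]; exact hn), hsim⟩
  | succ n ih =>
    intro s hsim
    obtain ⟨t, s', b, e, r⟩ := Leads.code (O := O) hp hs h1 (hX 0 (by omega)) s hsim
    obtain ⟨t', s'', b', e', r'⟩ := ih (h := p.run O h) (by rw [Code.run_one O hp, h1])
      (fun k hk => hX (k + 1) (by omega)) (fun k hk => hlt (k + 1) (by omega)) hn s' r
    refine ⟨_, s'', ?_, .while_true (by rw [hsim.1]; exact hlt 0 (by omega)) e e', r'⟩
    rw [add_mul, one_mul]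
    omega

end RealRAM

open scoped Matrix.Norms.L2Operator
namespace RealRAM
namespace Code

variable {O : ℕ → ℕ → ℂ} {h : CStore} {m : ℕ}

/-! ### The matrix computations -/

/-- The array `40` holds the integers up to `n` in its column `0`. -/
def HasNums (h : CStore) (n : ℕ) : Prop := ∀ i ≤ n, h.arr 40 i 0 = i

theorem HasNums.of_eq {h h' : CStore} {n : ℕ} (hn : HasNums h n) (e : h'.arr 40 = h.arr 40) :
    HasNums h' n := fun i hi => by rw [e, hn i hi]

theorem HasNums.mono {h : CStore} {n n' : ℕ} (hn : HasNums h n) (hle : n' ≤ n) : HasNums h n' :=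
  fun i hi => hn i (hi.trans hle)

/-- Write the integers up to the bound in register `9` to the array `40`. -/
def fillNums : Code :=
  loop 10 9 (seq (natAdd 11 10 1) (set ⟨40, 11, 2⟩ (.add (entry 40 10 2) .one)))

/-- No instruction converts an integer register to a real number. Repeated addition of `1` fills a
table, from which later programs read the integers they need as reals. -/
theorem run_fillNums (h1 : h.nat 1 = 1) (h2 : h.nat 2 = 0) (h0 : h.arr 40 0 0 = 0) :
    HasNums (fillNums.run O h) (h.nat 9) := by
  refine run_loop O h (fun k h' => HasNums h' k) (fun i hi => ?_)
    (fun k hk h' hv hr ha hI i hi => ?_)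
  · obtain rfl : i = 0 := by omega
    rw [Nat.cast_zero, ← h0]
    rfl
  · have r1 : h'.nat 1 = 1 := (hr 1 (by decide) rfl).trans h1
    have r2 : h'.nat 2 = 0 := (hr 2 (by decide) rfl).trans h2
    have e : ((seq (natAdd 11 10 1) (set ⟨40, 11, 2⟩ (.add (entry 40 10 2) .one))).run O h').arr 40 i 0
        = if i = k + 1 then h'.arr 40 k 0 + 1 else h'.arr 40 i 0 := by
      refine (CStore.arr_set (h'.setNat 11 (h'.nat 10 + h'.nat 1)) ⟨40, 11, 2⟩ _ i 0).trans ?_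
      simp only [run, CStore.nat_setNat_self, CStore.nat_setNat_of_ne _ _ (show 2 ≠ 11 by decide),
        CExpr.eval, CStore.get, CStore.nat_setNat_of_ne _ _ (show 10 ≠ 11 by decide), r1, r2, hv,
        and_true]
      rfl
    refine e.trans ?_
    split_ifs with hik
    · rw [hI k le_rfl, hik]
      push_cast
      rfl
    · exact hI i (by omega)

theorem run_setScalar {a : ℕ} {e : CExpr} (h2 : h.nat 2 = 0) :
    ((set ⟨a, 2, 2⟩ e).run O h).arr a 0 0 = e.eval h := by
  refine (CStore.arr_set h ⟨a, 2, 2⟩ _ 0 0).trans ?_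
  simp only [h2, and_self, if_true]

/-- The completion of the matrix in array `20`, with the swap in array `21`. -/
def completionCode : Code :=
  seq (adj 23 20) (seq (mm 24 23 21) (seq (mm 25 21 24) (seq (mm 26 20 24) (seq (mm 27 23 20)
    (seq (mm 28 21 27) (ew 22 (.sub (.sub (.sub (.add (entry 21 10 11) (entry 20 10 11))
      (entry 25 10 11)) (entry 26 10 11)) (entry 28 10 11))))))))

theorem mat_completionCode (hm : h.nat 6 = m) :
    (completionCode.run O h).mat m 22 = completion (h.mat m 21) (h.mat m 20) := by
  set h1 := (adj 23 20).run O h with e1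
  set h2 := (mm 24 23 21).run O h1 with e2
  set h3 := (mm 25 21 24).run O h2 with e3
  set h4 := (mm 26 20 24).run O h3 with e4
  set h5 := (mm 27 23 20).run O h4 with e5
  set h6 := (mm 28 21 27).run O h5 with e6
  have m1 : h1.nat 6 = m := (run_nat O rfl _).trans hm
  have m2 : h2.nat 6 = m := (run_nat O rfl _).trans m1
  have m3 : h3.nat 6 = m := (run_nat O rfl _).trans m2
  have m4 : h4.nat 6 = m := (run_nat O rfl _).trans m3
  have m5 : h5.nat 6 = m := (run_nat O rfl _).trans m4
  have m6 : h6.nat 6 = m := (run_nat O rfl _).trans m5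
  have f1 : ∀ a, (adj 23 20).arrWrites.contains a = false → h1.mat m a = h.mat m a :=
    fun a ha => mat_run_of_not_mem ha
  have f2 : ∀ a, (mm 24 23 21).arrWrites.contains a = false → h2.mat m a = h1.mat m a :=
    fun a ha => mat_run_of_not_mem ha
  have f3 : ∀ a, (mm 25 21 24).arrWrites.contains a = false → h3.mat m a = h2.mat m a :=
    fun a ha => mat_run_of_not_mem ha
  have f4 : ∀ a, (mm 26 20 24).arrWrites.contains a = false → h4.mat m a = h3.mat m a :=
    fun a ha => mat_run_of_not_mem ha
  have f5 : ∀ a, (mm 27 23 20).arrWrites.contains a = false → h5.mat m a = h4.mat m a :=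
    fun a ha => mat_run_of_not_mem ha
  have f6 : ∀ a, (mm 28 21 27).arrWrites.contains a = false → h6.mat m a = h5.mat m a :=
    fun a ha => mat_run_of_not_mem ha
  have v1 : h1.mat m 23 = star (h.mat m 20) := mat_adj hm (by decide)
  have v2 : h2.mat m 24 = h1.mat m 23 * h1.mat m 21 := mat_mm m1 (by decide) (by decide)
  have v3 : h3.mat m 25 = h2.mat m 21 * h2.mat m 24 := mat_mm m2 (by decide) (by decide)
  have v4 : h4.mat m 26 = h3.mat m 20 * h3.mat m 24 := mat_mm m3 (by decide) (by decide)
  have v5 : h5.mat m 27 = h4.mat m 23 * h4.mat m 20 := mat_mm m4 (by decide) (by decide)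
  have v6 : h6.mat m 28 = h5.mat m 21 * h5.mat m 27 := mat_mm m5 (by decide) (by decide)
  have key : (completionCode.run O h).mat m 22 =
      h6.mat m 21 + h6.mat m 20 - h6.mat m 25 - h6.mat m 26 - h6.mat m 28 :=
    mat_ew m6 _ fun i j h' r1 r2 _ r4 _ => by
      simp only [CExpr.eval, CStore.get, r1, r2, r4 21 (by decide), r4 20 (by decide),
        r4 25 (by decide), r4 26 (by decide), r4 28 (by decide)]
      rfl
  rw [key, f6 21 rfl, f6 20 rfl, f6 25 rfl, f6 26 rfl, v6, v5, f5 21 rfl, f5 20 rfl, f5 25 rfl,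
    f5 26 rfl, v4, f4 21 rfl, f4 20 rfl, f4 25 rfl, f4 23 rfl, v3, f3 21 rfl, f3 20 rfl, f3 23 rfl,
    f3 24 rfl, v2, f2 21 rfl, f2 20 rfl, f2 23 rfl, v1, f1 21 rfl, f1 20 rfl, completion]
  simp only [mul_assoc]

/-- The Newton steps for the matrix in array `22`. -/
def newtonCode : Code :=
  loop 13 7 (seq (adj 23 22) (seq (mm 24 23 22) (seq (mm 25 22 24)
    (ew 22 (.divRe (.sub (.add (.add (entry 22 10 11) (entry 22 10 11)) (entry 22 10 11))
      (entry 25 10 11)) (.num 2))))))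

theorem mat_newtonCode (hm : h.nat 6 = m) :
    (newtonCode.run O h).mat m 22 = newtonStep^[h.nat 7] (h.mat m 22) := by
  refine run_loop O h (fun k h' => h'.mat m 22 = newtonStep^[k] (h.mat m 22)) rfl
    (fun k hk h' hv hr ha hI => ?_)
  have m0 : h'.nat 6 = m := (hr 6 (by decide) rfl).trans hm
  set h1 := (adj 23 22).run O h' with e1
  set h2 := (mm 24 23 22).run O h1 with e2
  set h3 := (mm 25 22 24).run O h2 with e3
  have m1 : h1.nat 6 = m := (run_nat O rfl _).trans m0
  have m2 : h2.nat 6 = m := (run_nat O rfl _).trans m1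
  have m3 : h3.nat 6 = m := (run_nat O rfl _).trans m2
  have v1 : h1.mat m 23 = star (h'.mat m 22) := mat_adj m0 (by decide)
  have v2 : h2.mat m 24 = h1.mat m 23 * h1.mat m 22 := mat_mm m1 (by decide) (by decide)
  have v3 : h3.mat m 25 = h2.mat m 22 * h2.mat m 24 := mat_mm m2 (by decide) (by decide)
  have f1 : h1.mat m 22 = h'.mat m 22 := mat_run_of_not_mem rfl
  have f2 : h2.mat m 22 = h1.mat m 22 := mat_run_of_not_mem rfl
  have f3 : h3.mat m 22 = h2.mat m 22 := mat_run_of_not_mem rfl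
  rw [Function.iterate_succ_apply', ← hI]
  refine mat_ew m3 _ fun i j h'' r1 r2 _ r4 r5 => ?_
  have e22 : h3.arr 22 i j = h'.mat m 22 i j := congrFun (congrFun (f3.trans (f2.trans f1)) i) j
  have e25 : h3.arr 25 i j = (h'.mat m 22 * (star (h'.mat m 22) * h'.mat m 22)) i j := by
    have := congrFun (congrFun v3 i) j
    rwa [v2, v1, f2, f1] at this
  simp only [CExpr.eval, CStore.get, r1, r2, r4 25 (by decide), r5, CExpr.eval_num, e22, e25]
  rw [newtonStep, Matrix.sub_apply, Matrix.smul_apply, Matrix.smul_apply, smul_eq_mul, smul_eq_mul]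
  simp
  ring

/-- Store the phase with the index in register `r` to the scalar `30`. -/
def phaseCode (r : ℕ) : Code := set ⟨30, 2, 2⟩
  (.divRe (.mul (.add (entry 40 6 2) (.mul .imag (entry 40 r 2)))
    (.add (entry 40 6 2) (.mul .imag (entry 40 r 2))))
    (.add (.mul (entry 40 6 2) (entry 40 6 2)) (.mul (entry 40 r 2) (entry 40 r 2))))

theorem run_phaseCode (h2 : h.nat 2 = 0) (hm : h.nat 6 = m) (hn : HasNums h m) {r : ℕ}
    (hr : h.nat r ≤ m) : ((phaseCode r).run O h).arr 30 0 0 = phase m (h.nat r) := by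
  refine (run_setScalar h2).trans ?_
  simp only [CExpr.eval, CStore.get, h2, hm, hn m le_rfl, hn _ hr, phase]
  congr 1
  have : (m : ℂ) * m + (h.nat r : ℂ) * (h.nat r : ℂ) = (((m : ℝ) * m + (h.nat r : ℝ) * h.nat r : ℝ) : ℂ) := by
    push_cast
    rfl
  rw [this, Complex.ofReal_re]

/-- Store the squared Frobenius norm of array `26` to the scalar `31`. -/
def frobCode : Code := seq (set ⟨31, 2, 2⟩ (.num 0)) (loop 10 6 (loop 11 6
  (set ⟨31, 2, 2⟩ (.add (scalar 31) (.mul (entry 26 10 11) (.cconj (entry 26 10 11)))))))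

theorem run_frobCode (h2 : h.nat 2 = 0) (hm : h.nat 6 = m) :
    (frobCode.run O h).arr 31 0 0 = ((∑ i, ∑ j, ‖h.mat m 26 i j‖ ^ 2 : ℝ) : ℂ) := by
  set h0 := (set ⟨31, 2, 2⟩ (.num 0)).run O h with hh0
  have m0 : h0.nat 6 = m := (run_nat O rfl _).trans hm
  have z0 : h0.nat 2 = 0 := (run_nat O rfl _).trans h2
  have a0 : h0.arr 26 = h.arr 26 := run_arr O rfl _
  have s0 : h0.arr 31 0 0 = 0 := (run_setScalar h2).trans (by rw [CExpr.eval_num]; simp)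
  have := run_loop O (v := 10) (n := 6) (p := loop 11 6 (set ⟨31, 2, 2⟩
    (.add (scalar 31) (.mul (entry 26 10 11) (.cconj (entry 26 10 11)))))) h0
    (fun k h' => h'.arr 31 0 0 = ∑ i ∈ Finset.range k, ∑ j ∈ Finset.range m,
      ((‖h.arr 26 i j‖ ^ 2 : ℝ) : ℂ)) s0 (fun k hk h' hv hr ha hI => by
      have m1 : h'.nat 6 = m := (hr 6 (by decide) rfl).trans m0
      have z1 : h'.nat 2 = 0 := (hr 2 (by decide) rfl).trans z0
      have a1 : h'.arr 26 = h.arr 26 := (ha 26 rfl).trans a0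
      have inner := run_loop O (v := 11) (n := 6) (p := set ⟨31, 2, 2⟩
        (.add (scalar 31) (.mul (entry 26 10 11) (.cconj (entry 26 10 11))))) h'
        (fun l h'' => h''.arr 31 0 0 = (∑ i ∈ Finset.range k, ∑ j ∈ Finset.range m,
          ((‖h.arr 26 i j‖ ^ 2 : ℝ) : ℂ)) + ∑ j ∈ Finset.range l, ((‖h.arr 26 k j‖ ^ 2 : ℝ) : ℂ))
        (by rw [Finset.sum_range_zero, add_zero]; exact hI) (fun l hl h'' hv' hr' ha' hI' => by
          have z2 : h''.nat 2 = 0 := (hr' 2 (by decide) rfl).trans z1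
          have k2 : h''.nat 10 = k := (hr' 10 (by decide) rfl).trans hv
          have a2 : h''.arr 26 = h.arr 26 := (ha' 26 rfl).trans a1
          refine (run_setScalar (O := O) (a := 31) z2).trans ?_
          simp only [CExpr.eval, CStore.get, z2, k2, hv', a2]
          rw [hI', Finset.sum_range_succ (n := l), Complex.mul_conj', add_assoc]
          push_cast
          rfl)
      rw [m1] at inner
      rw [Finset.sum_range_succ]
      exact inner)
  rw [m0] at this
  refine Eq.trans this ?_
  rw [Finset.sum_range]
  push_cast
  refine Finset.sum_congr rfl fun i _ => ?_
  rw [Finset.sum_range]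
  rfl

theorem mat_smulCode {C A s : ℕ} (hm : h.nat 6 = m) (h2 : h.nat 2 = 0) (hA : A ≠ C) (hs : s ≠ C) :
    ((ew C (.mul (scalar s) (entry A 10 11))).run O h).mat m C = h.arr s 0 0 • h.mat m A :=
  mat_ew hm _ fun i j h' r1 r2 r3 r4 _ => by
    simp only [CExpr.eval, CStore.get, r1, r2, r3 2 (by decide) (by decide), h2, r4 A hA, r4 s hs]
    rfl

theorem mat_copyCode {C A : ℕ} (hm : h.nat 6 = m) (hA : A ≠ C) :
    ((ew C (entry A 10 11)).run O h).mat m C = h.mat m A :=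
  mat_ew hm _ fun i j h' r1 r2 _ r4 _ => by
    simp only [CExpr.eval, CStore.get, r1, r2, r4 A hA]
    rfl

/-- Store the `N`-th power of array `25` to array `26`; array `29` holds the identity. -/
def powCode : Code := seq (ew 26 (entry 29 10 11))
  (loop 14 7 (seq (mm 27 26 25) (ew 26 (entry 27 10 11))))

theorem mat_powCode (hm : h.nat 6 = m) (hid : h.mat m 29 = 1) :
    (powCode.run O h).mat m 26 = h.mat m 25 ^ h.nat 7 := by
  set h0 := (ew 26 (entry 29 10 11)).run O h with hh0
  have m0 : h0.nat 6 = m := (run_nat O rfl _).trans hm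
  have n0 : h0.nat 7 = h.nat 7 := run_nat O rfl _
  have v0 : h0.mat m 26 = 1 := (mat_copyCode hm (by decide)).trans hid
  have a0 : h0.mat m 25 = h.mat m 25 := mat_run_of_not_mem rfl
  have := run_loop O (v := 14) (n := 7) (p := seq (mm 27 26 25) (ew 26 (entry 27 10 11))) h0
    (fun k h' => h'.mat m 26 = h.mat m 25 ^ k) (by rw [pow_zero]; exact v0)
    (fun k hk h' hv hr ha hI => by
      have m1 : h'.nat 6 = m := (hr 6 (by decide) rfl).trans m0
      have a1 : h'.mat m 25 = h.mat m 25 := by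
        rw [← a0, CStore.mat, CStore.mat, ha 25 rfl]
      have m2 : ((mm 27 26 25).run O h').nat 6 = m := (run_nat O rfl _).trans m1
      refine (mat_copyCode (O := O) m2 (by decide)).trans ?_
      rw [mat_mm m1 (by decide) (by decide), hI, a1, pow_succ])
  rw [n0] at this
  exact this

/-- Test the phase with the index in register `13`, and keep it in register `15` if it passes. -/
def testBody : Code := seq (phaseCode 13) (seq (ew 23 (.mul (scalar 30) (entry 22 10 11)))
  (seq (adj 24 23) (seq (ew 25 (.sub (.divRe (entry 29 10 11) (.num 2))
    (.divRe (.add (entry 23 10 11) (entry 24 10 11)) (.num 4)))) (seq powCode (seq frobCode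
    (ifRe (scalar 31) (.divRe .one (.num 4)) (natAdd 15 13 2) (natAdd 15 15 2)))))))

theorem run_testBody (h2 : h.nat 2 = 0) (hm : h.nat 6 = m) (hn : HasNums h m)
    (hs : h.nat 13 ≤ m) (hid : h.mat m 29 = 1) :
    (testBody.run O h).nat 15 =
      if ∑ i, ∑ j, ‖(gapOp (phase m (h.nat 13) • h.mat m 22) ^ h.nat 7) i j‖ ^ 2 ≤ 1 / 4
      then h.nat 13 else h.nat 15 := by
  set h1 := (phaseCode 13).run O h with e1
  set h3 := (ew 23 (.mul (scalar 30) (entry 22 10 11))).run O h1 with e3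
  set h4 := (adj 24 23).run O h3 with e4
  set h5 := (ew 25 (.sub (.divRe (entry 29 10 11) (.num 2))
    (.divRe (.add (entry 23 10 11) (entry 24 10 11)) (.num 4)))).run O h4 with e5
  set h6 := powCode.run O h5 with e6
  set h7 := frobCode.run O h6 with e7
  have m1 : h1.nat 6 = m := (run_nat O rfl _).trans hm
  have m3 : h3.nat 6 = m := (run_nat O rfl _).trans m1
  have m4 : h4.nat 6 = m := (run_nat O rfl _).trans m3
  have m5 : h5.nat 6 = m := (run_nat O rfl _).trans m4
  have m6 : h6.nat 6 = m := (run_nat O rfl _).trans m5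
  have z1 : h1.nat 2 = 0 := (run_nat O rfl _).trans h2
  have key : ∀ r, (phaseCode 13).natWrites.contains r = false →
      (∀ C e, (ew C e).natWrites.contains r = false) →
      powCode.natWrites.contains r = false → frobCode.natWrites.contains r = false →
      h7.nat r = h.nat r := fun r k1 k2 k3 k4 =>
    (run_nat O k4 _).trans ((run_nat O k3 _).trans ((run_nat O (k2 _ _) _).trans
      ((run_nat O (k2 _ _) _).trans ((run_nat O (k2 _ _) _).trans (run_nat O k1 _)))))
  have z6 : h6.nat 2 = 0 := (run_nat O rfl _).trans ((run_nat O rfl _).trans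
    ((run_nat O rfl _).trans ((run_nat O rfl _).trans z1)))
  have n5 : h5.nat 7 = h.nat 7 := (run_nat O rfl _).trans ((run_nat O rfl _).trans
    ((run_nat O rfl _).trans (run_nat O rfl _)))
  have v3 : h3.mat m 23 = phase m (h.nat 13) • h.mat m 22 := by
    rw [e3, mat_smulCode m1 z1 (by decide) (by decide), e1, run_phaseCode h2 hm hn hs,
      mat_run_of_not_mem rfl]
  have i3 : h3.mat m 29 = 1 := (mat_run_of_not_mem rfl).trans ((mat_run_of_not_mem rfl).trans hid)
  have v4 : h4.mat m 24 = star (h3.mat m 23) := mat_adj m3 (by decide)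
  have c4 : h4.mat m 23 = h3.mat m 23 := mat_run_of_not_mem rfl
  have i4 : h4.mat m 29 = 1 := (mat_run_of_not_mem rfl).trans i3
  have i5 : h5.mat m 29 = 1 := (mat_run_of_not_mem rfl).trans i4
  have v5 : h5.mat m 25 = gapOp (h3.mat m 23) :=
    mat_ew m4 _ fun i j h' r1 r2 _ r4 _ => by
      have q1 : h4.arr 29 i j = (1 : Matrix (Fin m) (Fin m) ℂ) i j := congrFun (congrFun i4 i) j
      have q2 : h4.arr 24 i j = star (h3.mat m 23) i j := congrFun (congrFun v4 i) j
      have q3 : h4.arr 23 i j = h3.mat m 23 i j := congrFun (congrFun c4 i) j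
      simp only [CExpr.eval, CStore.get, r1, r2, r4 29 (by decide), r4 23 (by decide),
        r4 24 (by decide), CExpr.eval_num, q1, q2, q3]
      rw [gapOp, Matrix.sub_apply, Matrix.smul_apply, Matrix.smul_apply, Matrix.add_apply,
        smul_eq_mul, smul_eq_mul]
      simp
      ring
  have v6 : h6.mat m 26 = gapOp (phase m (h.nat 13) • h.mat m 22) ^ h.nat 7 := by
    rw [e6, mat_powCode m5 i5, v5, v3, n5]
  have v7 : h7.arr 31 0 0 = ((∑ i, ∑ j, ‖h6.mat m 26 i j‖ ^ 2 : ℝ) : ℂ) := run_frobCode z6 m6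
  have z7 : h7.nat 2 = 0 := (run_nat O rfl _).trans z6
  change ((ifRe (scalar 31) (.divRe .one (.num 4)) (natAdd 15 13 2) (natAdd 15 15 2)).run O h7).nat 15
    = _
  rw [run]
  have q : ((CExpr.divRe .one (.num 4)).eval h7).re = 1 / 4 := by
    rw [CExpr.eval, CExpr.eval_num, CExpr.eval]
    have : (1 : ℂ) / ((((4 : ℕ) : ℂ).re : ℝ) : ℂ) = ((1 / 4 : ℝ) : ℂ) := by
      rw [Complex.natCast_re]
      push_cast
      rfl
    rw [this, Complex.ofReal_re]
  have q2 : ((scalar 31).eval h7).re =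
      ∑ i, ∑ j, ‖(gapOp (phase m (h.nat 13) • h.mat m 22) ^ h.nat 7) i j‖ ^ 2 := by
    rw [CExpr.eval, CStore.get, z7, v7, v6, Complex.ofReal_re]
  rw [q, q2]
  split_ifs
  · rw [run, CStore.nat_setNat_self, z7, add_zero, key 13 rfl (fun _ _ => rfl) rfl rfl]
  · rw [run, CStore.nat_setNat_self, z7, add_zero, key 15 rfl (fun _ _ => rfl) rfl rfl]

/-- Find a phase that passes the test. -/
def testCode : Code := loop 13 8 testBody

/-- Register `15` is overwritten by every index that passes. The invariant claims only that once the
guaranteed index `s` has been reached, the register holds some passing index. -/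
theorem run_testCode (h2 : h.nat 2 = 0) (hm : h.nat 6 = m) (h8 : h.nat 8 = m + 1)
    (hn : HasNums h m) (hid : h.mat m 29 = 1)
    (hex : ∃ s ≤ m, ∑ i, ∑ j, ‖(gapOp (phase m s • h.mat m 22) ^ h.nat 7) i j‖ ^ 2 ≤ 1 / 4) :
    (testCode.run O h).nat 15 ≤ m ∧ ∑ i, ∑ j, ‖(gapOp (phase m ((testCode.run O h).nat 15) •
      h.mat m 22) ^ h.nat 7) i j‖ ^ 2 ≤ 1 / 4 := by
  obtain ⟨s, hs, hpass⟩ := hex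
  have := run_loop O (v := 13) (n := 8) (p := testBody) h (fun k h' => s < k →
    h'.nat 15 ≤ m ∧ ∑ i, ∑ j, ‖(gapOp (phase m (h'.nat 15) •
      h.mat m 22) ^ h.nat 7) i j‖ ^ 2 ≤ 1 / 4) (fun h => absurd h (Nat.not_lt_zero _))
    (fun k hk h' hv hr ha hI hsk => by
      rw [h8] at hk
      have b := run_testBody (O := O) (h := h') (m := m) ((hr 2 (by decide) rfl).trans h2)
        ((hr 6 (by decide) rfl).trans hm) (hn.of_eq (ha 40 rfl)) (by omega)
        (by rw [CStore.mat, ha 29 rfl]; exact hid)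
      have e22 : h'.mat m 22 = h.mat m 22 := by rw [CStore.mat, CStore.mat, ha 22 rfl]
      rw [hv, e22, hr 7 (by decide) rfl] at b
      rw [CStore.nat_setNat_of_ne _ _ (show 15 ≠ 13 by decide), b]
      split_ifs with hp
      · exact ⟨by omega, hp⟩
      · refine hI (lt_of_le_of_ne (by omega) ?_)
        rintro rfl
        exact hp hpass)
  exact this (by omega)

/-- The approximate logarithm of the rotated matrix, to array `28`. -/
def logCode : Code := seq (phaseCode 15) (seq (ew 23 (.mul (scalar 30) (entry 22 10 11)))
  (seq (ew 26 (entry 29 10 11)) (seq (ew 28 (.num 0)) (seq (set ⟨32, 2, 2⟩ .one)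
  (seq (set ⟨33, 2, 2⟩ (.num 0)) (loop 13 7 (seq (mm 27 26 23) (seq (ew 26 (entry 27 10 11))
    (seq (adj 24 26) (seq (set ⟨33, 2, 2⟩ (.add (scalar 33) .one))
    (seq (ew 28 (.add (entry 28 10 11) (.mul (.divRe (.mul (.sub (.num 0) .imag) (scalar 32))
      (scalar 33)) (.sub (entry 26 10 11) (entry 24 10 11)))))
    (set ⟨32, 2, 2⟩ (.sub (.num 0) (scalar 32))))))))))))))

/-- In the main loop array `26` carries the power `X^k`, array `28` the partial sum, and the scalars
`32` and `33` the sign `(-1)^k` and the number `k`. -/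
theorem mat_logCode (h2 : h.nat 2 = 0) (hm : h.nat 6 = m) (hn : HasNums h m)
    (hs : h.nat 15 ≤ m) (hid : h.mat m 29 = 1) :
    (logCode.run O h).mat m 28 = argSeries (h.nat 7) (phase m (h.nat 15) • h.mat m 22) := by
  set h1 := (phaseCode 15).run O h with e1
  set h3 := (ew 23 (.mul (scalar 30) (entry 22 10 11))).run O h1 with e3
  set h4 := (ew 26 (entry 29 10 11)).run O h3 with e4
  set h5 := (ew 28 (.num 0)).run O h4 with e5
  set h6 := (set ⟨32, 2, 2⟩ .one).run O h5 with e6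
  set h7 := (set ⟨33, 2, 2⟩ (.num 0)).run O h6 with e7
  have m1 : h1.nat 6 = m := (run_nat O rfl _).trans hm
  have m3 : h3.nat 6 = m := (run_nat O rfl _).trans m1
  have m4 : h4.nat 6 = m := (run_nat O rfl _).trans m3
  have m5 : h5.nat 6 = m := (run_nat O rfl _).trans m4
  have m7 : h7.nat 6 = m := m5
  have z1 : h1.nat 2 = 0 := (run_nat O rfl _).trans h2
  have z5 : h5.nat 2 = 0 := (run_nat O rfl _).trans ((run_nat O rfl _).trans
    ((run_nat O rfl _).trans z1))
  have z7 : h7.nat 2 = 0 := z5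
  have n7 : h7.nat 7 = h.nat 7 := (run_nat O rfl _ : h7.nat 7 = h6.nat 7).trans
    ((run_nat O rfl _ : h6.nat 7 = h5.nat 7).trans ((run_nat O rfl _).trans ((run_nat O rfl _).trans
    ((run_nat O rfl _).trans (run_nat O rfl _)))))
  have v3 : h3.mat m 23 = phase m (h.nat 15) • h.mat m 22 := by
    rw [e3, mat_smulCode m1 z1 (by decide) (by decide), e1, run_phaseCode h2 hm hn hs,
      mat_run_of_not_mem rfl]
  have i3 : h3.mat m 29 = 1 := (mat_run_of_not_mem rfl).trans ((mat_run_of_not_mem rfl).trans hid)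
  have v4 : h4.mat m 26 = 1 := (mat_copyCode m3 (by decide)).trans i3
  have v5 : h5.mat m 28 = 0 := mat_ew m4 _ fun i j h' _ _ _ _ _ => by
    rw [CExpr.eval_num]
    simp
  have x7 : h7.mat m 23 = phase m (h.nat 15) • h.mat m 22 := by
    rw [← v3, e7, mat_run_of_not_mem rfl, e6, mat_run_of_not_mem rfl, e5, mat_run_of_not_mem rfl,
      e4, mat_run_of_not_mem rfl]
  have p7 : h7.mat m 26 = 1 := by
    rw [← v4, e7, mat_run_of_not_mem rfl, e6, mat_run_of_not_mem rfl, e5, mat_run_of_not_mem rfl]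
  have l7 : h7.mat m 28 = 0 := by
    rw [← v5, e7, mat_run_of_not_mem rfl, e6, mat_run_of_not_mem rfl]
  have s7 : h7.arr 32 0 0 = 1 := by
    rw [e7, run_arr O rfl, e6, run_setScalar z5]
    rfl
  have c7 : h7.arr 33 0 0 = 0 := by
    rw [e7, run_setScalar (show h6.nat 2 = 0 from z5), CExpr.eval_num, Nat.cast_zero]
  set X := phase m (h.nat 15) • h.mat m 22 with hX
  have := run_loop O (v := 13) (n := 7) (p := seq (mm 27 26 23) (seq (ew 26 (entry 27 10 11))
    (seq (adj 24 26) (seq (set ⟨33, 2, 2⟩ (.add (scalar 33) .one))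
    (seq (ew 28 (.add (entry 28 10 11) (.mul (.divRe (.mul (.sub (.num 0) .imag) (scalar 32))
      (scalar 33)) (.sub (entry 26 10 11) (entry 24 10 11)))))
    (set ⟨32, 2, 2⟩ (.sub (.num 0) (scalar 32)))))))) h7
    (fun k h' => h'.mat m 26 = X ^ k ∧ h'.mat m 28 = argSeries k X ∧ h'.arr 32 0 0 = (-1) ^ k ∧
      h'.arr 33 0 0 = k)
    ⟨p7, by rw [argSeries, Finset.sum_range_zero]; exact l7, by rw [pow_zero]; exact s7,
      by rw [Nat.cast_zero]; exact c7⟩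
    (fun k hk h' hv hr ha hI => by
      obtain ⟨I1, I2, I3, I4⟩ := hI
      have x0 : h'.mat m 23 = X := by rw [← x7, CStore.mat, CStore.mat, ha 23 rfl]
      have q0 : h'.nat 6 = m := (hr 6 (by decide) rfl).trans m7
      have w0 : h'.nat 2 = 0 := (hr 2 (by decide) rfl).trans z7
      set g1 := (mm 27 26 23).run O h' with d1
      set g2 := (ew 26 (entry 27 10 11)).run O g1 with d2
      set g3 := (adj 24 26).run O g2 with d3
      set g4 := (set ⟨33, 2, 2⟩ (.add (scalar 33) .one)).run O g3 with d4
      set g5 := (ew 28 (.add (entry 28 10 11) (.mul (.divRe (.mul (.sub (.num 0) .imag) (scalar 32))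
        (scalar 33)) (.sub (entry 26 10 11) (entry 24 10 11))))).run O g4 with d5
      have q1 : g1.nat 6 = m := (run_nat O rfl _).trans q0
      have q2 : g2.nat 6 = m := (run_nat O rfl _).trans q1
      have q4 : g4.nat 6 = m := (run_nat O rfl _ : g4.nat 6 = g3.nat 6).trans
        ((run_nat O rfl _).trans q2)
      have w3 : g3.nat 2 = 0 := (run_nat O rfl _).trans ((run_nat O rfl _).trans
        ((run_nat O rfl _).trans w0))
      have w4 : g4.nat 2 = 0 := w3
      have w5 : g5.nat 2 = 0 := (run_nat O rfl _).trans w4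
      have u1 : g1.mat m 27 = X ^ (k + 1) := by
        rw [d1, mat_mm q0 (by decide) (by decide), I1, x0, pow_succ]
      have u2 : g2.mat m 26 = X ^ (k + 1) := (mat_copyCode q1 (by decide)).trans u1
      have u3 : g3.mat m 24 = star (X ^ (k + 1)) := by
        rw [d3, mat_adj q2 (by decide), u2]
      have t4 : g4.mat m 24 = star (X ^ (k + 1)) := by rw [d4, mat_run_of_not_mem rfl, u3]
      have t26 : g4.mat m 26 = X ^ (k + 1) := by
        rw [d4, mat_run_of_not_mem rfl, d3, mat_run_of_not_mem rfl, u2]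
      have t28 : g4.mat m 28 = argSeries k X := by
        rw [d4, mat_run_of_not_mem rfl, d3, mat_run_of_not_mem rfl, d2, mat_run_of_not_mem rfl, d1,
          mat_run_of_not_mem rfl, I2]
      have t32 : g4.arr 32 0 0 = (-1) ^ k := by
        rw [d4, run_arr O rfl, d3, run_arr O rfl, d2, run_arr O rfl, d1, run_arr O rfl, I3]
      have t33 : g4.arr 33 0 0 = k + 1 := by
        rw [d4, run_setScalar w3]
        simp only [CExpr.eval, CStore.get, w3]
        rw [d3, run_arr O rfl, d2, run_arr O rfl, d1, run_arr O rfl, I4]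
      have u5 : g5.mat m 28 = argSeries (k + 1) X := mat_ew q4 _ fun i j h'' r1 r2 r3 r4 r5 => by
        have y24 : g4.arr 24 i j = star (X ^ (k + 1)) i j := congrFun (congrFun t4 i) j
        have y26 : g4.arr 26 i j = (X ^ (k + 1)) i j := congrFun (congrFun t26 i) j
        have y28 : g4.arr 28 i j = argSeries k X i j := congrFun (congrFun t28 i) j
        have hre : ((k : ℂ) + 1).re = (k : ℝ) + 1 := by simp
        simp only [CExpr.eval, CStore.get, r1, r2, r3 2 (by decide) (by decide), w4,
          r4 26 (by decide), r4 24 (by decide), r4 32 (by decide), r4 33 (by decide), r5, t32, t33,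
          CExpr.eval_num, y24, y26, y28, hre]
        have hsum : argSeries (k + 1) X = argSeries k X +
            (-Complex.I * ((-1) ^ k / ((k : ℂ) + 1))) • (X ^ (k + 1) - star (X ^ (k + 1))) :=
          Finset.sum_range_succ _ _
        rw [hsum, Matrix.add_apply, Matrix.smul_apply, Matrix.sub_apply, smul_eq_mul]
        push_cast
        ring
      refine ⟨?_, ?_, ?_, ?_⟩
      · change ((set ⟨32, 2, 2⟩ (.sub (.num 0) (scalar 32))).run O g5).mat m 26 = _
        rw [mat_run_of_not_mem rfl, d5, mat_run_of_not_mem rfl, t26]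
      · change ((set ⟨32, 2, 2⟩ (.sub (.num 0) (scalar 32))).run O g5).mat m 28 = _
        rw [mat_run_of_not_mem rfl, u5]
      · change ((set ⟨32, 2, 2⟩ (.sub (.num 0) (scalar 32))).run O g5).arr 32 0 0 = _
        rw [run_setScalar w5]
        simp only [CExpr.eval, CStore.get, w5, CExpr.eval_num]
        rw [d5, run_arr O rfl, t32, pow_succ]
        push_cast
        ring
      · change ((set ⟨32, 2, 2⟩ (.sub (.num 0) (scalar 32))).run O g5).arr 33 0 0 = _
        rw [run_arr O rfl, d5, run_arr O rfl, t33]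
        push_cast
        rfl)
  rw [n7] at this
  exact this.2.1

end Code
end RealRAM

namespace RealRAM

/-! ### The coefficients of the polynomial -/

/-- The array `a` holds the coefficients of `P`, of degree at most `D`, shifted by one. -/
structure Holds (D : ℕ) (h : CStore) (a : ℕ) (P : CanonicalPoly) : Prop where
  arr : ∀ u v, h.arr a u v = if u = 0 ∨ v = 0 then 0 else P (u - 1, v - 1)
  deg : P.DegLE D

theorem Holds.of_eq {D a : ℕ} {h h' : CStore} {P : CanonicalPoly} (hP : Holds D h a P)
    (e : h'.arr a = h.arr a) : Holds D h' a P :=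
  ⟨fun u v => by rw [e, hP.arr], hP.deg⟩

theorem Holds.arr_succ {D a : ℕ} {h : CStore} {P : CanonicalPoly} (hP : Holds D h a P) (j k : ℕ) :
    h.arr a (j + 1) (k + 1) = P (j, k) := by
  rw [hP.arr, if_neg (by omega)]
  rfl

namespace Code

variable {O : ℕ → ℕ → ℂ} {h : CStore}

/-- Set the coefficients in array `C`; the bound for the exponents is in register `9`. -/
def psweep (C : ℕ) (e : CExpr) : Code := sweep 16 17 9 (seq (natAdd 18 16 1) (seq (natAdd 20 17 1)
  (seq (natAdd 19 18 1) (set ⟨C, 18, 20⟩ e))))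

/-- The sweep covers the square of exponents up to `D`. Outside it the entries of the old polynomial
remain, and they are zero, as those of the new one must be, because both degrees are at most `D`. -/
theorem holds_psweep {C D : ℕ} {e : CExpr} {P Q : CanonicalPoly} (h1 : h.nat 1 = 1)
    (h9 : h.nat 9 = D + 1) (hQ : Holds D h C Q) (hP : P.DegLE D)
    (he : ∀ j k, j ≤ D → ∀ h' : CStore, h'.nat 16 = j → h'.nat 17 = k → h'.nat 18 = j + 1 →
      h'.nat 19 = j + 1 + 1 → h'.nat 20 = k + 1 → (∀ r < 16, h'.nat r = h.nat r) →
      (∀ a, a ≠ C → h'.arr a = h.arr a) → h'.arr C (j + 1) (k + 1) = Q (j, k) →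
      e.eval h' = P (j, k)) :
    Holds D ((psweep C e).run O h) C P := by
  refine ⟨fun u v => ?_, hP⟩
  have := run_sweep O (p := seq (natAdd 18 16 1) (seq (natAdd 20 17 1)
    (seq (natAdd 19 18 1) (set ⟨C, 18, 20⟩ e)))) (C := C) 1 (h := h) (fun j k => P (j, k))
    (show 16 ≠ 17 by decide) (show 9 ≠ 17 by decide) (show 9 ≠ 16 by decide) rfl rfl
    (fun i hi j hj h' r16 r17 hr ha hC a b => by
      set g := ((h'.setNat 18 (h'.nat 16 + h'.nat 1)).setNat 20
        ((h'.setNat 18 (h'.nat 16 + h'.nat 1)).nat 17 +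
        (h'.setNat 18 (h'.nat 16 + h'.nat 1)).nat 1)).setNat 19
        (((h'.setNat 18 (h'.nat 16 + h'.nat 1)).setNat 20
        ((h'.setNat 18 (h'.nat 16 + h'.nat 1)).nat 17 +
        (h'.setNat 18 (h'.nat 16 + h'.nat 1)).nat 1)).nat 18 +
        ((h'.setNat 18 (h'.nat 16 + h'.nat 1)).setNat 20
        ((h'.setNat 18 (h'.nat 16 + h'.nat 1)).nat 17 +
        (h'.setNat 18 (h'.nat 16 + h'.nat 1)).nat 1)).nat 1) with hg
      have r1 : h'.nat 1 = 1 := (hr 1 (by decide) (by decide) rfl).trans h1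
      have g18 : g.nat 18 = i + 1 := by simp [hg, CStore.setNat, r16, r1]
      have g20 : g.nat 20 = j + 1 := by simp [hg, CStore.setNat, r17, r1]
      refine (CStore.arr_set g ⟨C, 18, 20⟩ (e.eval g) a b).trans ?_
      rw [he i j (by omega) g (by simp [hg, CStore.setNat, r16]) (by simp [hg, CStore.setNat, r17]) g18
        (by simp [hg, CStore.setNat, r16, r1]) g20 (fun r hr16 => ?_)
        (fun a ha' => ha a (by simp [arrWrites, ha'])) (hC.trans (hQ.arr_succ i j))]
      · simp only [g18, g20]
        rfl
      · rw [← hr r (by omega) (by omega) (by simp [natWrites]; omega)]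
        simp only [hg, CStore.setNat, Function.update_apply]
        rw [if_neg (by omega), if_neg (by omega), if_neg (by omega)]) u v
  refine this.trans ?_
  rw [h9]
  split_ifs with q1 q2 q2
  · omega
  · rfl
  · rw [hQ.arr, if_pos q2]
  · rw [hQ.arr, if_neg q2, hQ.deg _ _ (by omega), hP _ _ (by omega)]

/-- The conditions under which the polynomial programs run. -/
structure PolyEnv (D : ℕ) (h : CStore) : Prop where
  one : h.nat 1 = 1
  zero : h.nat 2 = 0
  bound : h.nat 9 = D + 1
  nums : HasNums h (D + 1)
  free : ∀ a, 50 ≤ a → a ≤ 55 → ∃ Q, Holds D h a Q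

theorem PolyEnv.run {D : ℕ} (hE : PolyEnv D h) {p : Code} (p1 : p.natWrites.contains 1 = false)
    (p2 : p.natWrites.contains 2 = false) (p9 : p.natWrites.contains 9 = false)
    (pn : p.arrWrites.contains 40 = false)
    (hf : ∀ a, 50 ≤ a → a ≤ 55 → p.arrWrites.contains a = true → ∃ Q, Holds D (p.run O h) a Q) :
    PolyEnv D (p.run O h) where
  one := (run_nat O p1 h).trans hE.one
  zero := (run_nat O p2 h).trans hE.zero
  bound := (run_nat O p9 h).trans hE.bound
  nums := hE.nums.of_eq (run_arr O pn h)
  free a h1 h2 := by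
    cases hc : p.arrWrites.contains a with
    | true => exact hf a h1 h2 hc
    | false =>
      obtain ⟨Q, hQ⟩ := hE.free a h1 h2
      exact ⟨Q, hQ.of_eq (run_arr O hc h)⟩

theorem PolyEnv.setNat {D : ℕ} (hE : PolyEnv D h) {v : ℕ} (h1 : v ≠ 1) (h2 : v ≠ 2) (h9 : v ≠ 9)
    (n : ℕ) : PolyEnv D (h.setNat v n) where
  one := (CStore.nat_setNat_of_ne h n h1.symm).trans hE.one
  zero := (CStore.nat_setNat_of_ne h n h2.symm).trans hE.zero
  bound := (CStore.nat_setNat_of_ne h n h9.symm).trans hE.bound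
  nums := hE.nums
  free a ha hb := by
    obtain ⟨Q, hQ⟩ := hE.free a ha hb
    exact ⟨Q, hQ.of_eq rfl⟩

theorem PolyEnv.of_psweep {D C : ℕ} (hE : PolyEnv D h) {e : CExpr} {P : CanonicalPoly}
    (hC : 50 ≤ C) (hP : Holds D ((psweep C e).run O h) C P) : PolyEnv D ((psweep C e).run O h) :=
  hE.run rfl rfl rfl (by simp [psweep, sweep, arrWrites]; omega) fun a h1 h2 ha => by
    have : a = C := by simpa [psweep, sweep, arrWrites] using ha
    exact ⟨P, this ▸ hP⟩

/-- Copy the polynomial in array `A` to array `C`. -/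
def pcopy (C A : ℕ) : Code := psweep C (entry A 18 20)

theorem holds_pcopy {D C A : ℕ} {P : CanonicalPoly} (hE : PolyEnv D h) (hC : 50 ≤ C) (hC' : C ≤ 55)
    (hA : A ≠ C) (hP : Holds D h A P) : Holds D ((pcopy C A).run O h) C P := by
  obtain ⟨Q, hQ⟩ := hE.free C hC hC'
  refine holds_psweep hE.one hE.bound hQ hP.deg fun j k _ h' _ _ r18 _ r20 _ ha _ => ?_
  rw [CExpr.eval, CStore.get, r18, r20, ha A hA, hP.arr_succ]

/-- Apply the ladder operator to the polynomial in array `A`, with the result in array `C`. -/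
def pladder (C A : ℕ) (σ : CExpr) : Code := psweep C (.divRe (.add (entry A 16 20)
  (.mul σ (.add (.mul .imag (entry A 18 17)) (.mul (entry 40 18 2) (entry A 19 20)))))
  (.sqrtRe (.num 2)))

/-- Because of the shift by one, the entries at exponents `j - 1` and `k - 1` are read from rows and
columns `j` and `k`, and for `j = 0` or `k = 0` from the zero padding. So the code needs no case
distinction. -/
theorem holds_pladder {D C A : ℕ} {σ : CExpr} {z : ℂ} (hσ : ∀ h, σ.eval h = z) {P : CanonicalPoly}
    (hE : PolyEnv D h) (hC : 50 ≤ C) (hC' : C ≤ 55) (hA : A ≠ C) (hP : Holds D h A P)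
    (hD : (CanonicalPoly.ladder z P).DegLE D) :
    Holds D ((pladder C A σ).run O h) C (CanonicalPoly.ladder z P) := by
  obtain ⟨Q, hQ⟩ := hE.free C hC hC'
  refine holds_psweep hE.one hE.bound hQ hD fun j k hj h' r16 r17 r18 r19 r20 hr ha _ => ?_
  have r2 : h'.nat 2 = 0 := (hr 2 (by decide)).trans hE.zero
  have e1 : h'.arr 40 (j + 1) 0 = ((j + 1 : ℕ) : ℂ) := by
    rw [ha 40 (by omega)]
    exact hE.nums (j + 1) (by omega)
  have e2 : h'.arr A j (k + 1) = if j = 0 then 0 else P (j - 1, k) := by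
    rw [ha A hA, hP.arr]
    simp
  have e3 : h'.arr A (j + 1) k = if k = 0 then 0 else P (j, k - 1) := by
    rw [ha A hA, hP.arr]
    simp
  have e4 : h'.arr A (j + 1 + 1) (k + 1) = P (j + 1, k) := by rw [ha A hA, hP.arr_succ]
  have e5 : (((2 : ℕ) : ℂ)).re = 2 := by simp
  simp only [CExpr.eval, CStore.get, r16, r17, r18, r19, r20, r2, e1, e2, e3, e4, hσ,
    CExpr.eval_num, e5, Complex.ofReal_re, CanonicalPoly.ladder_apply]
  push_cast
  ring

/-- Apply `x + y n̂` to the polynomial in array `A`. -/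
def paffine (A : ℕ) (x y : CExpr) : Code := seq (pladder 53 A .one)
  (seq (pladder 54 53 (.sub (.num 0) .one))
  (psweep A (.add (.mul x (entry A 18 20)) (.mul y (entry 54 18 20)))))

/-- Arrays `53` and `54` are scratch space. The coefficients may depend on registers below `16` and
on the table of integers, which the intermediate steps leave alone. -/
theorem holds_paffine {D A : ℕ} {x y : CExpr} {a b : ℂ} {P : CanonicalPoly} (hE : PolyEnv D h)
    (hA : 50 ≤ A) (hA' : A ≤ 55) (h53 : A ≠ 53) (h54 : A ≠ 54) (hP : Holds D h A P)
    (hx : ∀ h' : CStore, (∀ r < 16, h'.nat r = h.nat r) → h'.arr 40 = h.arr 40 → x.eval h' = a)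
    (hy : ∀ h' : CStore, (∀ r < 16, h'.nat r = h.nat r) → h'.arr 40 = h.arr 40 → y.eval h' = b)
    {d : ℕ} (hd : P.DegLE d) (hdD : d + 2 ≤ D) :
    Holds D ((paffine A x y).run O h) A (CanonicalPoly.affineNumber a b P) ∧
      PolyEnv D ((paffine A x y).run O h) := by
  set g1 := (pladder 53 A .one).run O h with e1
  set g2 := (pladder 54 53 (.sub (.num 0) .one)).run O g1 with e2
  have p1 : Holds D g1 53 (CanonicalPoly.ladder 1 P) := holds_pladder (fun _ => rfl) hE (by decide)
    (by decide) h53 hP ((hd.ladder 1).mono (by omega))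
  have E1 : PolyEnv D g1 := hE.of_psweep (by decide) p1
  have p2 : Holds D g2 54 (CanonicalPoly.ladder (-1) (CanonicalPoly.ladder 1 P)) :=
    holds_pladder (fun h => by rw [CExpr.eval, CExpr.eval_num]; simp [CExpr.eval]) E1 (by decide)
      (by decide) (by decide) p1 (((hd.ladder 1).ladder (-1)).mono (by omega))
  have E2 : PolyEnv D g2 := E1.of_psweep (by decide) p2
  have c1 : g1.arr A = h.arr A := run_arr O (by simp [pladder, psweep, sweep, arrWrites, h53]) h
  have c2 : g2.arr A = g1.arr A :=
    run_arr O (by simp [pladder, psweep, sweep, arrWrites, h54]) g1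
  have r1 : ∀ r < 16, g1.nat r = h.nat r := fun r hr => run_nat O
    (by simp [pladder, psweep, sweep, natWrites]; omega) h
  have r2 : ∀ r < 16, g2.nat r = g1.nat r := fun r hr => run_nat O
    (by simp [pladder, psweep, sweep, natWrites]; omega) g1
  have n1 : g1.arr 40 = h.arr 40 := run_arr O rfl h
  have n2 : g2.arr 40 = g1.arr 40 := run_arr O rfl g1
  have p3 : Holds D ((psweep A (.add (.mul x (entry A 18 20)) (.mul y (entry 54 18 20)))).run O g2) A
      (CanonicalPoly.affineNumber a b P) := by
    refine holds_psweep E2.one E2.bound ((hP.of_eq c1).of_eq c2) ((hd.affineNumber a b).mono hdD)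
      fun j k _ h' _ _ r18 _ r20 hr ha hC => ?_
    have q1 : ∀ r < 16, h'.nat r = h.nat r := fun r h16 =>
      (hr r h16).trans ((r2 r h16).trans (r1 r h16))
    have q2 : h'.arr 40 = h.arr 40 := (ha 40 (by omega)).trans (n2.trans n1)
    simp only [CExpr.eval, CStore.get, r18, r20, hx h' q1 q2, hy h' q1 q2, hC, ha 54 h54.symm,
      p2.arr_succ, CanonicalPoly.affineNumber, Finsupp.add_apply, Finsupp.smul_apply, smul_eq_mul]
  exact ⟨p3, E2.of_psweep hA p3⟩

/-- Apply the polynomial `∏ (1 - n̂ / (k + 1))` to array `52`. -/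
def vacuumCode : Code := loop 13 6 (paffine 52 .one
  (.divRe (.sub (.num 0) .one) (.add (entry 40 13 2) .one)))

theorem holds_vacuumCode {D m d : ℕ} {P : CanonicalPoly} (hE : PolyEnv D h) (hm : h.nat 6 = m)
    (hP : Holds D h 52 P) (hd : P.DegLE d) (hD : d + 2 * m ≤ D) :
    Holds D (vacuumCode.run O h) 52 (P.vacuum m) ∧ PolyEnv D (vacuumCode.run O h) := by
  have := run_loop O (v := 13) (n := 6) (p := paffine 52 .one
    (.divRe (.sub (.num 0) .one) (.add (entry 40 13 2) .one))) h
    (fun k h' => Holds D h' 52 (P.vacuum k) ∧ PolyEnv D h')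
    ⟨hP.of_eq rfl, hE.setNat (by decide) (by decide) (by decide) 0⟩
    (fun k hk h' hv hr ha hI => by
      have key := holds_paffine (O := O) (A := 52) (x := .one)
        (y := .divRe (.sub (.num 0) .one) (.add (entry 40 13 2) .one)) (a := 1)
        (b := -1 / ((k : ℂ) + 1)) hI.2 (by decide) (by decide) (by decide) (by decide) hI.1
        (fun _ _ _ => rfl) (fun h'' r40 a40 => by
          have e : h''.arr 40 k 0 = k := by
            rw [a40]
            exact hI.2.nums k (by omega)
          have hre : ((k : ℂ) + 1).re = (k : ℝ) + 1 := by simp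
          simp only [CExpr.eval, CStore.get, r40 13 (by decide), r40 2 (by decide), hv, hI.2.zero, e,
            CExpr.eval_num, hre]
          push_cast
          ring) (hd.vacuum k) (by omega)
      exact ⟨key.1.of_eq rfl, key.2.setNat (by decide) (by decide) (by decide) _⟩)
  rw [hm] at this
  exact this

/-- Apply the polynomial `∏ (n̂ - k) ^ 2` to array `55`. -/
def confiningCode : Code := loop 13 8 (seq (paffine 55 (.sub (.num 0) (entry 40 13 2)) .one)
  (paffine 55 (.sub (.num 0) (entry 40 13 2)) .one))

theorem holds_confiningCode {D m d : ℕ} {P : CanonicalPoly} (hE : PolyEnv D h) (hm : h.nat 8 = m)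
    (hP : Holds D h 55 P) (hd : P.DegLE d) (hD : d + 4 * m ≤ D) :
    Holds D (confiningCode.run O h) 55 (P.confining m) ∧ PolyEnv D (confiningCode.run O h) := by
  have := run_loop O (v := 13) (n := 8)
    (p := seq (paffine 55 (.sub (.num 0) (entry 40 13 2)) .one)
      (paffine 55 (.sub (.num 0) (entry 40 13 2)) .one)) h
    (fun k h' => Holds D h' 55 (P.confining k) ∧ PolyEnv D h')
    ⟨hP.of_eq rfl, hE.setNat (by decide) (by decide) (by decide) 0⟩
    (fun k hk h' hv hr ha hI => by
      have step : ∀ (g : CStore) (Q : CanonicalPoly) (d' : ℕ), g.nat 13 = k → PolyEnv D g →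
          Holds D g 55 Q → Q.DegLE d' → d' + 2 ≤ D →
          Holds D ((paffine 55 (.sub (.num 0) (entry 40 13 2)) .one).run O g) 55
            (CanonicalPoly.affineNumber (-(k : ℂ)) 1 Q) ∧
          PolyEnv D ((paffine 55 (.sub (.num 0) (entry 40 13 2)) .one).run O g) :=
        fun g Q d' g13 hg hQ hd' hdD => holds_paffine hg (by decide) (by decide) (by decide)
          (by decide) hQ (fun h'' r40 a40 => by
            have e : h''.arr 40 k 0 = k := by
              rw [a40]
              exact hg.nums k (by omega)
            simp only [CExpr.eval, CStore.get, r40 13 (by decide), r40 2 (by decide), g13, hg.zero, e,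
              CExpr.eval_num, Nat.cast_zero, zero_sub]) (fun _ _ _ => rfl) hd' hdD
      have s1 := step h' _ _ hv hI.2 hI.1 (hd.confining k) (by omega)
      have s2 := step _ _ _ ((run_nat O rfl _).trans hv) s1.2 s1.1
        ((hd.confining k).affineNumber _ _) (by omega)
      exact ⟨s2.1.of_eq rfl, s2.2.setNat (by decide) (by decide) (by decide) _⟩)
  rw [hm] at this
  exact this

end Code
end RealRAM

namespace RealRAM
namespace Code

variable {O : ℕ → ℕ → ℂ} {h : CStore}

/-! ### The program for the block Hamiltonian -/

/-- Add a multiple of array `52` to array `50`, and apply the creation operator to array `52`. -/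
def columnCode : Code :=
  seq (psweep 50 (.add (entry 50 18 20) (.mul (.divRe (entry 28 10 11) (.mul (scalar 34) (scalar 35)))
    (entry 52 18 20)))) (seq (pladder 53 52 (.sub (.num 0) .one)) (seq (pcopy 52 53)
  (seq (natAdd 12 10 1) (set ⟨34, 2, 2⟩ (.mul (scalar 34) (.sqrtRe (entry 40 12 2)))))))

/-- The scalars `s` and `t` will be `√(i!)` and `√(j!)`; the first is multiplied by `√(i + 1)` on
the way, so no factorial is ever computed. -/
theorem run_columnCode {D d i j : ℕ} {S Q : CanonicalPoly} {s t : ℝ} (hE : PolyEnv D h)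
    (h10 : h.nat 10 = i) (h11 : h.nat 11 = j) (hi : i ≤ D) (hS : Holds D h 50 S)
    (hQ : Holds D h 52 Q) (hd : Q.DegLE d) (hdD : d + 1 ≤ D) (hs : h.arr 34 0 0 = s)
    (ht : h.arr 35 0 0 = t) :
    Holds D (columnCode.run O h) 50 (S + (h.arr 28 i j / ((s : ℂ) * t)) • Q) ∧
    Holds D (columnCode.run O h) 52 (CanonicalPoly.ladder (-1) Q) ∧
    (columnCode.run O h).arr 34 0 0 = ((s * Real.sqrt (i + 1 : ℝ) : ℝ) : ℂ) ∧
    PolyEnv D (columnCode.run O h) := by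
  set g1 := (psweep 50 (.add (entry 50 18 20) (.mul (.divRe (entry 28 10 11)
    (.mul (scalar 34) (scalar 35))) (entry 52 18 20)))).run O h with e1
  set g2 := (pladder 53 52 (.sub (.num 0) .one)).run O g1 with e2
  set g3 := (pcopy 52 53).run O g2 with e3
  set g4 := g3.setNat 12 (g3.nat 10 + g3.nat 1) with e4
  have p1 : Holds D g1 50 (S + (h.arr 28 i j / ((s : ℂ) * t)) • Q) := by
    refine holds_psweep hE.one hE.bound hS (hS.deg.add (hQ.deg.smul _))
      fun j' k _ h' _ _ r18 _ r20 hr ha hC => ?_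
    simp only [CExpr.eval, CStore.get, r18, r20, hr 2 (by decide), hE.zero, hr 10 (by decide),
      hr 11 (by decide), h10, h11, ha 28 (by decide), ha 34 (by decide), ha 35 (by decide),
      ha 52 (by decide), hs, ht, hC, hQ.arr_succ, Finsupp.add_apply, Finsupp.smul_apply, smul_eq_mul]
    rw [← Complex.ofReal_mul, Complex.ofReal_re]
  have E1 : PolyEnv D g1 := hE.of_psweep (by decide) p1
  have q1 : Holds D g1 52 Q := hQ.of_eq (run_arr O rfl h)
  have p2 : Holds D g2 53 (CanonicalPoly.ladder (-1) Q) :=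
    holds_pladder (fun h => by rw [CExpr.eval, CExpr.eval_num]; simp [CExpr.eval]) E1 (by decide)
      (by decide) (by decide) q1 ((hd.ladder (-1)).mono hdD)
  have E2 : PolyEnv D g2 := E1.of_psweep (by decide) p2
  have p3 : Holds D g3 52 (CanonicalPoly.ladder (-1) Q) :=
    holds_pcopy E2 (by decide) (by decide) (by decide) p2
  have E3 : PolyEnv D g3 := E2.of_psweep (by decide) p3
  have p4 : Holds D g3 50 (S + (h.arr 28 i j / ((s : ℂ) * t)) • Q) :=
    (p1.of_eq (run_arr O rfl g1 : g2.arr 50 = g1.arr 50)).of_eq (run_arr O rfl g2)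
  have r10 : g3.nat 10 = i := (run_nat O rfl g2).trans ((run_nat O rfl g1).trans
    ((run_nat O rfl h).trans h10))
  have a34 : g3.arr 34 0 0 = s := by
    rw [e3, run_arr O rfl, e2, run_arr O rfl, e1, run_arr O rfl, hs]
  have E4 : PolyEnv D g4 := E3.setNat (by decide) (by decide) (by decide) _
  have r12 : g4.nat 12 = i + 1 := by rw [e4, CStore.nat_setNat_self, r10, E3.one]
  have E5 : PolyEnv D ((set ⟨34, 2, 2⟩ (.mul (scalar 34) (.sqrtRe (entry 40 12 2)))).run O g4) :=
    E4.run rfl rfl rfl rfl fun a h1 h2 ha => by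
      have : a = 34 := by simpa [arrWrites] using ha
      omega
  refine ⟨(p4.of_eq rfl : Holds D g4 50 _).of_eq (run_arr O rfl g4),
    (p3.of_eq rfl : Holds D g4 52 _).of_eq (run_arr O rfl g4), ?_, E5⟩
  refine (run_setScalar (O := O) (a := 34) E4.zero).trans ?_
  have e40 : g4.arr 40 (i + 1) 0 = ((i + 1 : ℕ) : ℂ) := E4.nums (i + 1) (by omega)
  simp only [CExpr.eval, CStore.get, E4.zero, r12, e40, Complex.natCast_re]
  rw [show g4.arr 34 0 0 = s from a34]
  push_cast
  rfl

theorem sqrt_factorial_succ (n : ℕ) :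
    Real.sqrt (n.factorial : ℝ) * Real.sqrt (n + 1 : ℝ) = Real.sqrt ((n + 1).factorial : ℝ) := by
  rw [← Real.sqrt_mul (by positivity), Nat.factorial_succ]
  push_cast
  ring_nf

/-- The contribution of one column, and the annihilation operator applied to array `51`. -/
def blockBody : Code := seq (pcopy 52 51) (seq vacuumCode (seq (set ⟨34, 2, 2⟩ .one)
  (seq (loop 10 6 columnCode) (seq (pladder 53 51 .one) (seq (pcopy 51 53) (seq (natAdd 12 11 1)
    (set ⟨35, 2, 2⟩ (.mul (scalar 35) (.sqrtRe (entry 40 12 2))))))))))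

/-- The polynomial of `a^j` in array `51` is carried along the columns, and that of `a†^i v(n̂) a^j`
in array `52` along the rows. Each step thus costs one application of a ladder operator instead of a
product of polynomials. -/
theorem run_blockBody {D m j : ℕ} {S : CanonicalPoly} (hE : PolyEnv D h) (h6 : h.nat 6 = m)
    (h11 : h.nat 11 = j) (hj : j < m) (hD : 4 * m ≤ D) (hS : Holds D h 50 S)
    (hQ : Holds D h 51 ((CanonicalPoly.ladder 1)^[j] CanonicalPoly.unit))
    (ht : h.arr 35 0 0 = (Real.sqrt (j.factorial : ℝ) : ℂ)) :
    Holds D (blockBody.run O h) 50 (S + ∑ i ∈ Finset.range m, CanonicalPoly.blockCoeff (h.arr 28) i j •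
      (CanonicalPoly.ladder (-1))^[i]
        (CanonicalPoly.vacuum ((CanonicalPoly.ladder 1)^[j] CanonicalPoly.unit) m)) ∧
    Holds D (blockBody.run O h) 51 ((CanonicalPoly.ladder 1)^[j + 1] CanonicalPoly.unit) ∧
    (blockBody.run O h).arr 35 0 0 = (Real.sqrt ((j + 1).factorial : ℝ) : ℂ) ∧
    PolyEnv D (blockBody.run O h) := by
  set R := (CanonicalPoly.ladder 1)^[j] CanonicalPoly.unit with hR
  have dR : R.DegLE (0 + j) := CanonicalPoly.degLE_unit.ladder_iterate 1 j
  have dV : (R.vacuum m).DegLE (0 + j + 2 * m) := dR.vacuum m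
  set g1 := (pcopy 52 51).run O h with e1
  set g2 := vacuumCode.run O g1 with e2
  set g3 := (set ⟨34, 2, 2⟩ .one).run O g2 with e3
  set g4 := (loop 10 6 columnCode).run O g3 with e4
  set g5 := (pladder 53 51 .one).run O g4 with e5
  set g6 := (pcopy 51 53).run O g5 with e6
  set g7 := g6.setNat 12 (g6.nat 11 + g6.nat 1) with e7
  have p1 : Holds D g1 52 R := holds_pcopy hE (by decide) (by decide) (by decide) hQ
  have E1 : PolyEnv D g1 := hE.of_psweep (by decide) p1
  obtain ⟨p2, E2⟩ := holds_vacuumCode (O := O) E1 ((run_nat O rfl h).trans h6) p1 dR (by omega)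
  have E3 : PolyEnv D g3 := E2.run rfl rfl rfl rfl fun a h1 h2 ha => by
    have : a = 34 := by simpa [arrWrites] using ha
    omega
  have n3 : ∀ r < 13, g3.nat r = h.nat r := fun r hr => by
    have t1 : g1.nat r = h.nat r := run_nat O (by simp [pcopy, psweep, sweep, natWrites]; omega) h
    have t2 : g2.nat r = g1.nat r := run_nat O
      (by simp [vacuumCode, paffine, pladder, psweep, sweep, natWrites]; omega) g1
    exact t2.trans t1
  have t3 : ∀ a, (seq (pcopy 52 51) (seq vacuumCode (set ⟨34, 2, 2⟩ .one))).arrWrites.contains a = false →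
      g3.arr a = h.arr a := fun a ha => run_arr O ha h
  have S3 : Holds D g3 50 S := hS.of_eq (t3 50 rfl)
  have p3 : Holds D g3 52 (R.vacuum m) := p2.of_eq (run_arr O rfl g2)
  have s3 : g3.arr 34 0 0 = 1 := run_setScalar E2.zero
  have main := run_loop O (v := 10) (n := 6) (p := columnCode) g3 (fun k h' =>
    Holds D h' 50 (S + ∑ i ∈ Finset.range k, CanonicalPoly.blockCoeff (h.arr 28) i j •
      (CanonicalPoly.ladder (-1))^[i] (R.vacuum m)) ∧
    Holds D h' 52 ((CanonicalPoly.ladder (-1))^[k] (R.vacuum m)) ∧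
    h'.arr 34 0 0 = (Real.sqrt (k.factorial : ℝ) : ℂ) ∧ PolyEnv D h')
    ⟨by rw [Finset.sum_range_zero, add_zero]; exact S3.of_eq rfl, p3.of_eq rfl,
      by rw [Nat.factorial_zero, Nat.cast_one, Real.sqrt_one]; exact s3,
      E3.setNat (by decide) (by decide) (by decide) 0⟩
    (fun k hk h' hv hr ha hI => by
      obtain ⟨I1, I2, I3, I4⟩ := hI
      have hkm : k < m := by rwa [n3 6 (by decide), h6] at hk
      have a28 : h'.arr 28 = h.arr 28 := (ha 28 rfl).trans (t3 28 rfl)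
      have a35 : h'.arr 35 0 0 = (Real.sqrt (j.factorial : ℝ) : ℂ) := by
        rw [ha 35 rfl, t3 35 rfl, ht]
      obtain ⟨J1, J2, J3, J4⟩ := run_columnCode (O := O) I4 hv
        ((hr 11 (by decide) rfl).trans ((n3 11 (by decide)).trans h11)) (by omega) I1 I2
        (dV.ladder_iterate (-1) k) (by omega) I3 a35
      refine ⟨?_, ?_, ?_, J4.setNat (by decide) (by decide) (by decide) _⟩
      · rw [a28] at J1
        rw [Finset.sum_range_succ, ← add_assoc]
        exact J1.of_eq rfl
      · rw [Function.iterate_succ_apply']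
        exact J2.of_eq rfl
      · rw [← sqrt_factorial_succ]
        exact J3)
  rw [n3 6 (by decide), h6] at main
  obtain ⟨p4, -, -, E4⟩ := main
  have q4 : Holds D g4 51 R := (hQ.of_eq (t3 51 rfl)).of_eq (run_arr O rfl g3)
  have p5 : Holds D g5 53 (CanonicalPoly.ladder 1 R) := holds_pladder (fun _ => rfl) E4 (by decide)
    (by decide) (by decide) q4 ((dR.ladder 1).mono (by omega))
  have E5 : PolyEnv D g5 := E4.of_psweep (by decide) p5
  have p6 : Holds D g6 51 (CanonicalPoly.ladder 1 R) :=
    holds_pcopy E5 (by decide) (by decide) (by decide) p5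
  have E6 : PolyEnv D g6 := E5.of_psweep (by decide) p6
  have q6 : Holds D g6 50 _ := (p4.of_eq (run_arr O rfl g4 : g5.arr 50 = g4.arr 50)).of_eq
    (run_arr O rfl g5)
  have E7 : PolyEnv D g7 := E6.setNat (by decide) (by decide) (by decide) _
  have r11 : g6.nat 11 = j := by
    rw [e6, run_nat O rfl, e5, run_nat O rfl, e4, run_nat O rfl, n3 11 (by decide), h11]
  have r12 : g7.nat 12 = j + 1 := by rw [e7, CStore.nat_setNat_self, r11, E6.one]
  have a35 : g7.arr 35 0 0 = (Real.sqrt (j.factorial : ℝ) : ℂ) := by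
    change g6.arr 35 0 0 = _
    rw [e6, run_arr O rfl, e5, run_arr O rfl, e4, run_arr O rfl, t3 35 rfl, ht]
  have E8 : PolyEnv D ((set ⟨35, 2, 2⟩ (.mul (scalar 35) (.sqrtRe (entry 40 12 2)))).run O g7) :=
    E7.run rfl rfl rfl rfl fun a h1 h2 ha => by
      have : a = 35 := by simpa [arrWrites] using ha
      omega
  refine ⟨(q6.of_eq rfl : Holds D g7 50 _).of_eq (run_arr O rfl g7), ?_, ?_, E8⟩
  · rw [Function.iterate_succ_apply', ← hR]
    exact (p6.of_eq rfl : Holds D g7 51 _).of_eq (run_arr O rfl g7)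
  · refine (run_setScalar (O := O) (a := 35) E7.zero).trans ?_
    have e40 : g7.arr 40 (j + 1) 0 = ((j + 1 : ℕ) : ℂ) := E7.nums (j + 1) (by omega)
    simp only [CExpr.eval, CStore.get, E7.zero, r12, e40, Complex.natCast_re, a35]
    rw [← sqrt_factorial_succ]
    push_cast
    rfl

/-- Write the polynomial in array `50` to array `0`. -/
def outCode : Code := sweep 16 17 9 (seq (natAdd 18 16 1) (seq (natAdd 20 17 1)
  (set ⟨0, 16, 17⟩ (entry 50 18 20))))

/-- Here the shift by one is undone: the entry is read at `(j + 1, k + 1)` and written at `(j, k)`.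
The rest of array `0` has to be zero beforehand. -/
theorem run_outCode {D : ℕ} {P : CanonicalPoly} (h1 : h.nat 1 = 1) (h9 : h.nat 9 = D + 1)
    (hP : Holds D h 50 P) (h0 : ∀ u v, h.arr 0 u v = 0) (u v : ℕ) :
    (outCode.run O h).arr 0 u v = P (u, v) := by
  have := run_sweep O (p := seq (natAdd 18 16 1) (seq (natAdd 20 17 1)
    (set ⟨0, 16, 17⟩ (entry 50 18 20)))) (C := 0) 0 (h := h) (fun j k => P (j, k))
    (show 16 ≠ 17 by decide) (show 9 ≠ 17 by decide) (show 9 ≠ 16 by decide) rfl rfl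
    (fun i hi j hj h' r16 r17 hr ha _ a b => by
      set g := (h'.setNat 18 (h'.nat 16 + h'.nat 1)).setNat 20
        ((h'.setNat 18 (h'.nat 16 + h'.nat 1)).nat 17 +
        (h'.setNat 18 (h'.nat 16 + h'.nat 1)).nat 1) with hg
      have r1 : h'.nat 1 = 1 := (hr 1 (by decide) (by decide) rfl).trans h1
      have g16 : g.nat 16 = i := by simp [hg, CStore.setNat, r16]
      have g17 : g.nat 17 = j := by simp [hg, CStore.setNat, r17]
      have g18 : g.nat 18 = i + 1 := by simp [hg, CStore.setNat, r16, r1]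
      have g20 : g.nat 20 = j + 1 := by simp [hg, CStore.setNat, r17, r1]
      refine (CStore.arr_set g ⟨0, 16, 17⟩ ((entry 50 18 20).eval g) a b).trans ?_
      have e : (entry 50 18 20).eval g = P (i, j) := by
        rw [CExpr.eval, CStore.get, g18, g20]
        change h'.arr 50 _ _ = _
        rw [ha 50 rfl, hP.arr_succ]
      simp only [e, g16, g17]
      rfl) u v
  refine this.trans ?_
  rw [h9]
  split_ifs with q
  · rfl
  · rw [h0, hP.deg _ _ (by omega)]

/-- Compute the block Hamiltonian of the matrix in array `28`, and write it to array `0`. -/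
def polyCode : Code := seq (set ⟨51, 1, 1⟩ .one) (seq (set ⟨55, 1, 1⟩ .one)
  (seq (set ⟨35, 2, 2⟩ .one) (seq (loop 11 6 blockBody) (seq confiningCode
    (seq (psweep 50 (.add (entry 50 18 20) (entry 55 18 20))) outCode)))))

/-- The constant coefficient sits at row and column `1` because of the shift, and register `1` holds
the number `1`. -/
theorem holds_unit {D a : ℕ} (h1 : h.nat 1 = 1) (ha : ∀ u v, h.arr a u v = 0) :
    Holds D ((set ⟨a, 1, 1⟩ .one).run O h) a CanonicalPoly.unit := by
  refine ⟨fun u v => ?_, CanonicalPoly.degLE_unit.mono (Nat.zero_le _)⟩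
  refine (CStore.arr_set h ⟨a, 1, 1⟩ 1 u v).trans ?_
  simp only [h1, ha, CanonicalPoly.unit, Finsupp.single_apply, Prod.mk.injEq]
  split_ifs with q1 q2 q3 q3
  all_goals first | rfl | omega

theorem run_polyCode {m : ℕ} (h1 : h.nat 1 = 1) (h2 : h.nat 2 = 0) (h6 : h.nat 6 = m)
    (h8 : h.nat 8 = m + 1) (h9 : h.nat 9 = 4 * m + 5) (hn : HasNums h (4 * m + 5))
    (h50 : ∀ a, 50 ≤ a → a ≤ 55 → ∀ u v, h.arr a u v = 0) (h0 : ∀ u v, h.arr 0 u v = 0) (u v : ℕ) :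
    (polyCode.run O h).arr 0 u v = CanonicalPoly.blockHamiltonian m (h.arr 28) (u, v) := by
  set D := 4 * m + 4 with hD
  have hz : ∀ a, 50 ≤ a → a ≤ 55 → Holds D h a 0 := fun a ha hb =>
    ⟨fun u v => by rw [h50 a ha hb]; simp, fun _ _ _ => rfl⟩
  have E0 : PolyEnv D h := ⟨h1, h2, h9, hn, fun a ha hb => ⟨0, hz a ha hb⟩⟩
  set g1 := (set ⟨51, 1, 1⟩ .one).run O h with e1
  set g2 := (set ⟨55, 1, 1⟩ .one).run O g1 with e2
  set g3 := (set ⟨35, 2, 2⟩ .one).run O g2 with e3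
  set g4 := (loop 11 6 blockBody).run O g3 with e4
  set g5 := confiningCode.run O g4 with e5
  set g6 := (psweep 50 (.add (entry 50 18 20) (entry 55 18 20))).run O g5 with e6
  have p1 : Holds D g1 51 CanonicalPoly.unit := holds_unit h1 (h50 51 (by decide) (by decide))
  have E1 : PolyEnv D g1 := E0.run rfl rfl rfl rfl fun a ha hb hc => by
    have : a = 51 := by simpa [arrWrites] using hc
    exact ⟨_, this ▸ p1⟩
  have p2 : Holds D g2 55 CanonicalPoly.unit := holds_unit h1 fun u v => by
    rw [e1, run_arr O rfl, h50 55 (by decide) (by decide)]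
  have E2 : PolyEnv D g2 := E1.run rfl rfl rfl rfl fun a ha hb hc => by
    have : a = 55 := by simpa [arrWrites] using hc
    exact ⟨_, this ▸ p2⟩
  have E3 : PolyEnv D g3 := E2.run rfl rfl rfl rfl fun a ha hb hc => by
    have : a = 35 := by simpa [arrWrites] using hc
    omega
  have f3 : ∀ a, a ≠ 51 → a ≠ 55 → a ≠ 35 → g3.arr a = h.arr a := fun a ha hb hc => by
    rw [e3, run_arr O (by simpa [arrWrites] using hc), e2, run_arr O (by simpa [arrWrites] using hb),
      e1, run_arr O (by simpa [arrWrites] using ha)]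
  have p3 : Holds D g3 51 CanonicalPoly.unit :=
    (p1.of_eq (run_arr O rfl g1 : g2.arr 51 = g1.arr 51)).of_eq (run_arr O rfl g2)
  have q3 : Holds D g3 55 CanonicalPoly.unit := p2.of_eq (run_arr O rfl g2)
  have z3 : Holds D g3 50 0 := (hz 50 (by decide) (by decide)).of_eq
    (f3 50 (by decide) (by decide) (by decide))
  have s3 : g3.arr 35 0 0 = 1 := run_setScalar E2.zero
  have n3 : ∀ r, g3.nat r = h.nat r := fun _ => rfl
  have main := run_loop O (v := 11) (n := 6) (p := blockBody) g3 (fun k h' =>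
    Holds D h' 50 (∑ j ∈ Finset.range k, ∑ i ∈ Finset.range m,
      CanonicalPoly.blockCoeff (h.arr 28) i j • (CanonicalPoly.ladder (-1))^[i]
        (CanonicalPoly.vacuum ((CanonicalPoly.ladder 1)^[j] CanonicalPoly.unit) m)) ∧
    Holds D h' 51 ((CanonicalPoly.ladder 1)^[k] CanonicalPoly.unit) ∧
    h'.arr 35 0 0 = (Real.sqrt (k.factorial : ℝ) : ℂ) ∧ PolyEnv D h')
    ⟨by rw [Finset.sum_range_zero]; exact z3.of_eq rfl, p3.of_eq rfl,
      by rw [Nat.factorial_zero, Nat.cast_one, Real.sqrt_one]; exact s3,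
      E3.setNat (by decide) (by decide) (by decide) 0⟩
    (fun k hk h' hv hr ha hI => by
      obtain ⟨I1, I2, I3, I4⟩ := hI
      rw [n3, h6] at hk
      have a28 : h'.arr 28 = h.arr 28 := (ha 28 rfl).trans (f3 28 (by decide) (by decide) (by decide))
      obtain ⟨J1, J2, J3, J4⟩ := run_blockBody (O := O) I4
        ((hr 6 (by decide) rfl).trans ((n3 6).trans h6)) hv hk (by omega) I1 I2 I3
      refine ⟨?_, J2.of_eq rfl, J3, J4.setNat (by decide) (by decide) (by decide) _⟩
      rw [Finset.sum_range_succ, ← a28]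
      rw [← a28] at J1
      exact J1.of_eq rfl)
  rw [n3, h6] at main
  obtain ⟨p4, -, -, E4⟩ := main
  have q4 : Holds D g4 55 CanonicalPoly.unit := q3.of_eq (run_arr O rfl g3)
  have n4 : g4.nat 8 = m + 1 := (run_nat O rfl g3).trans h8
  obtain ⟨p5, E5⟩ := holds_confiningCode (O := O) E4 n4 q4 CanonicalPoly.degLE_unit (by omega)
  have q5 : Holds D g5 50 _ := p4.of_eq (run_arr O rfl g4)
  have p6 : Holds D g6 50 (CanonicalPoly.blockHamiltonian m (h.arr 28)) := by
    refine holds_psweep E5.one E5.bound q5 (CanonicalPoly.degLE_blockHamiltonian m _)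
      fun j' k _ h' _ _ r18 _ r20 hr ha hC => ?_
    rw [CanonicalPoly.blockHamiltonian, Finsupp.add_apply, ← hC, ← p5.arr_succ, ← ha 55 (by decide)]
    simp only [CExpr.eval, CStore.get, r18, r20]
  have n6 : g6.nat 1 = 1 := (run_nat O rfl g5).trans E5.one
  have b6 : g6.nat 9 = D + 1 := (run_nat O rfl g5).trans E5.bound
  refine run_outCode n6 b6 p6 (fun u v => ?_) u v
  rw [e6, run_arr O rfl, e5, run_arr O rfl, e4, run_arr O rfl,
    f3 0 (by decide) (by decide) (by decide), h0]

end Code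
end RealRAM

namespace RealRAM
namespace Code

variable {O : ℕ → ℕ → ℂ} {h : CStore} {m : ℕ}

/-! ### From the matrix entries to the polynomial -/

theorem mat_sweep {C : ℕ} {p : Code} (hm : h.nat 6 = m) (h10 : p.natWrites.contains 10 = false)
    (h6 : p.natWrites.contains 6 = false) (F : ℕ → ℕ → ℂ)
    (step : ∀ i < m, ∀ j < m, ∀ h' : CStore, h'.nat 10 = i → h'.nat 11 = j →
      (∀ r, r ≠ 10 → r ≠ 11 → p.natWrites.contains r = false → h'.nat r = h.nat r) →
      ∀ a b, (p.run O h').arr C a b = if a = i ∧ b = j then F i j else h'.arr C a b) :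
    ((sweep 10 11 6 p).run O h).mat m C = Matrix.of fun i j : Fin m => F i j := by
  ext i j
  have := run_sweep O (p := p) (C := C) 0 (h := h) F (show 10 ≠ 11 by decide) (show 6 ≠ 11 by decide)
    (show 6 ≠ 10 by decide) h10 h6 (fun i hi j hj h' r1 r2 hr _ _ =>
      step i (hm ▸ hi) j (hm ▸ hj) h' r1 r2 hr) i j
  rw [hm, if_pos (by omega)] at this
  exact this

theorem arr_set_entry {C : ℕ} {x : ℂ} {i j : ℕ} (h1 : h.nat 10 = i) (h2 : h.nat 11 = j) (a b : ℕ) :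
    (h.set ⟨C, 10, 11⟩ x).arr C a b = if a = i ∧ b = j then x else h.arr C a b := by
  rw [CStore.arr_set h ⟨C, 10, 11⟩ x a b]
  simp only [h1, h2]

theorem run_seq (O : ℕ → ℕ → ℂ) (p q : Code) (h : CStore) :
    (seq p q).run O h = q.run O (p.run O h) := rfl

theorem run_nat_of_lt (p : Code) {n r : ℕ} (hp : (p.natWrites.all fun x => Nat.ble n x) = true)
    (hr : r < n) (h : CStore) : (p.run O h).nat r = h.nat r := by
  refine run_nat O ?_ h
  rw [List.contains_eq_mem, decide_eq_false_iff_not]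
  exact fun hmem => absurd (Nat.le_of_ble_eq_true (List.all_eq_true.mp hp r hmem)) (by omega)

/-- Query the truncated matrix, to array `20`. -/
def truncCode : Code := sweep 10 11 6 (ifNat 5 10 (set ⟨20, 10, 11⟩ (.num 0))
  (ifNat 3 11 (set ⟨20, 10, 11⟩ (.num 0)) (query ⟨20, 10, 11⟩ 10 11)))

theorem mat_truncCode {K L : ℕ} (h3 : h.nat 3 = K) (h5 : h.nat 5 = L + 1)
    (h6 : h.nat 6 = 2 * (L + 1)) :
    (truncCode.run O h).mat (2 * (L + 1)) 20 = truncMat O K L := by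
  refine mat_sweep h6 rfl rfl (fun i j => if i ≤ L ∧ j < K then O i j else 0)
    fun i hi j hj h' r1 r2 hr a b => ?_
  have r5 : h'.nat 5 = L + 1 := (hr 5 (by decide) (by decide) rfl).trans h5
  have r3 : h'.nat 3 = K := (hr 3 (by decide) (by decide) rfl).trans h3
  simp only [run, r5, r3, r1, r2]
  split_ifs with q1 q2 q3 q4
  all_goals first | omega | skip
  all_goals refine (arr_set_entry r1 r2 a b).trans ?_
  all_goals simp_all [CExpr.eval_num]

/-- The matrix exchanging the halves of the basis, to array `21`. -/
def swapCode : Code := sweep 10 11 6 (seq (natAdd 12 11 5) (seq (natAdd 13 10 5)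
  (seq (set ⟨21, 10, 11⟩ (.num 0))
  (seq (ifNat 10 12 (ifNat 12 10 (set ⟨21, 10, 11⟩ .one) (natZero 14)) (natZero 14))
    (ifNat 11 13 (ifNat 13 11 (set ⟨21, 10, 11⟩ .one) (natZero 14)) (natZero 14))))))

theorem mat_swapCode {L : ℕ} (h5 : h.nat 5 = L + 1) (h6 : h.nat 6 = 2 * (L + 1)) :
    (swapCode.run O h).mat (2 * (L + 1)) 21 = swapMat L := by
  refine mat_sweep h6 rfl rfl (fun i j => if i = j + (L + 1) ∨ j = i + (L + 1) then 1 else 0)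
    fun i hi j hj h' r1 r2 hr a b => ?_
  have r5 : h'.nat 5 = L + 1 := (hr 5 (by decide) (by decide) rfl).trans h5
  set g0 := (h'.setNat 12 (h'.nat 11 + h'.nat 5)).setNat 13
    ((h'.setNat 12 (h'.nat 11 + h'.nat 5)).nat 10 + (h'.setNat 12 (h'.nat 11 + h'.nat 5)).nat 5) with hg
  have g10 : g0.nat 10 = i := by simp [hg, CStore.setNat, r1]
  have g11 : g0.nat 11 = j := by simp [hg, CStore.setNat, r2]
  have g12 : g0.nat 12 = j + (L + 1) := by simp [hg, CStore.setNat, r2, r5]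
  have g13 : g0.nat 13 = i + (L + 1) := by simp [hg, CStore.setNat, r1, r5]
  -- Equality of two registers is tested by two inequalities; clearing register `14` serves as the
  -- empty program in the other branches.
  have test : ∀ (g : CStore) (v w : ℕ) (a b : ℕ), g.nat 10 = i → g.nat 11 = j →
      ((ifNat v w (ifNat w v (set ⟨21, 10, 11⟩ .one) (natZero 14)) (natZero 14)).run O g).arr 21 a b =
        if g.nat v = g.nat w ∧ a = i ∧ b = j then 1 else g.arr 21 a b := fun g v w a b q1 q2 => by
    simp only [run]
    split_ifs with c1 c2 c3 c3 c3
    · refine (arr_set_entry q1 q2 a b).trans ?_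
      rw [if_pos c3.2]
      rfl
    · refine (arr_set_entry q1 q2 a b).trans ?_
      rw [if_neg fun c => c3 ⟨by omega, c⟩]
    all_goals first | rfl | omega
  set g1 := (set ⟨21, 10, 11⟩ (.num 0)).run O g0 with hg1
  set g2 := (ifNat 10 12 (ifNat 12 10 (set ⟨21, 10, 11⟩ .one) (natZero 14)) (natZero 14)).run O g1
    with hg2
  have k2 : ∀ r, r ≠ 14 → g2.nat r = g0.nat r := fun r hr => by
    rw [hg2, run_nat O (by simp [natWrites, hr])]
    rfl
  have e1 : g1.arr 21 a b = if a = i ∧ b = j then 0 else h'.arr 21 a b := by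
    refine (arr_set_entry g10 g11 a b).trans ?_
    rw [CExpr.eval_num, Nat.cast_zero]
    rfl
  have e2 : g2.arr 21 a b = if i = j + (L + 1) ∧ a = i ∧ b = j then 1 else g1.arr 21 a b := by
    rw [hg2, test g1 10 12 a b g10 g11]
    rw [show g1.nat 10 = i from g10, show g1.nat 12 = j + (L + 1) from g12]
  change ((ifNat 11 13 (ifNat 13 11 (set ⟨21, 10, 11⟩ .one) (natZero 14)) (natZero 14)).run O
    g2).arr 21 a b = _
  rw [test g2 11 13 a b ((k2 10 (by decide)).trans g10) ((k2 11 (by decide)).trans g11), e2, e1,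
    k2 11 (by decide), k2 13 (by decide), g11, g13]
  split_ifs
  all_goals first | rfl | omega

/-- The identity matrix, to array `29`. -/
def idCode : Code := sweep 10 11 6 (ifNat 10 11
  (ifNat 11 10 (set ⟨29, 10, 11⟩ .one) (set ⟨29, 10, 11⟩ (.num 0))) (set ⟨29, 10, 11⟩ (.num 0)))

theorem mat_idCode (h6 : h.nat 6 = m) : (idCode.run O h).mat m 29 = 1 := by
  refine (mat_sweep h6 rfl rfl (fun i j => if i = j then 1 else 0)
    fun i hi j hj h' r1 r2 hr a b => ?_).trans ?_
  · simp only [run, r1, r2]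
    split_ifs with q1 q2 q3 q4
    all_goals first | omega | skip
    all_goals refine (arr_set_entry r1 r2 a b).trans ?_
    all_goals simp_all [CExpr.eval_num, CExpr.eval]
  · ext i j
    rw [Matrix.of_apply, Matrix.one_apply]
    congr 1
    rw [eq_iff_iff, Fin.ext_iff]

/-- Compute the matrix logarithm, to array `28`. -/
def hamiltonianCode : Code := seq truncCode (seq swapCode (seq idCode (seq completionCode
  (seq newtonCode (seq testCode logCode)))))

theorem run_hamiltonianCode {K L N : ℕ} (h2 : h.nat 2 = 0) (h3 : h.nat 3 = K)
    (h5 : h.nat 5 = L + 1) (h6 : h.nat 6 = 2 * (L + 1)) (h7 : h.nat 7 = N)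
    (h8 : h.nat 8 = 2 * (L + 1) + 1) (hn : HasNums h (2 * (L + 1)))
    (hex : ∃ s ≤ 2 * (L + 1), Passing O K L N s) :
    ∃ s, Passing O K L N s ∧ (hamiltonianCode.run O h).mat (2 * (L + 1)) 28 =
      argSeries N (phase (2 * (L + 1)) s • polarMat O K L N) := by
  set m := 2 * (L + 1) with hm
  obtain ⟨g1, e1⟩ : ∃ g, g = truncCode.run O h := ⟨_, rfl⟩
  obtain ⟨g2, e2⟩ : ∃ g, g = swapCode.run O g1 := ⟨_, rfl⟩
  obtain ⟨g3, e3⟩ : ∃ g, g = idCode.run O g2 := ⟨_, rfl⟩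
  obtain ⟨g4, e4⟩ : ∃ g, g = completionCode.run O g3 := ⟨_, rfl⟩
  obtain ⟨g5, e5⟩ : ∃ g, g = newtonCode.run O g4 := ⟨_, rfl⟩
  obtain ⟨g6, e6⟩ : ∃ g, g = testCode.run O g5 := ⟨_, rfl⟩
  have k1 : ∀ r < 10, g1.nat r = h.nat r := fun r hr => by
    rw [e1, run_nat_of_lt truncCode (n := 10) (by decide +kernel) hr]
  have k2 : ∀ r < 10, g2.nat r = h.nat r := fun r hr => by
    rw [e2, run_nat_of_lt swapCode (n := 10) (by decide +kernel) hr, k1 r hr]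
  have k3 : ∀ r < 10, g3.nat r = h.nat r := fun r hr => by
    rw [e3, run_nat_of_lt idCode (n := 10) (by decide +kernel) hr, k2 r hr]
  have k4 : ∀ r < 10, g4.nat r = h.nat r := fun r hr => by
    rw [e4, run_nat_of_lt completionCode (n := 10) (by decide +kernel) hr, k3 r hr]
  have k5 : ∀ r < 10, g5.nat r = h.nat r := fun r hr => by
    rw [e5, run_nat_of_lt newtonCode (n := 10) (by decide +kernel) hr, k4 r hr]
  have k6 : ∀ r < 10, g6.nat r = h.nat r := fun r hr => by
    rw [e6, run_nat_of_lt testCode (n := 10) (by decide +kernel) hr, k5 r hr]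
  have n5 : HasNums g5 m := hn.of_eq (by
    rw [e5, run_arr O (by decide +kernel), e4, run_arr O (by decide +kernel), e3, run_arr O (by decide +kernel), e2, run_arr O (by decide +kernel), e1, run_arr O (by decide +kernel)])
  have n6 : HasNums g6 m := n5.of_eq (by rw [e6, run_arr O (by decide +kernel)])
  have t1 : g1.mat m 20 = truncMat O K L := e1 ▸ mat_truncCode h3 h5 h6
  have t3 : g3.mat m 20 = truncMat O K L := by
    rw [e3, mat_run_of_not_mem (by decide +kernel), e2, mat_run_of_not_mem (by decide +kernel), t1]
  have w3 : g3.mat m 21 = swapMat L := by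
    rw [e3, mat_run_of_not_mem (by decide +kernel), e2]
    exact mat_swapCode ((k1 5 (by decide)).trans h5) ((k1 6 (by decide)).trans h6)
  have i3 : g3.mat m 29 = 1 := e3 ▸ mat_idCode ((k2 6 (by decide)).trans h6)
  have i5 : g5.mat m 29 = 1 := by
    rw [e5, mat_run_of_not_mem (by decide +kernel), e4, mat_run_of_not_mem (by decide +kernel), i3]
  have i6 : g6.mat m 29 = 1 := by rw [e6, mat_run_of_not_mem (by decide +kernel), i5]
  have c4 : g4.mat m 22 = completion (swapMat L) (truncMat O K L) := by
    rw [e4, mat_completionCode ((k3 6 (by decide)).trans h6), t3, w3]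
  have c5 : g5.mat m 22 = polarMat O K L N := by
    rw [e5, mat_newtonCode ((k4 6 (by decide)).trans h6), c4, k4 7 (by decide), h7]
    rfl
  have c6 : g6.mat m 22 = polarMat O K L N := by rw [e6, mat_run_of_not_mem (by decide +kernel), c5]
  have hex' : ∃ s ≤ m, ∑ i, ∑ j, ‖(gapOp (phase m s • g5.mat m 22) ^ g5.nat 7) i j‖ ^ 2 ≤ 1 / 4 := by
    rw [c5, k5 7 (by decide), h7]
    exact hex
  obtain ⟨hs, hpass⟩ := run_testCode (O := O) ((k5 2 (by decide)).trans h2)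
    ((k5 6 (by decide)).trans h6) ((k5 8 (by decide)).trans h8) n5 i5 hex'
  rw [← e6] at hs
  rw [← e6, c5, k5 7 (by decide), h7] at hpass
  refine ⟨g6.nat 15, hpass, ?_⟩
  have := mat_logCode (O := O) ((k6 2 (by decide)).trans h2) ((k6 6 (by decide)).trans h6) n6 hs i6
  rw [k6 7 (by decide), h7, c6] at this
  rw [hamiltonianCode, run_seq, run_seq, run_seq, run_seq, run_seq, run_seq, ← e1, ← e2, ← e3, ← e4, ← e5, ← e6]
  exact this

/-- Compute the Hamiltonian from the matrix entries. -/
def mainCode : Code := seq fillNums (seq hamiltonianCode polyCode)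

theorem run_mainCode {K L N : ℕ} (h1 : h.nat 1 = 1) (h2 : h.nat 2 = 0) (h3 : h.nat 3 = K)
    (h5 : h.nat 5 = L + 1) (h6 : h.nat 6 = 2 * (L + 1)) (h7 : h.nat 7 = N)
    (h8 : h.nat 8 = 2 * (L + 1) + 1) (h9 : h.nat 9 = 4 * (2 * (L + 1)) + 5)
    (h40 : h.arr 40 0 0 = 0) (h50 : ∀ a, 50 ≤ a → a ≤ 55 → ∀ u v, h.arr a u v = 0)
    (h0 : ∀ u v, h.arr 0 u v = 0) (hex : ∃ s ≤ 2 * (L + 1), Passing O K L N s) :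
    ∃ (s : ℕ) (M : ℕ → ℕ → ℂ), Passing O K L N s ∧
      (Matrix.of fun i j : Fin (2 * (L + 1)) => M i j) =
        argSeries N (phase (2 * (L + 1)) s • polarMat O K L N) ∧
      ∀ u v, (mainCode.run O h).arr 0 u v = CanonicalPoly.blockHamiltonian (2 * (L + 1)) M (u, v) := by
  obtain ⟨g1, e1⟩ : ∃ g, g = fillNums.run O h := ⟨_, rfl⟩
  obtain ⟨g2, e2⟩ : ∃ g, g = hamiltonianCode.run O g1 := ⟨_, rfl⟩
  have k1 : ∀ r < 10, g1.nat r = h.nat r := fun r hr => by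
    rw [e1, run_nat_of_lt fillNums (n := 10) (by decide +kernel) hr]
  have k2 : ∀ r < 10, g2.nat r = h.nat r := fun r hr => by
    rw [e2, run_nat_of_lt hamiltonianCode (n := 10) (by decide +kernel) hr, k1 r hr]
  have n1 : HasNums g1 (4 * (2 * (L + 1)) + 5) := by
    rw [e1, ← h9]
    exact run_fillNums h1 h2 h40
  obtain ⟨s, hs, hM⟩ := run_hamiltonianCode (O := O) ((k1 2 (by decide)).trans h2)
    ((k1 3 (by decide)).trans h3) ((k1 5 (by decide)).trans h5) ((k1 6 (by decide)).trans h6)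
    ((k1 7 (by decide)).trans h7) ((k1 8 (by decide)).trans h8) (n1.mono (by omega)) hex
  rw [← e2] at hM
  refine ⟨s, g2.arr 28, hs, hM, fun u v => ?_⟩
  rw [mainCode, run_seq, run_seq, ← e1, ← e2]
  refine run_polyCode ((k2 1 (by decide)).trans h1) ((k2 2 (by decide)).trans h2)
    ((k2 6 (by decide)).trans h6) ((k2 8 (by decide)).trans h8) ((k2 9 (by decide)).trans h9)
    (n1.of_eq (by rw [e2, run_arr O (by decide +kernel)])) (fun a ha hb u v => ?_) (fun u v => ?_) u v
  · have q1 : hamiltonianCode.arrWrites.contains a = false := by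
      rw [List.contains_eq_mem, decide_eq_false_iff_not]
      intro hmem
      have : ∀ b ∈ hamiltonianCode.arrWrites, b < 50 := by decide +kernel
      exact absurd (this a hmem) (by omega)
    have q2 : fillNums.arrWrites.contains a = false := by
      simp [fillNums, arrWrites]
      omega
    rw [e2, run_arr O q1, e1, run_arr O q2, h50 a ha hb]
  · rw [e2, run_arr O (by decide +kernel), e1, run_arr O (by decide +kernel), h0]

end Code
end RealRAM

namespace RealRAM

variable {O : ℕ → ℕ → ℂ}

/-! ### Searches -/

/-- Repeat `p` until it sets the flag in register `21`, which signals that `Q` holds for the number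
of repetitions. -/
theorem Leads.search {p : Code} (hp : p.Valid = true) (hs : p.Stable = true) {h : CStore}
    (h1 : h.nat 1 = 1) (h21 : h.nat 21 = 0) (Q : ℕ → Prop) (hQ : ∃ n, 0 < n ∧ Q n)
    (Inv : ℕ → CStore → Prop) (h0 : Inv 0 h)
    (step : ∀ k h', (∀ r, p.natWrites.contains r = false → h'.nat r = h.nat r) →
      (∀ a, p.arrWrites.contains a = false → h'.arr a = h.arr a) → Inv k h' →
      Inv (k + 1) (p.run O h') ∧ (Q (k + 1) → (p.run O h').nat 21 = 1) ∧
        (¬ Q (k + 1) → (p.run O h').nat 21 = 0)) :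
    ∃ n h', 0 < n ∧ Q n ∧ (∀ k, 0 < k → k < n → ¬ Q k) ∧ Inv n h' ∧
      (∀ X, (∀ n ∈ p.bounds, h.nat n ≤ X) →
        Leads O (.whileNat 21 1 p.compile) h (n * (p.cost X + 1) + 1) h') ∧
      (∀ r, p.natWrites.contains r = false → h'.nat r = h.nat r) ∧
      (∀ a, p.arrWrites.contains a = false → h'.arr a = h.arr a) := by
  classical
  have frame : ∀ k, (∀ r, p.natWrites.contains r = false → ((p.run O)^[k] h).nat r = h.nat r) ∧
      ∀ a, p.arrWrites.contains a = false → ((p.run O)^[k] h).arr a = h.arr a := by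
    intro k
    induction k with
    | zero => exact ⟨fun _ _ => rfl, fun _ _ => rfl⟩
    | succ k ih =>
      rw [Function.iterate_succ_apply']
      exact ⟨fun r hr => (Code.run_nat O hr _).trans (ih.1 r hr),
        fun a ha => (Code.run_arr O ha _).trans (ih.2 a ha)⟩
  have inv : ∀ k, Inv k ((p.run O)^[k] h) := by
    intro k
    induction k with
    | zero => exact h0
    | succ k ih =>
      rw [Function.iterate_succ_apply']
      exact (step k _ (frame k).1 (frame k).2 ih).1
  have one : ∀ k, ((p.run O)^[k] h).nat 1 = 1 := fun k => by
    rw [(frame k).1 1 (by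
      rw [List.contains_eq_mem, decide_eq_false_iff_not]
      exact Code.one_not_mem_natWrites hp), h1]
  have flag : ∀ k, (0 < k → Q k → ((p.run O)^[k] h).nat 21 = 1) ∧
      ((0 < k → ¬ Q k) → ((p.run O)^[k] h).nat 21 = 0) := by
    rintro (_ | k)
    · exact ⟨fun h => absurd h (lt_irrefl _), fun _ => h21⟩
    · rw [Function.iterate_succ_apply']
      have := (step k _ (frame k).1 (frame k).2 (inv k)).2
      exact ⟨fun _ => this.1, fun h => this.2 (h (Nat.succ_pos k))⟩
  obtain ⟨hn0, hn⟩ := Nat.find_spec hQ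
  have hmin : ∀ k, 0 < k → k < Nat.find hQ → ¬ Q k := fun k hk hlt hq => Nat.find_min hQ hlt ⟨hk, hq⟩
  refine ⟨Nat.find hQ, _, hn0, hn, hmin, inv _, fun X hX => ?_, (frame _).1, (frame _).2⟩
  refine Leads.while hp hs h1 _ (fun k _ r hr => ?_) (fun k hk => ?_) ?_
  · have := List.all_eq_true.mp hs r hr
    rw [(frame k).1 r (by simpa using this)]
    exact hX r hr
  · rw [one, (flag k).2 fun h0 => hmin k h0 hk]
    exact Nat.zero_lt_one
  · rw [one, (flag _).1 hn0 hn]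
    exact lt_irrefl _

namespace Code

/-! ### The parameters -/

/-- The input, as a memory of complex arrays. -/
def _root_.Boson.RealRAM.CStore.input (E ε : ℝ) : CStore where
  nat := fun _ => 0
  arr := fun a i j =>
    if a = 0 ∧ i = 0 ∧ j = 0 then (E : ℂ) else if a = 0 ∧ i = 0 ∧ j = 1 then (ε : ℂ) else 0

theorem sim_input (E ε : ℝ) : Sim (input E ε) (CStore.input E ε) := by
  refine ⟨rfl, fun a ha i j => ?_⟩
  simp only [input, CStore.input, Nat.mul_eq_zero, OfNat.ofNat_ne_zero, false_or]
  constructor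
  · split_ifs <;> simp
  · rw [if_neg (by omega), if_neg (by omega)]
    split_ifs <;> simp

theorem leads_natOne {h : CStore} (v : ℕ) : Leads O (.instr (.natOne v)) h 1 (h.setNat v 1) :=
  fun _ hs => ⟨1, _, le_rfl, .instr _ _, hs.setNat v 1⟩

/-- Move the input to the scalars `60` and `61`, and compute the thresholds. -/
def initCode : Code := seq (set ⟨60, 2, 2⟩ (entry 0 2 2)) (seq (set ⟨61, 2, 2⟩ (entry 0 2 1))
  (seq (set ⟨0, 2, 2⟩ (.num 0)) (seq (set ⟨0, 2, 1⟩ (.num 0))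
  (seq (set ⟨62, 2, 2⟩ (.mul (.num 64) (scalar 60))) (seq (set ⟨63, 2, 2⟩ (.mul (scalar 61) (scalar 61)))
  (set ⟨68, 2, 2⟩ (.divRe (scalar 63) (.mul (.num 10) (.num 100)))))))))

/-- The memory after the initialization. -/
structure Ready (E ε : ℝ) (h : CStore) : Prop where
  one : h.nat 1 = 1
  nat : ∀ r, r ≠ 1 → h.nat r = 0
  eps : h.arr 61 0 0 = (ε : ℂ)
  energy : h.arr 62 0 0 = ((64 * E : ℝ) : ℂ)
  epsSq : h.arr 63 0 0 = ((ε ^ 2 : ℝ) : ℂ)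
  tol : h.arr 68 0 0 = ((ε ^ 2 / 1000 : ℝ) : ℂ)
  zero : ∀ a < 60, ∀ u v, h.arr a u v = 0
  zero' : ∀ a, 64 ≤ a → a < 68 → ∀ u v, h.arr a u v = 0

theorem ready_initCode (E ε : ℝ) : Ready E ε (initCode.run O ((CStore.input E ε).setNat 1 1)) where
  one := rfl
  nat r hr := Function.update_of_ne hr _ _
  eps := by simp [initCode, run, CStore.set, CExpr.eval, CStore.get, CStore.setNat, CStore.input]
  energy := by
    simp [initCode, run, CStore.set, CExpr.eval, CStore.get, CStore.setNat, CStore.input,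
      CExpr.eval_num]
  epsSq := by
    simp [initCode, run, CStore.set, CExpr.eval, CStore.get, CStore.setNat, CStore.input, pow_two]
  tol := by
    simp [initCode, run, CStore.set, CExpr.eval, CStore.get, CStore.setNat, CStore.input, pow_two,
      CExpr.eval_num]
    norm_num
  zero a ha u v := by
    have h1 : a ≠ 60 := by omega
    have h2 : a ≠ 61 := by omega
    have h3 : a ≠ 62 := by omega
    have h4 : a ≠ 63 := by omega
    have h5 : a ≠ 68 := by omega
    simp only [initCode, run, CStore.set, CStore.setNat, CStore.input, h1, h2, h3, h4, h5,
      CExpr.eval_num, false_and, if_false]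
    simp only [Function.update_self, Function.update_of_ne (show (2 : ℕ) ≠ 1 by decide)]
    split_ifs <;> simp
  zero' a ha hb u v := by
    have h0 : a ≠ 0 := by omega
    have h1 : a ≠ 60 := by omega
    have h2 : a ≠ 61 := by omega
    have h3 : a ≠ 62 := by omega
    have h4 : a ≠ 63 := by omega
    have h5 : a ≠ 68 := by omega
    simp only [initCode, run, CStore.set, CStore.setNat, CStore.input, h0, h1, h2, h3, h4, h5,
      false_and, if_false]

variable {h : CStore}

/-- One step of the search for the number of columns. -/
def columnsCode : Code := seq (natAdd 3 3 1) (seq (set ⟨64, 2, 2⟩ (.add (scalar 64) (scalar 63)))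
  (seq (set ⟨65, 2, 2⟩ (.add (scalar 65) .one))
    (ifRe (scalar 64) (scalar 62) (natZero 21) (natAdd 21 1 2))))

theorem run_columnsCode {k : ℕ} {a b : ℝ} (h1 : h.nat 1 = 1) (h2 : h.nat 2 = 0) (h3 : h.nat 3 = k)
    (h62 : h.arr 62 0 0 = (a : ℂ)) (h63 : h.arr 63 0 0 = (b : ℂ))
    (h64 : h.arr 64 0 0 = ((k * b : ℝ) : ℂ)) (h65 : h.arr 65 0 0 = ((k : ℝ) : ℂ)) :
    (columnsCode.run O h).nat 3 = k + 1 ∧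
    (columnsCode.run O h).arr 64 0 0 = (((k + 1 : ℕ) * b : ℝ) : ℂ) ∧
    (columnsCode.run O h).arr 65 0 0 = (((k + 1 : ℕ) : ℝ) : ℂ) ∧
    (columnsCode.run O h).nat 21 = if (k + 1 : ℕ) * b ≤ a then 0 else 1 := by
  have e : ((k : ℝ) * b + b ≤ a) ↔ ((k + 1 : ℕ) * b ≤ a) := by
    push_cast
    rw [add_mul, one_mul]
  have key : columnsCode.run O h = if (k + 1 : ℕ) * b ≤ a then
      (((h.setNat 3 (k + 1)).set ⟨64, 2, 2⟩ (((k + 1 : ℕ) * b : ℝ) : ℂ)).set ⟨65, 2, 2⟩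
        (((k + 1 : ℕ) : ℝ) : ℂ)).setNat 21 0 else
      (((h.setNat 3 (k + 1)).set ⟨64, 2, 2⟩ (((k + 1 : ℕ) * b : ℝ) : ℂ)).set ⟨65, 2, 2⟩
        (((k + 1 : ℕ) : ℝ) : ℂ)).setNat 21 1 := by
    simp [columnsCode, run, CStore.set, CStore.setNat, CStore.get, CExpr.eval, h1, h2, h3, h62, h63,
      h64, h65, add_mul]
  rw [key]
  split_ifs <;> simp [CStore.set, CStore.setNat, h2]

/-- One step of the search for the precision. -/
def precisionCode : Code := seq (natAdd 4 4 1) (seq (set ⟨66, 2, 2⟩ (.add (scalar 66) (scalar 61)))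
  (ifRe .one (scalar 66) (natAdd 21 1 2) (natZero 21)))

theorem run_precisionCode {k : ℕ} {b : ℝ} (h1 : h.nat 1 = 1) (h2 : h.nat 2 = 0) (h4 : h.nat 4 = k)
    (h61 : h.arr 61 0 0 = (b : ℂ)) (h66 : h.arr 66 0 0 = ((k * b : ℝ) : ℂ)) :
    (precisionCode.run O h).nat 4 = k + 1 ∧
    (precisionCode.run O h).arr 66 0 0 = (((k + 1 : ℕ) * b : ℝ) : ℂ) ∧
    (precisionCode.run O h).nat 21 = if 1 ≤ (k + 1 : ℕ) * b then 1 else 0 := by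
  have key : precisionCode.run O h = if 1 ≤ (k + 1 : ℕ) * b then
      ((h.setNat 4 (k + 1)).set ⟨66, 2, 2⟩ (((k + 1 : ℕ) * b : ℝ) : ℂ)).setNat 21 1 else
      ((h.setNat 4 (k + 1)).set ⟨66, 2, 2⟩ (((k + 1 : ℕ) * b : ℝ) : ℂ)).setNat 21 0 := by
    simp [precisionCode, run, CStore.set, CStore.setNat, CStore.get, CExpr.eval, h1, h2, h4, h61,
      h66, add_mul]
  rw [key]
  split_ifs <;> simp [CStore.set, CStore.setNat, h2]

/-- The squared norm of the first `n` rows of the first `K` columns. -/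
def rowSum (O : ℕ → ℕ → ℂ) (K n : ℕ) : ℝ :=
  ∑ i ∈ Finset.range n, ∑ j ∈ Finset.range K, ‖O i j‖ ^ 2

theorem headSum_eq_rowSum (O : ℕ → ℕ → ℂ) (K L : ℕ) : headSum O K L = rowSum O K (L + 1) :=
  Finset.sum_comm

/-- Add the squared norm of the row in register `5` to the scalar `67`. -/
def rowCode : Code := loop 10 3 (seq (query ⟨37, 2, 2⟩ 5 10)
  (set ⟨67, 2, 2⟩ (.add (scalar 67) (.mul (scalar 37) (.cconj (scalar 37))))))

theorem run_rowCode {K k : ℕ} (h2 : h.nat 2 = 0) (h3 : h.nat 3 = K) (h5 : h.nat 5 = k)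
    (h67 : h.arr 67 0 0 = (rowSum O K k : ℂ)) :
    (rowCode.run O h).arr 67 0 0 = (rowSum O K (k + 1) : ℂ) := by
  have := run_loop O (v := 10) (n := 3) (p := seq (query ⟨37, 2, 2⟩ 5 10)
    (set ⟨67, 2, 2⟩ (.add (scalar 67) (.mul (scalar 37) (.cconj (scalar 37)))))) h
    (fun l h' => h'.arr 67 0 0 = (rowSum O K k : ℂ) +
      ∑ j ∈ Finset.range l, ((‖O k j‖ ^ 2 : ℝ) : ℂ))
    (by rw [Finset.sum_range_zero, add_zero]; exact h67) (fun l hl h' hv hr _ hI => by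
      have r2 : h'.nat 2 = 0 := (hr 2 (by decide) rfl).trans h2
      have r5 : h'.nat 5 = k := (hr 5 (by decide) rfl).trans h5
      set g := (query ⟨37, 2, 2⟩ 5 10).run O h' with hg
      have g2 : g.nat 2 = 0 := r2
      have g37 : g.arr 37 0 0 = O k l := by
        refine (CStore.arr_set h' ⟨37, 2, 2⟩ _ 0 0).trans ?_
        rw [if_pos ⟨r2.symm, r2.symm⟩, r5, hv]
      have g67 : g.arr 67 = h'.arr 67 := run_arr O rfl h'
      refine (run_setScalar (O := O) (a := 67) g2).trans ?_
      simp only [CExpr.eval, CStore.get, g2, g37, g67, hI]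
      rw [Finset.sum_range_succ, Complex.mul_conj', add_assoc]
      push_cast
      rfl)
  rw [h3] at this
  refine this.trans ?_
  rw [rowSum, rowSum, Finset.sum_range_succ]
  push_cast
  rfl

/-- One step of the search for the number of rows. -/
def rowsCode : Code := seq rowCode (seq (natAdd 5 5 1)
  (ifRe (.sub (scalar 65) (scalar 68)) (scalar 67) (natAdd 21 1 2)
    (ifRe (.num 4) (scalar 61) (natAdd 21 1 2) (natZero 21))))

/-- The second exit, `4 ≤ ε`, stops the search at the first row. Then `L = 0` and the zero
polynomial is good enough. -/
theorem run_rowsCode {K k : ℕ} {ε τ : ℝ} (h1 : h.nat 1 = 1) (h2 : h.nat 2 = 0) (h3 : h.nat 3 = K)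
    (h5 : h.nat 5 = k) (h61 : h.arr 61 0 0 = (ε : ℂ)) (h65 : h.arr 65 0 0 = ((K : ℝ) : ℂ))
    (h68 : h.arr 68 0 0 = (τ : ℂ)) (h67 : h.arr 67 0 0 = (rowSum O K k : ℂ)) :
    (rowsCode.run O h).nat 5 = k + 1 ∧
    (rowsCode.run O h).arr 67 0 0 = (rowSum O K (k + 1) : ℂ) ∧
    (rowsCode.run O h).nat 21 = if K - τ ≤ rowSum O K (k + 1) ∨ 4 ≤ ε then 1 else 0 := by
  obtain ⟨g, hg⟩ : ∃ g, g = rowCode.run O h := ⟨_, rfl⟩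
  have g67 : g.arr 67 0 0 = (rowSum O K (k + 1) : ℂ) := hg ▸ run_rowCode h2 h3 h5 h67
  have gr : ∀ r, r ≠ 10 → g.nat r = h.nat r := fun r hr => by
    rw [hg, run_nat O (by simpa [rowCode, natWrites] using hr)]
  have ga : ∀ a, a ≠ 37 → a ≠ 67 → g.arr a = h.arr a := fun a h1 h2 => by
    rw [hg, run_arr O (by simp [rowCode, arrWrites, h1, h2])]
  have g1 := (gr 1 (by decide)).trans h1
  have g2 := (gr 2 (by decide)).trans h2
  have g5 := (gr 5 (by decide)).trans h5
  have g61 : g.arr 61 0 0 = (ε : ℂ) := by rw [ga 61 (by decide) (by decide), h61]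
  have g65 : g.arr 65 0 0 = ((K : ℝ) : ℂ) := by rw [ga 65 (by decide) (by decide), h65]
  have g68 : g.arr 68 0 0 = (τ : ℂ) := by rw [ga 68 (by decide) (by decide), h68]
  have key : rowsCode.run O h = if K - τ ≤ rowSum O K (k + 1) ∨ 4 ≤ ε then
      (g.setNat 5 (k + 1)).setNat 21 1 else (g.setNat 5 (k + 1)).setNat 21 0 := by
    rw [rowsCode, run_seq, ← hg]
    have e4 : ((4 : ℕ) : ℂ).re = 4 := by simp
    simp only [run, CExpr.eval, CStore.get, CExpr.eval_num, CStore.setNat, ne_eq,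
      Nat.reduceEqDiff, not_false_eq_true, Function.update_of_ne, g1, g2, g5,
      g61, g65, g67, g68, ← Complex.ofReal_sub, Complex.ofReal_re, e4]
    by_cases c1 : K - τ ≤ rowSum O K (k + 1)
    · simp [c1]
    · by_cases c2 : 4 ≤ ε
      · simp [c1, c2]
      · simp [c1, c2]
  rw [key]
  split_ifs
  · exact ⟨rfl, g67, rfl⟩
  · exact ⟨rfl, g67, rfl⟩

/-- Compute the dimensions from the number of rows. -/
def dimCode : Code := seq (natAdd 6 5 5) (seq (natAdd 8 6 1) (seq (natAdd 9 6 6) (seq (natAdd 9 9 9)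
  (seq (natAdd 9 9 1) (seq (natAdd 9 9 1) (seq (natAdd 9 9 1) (seq (natAdd 9 9 1) (natAdd 9 9 1))))))))

theorem run_dimCode {n : ℕ} (h1 : h.nat 1 = 1) (h5 : h.nat 5 = n) :
    (dimCode.run O h).nat 6 = 2 * n ∧ (dimCode.run O h).nat 8 = 2 * n + 1 ∧
      (dimCode.run O h).nat 9 = 4 * (2 * n) + 5 := by
  simp [dimCode, run, CStore.setNat, h1, h5]
  omega

/-- The product of the registers `a` and `b`, to the register `v`. -/
def natMulCode (v a b : ℕ) : Code := seq (natZero v) (loop 10 a (natAdd v v b))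

theorem run_natMulCode {v a b : ℕ} (hv : v ≠ 10) (hb : b ≠ 10) (hva : a ≠ v)
    (hvb : b ≠ v) (r : ℕ) (hr : r ≠ 10) : ((natMulCode v a b).run O h).nat r =
      if r = v then h.nat a * h.nat b else h.nat r := by
  have := run_loop O (v := 10) (n := a) (p := natAdd v v b) (h.setNat v 0) (fun k h' => ∀ r, r ≠ 10 →
    h'.nat r = if r = v then k * h.nat b else h.nat r)
    (fun r hr => by
      rw [CStore.nat_setNat_of_ne _ _ hr, zero_mul]
      split_ifs with q
      · rw [q, CStore.nat_setNat_self]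
      · rw [CStore.nat_setNat_of_ne _ _ q])
    (fun k hk h' h10 _ _ hI r hr => by
      rw [CStore.nat_setNat_of_ne _ _ hr, run, hI v hv, hI b hb, if_pos rfl, if_neg hvb]
      split_ifs with q
      · rw [q, CStore.nat_setNat_self, add_mul, one_mul]
      · rw [CStore.nat_setNat_of_ne _ _ q, hI r hr, if_neg q])
  rw [CStore.nat_setNat_of_ne _ _ hva] at this
  exact this r hr

/-- The number of terms and iterations, to the register `7`. -/
def orderCode : Code := seq (natMulCode 22 6 6) (seq (natMulCode 23 6 22) (seq (natMulCode 24 4 23)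
  (seq (natMulCode 25 4 24) (seq (natAdd 25 25 25) (seq (natAdd 25 25 25) (seq (natAdd 25 25 25)
  (seq (natAdd 25 25 25) (seq (natAdd 25 25 25) (seq (natAdd 25 25 25) (seq (natAdd 25 25 25)
  (seq (natAdd 25 25 25) (seq (natAdd 25 25 25) (seq (natAdd 25 25 25) (seq (natAdd 25 25 25)
  (natAdd 7 25 25)))))))))))))))

/-- In the algorithm registers `4` and `6` hold `Y` and `m`, so that `N = 4096 Y² m³`. This meets
both requirements, `N ≥ 36 m³` for the existence of a phase and `N ε² ≥ 4096` for the precision; the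
factor is produced by twelve doublings. -/
theorem run_orderCode : (orderCode.run O h).nat 7 =
    4096 * (h.nat 4 * (h.nat 4 * (h.nat 6 * (h.nat 6 * h.nat 6)))) := by
  obtain ⟨g1, e1⟩ : ∃ g, g = (natMulCode 22 6 6).run O h := ⟨_, rfl⟩
  obtain ⟨g2, e2⟩ : ∃ g, g = (natMulCode 23 6 22).run O g1 := ⟨_, rfl⟩
  obtain ⟨g3, e3⟩ : ∃ g, g = (natMulCode 24 4 23).run O g2 := ⟨_, rfl⟩
  obtain ⟨g4, e4⟩ : ∃ g, g = (natMulCode 25 4 24).run O g3 := ⟨_, rfl⟩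
  have k1 := fun r (hr : r ≠ 10) => run_natMulCode (O := O) (h := h) (v := 22) (a := 6) (b := 6)
    (by decide) (by decide) (by decide) (by decide) r hr
  have k2 := fun r (hr : r ≠ 10) => run_natMulCode (O := O) (h := g1) (v := 23) (a := 6) (b := 22)
    (by decide) (by decide) (by decide) (by decide) r hr
  have k3 := fun r (hr : r ≠ 10) => run_natMulCode (O := O) (h := g2) (v := 24) (a := 4) (b := 23)
    (by decide) (by decide) (by decide) (by decide) r hr
  have k4 := fun r (hr : r ≠ 10) => run_natMulCode (O := O) (h := g3) (v := 25) (a := 4) (b := 24)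
    (by decide) (by decide) (by decide) (by decide) r hr
  rw [← e1] at k1
  rw [← e2] at k2
  rw [← e3] at k3
  rw [← e4] at k4
  have v4 : g4.nat 25 = h.nat 4 * (h.nat 4 * (h.nat 6 * (h.nat 6 * h.nat 6))) := by
    simp [k4, k3, k2, k1]
  rw [orderCode, run_seq, ← e1, run_seq, ← e2, run_seq, ← e3, run_seq, ← e4, ← v4]
  simp [run, CStore.setNat]
  omega

/-- Write the parameter `d` to register `0`. -/
def degreeCode : Code := seq (natSub 22 5 1) (seq (natAdd 0 22 22) (seq (natAdd 0 0 22)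
  (seq (natAdd 0 0 22) (seq (natAdd 0 0 22) (seq (natAdd 0 0 22) (natAdd 0 0 22))))))

/-- The factor `7` is the least integer that works: the degree bound `4m + 4 = 8L + 12` must not
exceed `3d`, and at `L = 1` this requires `d ≥ 20/3`. -/
theorem run_degreeCode {L : ℕ} (h1 : h.nat 1 = 1) (h5 : h.nat 5 = L + 1) :
    (degreeCode.run O h).nat 0 = 7 * L := by
  simp [degreeCode, run, CStore.setNat, h1, h5]
  omega

end Code
end RealRAM

namespace RealRAM
namespace Code

variable {O : ℕ → ℕ → ℂ}

/-! ### The algorithm -/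

/-- The machine program that computes the Hamiltonian. -/
def algorithm : Prog := .seq (.instr (.natOne 1)) (.seq initCode.compile
  (.seq (.whileNat 21 1 columnsCode.compile) (.seq (natZero 21).compile
  (.seq (.whileNat 21 1 precisionCode.compile) (.seq (natZero 21).compile
  (.seq (.whileNat 21 1 rowsCode.compile) (.seq dimCode.compile (.seq orderCode.compile
  (.seq (.ifNat 5 1 (natZero 22).compile mainCode.compile) degreeCode.compile)))))))))

/-- A structured program whose cost bounds that of the algorithm. -/
def costCode : Code := seq (natZero 1) (seq initCode (seq (loop 0 0 columnsCode)
  (seq (natZero 21) (seq (loop 0 0 precisionCode) (seq (natZero 21) (seq (loop 0 0 rowsCode)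
    (seq dimCode (seq orderCode (seq (ifNat 5 1 (natZero 22) mainCode) degreeCode)))))))))

/-- The number of terms and iterations for the precision `1 / Y` and `L + 1` rows. -/
def order (Y L : ℕ) : ℕ := 4096 * (Y * (Y * (2 * (L + 1) * (2 * (L + 1) * (2 * (L + 1))))))

theorem order_le {Y L W : ℕ} (hY : Y ≤ W) (hL : L + 1 ≤ W) : order Y L ≤ 32768 * W ^ 5 := by
  have h2 : 2 * (L + 1) ≤ 2 * W := by omega
  calc order Y L ≤ 4096 * (W * (W * (2 * W * (2 * W * (2 * W))))) := by
        unfold order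
        gcongr
    _ = 32768 * W ^ 5 := by ring

theorem leads_search_columns {E ε : ℝ} {h : CStore} (hε : 0 < ε) (hh : Ready E ε h) :
    ∃ (K : ℕ) (h' : CStore), 0 < K ∧ 64 * E < K * ε ^ 2 ∧ (∀ k : ℕ, 0 < k → k < K → k * ε ^ 2 ≤ 64 * E) ∧
      h'.nat 3 = K ∧ h'.arr 65 0 0 = ((K : ℝ) : ℂ) ∧
      (∀ X, Leads O (.whileNat 21 1 columnsCode.compile) h (K * (columnsCode.cost X + 1) + 1) h') ∧
      (∀ r, columnsCode.natWrites.contains r = false → h'.nat r = h.nat r) ∧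
      (∀ a, columnsCode.arrWrites.contains a = false → h'.arr a = h.arr a) := by
  have hex : ∃ n : ℕ, 0 < n ∧ 64 * E < n * ε ^ 2 := by
    obtain ⟨n, hn⟩ := exists_nat_gt (64 * E / ε ^ 2)
    refine ⟨n + 1, Nat.succ_pos n, ?_⟩
    rw [div_lt_iff₀ (by positivity)] at hn
    push_cast
    nlinarith [pow_pos hε 2]
  obtain ⟨K, h', hK, hKQ, hmin, hI, hL, hr, ha⟩ := Leads.search (O := O) (p := columnsCode) rfl rfl
    hh.one (hh.nat 21 (by decide)) (fun n => 64 * E < n * ε ^ 2) hex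
    (fun k g => g.nat 3 = k ∧ g.arr 64 0 0 = ((k * ε ^ 2 : ℝ) : ℂ) ∧ g.arr 65 0 0 = ((k : ℝ) : ℂ))
    ⟨hh.nat 3 (by decide), by simp [hh.zero' 64 (by decide) (by decide)],
      by simp [hh.zero' 65 (by decide) (by decide)]⟩
    (fun k g hr ha hI => by
      obtain ⟨r1, r2, r3, r4⟩ := run_columnsCode (O := O) ((hr 1 rfl).trans hh.one)
        ((hr 2 rfl).trans (hh.nat 2 (by decide))) hI.1 (by rw [ha 62 rfl, hh.energy])
        (by rw [ha 63 rfl, hh.epsSq]) hI.2.1 hI.2.2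
      refine ⟨⟨r1, r2, r3⟩, fun hq => ?_, fun hq => ?_⟩
      · rw [r4, if_neg (not_le.mpr hq)]
      · rw [r4, if_pos (not_lt.mp hq)])
  exact ⟨K, h', hK, hKQ, fun k h0 hk => not_lt.mp (hmin k h0 hk), hI.1, hI.2.2, fun X => hL X (List.forall_mem_nil _), hr, ha⟩

theorem leads_search_precision {ε : ℝ} {h : CStore} (hε : 0 < ε) (h1 : h.nat 1 = 1)
    (h2 : h.nat 2 = 0) (h21 : h.nat 21 = 0) (h4 : h.nat 4 = 0) (h61 : h.arr 61 0 0 = (ε : ℂ))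
    (h66 : h.arr 66 0 0 = 0) :
    ∃ (Y : ℕ) (h' : CStore), 0 < Y ∧ 1 ≤ Y * ε ∧ (∀ k : ℕ, 0 < k → k < Y → k * ε < 1) ∧ h'.nat 4 = Y ∧
      (∀ X, Leads O (.whileNat 21 1 precisionCode.compile) h (Y * (precisionCode.cost X + 1) + 1) h') ∧
      (∀ r, precisionCode.natWrites.contains r = false → h'.nat r = h.nat r) ∧
      (∀ a, precisionCode.arrWrites.contains a = false → h'.arr a = h.arr a) := by
  have hex : ∃ n : ℕ, 0 < n ∧ 1 ≤ n * ε := by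
    obtain ⟨n, hn⟩ := exists_nat_gt (1 / ε)
    refine ⟨n + 1, Nat.succ_pos n, ?_⟩
    rw [div_lt_iff₀ hε] at hn
    push_cast
    nlinarith
  obtain ⟨Y, h', hY, hYQ, hmin, hI, hL, hr, ha⟩ := Leads.search (O := O) (p := precisionCode) rfl rfl
    h1 h21 (fun n => 1 ≤ n * ε) hex (fun k g => g.nat 4 = k ∧ g.arr 66 0 0 = ((k * ε : ℝ) : ℂ))
    ⟨h4, by simp [h66]⟩
    (fun k g hr ha hI => by
      obtain ⟨r1, r2, r3⟩ := run_precisionCode (O := O) ((hr 1 rfl).trans h1) ((hr 2 rfl).trans h2)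
        hI.1 (by rw [ha 61 rfl, h61]) hI.2
      refine ⟨⟨r1, r2⟩, fun hq => ?_, fun hq => ?_⟩
      · rw [r3, if_pos hq]
      · rw [r3, if_neg hq])
  exact ⟨Y, h', hY, hYQ, fun k h0 hk => not_le.mp (hmin k h0 hk), hI.1, fun X => hL X (List.forall_mem_nil _), hr, ha⟩

theorem leads_search_rows {ε τ : ℝ} {K : ℕ} {h : CStore} (h1 : h.nat 1 = 1) (h2 : h.nat 2 = 0)
    (h21 : h.nat 21 = 0) (h3 : h.nat 3 = K) (h5 : h.nat 5 = 0) (h61 : h.arr 61 0 0 = (ε : ℂ))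
    (h65 : h.arr 65 0 0 = ((K : ℝ) : ℂ)) (h68 : h.arr 68 0 0 = (τ : ℂ)) (h67 : h.arr 67 0 0 = 0)
    (hO : ∃ L, K - τ ≤ headSum O K L) :
    ∃ (L : ℕ) (h' : CStore), (K - τ ≤ headSum O K L ∨ 4 ≤ ε) ∧ (∀ l < L, headSum O K l < K - τ ∧ ε < 4) ∧
      h'.nat 5 = L + 1 ∧
      (∀ X, K ≤ X →
        Leads O (.whileNat 21 1 rowsCode.compile) h ((L + 1) * (rowsCode.cost X + 1) + 1) h') ∧
      (∀ r, rowsCode.natWrites.contains r = false → h'.nat r = h.nat r) ∧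
      (∀ a, rowsCode.arrWrites.contains a = false → h'.arr a = h.arr a) := by
  obtain ⟨l, hl⟩ := hO
  obtain ⟨n, h', hn, hnQ, hmin, hI, hL, hr, ha⟩ := Leads.search (O := O) (p := rowsCode) rfl rfl
    h1 h21 (fun n => K - τ ≤ rowSum O K n ∨ 4 ≤ ε) ⟨l + 1, Nat.succ_pos l, by
      rw [← headSum_eq_rowSum]
      exact .inl hl⟩ (fun k g => g.nat 5 = k ∧ g.arr 67 0 0 = (rowSum O K k : ℂ))
    ⟨h5, by simp [h67, rowSum]⟩
    (fun k g hr ha hI => by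
      obtain ⟨r1, r2, r3⟩ := run_rowsCode (O := O) ((hr 1 rfl).trans h1) ((hr 2 rfl).trans h2)
        ((hr 3 rfl).trans h3) hI.1 (by rw [ha 61 rfl, h61]) (by rw [ha 65 rfl, h65])
        (by rw [ha 68 rfl, h68]) hI.2
      refine ⟨⟨r1, r2⟩, fun hq => ?_, fun hq => ?_⟩
      · rw [r3, if_pos hq]
      · rw [r3, if_neg hq])
  obtain ⟨L, rfl⟩ : ∃ L, n = L + 1 := ⟨n - 1, by omega⟩
  refine ⟨L, h', ?_, fun l hl => ?_, hI.1, fun X hX => hL X fun r hr => ?_, hr, ha⟩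
  · rw [headSum_eq_rowSum]
    exact hnQ
  · have := hmin (l + 1) (Nat.succ_pos l) (by omega)
    rw [← headSum_eq_rowSum, not_or, not_le, not_le] at this
    exact this
  · have : r = 3 := by simpa [rowsCode, rowCode, bounds] using hr
    rw [this, h3]
    exact hX

/-- The minimality of `K`, `Y` and `L` is recorded because it yields the bounds on `d` and on the
time. The run is correct for any oracle whose head sums come close to `K`; the existence of a
passing phase is left as a hypothesis, to be supplied by unitarity. -/
theorem exec_algorithm {E ε : ℝ} (hε : 0 < ε)
    (hO : ∀ (K : ℕ) (τ : ℝ), 0 < τ → ∃ L, K - τ ≤ headSum O K L) :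
    ∃ (K Y L t : ℕ) (s : Store), 0 < K ∧ 64 * E < K * ε ^ 2 ∧
      (∀ k : ℕ, 0 < k → k < K → k * ε ^ 2 ≤ 64 * E) ∧
      0 < Y ∧ 1 ≤ Y * ε ∧ (∀ k : ℕ, 0 < k → k < Y → k * ε < 1) ∧
      (K - ε ^ 2 / 1000 ≤ headSum O K L ∨ 4 ≤ ε) ∧
      (∀ l < L, headSum O K l < K - ε ^ 2 / 1000 ∧ ε < 4) ∧
      t ≤ costCode.cost (32768 * (K + Y + L + 1) ^ 5) ∧ Exec O algorithm (input E ε) t s ∧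
      s.nat 0 = 7 * L ∧ (L = 0 → s.Outputs (7 * L) 0) ∧
      (0 < L → (∃ i ≤ 2 * (L + 1), Passing O K L (order Y L) i) →
        ∃ (i : ℕ) (M : ℕ → ℕ → ℂ), Passing O K L (order Y L) i ∧
          (Matrix.of fun i j : Fin (2 * (L + 1)) => M i j) =
            argSeries (order Y L) (phase (2 * (L + 1)) i • polarMat O K L (order Y L)) ∧
          s.Outputs (7 * L) (CanonicalPoly.blockHamiltonian (2 * (L + 1)) M)) := by
  obtain ⟨g1, e1⟩ : ∃ g, g = initCode.run O ((CStore.input E ε).setNat 1 1) := ⟨_, rfl⟩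
  have R1 : Ready E ε g1 := e1 ▸ ready_initCode E ε
  obtain ⟨K, g2, hK, hKQ, hKmin, b3, b65, T2, fr2, fa2⟩ := leads_search_columns (O := O) hε R1
  obtain ⟨g3, e3⟩ : ∃ g, g = g2.setNat 21 0 := ⟨_, rfl⟩
  have fr3 : ∀ r, r ≠ 21 → g3.nat r = g2.nat r := fun r hr => by
    rw [e3, CStore.nat_setNat_of_ne _ _ hr]
  have fa3 : ∀ a, g3.arr a = g2.arr a := fun a => by rw [e3]; rfl
  obtain ⟨Y, g4, hY, hYQ, hYmin, b4, T4, fr4, fa4⟩ := leads_search_precision (O := O) (h := g3) hε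
    (by rw [fr3 1 (by decide), fr2 1 rfl, R1.one])
    (by rw [fr3 2 (by decide), fr2 2 rfl, R1.nat 2 (by decide)])
    (by rw [e3, CStore.nat_setNat_self])
    (by rw [fr3 4 (by decide), fr2 4 rfl, R1.nat 4 (by decide)])
    (by rw [fa3, fa2 61 rfl, R1.eps])
    (by rw [fa3, fa2 66 rfl, R1.zero' 66 (by decide) (by decide)])
  obtain ⟨g5, e5⟩ : ∃ g, g = g4.setNat 21 0 := ⟨_, rfl⟩
  have fr5 : ∀ r, r ≠ 21 → g5.nat r = g4.nat r := fun r hr => by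
    rw [e5, CStore.nat_setNat_of_ne _ _ hr]
  have fa5 : ∀ a, g5.arr a = g4.arr a := fun a => by rw [e5]; rfl
  have n1 : g5.nat 1 = 1 := by
    rw [fr5 1 (by decide), fr4 1 rfl, fr3 1 (by decide), fr2 1 rfl, R1.one]
  have n2 : g5.nat 2 = 0 := by
    rw [fr5 2 (by decide), fr4 2 rfl, fr3 2 (by decide), fr2 2 rfl, R1.nat 2 (by decide)]
  have n3 : g5.nat 3 = K := by
    rw [fr5 3 (by decide), fr4 3 rfl, fr3 3 (by decide), b3]
  have n4 : g5.nat 4 = Y := by rw [fr5 4 (by decide), b4]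
  obtain ⟨L, g6, hLQ, hLmin, b5, T6, fr6, fa6⟩ := leads_search_rows (O := O) (h := g5) (ε := ε)
    (τ := ε ^ 2 / 1000) (K := K) n1 n2 (by rw [e5, CStore.nat_setNat_self]) n3
    (by rw [fr5 5 (by decide), fr4 5 rfl, fr3 5 (by decide), fr2 5 rfl, R1.nat 5 (by decide)])
    (by rw [fa5, fa4 61 rfl, fa3, fa2 61 rfl, R1.eps]) (by rw [fa5, fa4 65 rfl, fa3, b65])
    (by rw [fa5, fa4 68 rfl, fa3, fa2 68 rfl, R1.tol])
    (by rw [fa5, fa4 67 rfl, fa3, fa2 67 rfl, R1.zero' 67 (by decide) (by decide)])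
    (hO K _ (by positivity))
  obtain ⟨g7, e7⟩ : ∃ g, g = dimCode.run O g6 := ⟨_, rfl⟩
  obtain ⟨g8, e8⟩ : ∃ g, g = orderCode.run O g7 := ⟨_, rfl⟩
  obtain ⟨W, hW⟩ : ∃ W, W = K + Y + L + 1 := ⟨_, rfl⟩
  -- `X` dominates every loop bound: the dimensions are linear in `W`, the order `4096 Y² m³` has
  -- degree five. Since it also exceeds the numbers of rounds of the three searches, these cost no
  -- more than ordinary loops do in `costCode`.
  obtain ⟨X, hXdef⟩ : ∃ X, X = 32768 * W ^ 5 := ⟨_, rfl⟩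
  have hWX : 32768 * W ≤ X := by
    rw [hXdef]
    exact Nat.mul_le_mul_left _ (Nat.le_self_pow (by decide) W)
  have o1 : g6.nat 1 = 1 := by rw [fr6 1 rfl, n1]
  obtain ⟨p6, p8, p9⟩ := run_dimCode (O := O) (h := g6) (n := L + 1) o1 b5
  rw [← e7] at p6 p8 p9
  have fr7 : ∀ r < 6, g7.nat r = g6.nat r := fun r hr => by
    rw [e7, run_nat_of_lt dimCode (n := 6) (by decide +kernel) hr]
  have fr8 : ∀ r < 7, g8.nat r = g7.nat r := fun r hr => by
    rw [e8, run_nat_of_lt orderCode (n := 7) (by decide +kernel) hr]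
  have q1 : g8.nat 1 = 1 := by rw [fr8 1 (by decide), fr7 1 (by decide), o1]
  have q2 : g8.nat 2 = 0 := by rw [fr8 2 (by decide), fr7 2 (by decide), fr6 2 rfl, n2]
  have q3 : g8.nat 3 = K := by rw [fr8 3 (by decide), fr7 3 (by decide), fr6 3 rfl, n3]
  have q5 : g8.nat 5 = L + 1 := by rw [fr8 5 (by decide), fr7 5 (by decide), b5]
  have q6 : g8.nat 6 = 2 * (L + 1) := by rw [fr8 6 (by decide), p6]
  have r4 : g7.nat 4 = Y := by rw [fr7 4 (by decide), fr6 4 rfl, n4]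
  have q7 : g8.nat 7 = order Y L := by rw [e8, run_orderCode, r4, p6, order]
  have q8 : g8.nat 8 = 2 * (L + 1) + 1 := by rw [e8, run_nat O (by decide +kernel), p8]
  have q9 : g8.nat 9 = 4 * (2 * (L + 1)) + 5 := by rw [e8, run_nat O (by decide +kernel), p9]
  have hz : ∀ a < 60, a ≠ 37 → ∀ u v, g8.arr a u v = 0 := fun a ha h37 u v => by
    have c2 : columnsCode.arrWrites.contains a = false := by
      simp [columnsCode, arrWrites]
      omega
    have c4 : precisionCode.arrWrites.contains a = false := by
      simp [precisionCode, arrWrites]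
      omega
    have c6 : rowsCode.arrWrites.contains a = false := by
      simp [rowsCode, rowCode, arrWrites]
      omega
    rw [e8, run_arr O (by rfl), e7, run_arr O (by rfl), fa6 a c6, fa5, fa4 a c4, fa3, fa2 a c2,
      R1.zero a ha]
  have main : ∃ g9, Leads O (.ifNat 5 1 (natZero 22).compile mainCode.compile) g8
      ((ifNat 5 1 (natZero 22) mainCode).cost X) g9 ∧ g9.nat 1 = 1 ∧ g9.nat 5 = L + 1 ∧
      (L = 0 → ∀ u v, g9.arr 0 u v = 0) ∧
      (0 < L → g9 = mainCode.run O g8) := by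
    -- The branch `nat 5 ≤ nat 1` is `L + 1 ≤ 1`. In it nothing is computed, and array `0`, cleared
    -- after the input was moved, already represents the zero polynomial.
    rcases Nat.eq_zero_or_pos L with hL | hL
    · refine ⟨g8.setNat 22 0, (Leads.ifNat_true (by rw [q5, q1, hL]) (Leads.code (p := natZero 22)
        (X := X) rfl rfl q1 (List.forall_mem_nil _))).mono ?_, ?_, ?_, fun _ => hz 0 (by decide) (by decide),
        fun h => absurd h (by omega)⟩
      · simp only [cost]
        omega
      · rw [CStore.nat_setNat_of_ne _ _ (by decide), q1]
      · rw [CStore.nat_setNat_of_ne _ _ (by decide), q5]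
    · refine ⟨mainCode.run O g8, (Leads.ifNat_false (by rw [q5, q1]; omega) (Leads.code (X := X)
        (by decide +kernel) (by decide +kernel) q1 fun n hn => ?_)).mono ?_, ?_, ?_,
        fun h => absurd h (by omega), fun _ => rfl⟩
      · have : ∀ n ∈ mainCode.bounds, n = 6 ∨ n = 7 ∨ n = 8 ∨ n = 9 := by decide +kernel
        rcases this n hn with rfl | rfl | rfl | rfl
        · omega
        · rw [q7, hXdef]
          exact order_le (by omega) (by omega)
        · omega
        · omega
      · simp only [cost]
        omega
      · rw [run_nat O (by decide +kernel), q1]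
      · rw [run_nat O (by decide +kernel), q5]
  obtain ⟨g9, T9, s1, s5, hg0, hg1⟩ := main
  have T1 : Leads O initCode.compile ((CStore.input E ε).setNat 1 1) (initCode.cost X) g1 :=
    e1 ▸ Leads.code rfl rfl rfl (List.forall_mem_nil _)
  have T3 : Leads O (natZero 21).compile g2 ((natZero 21).cost X) g3 :=
    e3 ▸ Leads.code (p := natZero 21) rfl rfl (by rw [fr2 1 rfl, R1.one]) (List.forall_mem_nil _)
  have T5 : Leads O (natZero 21).compile g4 ((natZero 21).cost X) g5 :=
    e5 ▸ Leads.code (p := natZero 21) rfl rfl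
      (by rw [fr4 1 rfl, fr3 1 (by decide), fr2 1 rfl, R1.one]) (List.forall_mem_nil _)
  have T7 : Leads O dimCode.compile g6 (dimCode.cost X) g7 :=
    e7 ▸ Leads.code rfl rfl o1 (List.forall_mem_nil _)
  have T8 : Leads O orderCode.compile g7 (orderCode.cost X) g8 :=
    e8 ▸ Leads.code (by decide +kernel) (by decide +kernel)
      (by rw [fr7 1 (by decide), o1]) (fun n hn => by
        have : ∀ n ∈ orderCode.bounds, n = 6 ∨ n = 4 := by decide +kernel
        rcases this n hn with rfl | rfl
        · omega
        · omega)
  have T10 : Leads O degreeCode.compile g9 (degreeCode.cost X) (degreeCode.run O g9) :=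
    Leads.code rfl rfl s1 (List.forall_mem_nil _)
  have total : Leads O algorithm (CStore.input E ε) (costCode.cost X) (degreeCode.run O g9) := by
    refine ((leads_natOne 1).seq (T1.seq ((T2 X).seq (T3.seq ((T4 X).seq (T5.seq
      ((T6 X (by omega)).seq (T7.seq (T8.seq (T9.seq T10)))))))))).mono ?_
    have m1 : K * (columnsCode.cost X + 1) ≤ X * (columnsCode.cost X + 2) :=
      Nat.mul_le_mul (by omega) (by omega)
    have m2 : Y * (precisionCode.cost X + 1) ≤ X * (precisionCode.cost X + 2) :=
      Nat.mul_le_mul (by omega) (by omega)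
    have m3 : (L + 1) * (rowsCode.cost X + 1) ≤ X * (rowsCode.cost X + 2) :=
      Nat.mul_le_mul (by omega) (by omega)
    have c : costCode.cost X = 1 + (initCode.cost X + (X * (columnsCode.cost X + 2) + 2 +
      ((natZero 21).cost X + (X * (precisionCode.cost X + 2) + 2 + ((natZero 21).cost X +
      (X * (rowsCode.cost X + 2) + 2 + (dimCode.cost X + (orderCode.cost X +
      ((ifNat 5 1 (natZero 22) mainCode).cost X + degreeCode.cost X))))))))) := rfl
    rw [c]
    omega
  obtain ⟨t, s, ht, hexec, hsim⟩ := total _ (sim_input E ε)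
  have s0 : s.nat 0 = 7 * L := by rw [hsim.1, run_degreeCode s1 s5]
  have out : ∀ P : CanonicalPoly, (∀ u v, g9.arr 0 u v = P (u, v)) → s.Outputs (7 * L) P :=
    fun P hP => ⟨s0, fun j k => by
      have := hsim.2 0 (by decide) j k
      rw [run_arr O rfl, hP] at this
      exact this⟩
  refine ⟨K, Y, L, t, s, hK, hKQ, hKmin, hY, hYQ, hYmin, hLQ, hLmin, ?_, hexec, s0,
    fun hL => out 0 (hg0 hL), fun hL hpass => ?_⟩
  · rw [← hW, ← hXdef]
    exact ht
  · obtain ⟨i, M, hi, hM, hP⟩ := run_mainCode (O := O) q1 q2 q3 q5 q6 q7 q8 q9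
      (hz 40 (by decide) (by decide) 0 0) (fun a ha hb => hz a (by omega) (by omega))
      (hz 0 (by decide) (by decide)) hpass
    exact ⟨i, M, hi, hM, out _ (by rw [hg1 hL]; exact hP)⟩

end Code
end RealRAM

/-! ### The size of the parameters -/

theorem isHermitian_zero : (0 : CanonicalPoly).IsHermitian := fun φ ψ => by
  have h : (0 : CanonicalPoly).op = 0 := by rw [← CanonicalPoly.opLin_apply, map_zero]
  rw [h]
  simp

theorem mul_sq_le_of_least {E ε : ℝ} (hE : 0 ≤ E) {K : ℕ} (hK : 0 < K)
    (h : ∀ k : ℕ, 0 < k → k < K → k * ε ^ 2 ≤ 64 * E) : K * ε ^ 2 ≤ 64 * E + ε ^ 2 := by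
  obtain ⟨k, rfl⟩ : ∃ k, K = k + 1 := ⟨K - 1, by omega⟩
  have hk : k * ε ^ 2 ≤ 64 * E := by
    rcases Nat.eq_zero_or_pos k with rfl | h0
    · rw [Nat.cast_zero, zero_mul]
      positivity
    · exact h k h0 (Nat.lt_succ_self k)
  push_cast
  linarith

theorem mul_le_of_least {ε : ℝ} {Y : ℕ} (hY : 0 < Y)
    (h : ∀ k : ℕ, 0 < k → k < Y → k * ε < 1) : Y * ε ≤ 1 + ε := by
  obtain ⟨k, rfl⟩ : ∃ k, Y = k + 1 := ⟨Y - 1, by omega⟩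
  have hk : k * ε ≤ 1 := by
    rcases Nat.eq_zero_or_pos k with rfl | h0
    · rw [Nat.cast_zero, zero_mul]
      exact zero_le_one
    · exact (h k h0 (Nat.lt_succ_self k)).le
  push_cast
  linarith

/-- The search did not stop at row index `L - 1`, so Markov's inequality applies there and gives `L
ε²/1000 ≤ K M`. By minimality of `K` every level `j < K` satisfies `j ε² ≤ 64E`, so its energy is
bounded by `E_U(64E/ε²)`, and `K ε² ≤ 64E + ε²`. -/
theorem rows_le {U : Mode ≃ₗᵢ[ℂ] Mode} (hU : IsPhysical U) {E ε : ℝ} (hE : 0 ≤ E) (hε : 0 < ε)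
    {K L : ℕ} (hK : 0 < K) (hKmin : ∀ k : ℕ, 0 < k → k < K → k * ε ^ 2 ≤ 64 * E)
    (hL : ∀ l < L, headSum (fockMatrix U) K l < K - ε ^ 2 / 1000) :
    (L : ℝ) ≤ 1000 * ((64 * E + ε ^ 2) / ε ^ 4) * (maxEnergy U (64 * E / ε ^ 2)).toReal := by
  set M := (maxEnergy U (64 * E / ε ^ 2)).toReal with hM
  have hM0 : 0 ≤ M := ENNReal.toReal_nonneg
  rcases Nat.eq_zero_or_pos L with rfl | h0
  · rw [Nat.cast_zero]
    positivity
  obtain ⟨l, rfl⟩ : ∃ l, L = l + 1 := ⟨L - 1, by omega⟩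
  have key := mul_le_of_headSum_lt U (maxEnergy_lt_top hU (64 * E / ε ^ 2)) (fun j hj =>
    energy_fock_le_maxEnergy U (by
      rw [le_div_iff₀ (by positivity)]
      rcases Nat.eq_zero_or_pos j with rfl | hj0
      · rw [Nat.cast_zero, zero_mul]
        positivity
      · exact hKmin j hj0 hj)) (hL l (Nat.lt_succ_self l))
  have hK2 := mul_sq_le_of_least hE hK hKmin
  have h4 : 0 < ε ^ 4 := by positivity
  rw [mul_div_assoc', div_mul_eq_mul_div, le_div_iff₀ h4]
  push_cast
  calc ((l : ℝ) + 1) * ε ^ 4 = 1000 * (((l : ℝ) + 1) * (ε ^ 2 / 1000)) * ε ^ 2 := by ring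
    _ ≤ 1000 * (K * M) * ε ^ 2 := by gcongr
    _ = 1000 * (K * ε ^ 2) * M := by ring
    _ ≤ 1000 * (64 * E + ε ^ 2) * M := by gcongr

/-- `K` is at most `64 E/ε² + 1` and `E/ε² ≤ B³`, where `B` is the base on the right; `Y + L` and
the constants contribute at most `3B³`. -/
theorem parameters_le {E ε : ℝ} (hE : 0 ≤ E) (hε : 0 < ε) {K Y L : ℕ} (hK : 0 < K)
    (hKmin : ∀ k : ℕ, 0 < k → k < K → k * ε ^ 2 ≤ 64 * E) (hY : 0 < Y)
    (hYmin : ∀ k : ℕ, 0 < k → k < Y → k * ε < 1) :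
    ((K + Y + L + 1 : ℕ) : ℝ) ≤ 67 * (1 + (7 * L : ℕ) + E + 1 / ε) ^ 3 := by
  set B : ℝ := 1 + (7 * L : ℕ) + E + 1 / ε with hB
  have hd : 0 ≤ 1 / ε := by positivity
  have hLn : (0 : ℝ) ≤ L := Nat.cast_nonneg L
  have hB' : B = 1 + 7 * L + E + 1 / ε := by
    rw [hB]
    push_cast
    ring
  have hB1 : 1 ≤ B := by linarith
  have hK2 : (K : ℝ) ≤ 64 * E * (1 / ε) ^ 2 + 1 := by
    have := mul_sq_le_of_least hE hK hKmin
    rw [div_pow, one_pow, mul_one_div, ← sub_le_iff_le_add, le_div_iff₀ (by positivity)]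
    linarith
  have hY2 : (Y : ℝ) ≤ 1 / ε + 1 := by
    have := mul_le_of_least hY hYmin
    rw [← sub_le_iff_le_add, le_div_iff₀ hε]
    linarith
  have h3 : E * (1 / ε) ^ 2 ≤ B ^ 3 := by
    calc E * (1 / ε) ^ 2 ≤ B * B ^ 2 := by
          gcongr
          · linarith
          · linarith
      _ = B ^ 3 := by ring
  have hB3 : B ≤ B ^ 3 := le_self_pow₀ hB1 (by decide)
  push_cast
  linarith

/-- `896000 = 7 · 1000 · 128`, since `64E + ε² ≤ 128E` in the second case. The slack `A` lets one
constant serve for both the degree and the running time. -/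
theorem degree_le_of_rows_le {E ε A M : ℝ} {L : ℕ} (hE : 0 ≤ E) (hA : 0 ≤ A) (hM : 0 ≤ M)
    (hL : (L : ℝ) ≤ 1000 * ((64 * E + ε ^ 2) / ε ^ 4) * M) :
    ((7 * L : ℕ) : ℝ) ≤ (896000 + A) * ((E + ε ^ 2) / ε ^ 4) * M ∧
      (ε ^ 2 ≤ 64 * E → ((7 * L : ℕ) : ℝ) ≤ (896000 + A) * (E / ε ^ 4) * M) := by
  have hd : ((7 * L : ℕ) : ℝ) ≤ 7000 * ((64 * E + ε ^ 2) / ε ^ 4) * M := by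
    push_cast
    linarith
  refine ⟨hd.trans (mul_le_mul_of_nonneg_right ?_ hM),
    fun hEε => hd.trans (mul_le_mul_of_nonneg_right ?_ hM)⟩
  all_goals
    rw [mul_div_assoc', mul_div_assoc']
    refine div_le_div_of_nonneg_right ?_ (by positivity)
  · nlinarith [sq_nonneg ε, mul_nonneg hA (add_nonneg hE (sq_nonneg ε))]
  · nlinarith [mul_nonneg hA hE]

/-- The exponent is `3 · 5 · k`: the parameters are cubic in `B`, the loop bound is of degree five
in the parameters, and the cost of degree `k` in the loop bound. -/
theorem cast_le_mul_pow {t c k a W : ℕ} {b B : ℝ} (hB : 0 ≤ B) {f : ℕ → ℕ}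
    (hf : ∀ X, 1 ≤ X → f X ≤ c * X ^ k) (ha : 0 < a) (hW0 : 0 < W) (ht : t ≤ f (a * W ^ 5))
    (hW : (W : ℝ) ≤ b * B ^ 3) :
    (t : ℝ) ≤ (896000 + c * (a * b ^ 5) ^ k) * B ^ (15 * k) := by
  calc (t : ℝ) ≤ ((c * (a * W ^ 5) ^ k : ℕ) : ℝ) := by
        exact_mod_cast ht.trans (hf _ (Nat.one_le_iff_ne_zero.mpr (by positivity)))
    _ = c * (a * (W : ℝ) ^ 5) ^ k := by push_cast; rfl
    _ ≤ c * (a * (b * B ^ 3) ^ 5) ^ k := by gcongr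
    _ = c * (a * b ^ 5) ^ k * B ^ (15 * k) := by
      rw [show a * (b * B ^ 3) ^ 5 = a * b ^ 5 * B ^ 15 by ring, mul_pow, ← pow_mul]
      ring
    _ ≤ (896000 + c * (a * b ^ 5) ^ k) * B ^ (15 * k) := by
      gcongr
      linarith

open RealRAM in
/-- The Hamiltonian computed by the algorithm. -/
theorem exists_approximation {U : Mode ≃ₗᵢ[ℂ] Mode} {E ε : ℝ} (hE : 0 ≤ E) (hε : 0 < ε) {K Y L : ℕ}
    {s : Store} (hK : 0 < K) (hKQ : 64 * E < K * ε ^ 2) (hY : 0 < Y) (hYQ : 1 ≤ Y * ε)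
    (hLQ : K - ε ^ 2 / 1000 ≤ headSum (fockMatrix U) K L ∨ 4 ≤ ε)
    (hLmin : ∀ l < L, headSum (fockMatrix U) K l < K - ε ^ 2 / 1000 ∧ ε < 4)
    (h0 : L = 0 → s.Outputs (7 * L) 0)
    (h1 : 0 < L → (∃ i ≤ 2 * (L + 1), Passing (fockMatrix U) K L (Code.order Y L) i) →
      ∃ (i : ℕ) (M : ℕ → ℕ → ℂ), Passing (fockMatrix U) K L (Code.order Y L) i ∧
        (Matrix.of fun i j : Fin (2 * (L + 1)) => M i j) = argSeries (Code.order Y L)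
          (phase (2 * (L + 1)) i • polarMat (fockMatrix U) K L (Code.order Y L)) ∧
        s.Outputs (7 * L) (CanonicalPoly.blockHamiltonian (2 * (L + 1)) M)) :
    ∃ (P : CanonicalPoly) (V : Mode ≃ₗᵢ[ℂ] Mode), P.degree ≤ 3 * (7 * L) ∧ P.IsHermitian ∧
      IsUnitaryExp P.unbounded V ∧ ecDiamond E U V ≤ ENNReal.ofReal ε ∧ s.Outputs (7 * L) P := by
  rcases Nat.eq_zero_or_pos L with hL | hL
  · refine ⟨0, LinearIsometryEquiv.refl ℂ Mode, Nat.zero_le _, isHermitian_zero, isUnitaryExp_zero,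
      ?_, h0 hL⟩
    by_cases h4 : 4 ≤ ε
    · exact (ecDiamond_le_four E U _).trans (ENNReal.ofReal_le_ofReal h4)
    · rw [hL] at hLQ
      exact ecDiamond_refl_le U hE hε (not_le.mp h4) hK hKQ.le (hLQ.resolve_right h4)
  · have h4 : ε < 4 := (hLmin 0 hL).2
    have hLQ' := hLQ.resolve_right (not_le.mpr h4)
    set m := 2 * (L + 1) with hm
    have hN : Code.order Y L = 4096 * (Y * (Y * (m * (m * m)))) := rfl
    set N := Code.order Y L with hNdef
    have hm1 : 1 ≤ m := by omega
    have hm3 : 1 ≤ m * (m * m) := Nat.one_le_iff_ne_zero.mpr (by positivity)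
    have hY2 : m * (m * m) ≤ Y * (Y * (m * (m * m))) :=
      (Nat.le_mul_of_pos_left _ hY).trans (Nat.le_mul_of_pos_left _ hY)
    have hN36 : 36 * m ^ 3 ≤ N := by
      have : m ^ 3 = m * (m * m) := by ring
      rw [this, hN]
      omega
    -- `N ε² = 4096 (Yε)² m³`, and both `Yε` and `m` are at least `1`.
    have hNε : 4096 ≤ (N : ℝ) * ε ^ 2 := by
      have hc : (1 : ℝ) ≤ (m : ℝ) * (m * m) := by exact_mod_cast hm3
      rw [hN]
      push_cast
      calc (4096 : ℝ) ≤ 4096 * ((Y * ε) * (Y * ε)) * (m * (m * m)) := by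
            have : 1 ≤ (Y * ε) * (Y * ε) := one_le_mul_of_one_le_of_one_le hYQ hYQ
            have := one_le_mul_of_one_le_of_one_le this hc
            linarith
        _ = _ := by ring
    obtain ⟨i, M, hi, hM, hout⟩ := h1 hL (exists_passing U hε h4 hLQ' hN36)
    -- The partial sums are exactly self-adjoint although the matrix they are evaluated at is only
    -- nearly unitary.
    have hh : ∀ i < m, ∀ j < m, conj (M i j) = M j i := fun a ha b hb => by
      have hsa : star (Matrix.of fun i j : Fin m => M i j) = Matrix.of fun i j : Fin m => M i j := by
        rw [hM]
        exact isSelfAdjoint_argSeries N _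
      exact congrFun (congrFun hsa ⟨b, hb⟩) ⟨a, ha⟩
    obtain ⟨V, hV, hVf⟩ := exists_unitary_blockHamiltonian m (by omega) M hh
    refine ⟨_, V, ?_, isHermitian_blockHamiltonian m M hh, hV, ?_, hout⟩
    -- The inequality is `8L + 12 ≤ 21L`, which uses `L ≥ 1`.
    · have := (CanonicalPoly.degLE_blockHamiltonian m M).degree_le
      omega
    · refine ecDiamond_le_of_passing U hE hε h4 hK hKQ.le hLQ' (by omega) hNε hi fun j => ?_
      rw [hVf j, hM]

end Boson

end

/-! ### The theorem -/

theorem theorem3 :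
    ∃ (alg : Boson.RealRAM.Prog) (C : ℝ) (k : ℕ),
      ∀ U : Boson.Mode ≃ₗᵢ[ℂ] Boson.Mode, Boson.IsPhysical U →
      ∀ E ε : ℝ, 0 ≤ E → 0 < ε →
        Boson.maxEnergy U (64 * E / ε ^ 2) < ⊤ ∧
        ∃ (d : ℕ) (P : Boson.CanonicalPoly) (V : Boson.Mode ≃ₗᵢ[ℂ] Boson.Mode),
          -- the size of `d`
          (d : ℝ) ≤ C * ((E + ε ^ 2) / ε ^ 4) * (Boson.maxEnergy U (64 * E / ε ^ 2)).toReal ∧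
          (ε ^ 2 ≤ 64 * E →
            (d : ℝ) ≤ C * (E / ε ^ 4) * (Boson.maxEnergy U (64 * E / ε ^ 2)).toReal) ∧
          -- `P(q, p)` is a polynomial Hamiltonian of degree at most `3d`, and `V = e^{iP(q, p)}`
          P.degree ≤ 3 * d ∧
          P.IsHermitian ∧
          Boson.IsUnitaryExp P.unbounded V ∧
          -- the approximation
          Boson.ecDiamond E U V ≤ ENNReal.ofReal ε ∧
          -- the running time
          ∃ (T : ℕ) (s : Boson.RealRAM.Store),
            (T : ℝ) ≤ C * (1 + d + E + 1 / ε) ^ k ∧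
            Boson.RealRAM.Exec (Boson.fockMatrix U) alg (Boson.RealRAM.input E ε) T s ∧
            s.Outputs d P := by
  obtain ⟨c, k, hcost⟩ := Boson.RealRAM.Code.exists_cost_le Boson.RealRAM.Code.costCode
  -- This is the coefficient of the running time: `c` and `k` come from the cost polynomial, `32768`
  -- from the loop bound `X` and `67` from the size of the parameters.
  obtain ⟨A, hA⟩ : ∃ A : ℝ, A = c * ((32768 : ℕ) * 67 ^ 5) ^ k := ⟨_, rfl⟩
  have hA0 : 0 ≤ A := by
    rw [hA]
    positivity
  refine ⟨Boson.RealRAM.Code.algorithm, 896000 + A, 15 * k, fun U hU E ε hE hε =>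
    ⟨Boson.maxEnergy_lt_top hU _, ?_⟩⟩
  obtain ⟨K, Y, L, t, s, hK, hKQ, hKmin, hY, hYQ, hYmin, hLQ, hLmin, ht, hexec, -, h0, h1⟩ :=
    Boson.RealRAM.Code.exec_algorithm (O := Boson.fockMatrix U) (E := E) hε fun K _ hτ =>
      Boson.exists_le_headSum U K hτ
  obtain ⟨P, V, hdeg, hherm, hV, hdist, hout⟩ :=
    Boson.exists_approximation hE hε hK hKQ hY hYQ hLQ hLmin h0 h1
  have hL := Boson.rows_le hU hE hε hK hKmin fun l hl => (hLmin l hl).1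
  obtain ⟨hd1, hd2⟩ := Boson.degree_le_of_rows_le hE hA0 ENNReal.toReal_nonneg hL
  have hB : 0 ≤ 1 + ((7 * L : ℕ) : ℝ) + E + 1 / ε :=
    add_nonneg (add_nonneg (add_nonneg zero_le_one (Nat.cast_nonneg _)) hE) (one_div_nonneg.mpr hε.le)
  have hT := Boson.cast_le_mul_pow hB hcost (Nat.succ_pos 32767) (Nat.succ_pos (K + Y + L)) ht
    (Boson.parameters_le hE hε hK hKmin hY hYmin)
  rw [← hA] at hT
  exact ⟨7 * L, P, V, hd1, hd2, hdeg, hherm, hV, hdist, t, s, hT, hexec, hout⟩
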